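/- Let $\mathbb K$ be a field of characteristic $p$ (for instance an algebraically closed one). For an invertible $n\times n$ matrix $A$ over $\mathbb K$ and parities $p_1,\dots,p_n\in\mathbb Z/2$, let $\mathfrak g(A)$ be the Lie (super)algebra with Cartan matrix $A$: the quotient of the Lie (super)algebra with generators $x_i,y_i$ (of parity $p_i$) and $h_i$ (even) and relations $[x_i,y_j]=\delta_{ij}h_i$, $[h_i,h_j]=0$, $[h_i,x_j]=A_{ij}x_j$, $[h_i,y_j]=-A_{ij}y_j$ by the largest ideal that meets $\mathrm{span}(h_i)$ trivially and is the sum of its intersections with the subalgebras generated by the $x_i$ and by the $y_i$. It is graded by root spaces $\mathfrak g_w$, $w\in\mathbb Z^n$. A NIS is a non-degenerate invariant (super)symmetric bilinear form. If $A=\mathrm{diag}(\varepsilon_1,\dots,\varepsilon_n)S$ with $S=S^T$, the standard form $B$ on $\mathfrak g(A)$ is the (super)symmetric form with $(h_i,h_j)=S_{ij}\varepsilon_i\varepsilon_j$, $(x_i,y_j)=\delta_{ij}\varepsilon_j$, $(a,[u,v])=([a,u],v)$ for $a\in\mathfrak g_w$ and $u,v$ root vectors of negative degree with $[u,v]\in\mathfrak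 g_{-w}$, and $\mathfrak g_w\perp\mathfrak g_{w'}$ if $w+w'\ne0$. Let $\mathfrak{br}(3)$ ($p=3$) be given by $A=\begin{pmatrix}2&-1&0\\-1&2&-1\\0&-1&0\end{pmatrix}$ (all parities even), $\mathfrak{brj}(2;3)$ ($p=3$) by $A=\begin{pmatrix}0&-1\\-1&0\end{pmatrix}$ with the first simple root odd and the second even, and $\mathfrak{wk}(4;\alpha)$ ($p=2$, $\alpha\in\mathbb K$, $\alpha\ne0,1$) by $A=\begin{pmatrix}0&\alpha&1&0\\\alpha&0&0&0\\1&0&0&1\\0&0&1&0\end{pmatrix}$. All three matrices are symmetric; take $\varepsilon_i=1$. (a) On each of the three algebras $\mathfrak g$ the standard form $B$ exists, is unique, and is a NIS. (b) Let $\mathfrak g=\mathfrak{br}(3)$ or $\mathfrak{brj}(2;3)$. Every odd 2-cocycle of $\mathfrak{brj}(2;3)$ with coefficients in the adjoint module is a coboundary. There are even 2-cocycles $c_1,\dots,c_m$ of $\mathfrak g$ whose classes form a basis of the even part of $H^2(\mathfrak g;\mathfrak g)$ such that for all $i$ and all $\lambda\in\mathbb K$ the bracket $[\cdot,\cdot]+\lambda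 c_i$ defines a Lie (super)algebra structure on the space $\mathfrak g$, for which the same form $B$ is a NIS. (c) Let $\mathfrak g=\mathfrak{wk}(4;\alpha)$. Put $x_5=[x_1,x_2]$, $x_6=[x_1,x_3]$, $x_7=[x_3,x_4]$, $x_8=[x_3,x_5]$, $x_9=[x_4,x_6]$, $x_{10}=[x_5,x_6]$, $x_{11}=[x_5,x_7]$, $x_{12}=[x_5,x_9]$, $x_{13}=[x_8,x_9]$, $x_{14}=[x_9,x_{10}]$, $x_{15}=[x_{10},x_{11}]$, and define $y_5,\dots,y_{15}$ in the same way from $y_1,\dots,y_4$. Then $h_1,\dots,h_4,x_1,\dots,x_{15},y_1,\dots,y_{15}$ is a basis of $\mathfrak g$. There are 2-cocycles $c_0,c_1,\dots,c_m$ whose classes form a basis of $H^2(\mathfrak g;\mathfrak g)$ such that (c1) for $i\neq0$ and all $\lambda\in\mathbb K$ the bracket $[\cdot,\cdot]+\lambda c_i$ is a Lie bracket, for which the same form $B$ is a NIS; (c2) $c_0$ preserves the root grading, and there is a family of Lie brackets $[\cdot,\cdot]_\lambda=[\cdot,\cdot]+\lambda c_0+\lambda^2\varphi_2+\dots+\lambda^N\varphi_N$,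 $\lambda\in\mathbb K$, on the space $\mathfrak g$, where the bilinear maps $\varphi_k$ preserve the root grading, with the following properties. For $\lambda\ne\alpha$, the symmetric form with Gram matrix $\begin{pmatrix}\Gamma_{h,h}&0&0\\0&0&\Gamma_{x,y}\\0&\Gamma_{x,y}^T&0\end{pmatrix}$ in the basis above is invariant with respect to $[\cdot,\cdot]_\lambda$, where $$\Gamma_{h,h}=\begin{pmatrix}0&\alpha&1&\lambda\\\alpha&0&0&0\\1&0&0&1\\\lambda&0&1&0\end{pmatrix},\qquad \Gamma_{x,y}=\mathrm{diag}\left(1,\tfrac{\alpha}{\alpha+\lambda},1,1,\alpha,1,1,\alpha,1,A_2,\alpha,A_2,A_2,A_3,\alpha A_3\right),$$ $A_2=\alpha^2+\lambda\alpha+\alpha$ and $A_3=\alpha^3+\alpha^2+\lambda^2\alpha+\lambda\alpha$; every invariant symmetric form is a scalar multiple of it; and it is a NIS if and only if $\lambda\ne\alpha+1$. (c3) For $\lambda=\alpha$, the symmetric form with $(x_2,y_2)=1$ and $0$ on all other pairs of vectors of the basis is invariant with respect to $[\cdot,\cdot]_\alpha$; every invariant symmetric form vanishes on all pairs of vectors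 of the basis that are not both in $\{x_2,y_2\}$, and is degenerate; thus there is no NIS. -/

import Mathlib

noncomputable section

namespace NISDeform

/-! ## Bilinear products, ideals, quotients -/

/-- A bilinear product on `V`; brackets and their deforms live on the same space `V`. -/
abbrev Bil (K V : Type*) [Field K] [AddCommGroup V] [Module K V] := V →ₗ[K] V →ₗ[K] V

section Products

variable {K V : Type*} [Field K] [AddCommGroup V] [Module K V]

/-- `I` is a two-sided ideal of `(V, β)`. -/
def IsIdeal (β : Bil K V) (I : Submodule K V) : Prop :=
  ∀ a : V, ∀ b ∈ I, β a b ∈ I ∧ β b a ∈ I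

/-- The smallest ideal of `(V, β)` that contains the set `S`. -/
def idealSpan (β : Bil K V) (S : Set V) : Submodule K V :=
  sInf {I | IsIdeal β I ∧ S ⊆ I}

theorem isIdeal_idealSpan (β : Bil K V) (S : Set V) : IsIdeal β (idealSpan β S) := by
  intro a b hb
  simp only [idealSpan, Submodule.mem_sInf] at hb ⊢
  exact ⟨fun I hI => (hI.1 a b (hb I hI)).1, fun I hI => (hI.1 a b (hb I hI)).2⟩

theorem isIdeal_sSup (β : Bil K V) (T : Set (Submodule K V)) (hT : ∀ I ∈ T, IsIdeal β I) :
    IsIdeal β (sSup T) := by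
  intro a b hb
  have h : sSup T ≤ (sSup T).comap (β a) ⊓ (sSup T).comap (β.flip a) := by
    refine sSup_le fun I hI c hc => ?_
    exact ⟨le_sSup hI (hT I hI a c hc).1, le_sSup hI (hT I hI a c hc).2⟩
  exact h hb

/-- The smallest subalgebra of `(V, β)` that contains the set `S`. -/
def subalgSpan (β : Bil K V) (S : Set V) : Submodule K V :=
  sInf {U | (∀ a ∈ U, ∀ b ∈ U, β a b ∈ U) ∧ S ⊆ U}

/-- The product induced on the quotient of `(V, β)` by an ideal. -/
def quotBil (β : Bil K V) (I : Submodule K V) (hI : IsIdeal β I) : Bil K (V ⧸ I) :=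
  (I.liftQ
    (I.liftQ (β.compr₂ I.mkQ) (by
      intro a ha
      ext b
      simpa using (hI b a ha).2)).flip (by
    intro b hb
    ext a
    exact (Submodule.Quotient.mk_eq_zero I).2 (hI a b hb).1)).flip

theorem quotBil_mk (β : Bil K V) (I : Submodule K V) (hI : IsIdeal β I) (a b : V) :
    quotBil β I hI (I.mkQ a) (I.mkQ b) = I.mkQ (β a b) := rfl

end Products

/-! ## Chevalley generators and bracket monomials -/

/-- The generators `x_i`, `y_i`, `h_i`. -/
inductive Gen (n : ℕ) : Type
  | x (i : Fin n) : Gen n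
  | y (i : Fin n) : Gen n
  | h (i : Fin n) : Gen n

/-- `x_i` and `y_i` have parity `p i`; `h_i` is even. -/
def genParity {n : ℕ} (p : Fin n → ZMod 2) : Gen n → ZMod 2
  | .x i => p i
  | .y i => p i
  | .h _ => 0

/-- The degrees with respect to the root lattice: `x_i ↦ α_i`, `y_i ↦ -α_i`, `h_i ↦ 0`. -/
def genWeight {n : ℕ} : Gen n → (Fin n → ℤ)
  | .x i => Pi.single i 1
  | .y i => -Pi.single i 1
  | .h _ => 0

/-- The additive extension of a degree function from generators to monomials. -/
def wordSum {X M : Type*} [Add M] (f : X → M) : FreeMagma X → M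
  | .of g => f g
  | .mul a b => wordSum f a + wordSum f b

/-- The value of a bracket monomial in `(V, β)`. -/
def wordVal {K V X : Type*} [Field K] [AddCommGroup V] [Module K V]
    (β : Bil K V) (e : X → V) : FreeMagma X → V
  | .of g => e g
  | .mul a b => β (wordVal β e a) (wordVal β e b)

/-- The span of the values of all bracket monomials of degree `m`. -/
def homPart {K V X M : Type*} [Field K] [AddCommGroup V] [Module K V] [Add M]
    (β : Bil K V) (e : X → V) (f : X → M) (m : M) : Submodule K V :=
  Submodule.span K {v | ∃ w : FreeMagma X, wordSum f w = m ∧ wordVal β e w = v}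

/-! ## Lie superalgebras

Superspaces are given by their even and odd parts `P 0`, `P 1`. The definitions are used for
characteristic different from 2, and, in characteristic 2, for `P 1 = 0`, that is, for
Lie algebras. -/

/-- The sign `(-1)^{ij}`. -/
def sgn (K : Type*) [Field K] (i j : ZMod 2) : K := (-1) ^ (i.val * j.val)

/-- `β` makes the superspace `V = P 0 ⊕ P 1` into a Lie superalgebra (into a Lie algebra, if
`P 1 = 0`). The conditions on `[a, a]` for even `a` and on `[a, [a, a]]` for odd `a` have to be
required separately in characteristics 2 and 3, respectively. -/
structure IsLieSuper {K V : Type*} [Field K] [AddCommGroup V] [Module K V]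
    (P : ZMod 2 → Submodule K V) (β : Bil K V) : Prop where
  compl : IsCompl (P 0) (P 1)
  mem : ∀ i j, ∀ a ∈ P i, ∀ b ∈ P j, β a b ∈ P (i + j)
  skew : ∀ i j, ∀ a ∈ P i, ∀ b ∈ P j, β a b = -(sgn K i j • β b a)
  alt : ∀ a ∈ P 0, β a a = 0
  jacobi : ∀ i j, ∀ a ∈ P i, ∀ b ∈ P j, ∀ c : V,
    β a (β b c) = β (β a b) c + sgn K i j • β b (β a c)
  cubic : ∀ a ∈ P 1, β a (β a a) = 0

/-! ## The Lie (super)algebra with a given Cartan matrix -/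

section Contragredient

variable (K : Type*) [Field K] {n : ℕ} (A : Matrix (Fin n) (Fin n) K) (p : Fin n → ZMod 2)

/-- The free non-associative algebra on the generators. -/
abbrev FreeAlg (n : ℕ) := FreeNonUnitalNonAssocAlgebra K (Gen n)

/-- Its product. -/
def freeMul (n : ℕ) : Bil K (FreeAlg K n) := LinearMap.mul K (FreeAlg K n)

/-- The generators inside the free algebra. -/
def freeGen (n : ℕ) : Gen n → FreeAlg K n := FreeNonUnitalNonAssocAlgebra.of K

/-- The even and the odd part of the free algebra. -/
def freeParity : ZMod 2 → Submodule K (FreeAlg K n) :=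
  homPart (freeMul K n) (freeGen K n) (genParity p)

variable {K}

/-- The axioms of Lie superalgebras together with the relations
`[x_i, y_j] = δ_ij h_i`, `[h_i, h_j] = 0`, `[h_i, x_j] = A_ij x_j`, `[h_i, y_j] = -A_ij y_j`. -/
inductive Rel : FreeAlg K n → Prop
  | skew (i j : ZMod 2) (a b : FreeAlg K n) (ha : a ∈ freeParity K p i)
      (hb : b ∈ freeParity K p j) :
      Rel (freeMul K n a b + sgn K i j • freeMul K n b a)
  | alt (a : FreeAlg K n) (ha : a ∈ freeParity K p 0) : Rel (freeMul K n a a)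
  | jacobi (i j : ZMod 2) (a b c : FreeAlg K n) (ha : a ∈ freeParity K p i)
      (hb : b ∈ freeParity K p j) :
      Rel (freeMul K n a (freeMul K n b c) - freeMul K n (freeMul K n a b) c
        - sgn K i j • freeMul K n b (freeMul K n a c))
  | cubic (a : FreeAlg K n) (ha : a ∈ freeParity K p 1) :
      Rel (freeMul K n a (freeMul K n a a))
  | xy (i : Fin n) :
      Rel (freeMul K n (freeGen K n (.x i)) (freeGen K n (.y i)) - freeGen K n (.h i))
  | xy_ne (i j : Fin n) (hij : i ≠ j) :
      Rel (freeMul K n (freeGen K n (.x i)) (freeGen K n (.y j)))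
  | hh (i j : Fin n) : Rel (freeMul K n (freeGen K n (.h i)) (freeGen K n (.h j)))
  | hx (i j : Fin n) :
      Rel (freeMul K n (freeGen K n (.h i)) (freeGen K n (.x j)) - A i j • freeGen K n (.x j))
  | hy (i j : Fin n) :
      Rel (freeMul K n (freeGen K n (.h i)) (freeGen K n (.y j)) + A i j • freeGen K n (.y j))

/-- The ideal of relations. -/
def relIdeal : Submodule K (FreeAlg K n) := idealSpan (freeMul K n) {v | Rel A p v}

/-- The Lie superalgebra `g̃(A)` presented by the generators and the relations above. -/
def Tilde : Type _ := FreeAlg K n ⧸ relIdeal A p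

instance : AddCommGroup (Tilde A p) :=
  inferInstanceAs (AddCommGroup (FreeAlg K n ⧸ relIdeal A p))

instance : Module K (Tilde A p) :=
  inferInstanceAs (Module K (FreeAlg K n ⧸ relIdeal A p))

/-- The bracket of `g̃(A)`. -/
def tildeBracket : Bil K (Tilde A p) :=
  quotBil (freeMul K n) (relIdeal A p) (isIdeal_idealSpan _ _)

/-- The generators of `g̃(A)`. -/
def tildeGen (g : Gen n) : Tilde A p := (relIdeal A p).mkQ (freeGen K n g)

/-- The span of the `h_i` in `g̃(A)`. -/
def tildeCartan : Submodule K (Tilde A p) :=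
  Submodule.span K (Set.range fun i => tildeGen A p (.h i))

/-- The subalgebra of `g̃(A)` generated by the `x_i`. -/
def tildePos : Submodule K (Tilde A p) :=
  subalgSpan (tildeBracket A p) (Set.range fun i => tildeGen A p (.x i))

/-- The subalgebra of `g̃(A)` generated by the `y_i`. -/
def tildeNeg : Submodule K (Tilde A p) :=
  subalgSpan (tildeBracket A p) (Set.range fun i => tildeGen A p (.y i))

/-- The ideals of `g̃(A)` that meet the span of the `h_i` trivially and are the sums of their
intersections with the positive and the negative part. -/
def radicalFamily : Set (Submodule K (Tilde A p)) :=
  {I | IsIdeal (tildeBracket A p) I ∧ Disjoint I (tildeCartan A p) ∧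
    I = (I ⊓ tildePos A p) ⊔ (I ⊓ tildeNeg A p)}

/-- The largest of these ideals. -/
def radical : Submodule K (Tilde A p) := sSup (radicalFamily A p)

/-- The Lie superalgebra `g(A)` with Cartan matrix `A`, where `p i` is the parity of the `i`th
simple root. The matrix `A` is assumed to be invertible: then the `h_i` span the maximal torus. -/
def CartanAlg : Type _ := Tilde A p ⧸ radical A p

instance : AddCommGroup (CartanAlg A p) :=
  inferInstanceAs (AddCommGroup (Tilde A p ⧸ radical A p))

instance : Module K (CartanAlg A p) :=
  inferInstanceAs (Module K (Tilde A p ⧸ radical A p))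

/-- The bracket of `g(A)`. -/
def bracket : Bil K (CartanAlg A p) :=
  quotBil (tildeBracket A p) (radical A p) (isIdeal_sSup _ _ fun _ hI => hI.1)

/-- The Chevalley generators of `g(A)`. -/
def gen (g : Gen n) : CartanAlg A p := (radical A p).mkQ (tildeGen A p g)

/-- The even and the odd part of `g(A)`. -/
def parity : ZMod 2 → Submodule K (CartanAlg A p) :=
  homPart (bracket A p) (gen A p) (genParity p)

/-- The root spaces of `g(A)`; the one of weight 0 is the span of the `h_i`. -/
def rootSpace : (Fin n → ℤ) → Submodule K (CartanAlg A p) :=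
  homPart (bracket A p) (gen A p) genWeight

end Contragredient

/-! ## Invariant forms -/

section Forms

variable {K V : Type*} [Field K] [AddCommGroup V] [Module K V]

/-- `B` is an even supersymmetric bilinear form invariant with respect to `β`. -/
structure IsInvariantForm (P : ZMod 2 → Submodule K V) (β : Bil K V)
    (B : LinearMap.BilinForm K V) : Prop where
  even : ∀ i j, i ≠ j → ∀ a ∈ P i, ∀ b ∈ P j, B a b = 0
  supersymm : ∀ i j, ∀ a ∈ P i, ∀ b ∈ P j, B a b = sgn K i j * B b a
  invariant : ∀ a b c, B (β a b) c = B a (β b c)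

/-- `B` is a NIS for `β`: a non-degenerate invariant (super)symmetric form. -/
structure IsNIS (P : ZMod 2 → Submodule K V) (β : Bil K V)
    (B : LinearMap.BilinForm K V) : Prop extends IsInvariantForm P β B where
  nondegenerate : B.Nondegenerate

/-- `G` is the Gram matrix of `B` on the family `e`. -/
def HasGram {ι : Type*} (B : LinearMap.BilinForm K V) (e : ι → V) (G : Matrix ι ι K) : Prop :=
  ∀ i j, B (e i) (e j) = G i j

/-- The (super)symmetric bilinear form on `g(A)`, where `A = diag(ε) S` and `S` is symmetric, that
is given on `g_0` and `g_{±1}` by its values on the Chevalley generators and on the other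
root spaces inductively by `(a, [u, v]) = ([a, u], v)`. -/
structure IsStandardForm {n : ℕ} (A : Matrix (Fin n) (Fin n) K) (p : Fin n → ZMod 2)
    (ε : Fin n → K) (S : Matrix (Fin n) (Fin n) K)
    (B : LinearMap.BilinForm K (CartanAlg A p)) : Prop where
  factor : A = Matrix.diagonal ε * S
  symm : S.IsSymm
  hh : ∀ i j, B (gen A p (.h i)) (gen A p (.h j)) = S i j * ε i * ε j
  xy : ∀ i j, B (gen A p (.x i)) (gen A p (.y j)) = if i = j then ε j else 0
  supersymm : ∀ i j, ∀ a ∈ parity A p i, ∀ b ∈ parity A p j, B a b = sgn K i j * B b a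
  step : ∀ w₁ w₂ : Fin n → ℤ, ∑ i, w₁ i < 0 → ∑ i, w₂ i < 0 →
    ∀ a ∈ rootSpace A p (-(w₁ + w₂)), ∀ u ∈ rootSpace A p w₁, ∀ v ∈ rootSpace A p w₂,
      B a (bracket A p u v) = B (bracket A p a u) v
  orth : ∀ w₁ w₂ : Fin n → ℤ, w₁ + w₂ ≠ 0 →
    ∀ a ∈ rootSpace A p w₁, ∀ b ∈ rootSpace A p w₂, B a b = 0

end Forms

/-! ## Second cohomology with adjoint coefficients, and deforms -/

section Cohomology

variable {K V : Type*} [Field K] [AddCommGroup V] [Module K V]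

/-- `c` is a 2-cocycle of parity `d` of the Lie superalgebra `(V, β)` with coefficients in the
adjoint module: infinitesimally, `[a, b] + τ c(a, b)`, with a parameter `τ` of parity `d`,
satisfies the axioms of `IsLieSuper`. -/
structure IsCocycle (P : ZMod 2 → Submodule K V) (β : Bil K V) (d : ZMod 2) (c : Bil K V) :
    Prop where
  mem : ∀ i j, ∀ a ∈ P i, ∀ b ∈ P j, c a b ∈ P (i + j + d)
  skew : ∀ i j, ∀ a ∈ P i, ∀ b ∈ P j, c a b = -(sgn K i j • c b a)
  alt : ∀ a ∈ P 0, c a a = 0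
  closed : ∀ i j, ∀ x ∈ P i, ∀ y ∈ P j, ∀ z : V,
    sgn K i d • β x (c y z) + c x (β y z) =
      β (c x y) z + c (β x y) z + sgn K i j • (sgn K j d • β y (c x z) + c y (β x z))
  cubic : ∀ x ∈ P 1, sgn K 1 d • β x (c x x) + c x (β x x) = 0

/-- `c` is the coboundary of a linear map of parity `d`. -/
def IsCoboundary (P : ZMod 2 → Submodule K V) (β : Bil K V) (d : ZMod 2) (c : Bil K V) : Prop :=
  ∃ f : V →ₗ[K] V, (∀ i, ∀ x ∈ P i, f x ∈ P (i + d)) ∧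
    ∀ i, ∀ x ∈ P i, ∀ y : V, c x y = f (β x y) - β (f x) y - sgn K i d • β x (f y)

/-- The `c i` are even 2-cocycles whose classes form a basis of the even part of the second
cohomology with adjoint coefficients. -/
def IsCohomologyBasis {ι : Type*} [Fintype ι] (P : ZMod 2 → Submodule K V) (β : Bil K V)
    (c : ι → Bil K V) : Prop :=
  (∀ i, IsCocycle P β 0 (c i)) ∧
    ∀ z, IsCocycle P β 0 z → ∃! a : ι → K, IsCoboundary P β 0 (z - ∑ i, a i • c i)

/-- The bracket `φ 0 + l φ 1 + l² φ 2 + … + l^N φ N`. -/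
def polyBracket (φ : ℕ → Bil K V) (N : ℕ) (l : K) : Bil K V :=
  ∑ k ∈ Finset.range (N + 1), l ^ k • φ k

end Cohomology

/-! ## The three algebras -/

/-- The Cartan matrix of `br(3)`, `p = 3`. -/
def br3Matrix (K : Type*) [Field K] : Matrix (Fin 3) (Fin 3) K :=
  !![2, -1, 0; -1, 2, -1; 0, -1, 0]

/-- The Lie algebra `br(3)`. -/
abbrev Br3 (K : Type*) [Field K] := CartanAlg (br3Matrix K) 0

/-- Its bracket. -/
abbrev br3Bracket (K : Type*) [Field K] : Bil K (Br3 K) := bracket (br3Matrix K) 0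

/-- Its even part (everything) and its odd part (zero). -/
abbrev br3Parts (K : Type*) [Field K] : ZMod 2 → Submodule K (Br3 K) := parity (br3Matrix K) 0

/-- The Cartan matrix of `brj(2;3)`, `p = 3`; see `brjParity` for the parities. -/
def brjMatrix (K : Type*) [Field K] : Matrix (Fin 2) (Fin 2) K :=
  !![0, -1; -1, 0]

/-- The first simple root is odd, the second one is even. -/
def brjParity : Fin 2 → ZMod 2 := ![1, 0]

/-- The Lie superalgebra `brj(2;3)`. -/
abbrev Brj (K : Type*) [Field K] := CartanAlg (brjMatrix K) brjParity

/-- Its bracket. -/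
abbrev brjBracket (K : Type*) [Field K] : Bil K (Brj K) := bracket (brjMatrix K) brjParity

/-- Its even and odd part. -/
abbrev brjParts (K : Type*) [Field K] : ZMod 2 → Submodule K (Brj K) :=
  parity (brjMatrix K) brjParity

/-- The Cartan matrix of `wk(4;α)`, `p = 2`. -/
def wkMatrix {K : Type*} [Field K] (α : K) : Matrix (Fin 4) (Fin 4) K :=
  !![0, α, 1, 0; α, 0, 0, 0; 1, 0, 0, 1; 0, 0, 1, 0]

/-- The Lie algebra `wk(4;α)`. -/
abbrev Wk {K : Type*} [Field K] (α : K) := CartanAlg (wkMatrix α) 0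

/-- Its bracket. -/
abbrev wkBracket {K : Type*} [Field K] (α : K) : Bil K (Wk α) := bracket (wkMatrix α) 0

/-- Its even part (everything) and its odd part (zero). -/
abbrev wkParts {K : Type*} [Field K] (α : K) : ZMod 2 → Submodule K (Wk α) :=
  parity (wkMatrix α) 0

/-- The root vectors of `wk(4;α)` obtained from the Chevalley generators `g 0, …, g 3` of one
sign; the `i`th entry below, counted from 1, is the vector `x_i` (or `y_i`). -/
def wkRootVectors {K V : Type*} [Field K] [AddCommGroup V] [Module K V] (β : Bil K V)
    (g : Fin 4 → V) : Fin 15 → V :=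
  let x5 := β (g 0) (g 1)
  let x6 := β (g 0) (g 2)
  let x7 := β (g 2) (g 3)
  let x8 := β (g 2) x5
  let x9 := β (g 3) x6
  let x10 := β x5 x6
  let x11 := β x5 x7
  let x12 := β x5 x9
  let x13 := β x8 x9
  let x14 := β x9 x10
  let x15 := β x10 x11
  ![g 0, g 1, g 2, g 3, x5, x6, x7, x8, x9, x10, x11, x12, x13, x14, x15]

/-- The Chevalley basis `h_1, …, h_4, x_1, …, x_15, y_1, …, y_15` of `wk(4;α)`. -/
def wkBasis {K : Type*} [Field K] (α : K) : Fin 4 ⊕ (Fin 15 ⊕ Fin 15) → Wk α :=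
  Sum.elim (fun i => gen (wkMatrix α) 0 (.h i))
    (Sum.elim (wkRootVectors (wkBracket α) fun i => gen (wkMatrix α) 0 (.x i))
      (wkRootVectors (wkBracket α) fun i => gen (wkMatrix α) 0 (.y i)))

/-- The matrix `Γ_{h,h}`. -/
def gammaHH {K : Type*} [Field K] (α l : K) : Matrix (Fin 4) (Fin 4) K :=
  !![0, α, 1, l; α, 0, 0, 0; 1, 0, 0, 1; l, 0, 1, 0]

/-- The matrix `Γ_{x,y}`. -/
def gammaXY {K : Type*} [Field K] (α l : K) : Matrix (Fin 15) (Fin 15) K :=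
  let A2 := α ^ 2 + l * α + α
  let A3 := α ^ 3 + α ^ 2 + l ^ 2 * α + l * α
  Matrix.diagonal
    ![1, α / (α + l), 1, 1, α, 1, 1, α, 1, A2, α, A2, A2, A3, α * A3]

/-- The Gram matrix with blocks `Γ_{h,h}`, `Γ_{x,y}` and the transpose of `Γ_{x,y}`. -/
def gammaMatrix {K : Type*} [Field K] (α l : K) :
    Matrix (Fin 4 ⊕ (Fin 15 ⊕ Fin 15)) (Fin 4 ⊕ (Fin 15 ⊕ Fin 15)) K :=
  Matrix.fromBlocks (gammaHH α l) 0 0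
    (Matrix.fromBlocks 0 (gammaXY α l) (gammaXY α l).transpose 0)

/-- The indices of `x_2` and `y_2` in the Chevalley basis. -/
def idxX2 : Fin 4 ⊕ (Fin 15 ⊕ Fin 15) := Sum.inr (Sum.inl 1)

/-- See `idxX2`. -/
def idxY2 : Fin 4 ⊕ (Fin 15 ⊕ Fin 15) := Sum.inr (Sum.inr 1)

/-- The Gram matrix of the form that is equal to 1 on the pair `(x_2, y_2)` and to 0 on all other
unordered pairs of vectors of the Chevalley basis. -/
def gammaDegenerate (K : Type*) [Field K] :
    Matrix (Fin 4 ⊕ (Fin 15 ⊕ Fin 15)) (Fin 4 ⊕ (Fin 15 ⊕ Fin 15)) K :=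
  Matrix.single idxX2 idxY2 1 + Matrix.single idxY2 idxX2 1

end NISDeform

end

/-!
The three algebras have dimensions 29, 10|8 and 34. Each is described by an explicit table of
structure constants (`Model`), and everything that concerns a single table is a finite
computation, carried out by the kernel on lists of natural numbers. The lemmas of this file reduce
the theorem to such computations.

*Tables.* Structure constants are polynomials over `𝔽_p` in a parameter `t`, so that one table
describes a family of algebras. A table has a distinguished basis `e_0, e_1, …`: first `n` vectors
of weight zero, then the positive and then the negative root vectors. If the `x_i` and `y_i` act by
derivations on pairs of basis vectors and generate, then the table defines a Lie superalgebra
(`Rep.isLieSuper`). If moreover the defining relations hold, and no nonzero subspace of the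
positive (negative) part is stable under all `y_i` (all `x_i`), then the algebra is `g(A)`: the
triangular decomposition of the presented algebra `g̃(A)` (`tilde_triangular`) shows that the kernel
of the map from `g̃(A)` is the largest ideal in question (`Triangular.radical_eq`,
`Model.exists_frame`).

*Standard form.* Its values on pairs of opposite root vectors are determined by those on the
generators, by induction along bracket monomials in the `y_i` (`isStandardForm_unique`). It exists
and is a NIS because the table comes with the Gram matrix of an invariant form and its inverse.

*Cohomology.* The torus acts trivially on cohomology, therefore only cochains whose weight vanishes
modulo `p` matter (`isCoboundary_of_weights`). A cocycle is reduced by coboundaries of elementary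
maps and by the given cocycles, along a triangular list of pivots (`exists_reduced`); then the
cocycle equations, used one at a time in a suitable order, show that its remaining coordinates
vanish (`of_run`). Linear functionals that vanish on coboundaries show that the given classes are
independent (`eq_zero_of_isCoboundary`).

*Linear deforms.* All classes but one are "squares" of even root vectors: if `D = ad e` satisfies
`D ^ p = 0`, then `D ^ p / p!`, computed formally on a product, leaves the cocycle `[Dx, Dy]`
(`p = 2`) or `[Dx, D²y] + [D²x, Dy]` (`p = 3`). As `D ^ p = 0`, this cocycle satisfies the Jacobi
identity itself, and invariant forms remain invariant, since `D` is skew with respect to them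
(`IsEvenDer.isLieSuper_sq2`, `IsEvenDer.isLieSuper_sq3`, `invariant_sq2`, `invariant_sq3`).

*The exceptional cocycle of `wk(4;α)`.* It is the derivative of the bracket with respect to the
parameter, in a suitable basis. In terms of the generators for `α = t`, the table uses the basis
`e_0 = h_1`, `e_1 = h_2 / t`, `e_2 = h_3`, `e_3 = h_4 + h_2`, `e_4, …, e_18 = x_1, …, x_15`, and
`e_19, …, e_33`, which are the `y_j` divided by `t ^ k`, where `k` is the multiplicity of the second
simple root in the degree of `x_j`. In this basis the structure constants are polynomials of degree
at most 3 in `t`, and they make sense for `t = 0` as well. Read in the basis given by `t = α`, the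
table at `t = α + λ` defines the bracket `[·,·]_λ` (`Rep.polyBracket`). The table has an invariant
form `Q_t`, non-degenerate if and only if `t ≠ 0, 1`; for `t ≠ 0` the form with the Gram matrix of
the theorem is `Q_t / t`, and for `t = 0` the form `Q_0 / α` is supported at `x_2`, `y_2`. That there
are no further forms follows by solving the invariance equations one at a time
(`eq_zero_of_formOK`).
-/

open NISDeform

namespace StructConst

/-! ### Polynomial coefficients and sparse vectors -/

/-- A polynomial with natural coefficients, constant term first. Structure constants are kept in
this form, so that identities between them can be checked by computation; they are read in a field
of characteristic `p` through `ev`. -/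
abbrev Coef := List ℕ

/-- The sum of two polynomials. -/
def cAdd : Coef → Coef → Coef
  | [], l => l
  | a :: l, [] => a :: l
  | a :: l, b :: m => (a + b) :: cAdd l m

/-- A natural multiple of a polynomial. -/
def cSmul (n : ℕ) (l : Coef) : Coef := l.map (n * ·)

/-- The product of two polynomials. -/
def cMul : Coef → Coef → Coef
  | [], _ => []
  | a :: l, m => cAdd (cSmul a m) (0 :: cMul l m)

/-- All coefficients of the polynomial are divisible by `p`. -/
def cZero (p : ℕ) (l : Coef) : Bool := l.all fun a => Nat.beq (a % p) 0

/-- The two polynomials are congruent modulo `p`. -/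
def cEq (p : ℕ) (c d : Coef) : Bool := cZero p (cAdd c (cSmul (p - 1) d))

/-- The polynomial `(-1)^s * c`, modulo `p`. -/
def cSgn (p s : ℕ) (c : Coef) : Coef := bif Nat.beq (s % 2) 1 then cSmul (p - 1) c else c

/-- The value of a polynomial at `t`. -/
def ev {R : Type*} [CommSemiring R] (t : R) : Coef → R
  | [] => 0
  | a :: l => a + t * ev t l

section Ev

variable {R : Type*} [CommRing R] (t : R)

@[simp] theorem ev_nil : ev t [] = 0 := rfl

@[simp] theorem ev_cons (a : ℕ) (l : Coef) : ev t (a :: l) = a + t * ev t l := rfl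

theorem ev_cAdd (c d : Coef) : ev t (cAdd c d) = ev t c + ev t d := by
  induction c generalizing d with
  | nil => simp [cAdd]
  | cons a l ih =>
    cases d with
    | nil => simp [cAdd]
    | cons b m => simp only [cAdd, ev_cons, ih]; push_cast; ring

theorem ev_cSmul (n : ℕ) (c : Coef) : ev t (cSmul n c) = n * ev t c := by
  induction c with
  | nil => simp [cSmul]
  | cons a l ih =>
    simp only [cSmul, List.map_cons, ev_cons] at ih ⊢
    rw [ih]; push_cast; ring

theorem ev_cMul (c d : Coef) : ev t (cMul c d) = ev t c * ev t d := by
  induction c with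
  | nil => simp [cMul]
  | cons a l ih =>
    simp only [cMul, ev_cAdd, ev_cSmul, ev_cons, ih]; push_cast; ring

variable {p : ℕ} [CharP R p]

theorem ev_eq_zero {c : Coef} (h : cZero p c = true) : ev t c = 0 := by
  induction c with
  | nil => rfl
  | cons a l ih =>
    simp only [cZero, List.all_cons, Bool.and_eq_true] at h ih
    have ha : (a : R) = 0 :=
      (CharP.cast_eq_zero_iff R p a).2 (Nat.dvd_of_mod_eq_zero (Nat.eq_of_beq_eq_true h.1))
    simp [ha, ih h.2]

theorem cast_pred (hp : 0 < p) : ((p - 1 : ℕ) : R) = -1 := by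
  rw [Nat.cast_sub hp, CharP.cast_eq_zero]; simp

theorem ev_eq_of_cEq (hp : 0 < p) {c d : Coef} (h : cEq p c d = true) : ev t c = ev t d := by
  have := ev_eq_zero (p := p) t h
  rw [ev_cAdd, ev_cSmul, cast_pred hp] at this
  linear_combination this

theorem ev_cSgn (hp : 0 < p) (s : ℕ) (c : Coef) : ev t (cSgn p s c) = (-1) ^ s * ev t c := by
  unfold cSgn
  rcases Nat.even_or_odd s with h | h
  · rw [Nat.even_iff] at h
    simp [h, (Nat.even_iff.2 h).neg_one_pow, Nat.beq]
  · rw [Nat.odd_iff] at h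
    simp only [h, Nat.beq_refl, cond_true, ev_cSmul, cast_pred hp, (Nat.odd_iff.2 h).neg_one_pow]

end Ev

/-- A sparse vector: a list of pairs of an index and a coefficient; indices may be repeated. -/
abbrev SVec := List (ℕ × Coef)

/-- A multiple of a sparse vector. -/
def scale (c : Coef) (u : SVec) : SVec := u.map fun y => (y.1, cMul c y.2)

/-- The sparse vector `(-1)^s * u`, modulo `p`. -/
def sSgn (p s : ℕ) (u : SVec) : SVec := u.map fun y => (y.1, cSgn p s y.2)

/-- The coefficient of a sparse vector at the index `k`. -/
def coefAt (k : ℕ) : SVec → Coef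
  | [] => []
  | y :: u => bif Nat.beq y.1 k then cAdd y.2 (coefAt k u) else coefAt k u

/-- The sparse vector vanishes modulo `p`. -/
def sZero (p : ℕ) (u : SVec) : Bool := u.all fun y => cZero p (coefAt y.1 u)

/-- The conjunction of `f 0, …, f (n - 1)`. -/
def upto (n : ℕ) (f : ℕ → Bool) : Bool := Nat.rec true (fun k b => f k && b) n

theorem of_upto {n : ℕ} {f : ℕ → Bool} (h : upto n f = true) : ∀ k < n, f k = true := by
  induction n with
  | zero => simp
  | succ n ih =>
    have h' : (f n && upto n f) = true := h
    rw [Bool.and_eq_true] at h'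
    intro k hk
    rcases Nat.lt_succ_iff_lt_or_eq.1 hk with hk | rfl
    · exact ih h'.2 k hk
    · exact h'.1

theorem upto_iff {n : ℕ} {f : ℕ → Bool} : upto n f = true ↔ ∀ k < n, f k = true := by
  refine ⟨of_upto, fun h => ?_⟩
  induction n with
  | zero => rfl
  | succ n ih =>
    change (f n && upto n f) = true
    rw [ih fun k hk => h k (by omega), h n (by omega)]
    rfl

/-! ### Frames -/

/-- A basis `e 0, …, e (N - 1)` of `V` together with its coordinate functionals, indexed by
natural numbers; `e k = 0` and `x k = 0` for `k ≥ N`. -/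
structure Frame (K V : Type*) [Field K] [AddCommGroup V] [Module K V] (N : ℕ) where
  /-- the basis vectors -/
  e : ℕ → V
  /-- the coordinates -/
  x : ℕ → V →ₗ[K] K
  e_out : ∀ k, N ≤ k → e k = 0
  x_out : ∀ k, N ≤ k → x k = 0
  x_e : ∀ i k, k < N → x k (e i) = if i = k then 1 else 0
  expand : ∀ v, v = ∑ k ∈ Finset.range N, x k v • e k

variable {K V : Type*} [Field K] [AddCommGroup V] [Module K V] {N : ℕ}

/-- The vector given by a sparse vector. -/
def val (e : ℕ → V) (t : K) : SVec → V
  | [] => 0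
  | y :: u => ev t y.2 • e y.1 + val e t u

section Val

variable (e : ℕ → V) (t : K)

@[simp] theorem val_nil : val e t [] = 0 := rfl

@[simp] theorem val_cons (y : ℕ × Coef) (u : SVec) :
    val e t (y :: u) = ev t y.2 • e y.1 + val e t u := rfl

theorem val_append (u v : SVec) : val e t (u ++ v) = val e t u + val e t v := by
  induction u with
  | nil => simp
  | cons y u ih => simp [ih, add_assoc]

theorem val_scale (c : Coef) (u : SVec) : val e t (scale c u) = ev t c • val e t u := by
  induction u with
  | nil => simp [scale]
  | cons y u ih =>
    simp only [scale, List.map_cons, val_cons] at ih ⊢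
    rw [ih, ev_cMul, smul_add, mul_smul]

theorem val_sSgn {p : ℕ} [CharP K p] (hp : 0 < p) (s : ℕ) (u : SVec) :
    val e t (sSgn p s u) = (-1 : K) ^ s • val e t u := by
  induction u with
  | nil => simp [sSgn]
  | cons y u ih =>
    simp only [sSgn, List.map_cons, val_cons] at ih ⊢
    rw [ih, ev_cSgn t hp, smul_add, mul_smul]

theorem val_flatMap (f : ℕ → SVec) (u : SVec) :
    val e t (u.flatMap fun y => scale y.2 (f y.1))
      = val (fun k => val e t (f k)) t u := by
  induction u with
  | nil => simp
  | cons y u ih => simp [List.flatMap_cons, val_append, val_scale, ih]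

theorem map_val {W : Type*} [AddCommGroup W] [Module K W] (L : V →ₗ[K] W) (u : SVec) :
    L (val e t u) = val (fun k => L (e k)) t u := by
  induction u with
  | nil => simp
  | cons y u ih => simp [ih]

end Val

namespace Frame

variable (F : Frame K V N) (t : K)

theorem ext {v w : V} (h : ∀ k < N, F.x k v = F.x k w) : v = w := by
  rw [F.expand v, F.expand w]
  exact Finset.sum_congr rfl fun k hk => by rw [h k (Finset.mem_range.1 hk)]

theorem x_val {k : ℕ} (hk : k < N) (u : SVec) : F.x k (val F.e t u) = ev t (coefAt k u) := by
  induction u with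
  | nil => simp [coefAt]
  | cons y u ih =>
    simp only [val_cons, map_add, map_smul, ih, F.x_e _ _ hk, coefAt, smul_eq_mul]
    by_cases h : y.1 = k
    · simp [h, ev_cAdd]
    · have : Nat.beq y.1 k = false := by rwa [← Bool.not_eq_true, Nat.beq_eq]
      simp [h, this]

theorem coefAt_eq_nil {k : ℕ} {u : SVec} (h : ∀ y ∈ u, y.1 ≠ k) : coefAt k u = [] := by
  induction u with
  | nil => rfl
  | cons y u ih =>
    have : Nat.beq y.1 k = false := by
      rw [← Bool.not_eq_true, Nat.beq_eq]
      exact h y (by simp)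
    simp only [coefAt, this, cond_false]
    exact ih fun z hz => h z (by simp [hz])

theorem val_eq_zero {p : ℕ} [CharP K p] {u : SVec} (h : sZero p u = true) : val F.e t u = 0 := by
  refine F.ext fun k hk => ?_
  rw [F.x_val t hk, map_zero]
  by_cases hu : ∃ y ∈ u, y.1 = k
  · obtain ⟨y, hy, rfl⟩ := hu
    exact ev_eq_zero (p := p) t (List.all_eq_true.1 h y hy)
  · push Not at hu
    simp [coefAt_eq_nil hu]

theorem linearMap_ext {W : Type*} [AddCommGroup W] [Module K W] {L L' : V →ₗ[K] W}
    (h : ∀ k < N, L (F.e k) = L' (F.e k)) (v : V) : L v = L' v := by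
  rw [F.expand v, map_sum, map_sum]
  exact Finset.sum_congr rfl fun k hk => by
    rw [map_smul, map_smul, h k (Finset.mem_range.1 hk)]

theorem bilin_ext {W : Type*} [AddCommGroup W] [Module K W] {L L' : V →ₗ[K] V →ₗ[K] W}
    (h : ∀ i < N, ∀ j < N, L (F.e i) (F.e j) = L' (F.e i) (F.e j)) : L = L' := by
  ext v w
  have h1 : ∀ i < N, L (F.e i) = L' (F.e i) := fun i hi =>
    LinearMap.ext fun w => F.linearMap_ext (h i hi) w
  rw [F.linearMap_ext h1 v]

/-- The bilinear map with prescribed values on pairs of basis vectors. -/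
noncomputable def bilin {W : Type*} [AddCommGroup W] [Module K W] (s : ℕ → ℕ → W) :
    V →ₗ[K] V →ₗ[K] W :=
  ∑ i ∈ Finset.range N, ∑ j ∈ Finset.range N,
    (F.x i).smulRight ((F.x j).smulRight (s i j))

theorem bilin_e {W : Type*} [AddCommGroup W] [Module K W] (s : ℕ → ℕ → W) {i j : ℕ} (hi : i < N)
    (hj : j < N) : F.bilin s (F.e i) (F.e j) = s i j := by
  simp only [bilin, LinearMap.sum_apply, LinearMap.smulRight_apply, LinearMap.smul_apply]
  rw [Finset.sum_eq_single i, Finset.sum_eq_single j]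
  · simp [F.x_e _ _ hi, F.x_e _ _ hj]
  · intro k hk hkj
    simp [F.x_e _ _ (Finset.mem_range.1 hk), hkj.symm]
  · simp [hj]
  · intro k hk hki
    simp [F.x_e _ _ (Finset.mem_range.1 hk), hki.symm]
  · simp [hi]

/-- The linear map with prescribed values on basis vectors. -/
noncomputable def lin {W : Type*} [AddCommGroup W] [Module K W] (s : ℕ → W) : V →ₗ[K] W :=
  ∑ i ∈ Finset.range N, (F.x i).smulRight (s i)

theorem lin_e {W : Type*} [AddCommGroup W] [Module K W] (s : ℕ → W) {i : ℕ} (hi : i < N) :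
    F.lin s (F.e i) = s i := by
  simp only [lin, LinearMap.sum_apply, LinearMap.smulRight_apply]
  rw [Finset.sum_eq_single i]
  · simp [F.x_e _ _ hi]
  · intro k hk hki
    simp [F.x_e _ _ (Finset.mem_range.1 hk), hki.symm]
  · simp [hi]

/-- The span of the basis vectors of degree `m`. -/
def graded {M : Type*} (deg : ℕ → M) (m : M) : Submodule K V :=
  Submodule.span K {v | ∃ j < N, deg j = m ∧ F.e j = v}

/-- The standard frame of `Fin N → K`. -/
noncomputable def std (K : Type*) [Field K] (N : ℕ) : Frame K (Fin N → K) N where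
  e i := fun j => if i = j.1 then 1 else 0
  x k := if h : k < N then LinearMap.proj ⟨k, h⟩ else 0
  e_out k hk := by
    ext j
    have := j.2
    simp [show k ≠ j.1 by omega]
  x_out k hk := dif_neg (by omega)
  x_e i k hk := by simp [hk]
  expand v := by
    ext j
    rw [Finset.sum_apply, Finset.sum_eq_single j.1]
    · simp
    · intro b _ hbj
      simp [hbj]
    · simp

/-- The frame obtained by transport along a linear equivalence. -/
noncomputable def transport {V' : Type*} [AddCommGroup V'] [Module K V'] (Φ : V' ≃ₗ[K] V) :
    Frame K V' N where
  e i := Φ.symm (F.e i)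
  x k := F.x k ∘ₗ Φ.toLinearMap
  e_out k hk := by rw [F.e_out k hk, map_zero]
  x_out k hk := by rw [F.x_out k hk, LinearMap.zero_comp]
  x_e i k hk := by simp [F.x_e i k hk]
  expand v := by
    apply Φ.injective
    conv_lhs => rw [F.expand (Φ v)]
    simp

end Frame

end StructConst

namespace StructConst

variable {K V : Type*} [Field K] [AddCommGroup V] [Module K V] {N : ℕ}

/-! ### Graded pieces of a frame -/

namespace Frame

variable (F : Frame K V N) {M : Type*} {deg : ℕ → M} {m : M}

theorem e_mem_graded {k : ℕ} (hk : k < N) : F.e k ∈ F.graded deg (deg k) :=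
  Submodule.subset_span ⟨k, hk, rfl, rfl⟩

theorem x_eq_zero_of_mem_graded {v : V} (hv : v ∈ F.graded deg m) {k : ℕ} (hk : k < N)
    (hkm : deg k ≠ m) : F.x k v = 0 := by
  have : F.graded deg m ≤ LinearMap.ker (F.x k) := by
    refine Submodule.span_le.2 ?_
    rintro _ ⟨j, hj, rfl, rfl⟩
    have : j ≠ k := fun h => hkm (h ▸ rfl)
    simp [F.x_e _ _ hk, this]
  exact this hv

theorem mem_graded_of_x {v : V} (h : ∀ k < N, deg k ≠ m → F.x k v = 0) : v ∈ F.graded deg m := by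
  rw [F.expand v]
  refine Submodule.sum_mem _ fun k hk => ?_
  have hk := Finset.mem_range.1 hk
  by_cases hkm : deg k = m
  · exact Submodule.smul_mem _ _ (hkm ▸ F.e_mem_graded hk)
  · simp [h k hk hkm]

theorem eq_zero_on_graded {W : Type*} [AddCommGroup W] [Module K W] (L : V →ₗ[K] W)
    (h : ∀ k < N, deg k = m → L (F.e k) = 0) {v : V} (hv : v ∈ F.graded deg m) : L v = 0 := by
  have : F.graded deg m ≤ LinearMap.ker L := by
    refine Submodule.span_le.2 ?_
    rintro _ ⟨j, hj, hm, rfl⟩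
    exact h j hj hm
  exact this hv

theorem map_mem_of_graded {W : Type*} [AddCommGroup W] [Module K W] (L : V →ₗ[K] W)
    (U : Submodule K W) (h : ∀ k < N, deg k = m → L (F.e k) ∈ U) {v : V}
    (hv : v ∈ F.graded deg m) : L v ∈ U := by
  have : F.graded deg m ≤ U.comap L := by
    refine Submodule.span_le.2 ?_
    rintro _ ⟨j, hj, hm, rfl⟩
    exact h j hj hm
  exact this hv

theorem bilin_mem_of_graded {W : Type*} [AddCommGroup W] [Module K W] (L : V →ₗ[K] V →ₗ[K] W)
    {m' : M} (U : Submodule K W)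
    (h : ∀ i < N, ∀ j < N, deg i = m → deg j = m' → L (F.e i) (F.e j) ∈ U) {v w : V}
    (hv : v ∈ F.graded deg m) (hw : w ∈ F.graded deg m') : L v w ∈ U :=
  F.map_mem_of_graded (L.flip w) U
    (fun i hi him => F.map_mem_of_graded (L (F.e i)) U (fun j hj => h i hi j hj him) hw) hv

theorem bilin_eq_zero_on_graded {W : Type*} [AddCommGroup W] [Module K W]
    (L : V →ₗ[K] V →ₗ[K] W) {m' : M}
    (h : ∀ i < N, ∀ j < N, deg i = m → deg j = m' → L (F.e i) (F.e j) = 0) {v w : V}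
    (hv : v ∈ F.graded deg m) (hw : w ∈ F.graded deg m') : L v w = 0 := by
  simpa using F.bilin_mem_of_graded L ⊥ (by simpa using h) hv hw

theorem val_mem (U : Submodule K V) (t : K) {u : SVec} (h : ∀ y ∈ u, F.e y.1 ∈ U) :
    val F.e t u ∈ U := by
  induction u with
  | nil => simp
  | cons y u ih =>
    exact U.add_mem (U.smul_mem _ (h y (by simp))) (ih fun z hz => h z (by simp [hz]))

theorem isCompl_graded (deg : ℕ → ZMod 2) : IsCompl (F.graded deg 0) (F.graded deg 1) := by
  have h01 : ∀ i : ZMod 2, i ≠ 0 → i = 1 := by decide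
  refine ⟨Submodule.disjoint_def.2 fun v h0 h1 => ?_, codisjoint_iff.2 (eq_top_iff.2 ?_)⟩
  · refine F.ext fun k hk => ?_
    rw [map_zero]
    by_cases h : deg k = 0
    · exact F.x_eq_zero_of_mem_graded h1 hk (by rw [h]; decide)
    · exact F.x_eq_zero_of_mem_graded h0 hk h
  · rintro v -
    rw [F.expand v]
    refine Submodule.sum_mem _ fun k hk => Submodule.smul_mem _ _ ?_
    have hk := Finset.mem_range.1 hk
    by_cases h : deg k = 0
    · exact Submodule.mem_sup_left (h ▸ F.e_mem_graded hk)
    · exact Submodule.mem_sup_right (h01 _ h ▸ F.e_mem_graded hk)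

end Frame

theorem sgn_natCast (a b : ℕ) : sgn K (a : ZMod 2) (b : ZMod 2) = (-1) ^ (a * b) := by
  unfold sgn
  rw [ZMod.val_natCast, ZMod.val_natCast, neg_one_pow_eq_pow_mod_two,
    neg_one_pow_eq_pow_mod_two (a * b), ← Nat.mul_mod]

theorem sgn_add_left (i j k : ZMod 2) : sgn K (i + j) k = sgn K i k * sgn K j k := by
  obtain ⟨a, rfl⟩ := ZMod.natCast_zmod_surjective i
  obtain ⟨b, rfl⟩ := ZMod.natCast_zmod_surjective j
  obtain ⟨c, rfl⟩ := ZMod.natCast_zmod_surjective k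
  rw [← Nat.cast_add, sgn_natCast, sgn_natCast, sgn_natCast]
  ring

theorem sgn_comm (i j : ZMod 2) : sgn K i j = sgn K j i := by
  unfold sgn; rw [mul_comm]

theorem sgn_add_right (i j k : ZMod 2) : sgn K i (j + k) = sgn K i j * sgn K i k := by
  rw [sgn_comm, sgn_add_left, sgn_comm j, sgn_comm k]

theorem sgn_mul_self (i j : ZMod 2) : sgn K i j * sgn K i j = 1 := by
  unfold sgn; rw [← pow_add, ← two_mul]; simp

@[simp] theorem sgn_zero_left (i : ZMod 2) : sgn K 0 i = 1 := by simp [sgn]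

@[simp] theorem sgn_zero_right (i : ZMod 2) : sgn K i 0 = 1 := by simp [sgn]

@[simp] theorem sgn_one_one : sgn K 1 1 = -1 := by simp [sgn, ZMod.val_one]

/-- Elements that act by derivations form a subalgebra. -/
theorem jacobi_closure {P : ZMod 2 → Submodule K V} {β : Bil K V}
    (hm : ∀ i j : ZMod 2, ∀ a ∈ P i, ∀ b ∈ P j, β a b ∈ P (i + j))
    {i i' : ZMod 2} {a b : V} (ha : a ∈ P i) (hb : b ∈ P i')
    (hja : ∀ j, ∀ u ∈ P j, ∀ c, β a (β u c) = β (β a u) c + sgn K i j • β u (β a c))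
    (hjb : ∀ j, ∀ u ∈ P j, ∀ c, β b (β u c) = β (β b u) c + sgn K i' j • β u (β b c)) :
    ∀ j, ∀ u ∈ P j, ∀ c, β (β a b) (β u c) =
      β (β (β a b) u) c + sgn K (i + i') j • β u (β (β a b) c) := by
  intro j u hu c
  have e : ∀ v, β (β a b) v = β a (β b v) - sgn K i i' • β b (β a v) := fun v => by
    rw [hja i' b hb v]; abel
  rw [e, e, e, hjb j u hu, hja j u hu, map_add, map_add, hja _ _ (hm _ _ _ hb _ hu), map_smul,
    map_smul, hja j u hu, hjb _ _ (hm _ _ _ ha _ hu), hjb j u hu, map_sub, map_sub, map_smul,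
    map_smul, sgn_add_left, sgn_add_right, sgn_add_right, sgn_comm i' i]
  have h1 : sgn K i i' * sgn K i i' = 1 := sgn_mul_self i i'
  simp only [LinearMap.sub_apply, LinearMap.smul_apply]
  linear_combination (norm := module) (-(sgn K i' j)) • h1 • β (β a u) (β b c)

/-! ### Tables of structure constants -/

/-- A family of Lie superalgebras over fields of characteristic `p`, depending polynomially on one
parameter, in a basis of `N = n + 2 r` vectors: `h_1, …, h_n`, then `r` positive root vectors and
`r` negative ones, the Chevalley generators `x_i` and `y_i` coming first in each of the two groups
of root vectors. -/
structure Model where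
  /-- the characteristic -/
  p : ℕ
  /-- the rank -/
  n : ℕ
  /-- the number of positive roots -/
  r : ℕ
  /-- the brackets of the basis vectors -/
  tab : List (List SVec)
  /-- the parities of the basis vectors, as `0` or `1` -/
  par : List ℕ
  /-- the weights of the basis vectors; `6` has been added to every coordinate -/
  wt : List (List ℕ)
  /-- triples `(j, u, v)` such that `[e_u, e_v]` is a multiple of `e_j`, up to basis vectors
  obtained before; in this way all basis vectors are obtained from the `x_i` and `y_i` -/
  words : List (ℕ × ℕ × ℕ)
  /-- the polynomials that may be used as denominators -/
  units : List Coef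
  /-- the Cartan matrix -/
  cartan : List (List Coef)
  /-- the elements `h_1, …, h_n` of the algebra presented by the Cartan matrix -/
  hGen : List SVec
  /-- the Chevalley generators `y_i` in the same sense are multiples of the `i`th negative root
  vectors with these coefficients, whereas the `x_i` are the positive root vectors -/
  yCoef : List Coef
  /-- triples `(b, a, j)` such that `b` is the only positive root, up to those listed before, for
  which the bracket of the `b`th basis vector with `e_a`, one of the `y_i`, involves `e_j` -/
  posTrans : List (ℕ × ℕ × ℕ)
  /-- the same for the negative roots and the `x_i` -/
  negTrans : List (ℕ × ℕ × ℕ)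

namespace Model

variable (M : Model)

/-- The number of basis vectors. -/
def dim : ℕ := M.n + 2 * M.r

/-- The brackets of the `i`th basis vector. -/
def row (i : ℕ) : List SVec := M.tab.getD i []

/-- The bracket of two basis vectors. -/
def br (i j : ℕ) : SVec := (M.row i).getD j []

/-- The parity of a basis vector as a natural number. -/
def pr (i : ℕ) : ℕ := M.par.getD i 0

/-- The parity of a basis vector. -/
def parity (i : ℕ) : ZMod 2 := (M.pr i : ZMod 2)

/-- The `q`th coordinate of the weight of a basis vector, increased by `6`. -/
def w (i q : ℕ) : ℕ := (M.wt.getD i []).getD q 6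

/-- The weight of a basis vector. -/
def weight {n : ℕ} (i : ℕ) : Fin n → ℤ := fun q => (M.w i q : ℤ) - 6

/-- Test whether a polynomial is one of the admitted denominators. -/
def isUnit (c : Coef) : Bool := M.units.any (cEq M.p c)

/-- Test whether a polynomial is a nonzero constant modulo `p`. -/
def isScalar (c : Coef) : Bool := !cZero M.p (c.take 1) && cZero M.p (c.drop 1)

/-- The bracket with a basis vector on the left. -/
def adl (i : ℕ) (u : SVec) : SVec := u.flatMap fun y => scale y.2 (M.br i y.1)

/-- The bracket with a basis vector on the right. -/
def adr (u : SVec) (k : ℕ) : SVec := u.flatMap fun y => scale y.2 (M.br y.1 k)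

/-- The bracket of two sparse vectors. -/
def brS (u v : SVec) : SVec := u.flatMap fun y => scale y.2 (M.adl y.1 v)

/-- No brackets are listed beyond the range of the basis. -/
def chkLen : Bool := Nat.ble M.tab.length M.dim && M.tab.all fun l => Nat.ble l.length M.dim

/-- The bracket is compatible with the parity. -/
def chkPar : Bool := upto M.dim fun i => upto M.dim fun j => (M.br i j).all fun y =>
  Nat.blt y.1 M.dim && Nat.beq ((M.pr y.1 + (M.pr i + M.pr j)) % 2) 0

/-- The bracket is compatible with the weights. -/
def chkWt : Bool := upto M.dim fun i => upto M.dim fun j => (M.br i j).all fun y =>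
  upto M.n fun q => Nat.beq (M.w y.1 q + 6) (M.w i q + M.w j q)

/-- The bracket is skew-symmetric, `[a, a] = 0` for even `a`, and `[a, [a, a]] = 0` for odd `a`. -/
def chkSkew : Bool := upto M.dim fun i =>
  (bif Nat.beq (M.pr i % 2) 0 then sZero M.p (M.br i i) else sZero M.p (M.adl i (M.br i i))) &&
  upto M.dim fun j => sZero M.p (M.br i j ++ sSgn M.p (M.pr i * M.pr j) (M.br j i))

/-- The Jacobi identity for the basis vectors with numbers `i`, `j`, `k`. -/
def jacOK (i j k : ℕ) : Bool :=
  sZero M.p (M.adl i (M.br j k) ++ (sSgn M.p 1 (M.adr (M.br i j) k) ++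
    sSgn M.p (1 + M.pr i * M.pr j) (M.adl j (M.br i k))))

/-- The Chevalley generators `x_i` and `y_i` act by derivations. -/
def chkJac : Bool := upto M.n fun i => upto M.dim fun j => upto M.dim fun k =>
  M.jacOK (M.n + i) j k && M.jacOK (M.n + M.r + i) j k

/-- Test that all basis vectors are obtained from those in the set `S`, given by its bits, along
the list of words. -/
def wordsOK : List (ℕ × ℕ × ℕ) → ℕ → Bool
  | [], S => upto M.dim fun i => S.testBit i
  | g :: l, S => Nat.blt g.2.1 M.dim && Nat.blt g.2.2 M.dim && S.testBit g.2.1 && S.testBit g.2.2 &&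
      ((M.br g.2.1 g.2.2).all fun y => Nat.beq y.1 g.1 || S.testBit y.1) &&
      M.isScalar (coefAt g.1 (M.br g.2.1 g.2.2)) && wordsOK l (S ||| 1 <<< g.1)

/-- The set of the Chevalley generators `x_i` and `y_i`. -/
def genSet : ℕ := (2 ^ M.n - 1) <<< M.n ||| (2 ^ M.n - 1) <<< (M.n + M.r)

/-- The algebra is generated by the `x_i` and `y_i`. -/
def chkWords : Bool := M.wordsOK M.words M.genSet && Nat.ble M.n M.r

end Model

/-- The product `β` on the superspace `V` has the given structure constants, evaluated at `t`, in
the frame `F`. -/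
structure Rep (M : Model) (t : K) (F : Frame K V M.dim) (P : ZMod 2 → Submodule K V)
    (β : Bil K V) : Prop where
  part : ∀ i, P i = F.graded M.parity i
  br : ∀ i j, β (F.e i) (F.e j) = val F.e t (M.br i j)

/-- The polynomials admitted as denominators do not vanish at `t`. -/
def Model.UnitsAt (M : Model) (t : K) : Prop := ∀ c ∈ M.units, ev t c ≠ 0

theorem Model.UnitsAt.ne_zero {M : Model} [CharP K M.p] (hp : 0 < M.p) {t : K} (h : M.UnitsAt t)
    {c : Coef} (hc : M.isUnit c = true) : ev t c ≠ 0 := by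
  obtain ⟨d, hd, hcd⟩ := List.any_eq_true.1 hc
  rw [ev_eq_of_cEq t hp hcd]
  exact h d hd

theorem Model.isScalar_ne_zero {M : Model} [CharP K M.p] {t : K} {c : Coef}
    (hc : M.isScalar c = true) : ev t c ≠ 0 := by
  rw [isScalar, Bool.and_eq_true, Bool.not_eq_true'] at hc
  cases c with
  | nil => exact absurd hc.1 (by simp [cZero])
  | cons a l =>
    have h0 : ev t l = 0 := ev_eq_zero (p := M.p) t hc.2
    rw [ev_cons, h0, mul_zero, add_zero, Ne, CharP.cast_eq_zero_iff K M.p]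
    intro h
    have := hc.1
    simp [cZero, Nat.mod_eq_zero_of_dvd h] at this

theorem val_eq_coefAt_add (e : ℕ → V) (t : K) (j : ℕ) (u : SVec) :
    val e t u = ev t (coefAt j u) • e j + val e t (u.filter fun y => !Nat.beq y.1 j) := by
  induction u with
  | nil => simp [coefAt]
  | cons y u ih =>
    rw [val_cons, ih]
    by_cases h : Nat.beq y.1 j = true
    · have h' := Nat.eq_of_beq_eq_true h
      simp only [coefAt, h, cond_true, ev_cAdd, List.filter_cons, Bool.not_true,
        Bool.false_eq_true, if_false]
      rw [h', add_smul, add_assoc]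
    · rw [Bool.not_eq_true] at h
      simp only [coefAt, h, cond_false, List.filter_cons, Bool.not_false, if_true, val_cons]
      abel

theorem testBit_or_shiftLeft {S j i : ℕ} (h : (S ||| 1 <<< j).testBit i = true) :
    S.testBit i = true ∨ i = j := by
  rw [Nat.testBit_or, Nat.one_shiftLeft, Nat.testBit_two_pow, Bool.or_eq_true] at h
  exact h.imp id fun h => (of_decide_eq_true h).symm

theorem Model.lt_of_testBit_genSet {M : Model} {i : ℕ} (h : M.genSet.testBit i = true) :
    (∃ k < M.n, i = M.n + k) ∨ ∃ k < M.n, i = M.n + M.r + k := by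
  rw [Model.genSet, Nat.testBit_or, Bool.or_eq_true, Nat.testBit_shiftLeft,
    Nat.testBit_shiftLeft, Nat.testBit_two_pow_sub_one, Nat.testBit_two_pow_sub_one] at h
  simp only [Bool.and_eq_true, decide_eq_true_eq] at h
  rcases h with h | h
  · exact Or.inl ⟨i - M.n, h.2, by omega⟩
  · exact Or.inr ⟨i - (M.n + M.r), h.2, by omega⟩

theorem Model.par_add {M : Model} (h : M.chkPar = true) {i j : ℕ} (hi : i < M.dim)
    (hj : j < M.dim) {y : ℕ × Coef} (hy : y ∈ M.br i j) : y.1 < M.dim ∧ M.parity y.1 = M.parity i + M.parity j := by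
  have := List.all_eq_true.1 (of_upto (of_upto h i hi) j hj) y hy
  rw [Bool.and_eq_true, Nat.blt_eq] at this
  refine ⟨this.1, ?_⟩
  have h2 : ((M.pr y.1 + (M.pr i + M.pr j) : ℕ) : ZMod 2) = 0 :=
    (ZMod.natCast_eq_zero_iff _ 2).2 (Nat.dvd_of_mod_eq_zero (Nat.eq_of_beq_eq_true this.2))
  push_cast at h2
  rw [Model.parity, Model.parity, Model.parity, eq_neg_of_add_eq_zero_left h2,
    ZModModule.neg_eq_self]

theorem Model.wt_add {M : Model} (h : M.chkWt = true) {i j : ℕ} (hi : i < M.dim)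
    (hj : j < M.dim) {y : ℕ × Coef} (hy : y ∈ M.br i j) : (M.weight y.1 : Fin M.n → ℤ) = M.weight i + M.weight j := by
  have := List.all_eq_true.1 (of_upto (of_upto h i hi) j hj) y hy
  ext q
  have := Nat.eq_of_beq_eq_true (of_upto this q q.2)
  simp only [Model.weight, Pi.add_apply]
  omega

namespace Rep

variable {M : Model} {t : K} {F : Frame K V M.dim} {P : ZMod 2 → Submodule K V} {β : Bil K V}
variable (R : Rep M t F P β)

include R

theorem adl (i : ℕ) (u : SVec) : β (F.e i) (val F.e t u) = val F.e t (M.adl i u) := by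
  rw [Model.adl, val_flatMap, map_val]
  simp_rw [R.br]

theorem adr (u : SVec) (k : ℕ) : β (val F.e t u) (F.e k) = val F.e t (M.adr u k) := by
  rw [Model.adr, val_flatMap F.e t (fun y => M.br y k), ← LinearMap.flip_apply, map_val]
  simp_rw [LinearMap.flip_apply, R.br]

theorem brS (u v : SVec) : β (val F.e t u) (val F.e t v) = val F.e t (M.brS u v) := by
  rw [Model.brS, val_flatMap F.e t (fun y => M.adl y v), ← LinearMap.flip_apply, map_val]
  simp_rw [LinearMap.flip_apply, R.adl]

/-- Induction along the list of words: a family of subspaces `Q m`, multiplicative with respect to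
a grading of the basis, contains all basis vectors as soon as it contains the generators. -/
theorem generate [CharP K M.p] (hw : M.chkWords = true)
    {D : Type*} [Add D] (deg : ℕ → D)
    (hdeg : ∀ i < M.dim, ∀ j < M.dim, ∀ y ∈ M.br i j, deg y.1 = deg i + deg j)
    (Q : D → Submodule K V) (hQ : ∀ m m', ∀ a ∈ Q m, ∀ b ∈ Q m', β a b ∈ Q (m + m'))
    (hx : ∀ i < M.n, F.e (M.n + i) ∈ Q (deg (M.n + i)))
    (hy : ∀ i < M.n, F.e (M.n + M.r + i) ∈ Q (deg (M.n + M.r + i))) :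
    ∀ j < M.dim, F.e j ∈ Q (deg j) := by
  suffices H : ∀ (l : List (ℕ × ℕ × ℕ)) (S : ℕ), M.wordsOK l S = true →
      (∀ i, S.testBit i = true → F.e i ∈ Q (deg i)) → ∀ j < M.dim, F.e j ∈ Q (deg j) by
    rw [Model.chkWords, Bool.and_eq_true] at hw
    refine H _ _ hw.1 fun i hi => ?_
    rcases Model.lt_of_testBit_genSet hi with ⟨k, hk, rfl⟩ | ⟨k, hk, rfl⟩
    exacts [hx k hk, hy k hk]
  intro l
  induction l with
  | nil => exact fun S h hS j hj => hS j (of_upto h j hj)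
  | cons g l ih =>
    intro S h hS
    obtain ⟨j, u, v⟩ := g
    simp only [Model.wordsOK, Bool.and_eq_true, List.all_eq_true, Bool.or_eq_true,
      Nat.blt_eq] at h
    obtain ⟨⟨⟨⟨⟨⟨huN, hvN⟩, hu'⟩, hv'⟩, hall⟩, hunit⟩, hl⟩ := h
    refine ih _ hl fun i hi => ?_
    rcases testBit_or_shiftLeft hi with hi | rfl
    · exact hS i hi
    · have hc : ev t _ ≠ 0 := Model.isScalar_ne_zero hunit
      have hdi : deg i = deg u + deg v := by
        by_contra hne
        apply hc
        rw [Frame.coefAt_eq_nil, ev_nil]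
        rintro y hy rfl
        exact hne (hdeg u huN v hvN y hy)
      have h1 := hQ _ _ _ (hS u hu') _ (hS v hv')
      rw [R.br, val_eq_coefAt_add F.e t i, ← hdi] at h1
      have h2 : val F.e t ((M.br u v).filter fun y => !Nat.beq y.1 i) ∈ Q (deg i) := by
        refine F.val_mem _ t fun y hy => ?_
        rw [List.mem_filter] at hy
        have hne : ¬ Nat.beq y.1 i = true := by
          rw [Bool.not_eq_true]
          simpa only [Bool.not_eq_true'] using hy.2
        have := hS y.1 ((hall y hy.1).resolve_left hne)
        rwa [hdeg u huN v hvN y hy.1, ← hdi] at this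
      have h3 := (Submodule.add_mem_iff_left _ h2).1 h1
      exact (Submodule.smul_mem_iff _ hc).1 h3

theorem mem (h : M.chkPar = true) (i j : ZMod 2) : ∀ a ∈ P i, ∀ b ∈ P j, β a b ∈ P (i + j) := by
  simp only [R.part]
  intro a ha b hb
  refine F.bilin_mem_of_graded β _ (fun k hk l hl hki hlj => ?_) ha hb
  rw [R.br]
  refine F.val_mem _ t fun y hy => ?_
  have := Model.par_add h hk hl hy
  rw [← hki, ← hlj, ← this.2]
  exact F.e_mem_graded this.1

variable [CharP K M.p] (hp : 0 < M.p)

include hp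

theorem skew (h : M.chkSkew = true) (i j : ZMod 2) :
    ∀ a ∈ P i, ∀ b ∈ P j, β a b = -(sgn K i j • β b a) := by
  simp only [R.part]
  intro a ha b hb
  rw [eq_neg_iff_add_eq_zero]
  refine F.bilin_eq_zero_on_graded (β + sgn K i j • β.flip) (fun k hk l hl hki hlj => ?_) ha hb
  have := of_upto h k hk
  rw [Bool.and_eq_true] at this
  have := F.val_eq_zero t (of_upto this.2 l hl)
  rw [val_append, val_sSgn _ _ hp, ← R.br, ← R.br, ← sgn_natCast] at this
  rw [← hki, ← hlj]
  exact this

theorem alt (h : M.chkSkew = true) : ∀ a ∈ P 0, β a a = 0 := by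
  have hs := R.skew hp h 0 0
  simp only [R.part] at hs ⊢
  intro a ha
  refine Submodule.span_induction (p := fun a _ => β a a = 0) ?_ (by simp) ?_ ?_ ha
  · rintro _ ⟨k, hk, hk0, rfl⟩
    have := of_upto h k hk
    rw [Bool.and_eq_true] at this
    have hk0 : M.pr k % 2 = 0 :=
      Nat.mod_eq_zero_of_dvd ((ZMod.natCast_eq_zero_iff _ 2).1 hk0)
    rw [R.br]
    simp only [hk0, Nat.beq_refl, cond_true] at this
    exact F.val_eq_zero t this.1
  · intro a b ha hb h1 h2
    have := hs a ha b hb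
    rw [sgn_zero_left, one_smul] at this
    simp [h1, h2, this]
  · intro c a _ h1
    simp [h1]

theorem jacobi_gen {g : ℕ}
    (h : ∀ j < M.dim, ∀ k < M.dim, M.jacOK g j k = true) :
    ∀ j, ∀ u ∈ P j, ∀ c, β (F.e g) (β u c) =
      β (β (F.e g) u) c + sgn K (M.parity g) j • β u (β (F.e g) c) := by
  intro j u hu c
  rw [R.part] at hu
  let L : V →ₗ[K] V →ₗ[K] V := β.compr₂ (β (F.e g)) - β ∘ₗ β (F.e g) -
    sgn K (M.parity g) j • β.compl₂ (β (F.e g))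
  have hL : L u c = 0 := by
    have h0 : L u = 0 := by
      refine F.eq_zero_on_graded L (fun k hk hkj => ?_) hu
      refine LinearMap.ext fun c => ?_
      refine F.linearMap_ext (fun l hl => ?_) c
      have := F.val_eq_zero (p := M.p) t (h k hk l hl)
      rw [val_append, val_append, val_sSgn _ _ hp, val_sSgn _ _ hp, pow_add, ← sgn_natCast,
        ← R.adl, ← R.adr, ← R.adl, ← R.br, ← R.br, ← R.br] at this
      simp only [L, LinearMap.sub_apply, LinearMap.compr₂_apply, LinearMap.comp_apply,
        LinearMap.smul_apply, LinearMap.compl₂_apply, LinearMap.zero_apply]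
      rw [← hkj, ← this]
      simp only [Model.parity]
      module
    rw [h0, LinearMap.zero_apply]
  simp only [L, LinearMap.sub_apply, LinearMap.compr₂_apply, LinearMap.comp_apply,
    LinearMap.smul_apply, LinearMap.compl₂_apply] at hL
  rw [sub_sub, sub_eq_zero] at hL
  exact hL

/-- The Jacobi identity holds in general if it holds with a Chevalley generator as one of the
three elements, since the elements that act by derivations form a subalgebra. -/
theorem jacobi (hj : M.chkJac = true) (hP : M.chkPar = true)
    (hw : M.chkWords = true) :
    ∀ i j, ∀ a ∈ P i, ∀ b ∈ P j, ∀ c : V,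
      β a (β b c) = β (β a b) c + sgn K i j • β b (β a c) := by
  let Q : ZMod 2 → Submodule K V := fun i =>
    { carrier := {a | a ∈ P i ∧ ∀ j, ∀ u ∈ P j, ∀ c,
        β a (β u c) = β (β a u) c + sgn K i j • β u (β a c)}
      add_mem' := by
        rintro a b ⟨ha, ha'⟩ ⟨hb, hb'⟩
        refine ⟨add_mem ha hb, fun j u hu c => ?_⟩
        simp only [map_add, LinearMap.add_apply, ha' j u hu c, hb' j u hu c]
        module
      zero_mem' := ⟨zero_mem _, by simp⟩
      smul_mem' := by
        rintro s a ⟨ha, ha'⟩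
        refine ⟨Submodule.smul_mem _ s ha, fun j u hu c => ?_⟩
        simp only [map_smul, LinearMap.smul_apply, ha' j u hu c]
        module }
  have hm := R.mem hP
  have hn : M.n ≤ M.r := by
    rw [Model.chkWords, Bool.and_eq_true] at hw
    exact Nat.le_of_ble_eq_true hw.2
  have hd : M.dim = M.n + 2 * M.r := rfl
  have hgen := R.generate hw M.parity (fun i hi j hj y hy => (Model.par_add hP hi hj hy).2)
    Q (fun i i' a ha b hb => ⟨hm _ _ _ ha.1 _ hb.1, jacobi_closure hm ha.1 hb.1 ha.2 hb.2⟩)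
    (fun i hi => ⟨by rw [R.part]; exact F.e_mem_graded (by omega),
      R.jacobi_gen hp fun j hj' k hk => by
        have := of_upto (of_upto (of_upto hj i hi) j hj') k hk
        rw [Bool.and_eq_true] at this; exact this.1⟩)
    (fun i hi => ⟨by rw [R.part]; exact F.e_mem_graded (by omega),
      R.jacobi_gen hp fun j hj' k hk => by
        have := of_upto (of_upto (of_upto hj i hi) j hj') k hk
        rw [Bool.and_eq_true] at this; exact this.2⟩)
  intro i j a ha b hb c
  have : a ∈ Q i := by
    rw [R.part] at ha
    exact F.map_mem_of_graded LinearMap.id (Q i) (fun k hk hki => by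
      rw [← hki]; exact hgen k hk) ha
  exact this.2 j b hb c

/-- The identity `[a, [a, a]] = 0` extends from odd basis vectors to their linear combinations: the
mixed terms vanish by the Jacobi identity. -/
theorem cubic (hs : M.chkSkew = true) (hP : M.chkPar = true)
    (hJ : ∀ i j, ∀ a ∈ P i, ∀ b ∈ P j, ∀ c : V,
      β a (β b c) = β (β a b) c + sgn K i j • β b (β a c)) :
    ∀ a ∈ P 1, β a (β a a) = 0 := by
  have hsk := R.skew hp hs
  have hm := R.mem hP
  intro a ha
  have ha' := ha
  rw [R.part] at ha'
  refine Submodule.span_induction (p := fun a _ => β a (β a a) = 0) ?_ (by simp) ?_ ?_ ha'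
  · rintro _ ⟨k, hk, hk0, rfl⟩
    have := of_upto hs k hk
    rw [Bool.and_eq_true] at this
    have hk0 : M.pr k % 2 = 1 := by
      by_contra h
      have h : M.pr k % 2 = 0 := by omega
      have : M.parity k = 0 := (ZMod.natCast_eq_zero_iff _ 2).2 (Nat.dvd_of_mod_eq_zero h)
      rw [this] at hk0
      exact absurd hk0 (by decide)
    have h1 := this.1
    have h2 : Nat.beq (M.pr k % 2) 0 = false := by rw [hk0]; rfl
    rw [h2, cond_false] at h1
    rw [R.br, R.adl]
    exact F.val_eq_zero t h1
  · intro a b ha hb h1 h2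
    have ha : a ∈ P 1 := by rw [R.part]; exact ha
    have hb : b ∈ P 1 := by rw [R.part]; exact hb
    have z : (1 + 1 : ZMod 2) = 0 := by decide
    have e1 := hsk 1 1 a ha b hb
    have e2 := hJ 1 1 b hb a ha a
    have e3 := hJ 1 1 a ha b hb b
    have e4 := hsk (1 + 1) 1 (β b a) (hm 1 1 b hb a ha) a ha
    have e5 := hsk (1 + 1) 1 (β b a) (hm 1 1 b hb a ha) b hb
    rw [z] at e4 e5
    simp only [sgn_one_one, sgn_zero_left, one_smul, neg_smul, neg_neg] at e1 e2 e3 e4 e5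
    rw [e1] at e3
    simp only [map_add, LinearMap.add_apply, h1, h2, e1, e2, e3, e4, e5]
    abel
  · intro c a _ h1
    simp [h1]

/-- A table passing the checks defines a Lie superalgebra. -/
theorem isLieSuper (hP : M.chkPar = true) (hs : M.chkSkew = true) (hj : M.chkJac = true)
    (hw : M.chkWords = true) : IsLieSuper P β where
  compl := by
    rw [R.part, R.part]
    exact F.isCompl_graded M.parity
  mem := R.mem hP
  skew := R.skew hp hs
  alt := R.alt hp hs
  jacobi := R.jacobi hp hj hP hw
  cubic := R.cubic hp hs hP (R.jacobi hp hj hP hw)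

end Rep

end StructConst

namespace StructConst

/-! ### Realizations of the Lie superalgebra with a given Cartan matrix -/

section Words

variable {K T X : Type*} [Field K] [AddCommGroup T] [Module K T]

theorem subset_subalgSpan (b : Bil K T) (S : Set T) : S ⊆ subalgSpan b S := by
  intro s hs
  simp only [subalgSpan, SetLike.mem_coe, Submodule.mem_sInf]
  exact fun U hU => hU.2 hs

theorem mul_mem_subalgSpan (b : Bil K T) (S : Set T) {u v : T} (hu : u ∈ subalgSpan b S)
    (hv : v ∈ subalgSpan b S) : b u v ∈ subalgSpan b S := by
  simp only [subalgSpan, Submodule.mem_sInf] at hu hv ⊢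
  exact fun U hU => hU.1 u (hu U hU) v (hv U hU)

theorem subalgSpan_le {b : Bil K T} {S : Set T} {U : Submodule K T}
    (h : ∀ u ∈ U, ∀ v ∈ U, b u v ∈ U) (hS : S ⊆ U) : subalgSpan b S ≤ U :=
  sInf_le ⟨h, hS⟩

/-- The span of the values of all bracket monomials. -/
def wordSpan (b : Bil K T) (e : X → T) : Submodule K T := Submodule.span K (Set.range (wordVal b e))

theorem wordVal_mem_wordSpan (b : Bil K T) (e : X → T) (w : FreeMagma X) :
    wordVal b e w ∈ wordSpan b e := Submodule.subset_span ⟨w, rfl⟩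

theorem mul_mem_wordSpan {b : Bil K T} {e : X → T} {u v : T} (hu : u ∈ wordSpan b e)
    (hv : v ∈ wordSpan b e) : b u v ∈ wordSpan b e := by
  have h1 : ∀ w, ∀ v ∈ wordSpan b e, b (wordVal b e w) v ∈ wordSpan b e := by
    intro w v hv
    have : wordSpan b e ≤ (wordSpan b e).comap (b (wordVal b e w)) := by
      refine Submodule.span_le.2 ?_
      rintro _ ⟨w', rfl⟩
      exact wordVal_mem_wordSpan b e (w.mul w')
    exact this hv
  have : wordSpan b e ≤ (wordSpan b e).comap (b.flip v) := by
    refine Submodule.span_le.2 ?_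
    rintro _ ⟨w, rfl⟩
    exact h1 w v hv
  exact this hu

theorem subalgSpan_range (b : Bil K T) (e : X → T) :
    subalgSpan b (Set.range e) = wordSpan b e := by
  refine le_antisymm (subalgSpan_le (fun u hu v hv => mul_mem_wordSpan hu hv) ?_) ?_
  · rintro _ ⟨i, rfl⟩
    exact wordVal_mem_wordSpan b e (.of i)
  · refine Submodule.span_le.2 ?_
    rintro _ ⟨w, rfl⟩
    induction w with
    | ih1 i => exact subset_subalgSpan _ _ ⟨i, rfl⟩
    | ih2 u v hu hv => exact mul_mem_subalgSpan _ _ hu hv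

variable {b : Bil K T} {Q : ZMod 2 → Submodule K T} {e : X → T} {q : X → ZMod 2}

theorem wordVal_mem_parity (hm : ∀ i j, ∀ u ∈ Q i, ∀ v ∈ Q j, b u v ∈ Q (i + j))
    (he : ∀ i, e i ∈ Q (q i)) (w : FreeMagma X) : wordVal b e w ∈ Q (wordSum q w) := by
  induction w with
  | ih1 i => exact he i
  | ih2 u v hu hv => exact hm _ _ _ hu _ hv

/-- An even element that maps the generators into the subalgebra they generate normalizes this
subalgebra. -/
theorem even_mul_mem_wordSpan (hm : ∀ i j, ∀ u ∈ Q i, ∀ v ∈ Q j, b u v ∈ Q (i + j))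
    (hj : ∀ i j, ∀ u ∈ Q i, ∀ v ∈ Q j, ∀ c, b u (b v c) = b (b u v) c + sgn K i j • b v (b u c))
    (he : ∀ i, e i ∈ Q (q i)) {c : T} (hc : c ∈ Q 0) (hce : ∀ i, b c (e i) ∈ wordSpan b e) :
    ∀ v ∈ wordSpan b e, b c v ∈ wordSpan b e := by
  have h : ∀ w, b c (wordVal b e w) ∈ wordSpan b e := by
    intro w
    induction w with
    | ih1 i => exact hce i
    | ih2 u v hu hv =>
      change b c (b (wordVal b e u) (wordVal b e v)) ∈ _
      rw [hj _ _ _ hc _ (wordVal_mem_parity hm he u)]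
      exact add_mem (mul_mem_wordSpan hu (wordVal_mem_wordSpan b e v))
        (Submodule.smul_mem _ _ (mul_mem_wordSpan (wordVal_mem_wordSpan b e u) hv))
  intro v hv
  have : wordSpan b e ≤ (wordSpan b e).comap (b c) := by
    refine Submodule.span_le.2 ?_
    rintro _ ⟨w, rfl⟩
    exact h w
  exact this hv

/-- If `o` maps the generators into a subspace `C` of the even part that normalizes the subalgebra
generated by them, then it maps this subalgebra into its sum with `C`. -/
theorem opposite_mul_mem (hm : ∀ i j, ∀ u ∈ Q i, ∀ v ∈ Q j, b u v ∈ Q (i + j))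
    (hs : ∀ i j, ∀ u ∈ Q i, ∀ v ∈ Q j, b u v = -(sgn K i j • b v u))
    (hj : ∀ i j, ∀ u ∈ Q i, ∀ v ∈ Q j, ∀ c, b u (b v c) = b (b u v) c + sgn K i j • b v (b u c))
    (he : ∀ i, e i ∈ Q (q i)) {C : Submodule K T} (hC : C ≤ Q 0)
    (hCe : ∀ c ∈ C, ∀ i, b c (e i) ∈ wordSpan b e) {o : T} {k : ZMod 2} (ho : o ∈ Q k)
    (hoe : ∀ i, b o (e i) ∈ C) :
    ∀ v ∈ wordSpan b e, b o v ∈ wordSpan b e ⊔ C := by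
  have h : ∀ w, b o (wordVal b e w) ∈ wordSpan b e ⊔ C := by
    intro w
    induction w with
    | ih1 i => exact Submodule.mem_sup_right (hoe i)
    | ih2 u v hu hv =>
      change b o (b (wordVal b e u) (wordVal b e v)) ∈ _
      rw [hj _ _ _ ho _ (wordVal_mem_parity hm he u)]
      obtain ⟨a, ha, c, hc, hac⟩ := Submodule.mem_sup.1 hu
      obtain ⟨a', ha', c', hc', hac'⟩ := Submodule.mem_sup.1 hv
      rw [← hac, ← hac', map_add, LinearMap.add_apply, map_add,
        hs _ _ _ (wordVal_mem_parity hm he u) c' (hC hc')]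
      have hw := wordVal_mem_wordSpan b e
      refine Submodule.mem_sup_left (add_mem (add_mem (mul_mem_wordSpan ha (hw v))
        (even_mul_mem_wordSpan hm hj he (hC hc) (hCe c hc) _ (hw v)))
        (Submodule.smul_mem _ _ (add_mem (mul_mem_wordSpan (hw u) ha')
          (neg_mem (Submodule.smul_mem _ _
            (even_mul_mem_wordSpan hm hj he (hC hc') (hCe c' hc') _ (hw u)))))))
  intro v hv
  have : wordSpan b e ≤ (wordSpan b e ⊔ C).comap (b o) := by
    refine Submodule.span_le.2 ?_
    rintro _ ⟨w, rfl⟩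
    exact h w
  exact this hv

end Words

section Free

variable (K : Type*) [Field K] {n : ℕ} {V : Type*} [AddCommGroup V] [Module K V]

/-- Generators of a free non-associative algebra may be mapped anywhere. -/
theorem exists_freeLift (β : Bil K V) (g : Gen n → V) : ∃ φ : FreeAlg K n →ₗ[K] V,
    (∀ a b, φ (freeMul K n a b) = β (φ a) (φ b)) ∧ ∀ a, φ (freeGen K n a) = g a := by
  let _ : NonUnitalNonAssocRing V :=
    { (inferInstance : AddCommGroup V) with
      mul := fun a b => β a b
      left_distrib := fun a b c => (β a).map_add b c
      right_distrib := fun a b c => LinearMap.map_add₂ β a b c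
      zero_mul := fun a => LinearMap.map_zero₂ β a
      mul_zero := fun a => (β a).map_zero }
  have _ : IsScalarTower K V V := ⟨fun c a b => LinearMap.map_smul₂ β c a b⟩
  have _ : SMulCommClass K V V := ⟨fun c a b => ((β a).map_smul c b).symm⟩
  let ψ := FreeNonUnitalNonAssocAlgebra.lift K g
  exact ⟨(ψ : FreeAlg K n →ₗ[K] V), fun a b => map_mul ψ a b,
    fun a => FreeNonUnitalNonAssocAlgebra.lift_of_apply K g a⟩

theorem wordVal_free (w : FreeMagma (Gen n)) :
    wordVal (freeMul K n) (freeGen K n) w = MonoidAlgebra.single w 1 := by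
  induction w with
  | ih1 i => rfl
  | ih2 u v hu hv =>
    change freeMul K n (wordVal _ _ u) (wordVal _ _ v) = _
    rw [hu, hv]
    change (MonoidAlgebra.single u (1 : K) * MonoidAlgebra.single v (1 : K) : FreeAlg K n) = _
    rw [MonoidAlgebra.single_mul_single, one_mul]

theorem wordSpan_free : wordSpan (freeMul K n) (freeGen K n) = ⊤ := by
  refine eq_top_iff.2 ?_
  rintro a -
  induction a using MonoidAlgebra.induction_linear with
  | zero => exact zero_mem _
  | add a b ha hb => exact add_mem ha hb
  | single w c =>
    have h : MonoidAlgebra.single w c = c • wordVal (freeMul K n) (freeGen K n) w := by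
      rw [wordVal_free, MonoidAlgebra.smul_single, smul_eq_mul, mul_one]
    rw [h]
    exact Submodule.smul_mem _ _ (wordVal_mem_wordSpan _ _ w)

end Free

section Realization

variable {K : Type*} [Field K] {n : ℕ} (A : Matrix (Fin n) (Fin n) K) (p : Fin n → ZMod 2)
variable {V : Type*} [AddCommGroup V] [Module K V]

/-- The elements `g` of the Lie superalgebra `(V, β)` satisfy the defining relations. -/
structure Realization (P : ZMod 2 → Submodule K V) (β : Bil K V) (g : Gen n → V) : Prop where
  lie : IsLieSuper P β
  mem : ∀ a, g a ∈ P (genParity p a)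
  xy : ∀ i j, β (g (.x i)) (g (.y j)) = if i = j then g (.h i) else 0
  hh : ∀ i j, β (g (.h i)) (g (.h j)) = 0
  hx : ∀ i j, β (g (.h i)) (g (.x j)) = A i j • g (.x j)
  hy : ∀ i j, β (g (.h i)) (g (.y j)) = -(A i j • g (.y j))

/-- A triangular decomposition of `(V, β)` without nonzero subspaces of the positive (negative)
part that are invariant under all `y_i` (all `x_i`). -/
structure Triangular (β : Bil K V) (g : Gen n → V) (Vp Vh Vn : Submodule K V) : Prop where
  x_mem : ∀ i, g (.x i) ∈ Vp
  y_mem : ∀ i, g (.y i) ∈ Vn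
  h_mem : ∀ i, g (.h i) ∈ Vh
  pos_mul : ∀ u ∈ Vp, ∀ v ∈ Vp, β u v ∈ Vp
  neg_mul : ∀ u ∈ Vn, ∀ v ∈ Vn, β u v ∈ Vn
  y_pos : ∀ i, ∀ v ∈ Vp, β (g (.y i)) v ∈ Vp ⊔ Vh
  x_neg : ∀ i, ∀ v ∈ Vn, β (g (.x i)) v ∈ Vn ⊔ Vh
  indep : ∀ a ∈ Vp, ∀ b ∈ Vh, ∀ c ∈ Vn, a + b + c = 0 → a = 0 ∧ b = 0 ∧ c = 0
  lin_h : LinearIndependent K fun i => g (.h i)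
  gen : ∀ U : Submodule K V, (∀ a, g a ∈ U) → (∀ u ∈ U, ∀ v ∈ U, β u v ∈ U) → U = ⊤
  pos_trans : ∀ W ≤ Vp, (∀ i, ∀ v ∈ W, β (g (.y i)) v ∈ W) → W = ⊥
  neg_trans : ∀ W ≤ Vn, (∀ i, ∀ v ∈ W, β (g (.x i)) v ∈ W) → W = ⊥

variable {A p}

theorem mkQ_eq_zero_of_rel {a : FreeAlg K n} (h : Rel A p a) : (relIdeal A p).mkQ a = 0 := by
  rw [Submodule.mkQ_apply, Submodule.Quotient.mk_eq_zero]
  simp only [relIdeal, idealSpan, Submodule.mem_sInf]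
  exact fun I hI => hI.2 h

variable (A p) in
/-- The even and the odd part of `g̃(A)`. -/
noncomputable def tildeParity (i : ZMod 2) : Submodule K (Tilde A p) :=
  (freeParity K p i).map (relIdeal A p).mkQ

theorem tilde_skew (i j : ZMod 2) : ∀ u ∈ tildeParity A p i, ∀ v ∈ tildeParity A p j,
    tildeBracket A p u v = -(sgn K i j • tildeBracket A p v u) := by
  rintro _ ⟨u, hu, rfl⟩ _ ⟨v, hv, rfl⟩
  rw [eq_neg_iff_add_eq_zero]
  exact mkQ_eq_zero_of_rel (Rel.skew i j u v hu hv)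

theorem tilde_jacobi (i j : ZMod 2) : ∀ u ∈ tildeParity A p i, ∀ v ∈ tildeParity A p j, ∀ c,
    tildeBracket A p u (tildeBracket A p v c) = tildeBracket A p (tildeBracket A p u v) c +
      sgn K i j • tildeBracket A p v (tildeBracket A p u c) := by
  rintro _ ⟨u, hu, rfl⟩ _ ⟨v, hv, rfl⟩ c
  obtain ⟨c, rfl⟩ := (relIdeal A p).mkQ_surjective c
  rw [← sub_eq_zero, ← sub_sub]
  exact mkQ_eq_zero_of_rel (Rel.jacobi i j u v c hu hv)

theorem mul_mem_homPart {X M : Type*} [Add M] (β : Bil K V) (e : X → V) (f : X → M) {m m' : M}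
    {u v : V} (hu : u ∈ homPart β e f m) (hv : v ∈ homPart β e f m') :
    β u v ∈ homPart β e f (m + m') := by
  refine Submodule.span_induction₂ (p := fun u v _ _ => β u v ∈ homPart β e f (m + m')) ?_
    (by simp) (by simp) ?_ ?_ ?_ ?_ hu hv
  · rintro _ _ ⟨w, rfl, rfl⟩ ⟨w', rfl, rfl⟩
    exact Submodule.subset_span ⟨w.mul w', rfl, rfl⟩
  · intro x y z _ _ _ h1 h2
    simpa using add_mem h1 h2
  · intro x y z _ _ _ h1 h2
    simpa using add_mem h1 h2
  · intro r x y _ _ h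
    simpa using Submodule.smul_mem _ r h
  · intro r x y _ _ h
    simpa using Submodule.smul_mem _ r h

theorem tilde_mul_mem (i j : ZMod 2) : ∀ u ∈ tildeParity A p i, ∀ v ∈ tildeParity A p j,
    tildeBracket A p u v ∈ tildeParity A p (i + j) := by
  rintro _ ⟨u, hu, rfl⟩ _ ⟨v, hv, rfl⟩
  exact ⟨freeMul K n u v, mul_mem_homPart _ _ _ hu hv, rfl⟩

theorem tildeGen_mem (a : Gen n) : tildeGen A p a ∈ tildeParity A p (genParity p a) :=
  ⟨freeGen K n a, Submodule.subset_span ⟨.of a, rfl, rfl⟩, rfl⟩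

theorem tildeCartan_le : tildeCartan A p ≤ tildeParity A p 0 := by
  refine Submodule.span_le.2 ?_
  rintro _ ⟨i, rfl⟩
  exact tildeGen_mem (.h i)

theorem tilde_hx (i j : Fin n) : tildeBracket A p (tildeGen A p (.h i)) (tildeGen A p (.x j)) =
    A i j • tildeGen A p (.x j) :=
  sub_eq_zero.1 (mkQ_eq_zero_of_rel (Rel.hx (A := A) (p := p) i j))

theorem tilde_hy (i j : Fin n) : tildeBracket A p (tildeGen A p (.h i)) (tildeGen A p (.y j)) =
    -(A i j • tildeGen A p (.y j)) :=
  eq_neg_of_add_eq_zero_left (mkQ_eq_zero_of_rel (Rel.hy (A := A) (p := p) i j))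

theorem tilde_hh (i j : Fin n) :
    tildeBracket A p (tildeGen A p (.h i)) (tildeGen A p (.h j)) = 0 :=
  mkQ_eq_zero_of_rel (Rel.hh (A := A) (p := p) i j)

theorem tilde_xy (i j : Fin n) :
    tildeBracket A p (tildeGen A p (.x i)) (tildeGen A p (.y j)) ∈ tildeCartan A p := by
  by_cases hij : i = j
  · subst hij
    have : tildeBracket A p (tildeGen A p (.x i)) (tildeGen A p (.y i)) = tildeGen A p (.h i) :=
      sub_eq_zero.1 (mkQ_eq_zero_of_rel (Rel.xy (A := A) (p := p) i))
    rw [this]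
    exact Submodule.subset_span ⟨i, rfl⟩
  · have : tildeBracket A p (tildeGen A p (.x i)) (tildeGen A p (.y j)) = 0 :=
      mkQ_eq_zero_of_rel (Rel.xy_ne (A := A) (p := p) i j hij)
    rw [this]
    exact zero_mem _

theorem cartan_map_mem {e : Fin n → Tilde A p}
    (h : ∀ i j, tildeBracket A p (tildeGen A p (.h i)) (e j) ∈ wordSpan (tildeBracket A p) e) :
    ∀ c ∈ tildeCartan A p, ∀ j, tildeBracket A p c (e j) ∈ wordSpan (tildeBracket A p) e := by
  intro c hc j
  have : tildeCartan A p ≤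
      (wordSpan (tildeBracket A p) e).comap ((tildeBracket A p).flip (e j)) := by
    refine Submodule.span_le.2 ?_
    rintro _ ⟨i, rfl⟩
    exact h i j
  exact this hc

theorem cartan_mul_cartan {c d : Tilde A p} (hc : c ∈ tildeCartan A p)
    (hd : d ∈ tildeCartan A p) : tildeBracket A p c d = 0 := by
  refine Submodule.span_induction₂ (p := fun c d _ _ => tildeBracket A p c d = 0) ?_
    (by simp) (by simp) ?_ ?_ ?_ ?_ hc hd
  · rintro _ _ ⟨i, rfl⟩ ⟨j, rfl⟩
    exact tilde_hh i j
  all_goals simp +contextual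

/-- The triangular decomposition of `g̃(A)`. -/
theorem tilde_triangular : tildePos A p ⊔ tildeCartan A p ⊔ tildeNeg A p = ⊤ := by
  have hcx : ∀ c ∈ tildeCartan A p, ∀ j, tildeBracket A p c (tildeGen A p (.x j)) ∈
      wordSpan (tildeBracket A p) fun i => tildeGen A p (.x i) := by
    refine cartan_map_mem fun i j => ?_
    rw [tilde_hx]
    exact Submodule.smul_mem _ _ (wordVal_mem_wordSpan _ _ (.of j))
  have hcy : ∀ c ∈ tildeCartan A p, ∀ j, tildeBracket A p c (tildeGen A p (.y j)) ∈
      wordSpan (tildeBracket A p) fun i => tildeGen A p (.y i) := by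
    refine cartan_map_mem fun i j => ?_
    rw [tilde_hy]
    exact neg_mem (Submodule.smul_mem _ _ (wordVal_mem_wordSpan _ _ (.of j)))
  have hx : ∀ i, tildeGen A p (.x i) ∈ tildeParity A p (p i) := fun i => tildeGen_mem (.x i)
  have hy : ∀ i, tildeGen A p (.y i) ∈ tildeParity A p (p i) := fun i => tildeGen_mem (.y i)
  have hpos : tildePos A p = wordSpan (tildeBracket A p) fun i => tildeGen A p (.x i) :=
    subalgSpan_range _ _
  have hneg : tildeNeg A p = wordSpan (tildeBracket A p) fun i => tildeGen A p (.y i) :=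
    subalgSpan_range _ _
  -- the sum `U` is stable under the generators, hence under all monomials, and contains them
  set U := tildePos A p ⊔ tildeCartan A p ⊔ tildeNeg A p with hU
  have hpU : tildePos A p ≤ U := le_sup_left.trans le_sup_left
  have hcU : tildeCartan A p ≤ U := le_sup_right.trans le_sup_left
  have hnU : tildeNeg A p ≤ U := le_sup_right
  have hcp : ∀ c ∈ tildeCartan A p, ∀ v ∈ tildePos A p, tildeBracket A p c v ∈ tildePos A p := by
    rw [hpos]
    exact fun c hc => even_mul_mem_wordSpan tilde_mul_mem tilde_jacobi hx (tildeCartan_le hc)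
      (hcx c hc)
  have hcn : ∀ c ∈ tildeCartan A p, ∀ v ∈ tildeNeg A p, tildeBracket A p c v ∈ tildeNeg A p := by
    rw [hneg]
    exact fun c hc => even_mul_mem_wordSpan tilde_mul_mem tilde_jacobi hy (tildeCartan_le hc)
      (hcy c hc)
  have hxp : ∀ i, ∀ v ∈ tildePos A p, tildeBracket A p (tildeGen A p (.x i)) v ∈ tildePos A p :=
    fun i v hv => mul_mem_subalgSpan _ _ (subset_subalgSpan _ _ ⟨i, rfl⟩) hv
  have hyn : ∀ i, ∀ v ∈ tildeNeg A p, tildeBracket A p (tildeGen A p (.y i)) v ∈ tildeNeg A p :=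
    fun i v hv => mul_mem_subalgSpan _ _ (subset_subalgSpan _ _ ⟨i, rfl⟩) hv
  have hxc : ∀ i, ∀ c ∈ tildeCartan A p,
      tildeBracket A p (tildeGen A p (.x i)) c ∈ tildePos A p := fun i c hc => by
    rw [tilde_skew _ _ _ (hx i) c (tildeCartan_le hc)]
    exact neg_mem (Submodule.smul_mem _ _ (hcp c hc _ (subset_subalgSpan _ _ ⟨i, rfl⟩)))
  have hyc : ∀ i, ∀ c ∈ tildeCartan A p,
      tildeBracket A p (tildeGen A p (.y i)) c ∈ tildeNeg A p := fun i c hc => by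
    rw [tilde_skew _ _ _ (hy i) c (tildeCartan_le hc)]
    exact neg_mem (Submodule.smul_mem _ _ (hcn c hc _ (subset_subalgSpan _ _ ⟨i, rfl⟩)))
  have hxn : ∀ i, ∀ v ∈ tildeNeg A p, tildeBracket A p (tildeGen A p (.x i)) v ∈ U := by
    intro i v hv
    rw [hneg] at hv
    have := opposite_mul_mem tilde_mul_mem tilde_skew tilde_jacobi hy tildeCartan_le hcy (hx i)
      (fun j => tilde_xy i j) v hv
    rw [← hneg] at this
    exact sup_le hnU hcU this
  have hyp : ∀ i, ∀ v ∈ tildePos A p, tildeBracket A p (tildeGen A p (.y i)) v ∈ U := by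
    intro i v hv
    rw [hpos] at hv
    have := opposite_mul_mem tilde_mul_mem tilde_skew tilde_jacobi hx tildeCartan_le hcx (hy i)
      (fun j => by
        rw [tilde_skew _ _ _ (hy i) _ (hx j)]
        exact neg_mem (Submodule.smul_mem _ _ (tilde_xy j i))) v hv
    rw [← hpos] at this
    exact sup_le hpU hcU this
  have hsplit : ∀ a, (∀ v ∈ tildePos A p, tildeBracket A p a v ∈ U) →
      (∀ v ∈ tildeCartan A p, tildeBracket A p a v ∈ U) →
      (∀ v ∈ tildeNeg A p, tildeBracket A p a v ∈ U) → ∀ v ∈ U, tildeBracket A p a v ∈ U := by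
    intro a h1 h2 h3
    have : U ≤ U.comap (tildeBracket A p a) := sup_le (sup_le h1 h2) h3
    exact this
  have hgen : ∀ a, ∀ v ∈ U, tildeBracket A p (tildeGen A p a) v ∈ U := by
    rintro (i | i | i)
    · exact hsplit _ (fun v hv => hpU (hxp i v hv)) (fun v hv => hpU (hxc i v hv)) (hxn i)
    · exact hsplit _ (hyp i) (fun v hv => hnU (hyc i v hv)) (fun v hv => hnU (hyn i v hv))
    · have hi : tildeGen A p (.h i) ∈ tildeCartan A p := Submodule.subset_span ⟨i, rfl⟩
      exact hsplit _ (fun v hv => hpU (hcp _ hi v hv))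
        (fun v hv => by rw [cartan_mul_cartan hi hv]; exact zero_mem _)
        (fun v hv => hnU (hcn _ hi v hv))
  have hword : ∀ w, ∀ v ∈ U,
      tildeBracket A p (wordVal (tildeBracket A p) (tildeGen A p) w) v ∈ U := by
    intro w
    induction w with
    | ih1 a => exact hgen a
    | ih2 a b ha hb =>
      intro v hv
      have hpa := wordVal_mem_parity tilde_mul_mem (tildeGen_mem (A := A) (p := p)) a
      have hpb := wordVal_mem_parity tilde_mul_mem (tildeGen_mem (A := A) (p := p)) b
      have := tilde_jacobi _ _ _ hpa _ hpb v
      rw [← sub_eq_iff_eq_add] at this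
      change tildeBracket A p (tildeBracket A p (wordVal _ _ a) (wordVal _ _ b)) v ∈ U
      rw [← this]
      exact sub_mem (ha _ (hb _ hv)) (Submodule.smul_mem _ _ (hb _ (ha _ hv)))
  have hwordU : ∀ w, wordVal (tildeBracket A p) (tildeGen A p) w ∈ U := by
    intro w
    induction w with
    | ih1 a =>
      rcases a with i | i | i
      · exact hpU (subset_subalgSpan _ _ ⟨i, rfl⟩)
      · exact hnU (subset_subalgSpan _ _ ⟨i, rfl⟩)
      · exact hcU (Submodule.subset_span ⟨i, rfl⟩)
    | ih2 a b _ hb => exact hword a _ hb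
  have hmk : ∀ w, (relIdeal A p).mkQ (wordVal (freeMul K n) (freeGen K n) w) =
      wordVal (tildeBracket A p) (tildeGen A p) w := by
    intro w
    induction w with
    | ih1 a => rfl
    | ih2 a b ha hb =>
      change _ = tildeBracket A p (wordVal _ _ a) (wordVal _ _ b)
      rw [← ha, ← hb]
      rfl
  refine eq_top_iff.2 ?_
  rintro a -
  obtain ⟨a, rfl⟩ := (relIdeal A p).mkQ_surjective a
  have ha : a ∈ wordSpan (freeMul K n) (freeGen K n) := by rw [wordSpan_free]; trivial
  have : wordSpan (freeMul K n) (freeGen K n) ≤ U.comap (relIdeal A p).mkQ := by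
    refine Submodule.span_le.2 ?_
    rintro _ ⟨w, rfl⟩
    change (relIdeal A p).mkQ _ ∈ U
    rw [hmk]
    exact hwordU w
  exact this ha

variable {P : ZMod 2 → Submodule K V} {β : Bil K V} {g : Gen n → V}

/-- The universal property of `g̃(A)`. -/
theorem Realization.exists_tildeLift (R : Realization A p P β g) : ∃ φ : Tilde A p →ₗ[K] V,
    (∀ a b, φ (tildeBracket A p a b) = β (φ a) (φ b)) ∧ ∀ a, φ (tildeGen A p a) = g a := by
  obtain ⟨φ, hφ, hg⟩ := exists_freeLift K β g
  have hpar : ∀ i, ∀ a ∈ freeParity K p i, φ a ∈ P i := by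
    intro i a ha
    have : freeParity K p i ≤ (P i).comap φ := by
      refine Submodule.span_le.2 ?_
      rintro _ ⟨w, rfl, rfl⟩
      clear ha
      change φ _ ∈ P _
      induction w with
      | ih1 a => exact (hg a).symm ▸ R.mem a
      | ih2 u v hu hv =>
        change φ (freeMul K n _ _) ∈ _
        rw [hφ]
        exact R.lie.mem _ _ _ hu _ hv
    exact this ha
  have hker : relIdeal A p ≤ LinearMap.ker φ := by
    refine sInf_le ⟨fun a b hb => ?_, ?_⟩
    · rw [LinearMap.mem_ker] at hb
      simp [hφ, hb]
    · intro a ha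
      change φ a = 0
      induction ha with
      | skew i j a b ha hb =>
        rw [map_add, map_smul, hφ, hφ, R.lie.skew i j _ (hpar i a ha) _ (hpar j b hb)]
        simp
      | alt a ha => rw [hφ, R.lie.alt _ (hpar 0 a ha)]
      | jacobi i j a b c ha hb =>
        simp only [map_sub, map_smul, hφ]
        rw [R.lie.jacobi i j _ (hpar i a ha) _ (hpar j b hb)]
        abel
      | cubic a ha => rw [hφ, hφ, R.lie.cubic _ (hpar 1 a ha)]
      | xy i => rw [map_sub, hφ, hg, hg, hg, R.xy, if_pos rfl, sub_self]
      | xy_ne i j hij => rw [hφ, hg, hg, R.xy, if_neg hij]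
      | hh i j => rw [hφ, hg, hg, R.hh]
      | hx i j => rw [map_sub, map_smul, hφ, hg, hg, R.hx, sub_self]
      | hy i j => rw [map_add, map_smul, hφ, hg, hg, R.hy, neg_add_cancel]
  refine ⟨(relIdeal A p).liftQ φ hker, fun a b => ?_, hg⟩
  obtain ⟨a, rfl⟩ := (relIdeal A p).mkQ_surjective a
  obtain ⟨b, rfl⟩ := (relIdeal A p).mkQ_surjective b
  exact hφ a b

variable {Vp Vh Vn : Submodule K V}

theorem Triangular.map_pos (T : Triangular β g Vp Vh Vn) {φ : Tilde A p →ₗ[K] V}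
    (hφ : ∀ a b, φ (tildeBracket A p a b) = β (φ a) (φ b)) (hg : ∀ a, φ (tildeGen A p a) = g a) :
    tildePos A p ≤ Vp.comap φ := by
  refine subalgSpan_le (fun u hu v hv => ?_) ?_
  · change φ _ ∈ Vp
    rw [hφ]
    exact T.pos_mul _ hu _ hv
  · rintro _ ⟨i, rfl⟩
    change φ _ ∈ Vp
    rw [hg]
    exact T.x_mem i

theorem Triangular.map_neg (T : Triangular β g Vp Vh Vn) {φ : Tilde A p →ₗ[K] V}
    (hφ : ∀ a b, φ (tildeBracket A p a b) = β (φ a) (φ b)) (hg : ∀ a, φ (tildeGen A p a) = g a) :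
    tildeNeg A p ≤ Vn.comap φ := by
  refine subalgSpan_le (fun u hu v hv => ?_) ?_
  · change φ _ ∈ Vn
    rw [hφ]
    exact T.neg_mul _ hu _ hv
  · rintro _ ⟨i, rfl⟩
    change φ _ ∈ Vn
    rw [hg]
    exact T.y_mem i

/-- The kernel of the map of `g̃(A)` onto a realization with a triangular decomposition as above is
the largest ideal used in the definition of `g(A)`. -/
theorem Triangular.radical_eq (T : Triangular β g Vp Vh Vn) {φ : Tilde A p →ₗ[K] V}
    (hφ : ∀ a b, φ (tildeBracket A p a b) = β (φ a) (φ b)) (hg : ∀ a, φ (tildeGen A p a) = g a) :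
    radical A p = LinearMap.ker φ := by
  have hp := T.map_pos hφ hg
  have hn := T.map_neg hφ hg
  have hh : tildeCartan A p ≤ Vh.comap φ := by
    refine Submodule.span_le.2 ?_
    rintro _ ⟨i, rfl⟩
    change φ _ ∈ Vh
    rw [hg]
    exact T.h_mem i
  have hdis : ∀ v ∈ tildeCartan A p, φ v = 0 → v = 0 := by
    intro v hv h0
    obtain ⟨c, rfl⟩ := (Submodule.mem_span_range_iff_exists_fun K).1 hv
    rw [map_sum] at h0
    simp_rw [map_smul, hg] at h0
    have := Fintype.linearIndependent_iff.1 T.lin_h c h0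
    simp [this]
  apply le_antisymm
  · refine sSup_le fun I hI => ?_
    obtain ⟨hI, -, hI'⟩ := hI
    -- the image of the positive part of the ideal is stable under the `y_i`
    have h1 : (I ⊓ tildePos A p).map φ = ⊥ := by
      refine T.pos_trans _ (Submodule.map_le_iff_le_comap.2 (inf_le_right.trans hp)) ?_
      rintro i _ ⟨u, hu, rfl⟩
      have h := (hI (tildeGen A p (.y i)) u hu.1).1
      rw [hI'] at h
      obtain ⟨a, ha, b, hb, hab⟩ := Submodule.mem_sup.1 h
      have hv := T.y_pos i _ (hp hu.2)
      obtain ⟨a', ha', c', hc', hac⟩ := Submodule.mem_sup.1 hv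
      rw [← hg, ← hφ, ← hab, map_add] at hac ⊢
      have h0 := T.indep (φ a - a') (sub_mem (hp ha.2) ha') (-c') (neg_mem hc') (φ b) (hn hb.2)
        (by rw [← sub_eq_zero] at hac; rw [← neg_eq_zero, ← hac]; abel)
      rw [h0.2.2, add_zero]
      exact ⟨a, ha, rfl⟩
    have h2 : (I ⊓ tildeNeg A p).map φ = ⊥ := by
      refine T.neg_trans _ (Submodule.map_le_iff_le_comap.2 (inf_le_right.trans hn)) ?_
      rintro i _ ⟨u, hu, rfl⟩
      have h := (hI (tildeGen A p (.x i)) u hu.1).1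
      rw [hI'] at h
      obtain ⟨a, ha, b, hb, hab⟩ := Submodule.mem_sup.1 h
      have hv := T.x_neg i _ (hn hu.2)
      obtain ⟨a', ha', c', hc', hac⟩ := Submodule.mem_sup.1 hv
      rw [← hg, ← hφ, ← hab, map_add] at hac ⊢
      have h0 := T.indep (φ a) (hp ha.2) (-c') (neg_mem hc') (φ b - a') (sub_mem (hn hb.2) ha')
        (by rw [← sub_eq_zero] at hac; rw [← neg_eq_zero, ← hac]; abel)
      rw [h0.1, zero_add]
      exact ⟨b, hb, rfl⟩
    rw [hI']
    exact sup_le (LinearMap.le_ker_iff_map.2 h1) (LinearMap.le_ker_iff_map.2 h2)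
  · refine le_sSup ⟨fun a b hb => ?_, ?_, ?_⟩
    · rw [LinearMap.mem_ker] at hb
      simp [hφ, hb]
    · exact Submodule.disjoint_def.2 fun v hv hv' => hdis v hv' hv
    · refine le_antisymm (fun v hv => ?_) (sup_le inf_le_left inf_le_left)
      have : v ∈ tildePos A p ⊔ tildeCartan A p ⊔ tildeNeg A p := by
        rw [tilde_triangular]; trivial
      obtain ⟨ab, hab, c, hc, rfl⟩ := Submodule.mem_sup.1 this
      obtain ⟨a, ha, b, hb, rfl⟩ := Submodule.mem_sup.1 hab
      rw [LinearMap.mem_ker, map_add, map_add] at hv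
      obtain ⟨ha0, hb0, hc0⟩ := T.indep _ (hp ha) _ (hh hb) _ (hn hc) hv
      rw [hdis b hb hb0, add_zero]
      exact Submodule.add_mem_sup ⟨ha0, ha⟩ ⟨hc0, hc⟩

/-- A realization of the defining relations with a triangular decomposition as above is isomorphic
to `g(A)`. -/
theorem Triangular.exists_equiv (T : Triangular β g Vp Vh Vn) (R : Realization A p P β g) :
    ∃ Φ : CartanAlg A p ≃ₗ[K] V, (∀ a b, Φ (bracket A p a b) = β (Φ a) (Φ b)) ∧
      ∀ a, Φ (NISDeform.gen A p a) = g a := by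
  obtain ⟨φ, hφ, hg⟩ := R.exists_tildeLift
  have hker := T.radical_eq hφ hg
  let ψ : CartanAlg A p →ₗ[K] V := (radical A p).liftQ φ hker.le
  have hψ : ∀ a, ψ ((radical A p).mkQ a) = φ a := fun a => rfl
  have hmul : ∀ a b, ψ (bracket A p a b) = β (ψ a) (ψ b) := by
    intro a b
    obtain ⟨a, rfl⟩ := (radical A p).mkQ_surjective a
    obtain ⟨b, rfl⟩ := (radical A p).mkQ_surjective b
    exact hφ a b
  have hgen : ∀ a, ψ (NISDeform.gen A p a) = g a := hg
  have hinj : Function.Injective ψ := by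
    rw [← LinearMap.ker_eq_bot, LinearMap.ker_eq_bot']
    intro a ha
    obtain ⟨a, rfl⟩ := (radical A p).mkQ_surjective a
    rw [hψ] at ha
    exact (Submodule.Quotient.mk_eq_zero _).2 (hker ▸ ha)
  have hsurj : Function.Surjective ψ := by
    rw [← LinearMap.range_eq_top]
    refine T.gen _ (fun a => ⟨_, hgen a⟩) ?_
    rintro _ ⟨u, rfl⟩ _ ⟨v, rfl⟩
    exact ⟨_, hmul u v⟩
  exact ⟨LinearEquiv.ofBijective ψ ⟨hinj, hsurj⟩, hmul, hgen⟩

end Realization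

end StructConst

namespace StructConst

variable {K V : Type*} [Field K] [AddCommGroup V] [Module K V]

/-! ### Realizations given by tables -/

/-- The functional `v ↦ x_k [e_i, v]`, where `row` is the list of brackets of `e_i`, as a sparse
combination of coordinates; the numbering of the list starts with `m`. -/
def colTerms (k : ℕ) : ℕ → List SVec → SVec
  | _, [] => []
  | m, u :: l => (u.filterMap fun y => bif Nat.beq y.1 k then some (m, y.2) else none) ++
      colTerms k (m + 1) l

theorem val_colTerms (t : K) (k : ℕ) (row : List SVec) (m j : ℕ) :
    val (fun i => if j = i then (1 : K) else 0) t (colTerms k m row) =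
      if m ≤ j then ev t (coefAt k (row.getD (j - m) [])) else 0 := by
  induction row generalizing m with
  | nil => simp [colTerms, coefAt]
  | cons u l ih =>
    have h1 : val (fun i => if j = i then (1 : K) else 0) t
        (u.filterMap fun y => bif Nat.beq y.1 k then some (m, y.2) else none) =
        if m = j then ev t (coefAt k u) else 0 := by
      induction u with
      | nil => simp [coefAt]
      | cons y u ihu =>
        by_cases h : Nat.beq y.1 k = true
        · simp only [List.filterMap_cons, h, cond_true, val_cons, ihu, coefAt, ev_cAdd]
          by_cases hm : m = j
          · simp [hm]
          · simp [hm, Ne.symm hm]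
        · rw [Bool.not_eq_true] at h
          simp only [List.filterMap_cons, h, cond_false, ihu, coefAt]
    rw [colTerms, val_append, h1, ih]
    rcases Nat.lt_trichotomy m j with h | h | h
    · rw [if_neg h.ne, if_pos (show m + 1 ≤ j from h), if_pos h.le, zero_add]
      have : j - m = (j - (m + 1)) + 1 := by omega
      rw [this, List.getD_cons_succ]
    · subst h
      simp
    · rw [if_neg h.ne', if_neg (by omega), if_neg (by omega), zero_add]

/-- The coordinates of `[e_i, v]` as combinations of those of `v`. -/
theorem Rep.x_mul {M : Model} {t : K} {F : Frame K V M.dim} {P : ZMod 2 → Submodule K V}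
    {β : Bil K V} (R : Rep M t F P β) {k : ℕ} (hk : k < M.dim) (i : ℕ) (v : V) :
    F.x k (β (F.e i) v) = val (fun m => F.x m v) t (colTerms k 0 (M.row i)) := by
  have key : ∀ (u : SVec), ∃ L : V →ₗ[K] K, ∀ v, L v = val (fun m => F.x m v) t u := by
    intro u
    induction u with
    | nil => exact ⟨0, fun v => rfl⟩
    | cons y u ih =>
      obtain ⟨L, hL⟩ := ih
      exact ⟨ev t y.2 • F.x y.1 + L, fun v => by simp [hL]⟩
  obtain ⟨L, hL⟩ := key (colTerms k 0 (M.row i))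
  rw [← hL, ← LinearMap.comp_apply]
  refine F.linearMap_ext (fun m hm => ?_) v
  have h1 : (fun j => F.x j (F.e m)) = fun j => if m = j then (1 : K) else 0 := by
    ext j
    by_cases hj : j < M.dim
    · rw [F.x_e _ _ hj]
    · rw [F.x_out j (by omega), if_neg (by omega), LinearMap.zero_apply]
  rw [hL, h1, val_colTerms, LinearMap.comp_apply, R.br, F.x_val t hk]
  rfl

namespace Model

variable (M : Model)

/-- The Chevalley generators of the algebra presented by the Cartan matrix. -/
def gen : Gen M.n → SVec
  | .x i => [(M.n + i, [1])]
  | .y i => [(M.n + M.r + i, M.yCoef.getD i [])]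
  | .h i => M.hGen.getD i []

/-- The entries of the Cartan matrix. -/
def cartanAt (i j : ℕ) : Coef := (M.cartan.getD i []).getD j []

/-- The defining relations hold, and the `h_i` lie in the span of the first `n` basis vectors. -/
def chkRel : Bool := upto M.n fun i =>
  M.isUnit (M.yCoef.getD i []) && ((M.hGen.getD i []).all fun y => Nat.blt y.1 M.n) &&
  upto M.n fun j =>
    let xj : SVec := [(M.n + j, [1])]
    let yj : SVec := [(M.n + M.r + j, M.yCoef.getD j [])]
    let hi : SVec := M.hGen.getD i []
    sZero M.p (M.brS [(M.n + i, [1])] yj ++ bif Nat.beq i j then sSgn M.p 1 hi else []) &&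
    sZero M.p (M.brS hi (M.hGen.getD j [])) &&
    sZero M.p (M.brS hi xj ++ sSgn M.p 1 (scale (M.cartanAt i j) xj)) &&
    sZero M.p (M.brS hi yj ++ scale (M.cartanAt i j) yj)

/-- The `k`th basis vector is a positive root vector. -/
def isPos (k : ℕ) : Bool := Nat.ble M.n k && Nat.blt k (M.n + M.r)

/-- The `k`th basis vector is a negative root vector. -/
def isNeg (k : ℕ) : Bool := Nat.ble (M.n + M.r) k

/-- The table is compatible with the triangular decomposition. -/
def chkTri : Bool := upto M.dim fun i => upto M.dim fun j => (M.br i j).all fun y =>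
  (!(M.isPos i && M.isPos j) || M.isPos y.1) && (!(M.isNeg i && M.isNeg j) || M.isNeg y.1) &&
  (!(M.isNeg i && Nat.blt i (M.n + M.r + M.n) && M.isPos j) || !M.isNeg y.1) &&
  (!(M.isPos i && Nat.blt i (M.n + M.n) && M.isNeg j) || !M.isPos y.1)

/-- Test that a subspace, stable under `n` of the generators, on which the coordinates in the set
`S` vanish, is zero; `o` is the number of the first of these generators. -/
def transOK (o : ℕ) : List (ℕ × ℕ × ℕ) → ℕ → Bool
  | [], S => upto M.dim fun i => S.testBit i
  | g :: l, S => Nat.ble o g.2.1 && Nat.blt g.2.1 (o + M.n) && Nat.blt g.2.2 M.dim &&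
      S.testBit g.2.2 &&
      ((colTerms g.2.2 0 (M.row g.2.1)).all fun y => Nat.beq y.1 g.1 || S.testBit y.1) &&
      M.isUnit (coefAt g.1 (colTerms g.2.2 0 (M.row g.2.1))) && transOK o l (S ||| 1 <<< g.1)

/-- The triangular decomposition has no nonzero invariant subspaces of one sign. -/
def chkTrans : Bool :=
  M.transOK (M.n + M.r) M.posTrans ((2 ^ M.n - 1) ||| (2 ^ M.r - 1) <<< (M.n + M.r)) &&
  M.transOK M.n M.negTrans (2 ^ (M.n + M.r) - 1)

end Model

section Trans

variable {M : Model} {t : K} {F : Frame K V M.dim} {P : ZMod 2 → Submodule K V} {β : Bil K V}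

/-- On a stable subspace the coordinates vanish one after the other: each of the listed brackets has
a coordinate that vanishes and involves only one coordinate not yet known to vanish. -/
theorem Rep.trans [CharP K M.p] (R : Rep M t F P β) (hp : 0 < M.p) (hu : M.UnitsAt t) {o : ℕ}
    {W : Submodule K V} (hW : ∀ a, o ≤ a → a < o + M.n → ∀ v ∈ W, β (F.e a) v ∈ W)
    (l : List (ℕ × ℕ × ℕ)) (S : ℕ) (hl : M.transOK o l S = true)
    (hS : ∀ i, S.testBit i = true → ∀ v ∈ W, F.x i v = 0) : W = ⊥ := by
  induction l generalizing S with
  | nil =>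
    refine (Submodule.eq_bot_iff _).2 fun v hv => F.ext fun k hk => ?_
    rw [map_zero]
    exact hS k (of_upto hl k hk) v hv
  | cons g l ih =>
    obtain ⟨b, a, j⟩ := g
    simp only [Model.transOK, Bool.and_eq_true, List.all_eq_true, Bool.or_eq_true,
      Nat.blt_eq, Nat.ble_eq] at hl
    obtain ⟨⟨⟨⟨⟨⟨ha, ha'⟩, hj⟩, hSj⟩, hall⟩, hunit⟩, hl⟩ := hl
    refine ih _ hl fun i hi v hv => ?_
    rcases testBit_or_shiftLeft hi with hi | rfl
    · exact hS i hi v hv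
    · have h0 := hS j hSj _ (hW a ha ha' v hv)
      rw [R.x_mul hj, val_eq_coefAt_add _ t i] at h0
      have h1 : val (fun m => F.x m v) t
          ((colTerms j 0 (M.row a)).filter fun y => !Nat.beq y.1 i) = 0 := by
        have : ∀ u : SVec, (∀ y ∈ u, F.x y.1 v = 0) → val (fun m => F.x m v) t u = 0 := by
          intro u
          induction u with
          | nil => simp
          | cons y u ih =>
            intro h
            rw [val_cons, ih fun z hz => h z (by simp [hz]), h y (by simp)]
            simp
        refine this _ fun y hy => ?_
        rw [List.mem_filter] at hy
        have hne : ¬ Nat.beq y.1 i = true := by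
          rw [Bool.not_eq_true]
          simpa only [Bool.not_eq_true'] using hy.2
        exact hS y.1 ((hall y hy.1).resolve_left hne) v hv
      rw [h1, add_zero, smul_eq_mul] at h0
      exact (mul_eq_zero.1 h0).resolve_left (hu.ne_zero hp hunit)

end Trans

/-- The bundle of checks which show that a table describes the Lie superalgebra with the given
Cartan matrix. -/
structure Model.Valid (M : Model) : Prop where
  p_pos : 0 < M.p
  len : M.chkLen = true
  par : M.chkPar = true
  wt : M.chkWt = true
  skew : M.chkSkew = true
  jac : M.chkJac = true
  words : M.chkWords = true
  rel : M.chkRel = true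
  tri : M.chkTri = true
  trans : M.chkTrans = true

theorem Model.Valid.n_le {M : Model} (hM : M.Valid) : M.n ≤ M.r := by
  have := hM.words
  rw [Model.chkWords, Bool.and_eq_true] at this
  exact Nat.le_of_ble_eq_true this.2

theorem Model.br_out {M : Model} (h : M.chkLen = true) {i j : ℕ} (hij : M.dim ≤ i ∨ M.dim ≤ j) :
    M.br i j = [] := by
  rw [Model.chkLen, Bool.and_eq_true, Nat.ble_eq] at h
  unfold Model.br Model.row
  by_cases hi : i < M.tab.length
  · have hj : M.dim ≤ j := by omega
    rw [List.getD_eq_getElem _ _ hi]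
    have := Nat.le_of_ble_eq_true (List.all_eq_true.1 h.2 _ (List.getElem_mem hi))
    exact List.getD_eq_default _ _ (this.trans hj)
  · rw [List.getD_eq_default _ _ (not_lt.1 hi)]
    rfl

theorem Rep.isLieSuper' {M : Model} (hM : M.Valid) {t : K} [CharP K M.p]
    {F : Frame K V M.dim} {P : ZMod 2 → Submodule K V} {β : Bil K V} (R : Rep M t F P β) :
    IsLieSuper P β :=
  R.isLieSuper hM.p_pos hM.par hM.skew hM.jac hM.words

section Std

variable (M : Model) (t : K)

/-- The bracket on `K^N` given by a table. -/
noncomputable def Model.stdBr : Bil K (Fin M.dim → K) :=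
  (Frame.std K M.dim).bilin fun i j => val (Frame.std K M.dim).e t (M.br i j)

theorem Model.stdRep (h : M.chkLen = true) : Rep M t (Frame.std K M.dim)
    ((Frame.std K M.dim).graded M.parity) (M.stdBr t) where
  part _ := rfl
  br i j := by
    by_cases hi : i < M.dim
    · by_cases hj : j < M.dim
      · exact Frame.bilin_e _ _ hi hj
      · rw [M.br_out h (Or.inr (not_lt.1 hj)), (Frame.std K M.dim).e_out j (not_lt.1 hj)]
        simp
    · rw [M.br_out h (Or.inl (not_lt.1 hi)), (Frame.std K M.dim).e_out i (not_lt.1 hi)]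
      simp

end Std

section Present

variable {M : Model} {t : K} [CharP K M.p] {F : Frame K V M.dim} {P : ZMod 2 → Submodule K V}
  {β : Bil K V} {A : Matrix (Fin M.n) (Fin M.n) K} {p : Fin M.n → ZMod 2}

/-- The Cartan matrix and the parities of the simple roots are those of the table; the `h_i` are
linearly independent. -/
structure Model.Presents (M : Model) (t : K) (A : Matrix (Fin M.n) (Fin M.n) K)
    (p : Fin M.n → ZMod 2) : Prop where
  units : M.UnitsAt t
  cartan : ∀ i j : Fin M.n, ev t (M.cartanAt i j) = A i j
  parH : ∀ i < M.n, M.parity i = 0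
  parX : ∀ i : Fin M.n, M.parity (M.n + i) = p i
  parY : ∀ i : Fin M.n, M.parity (M.n + M.r + i) = p i
  wtH : ∀ i < M.n, (M.weight i : Fin M.n → ℤ) = 0
  wtX : ∀ i : Fin M.n, M.weight (M.n + i) = Pi.single i 1
  wtY : ∀ i : Fin M.n, M.weight (M.n + M.r + i) = -Pi.single i 1
  lin_h : LinearIndependent K fun i => val (Frame.std K M.dim).e t (M.gen (.h i))

theorem Model.chkRel_iff (hM : M.Valid) (i : Fin M.n) :
    M.isUnit (M.yCoef.getD i []) = true ∧ (∀ y ∈ M.gen (.h i), y.1 < M.n) ∧ ∀ j : Fin M.n,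
      sZero M.p (M.brS (M.gen (.x i)) (M.gen (.y j)) ++
        bif Nat.beq i j then sSgn M.p 1 (M.gen (.h i)) else []) = true ∧
      sZero M.p (M.brS (M.gen (.h i)) (M.gen (.h j))) = true ∧
      sZero M.p (M.brS (M.gen (.h i)) (M.gen (.x j)) ++
        sSgn M.p 1 (scale (M.cartanAt i j) (M.gen (.x j)))) = true ∧
      sZero M.p (M.brS (M.gen (.h i)) (M.gen (.y j)) ++
        scale (M.cartanAt i j) (M.gen (.y j))) = true := by
  have h := of_upto hM.rel i i.2
  rw [Bool.and_eq_true, Bool.and_eq_true] at h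
  refine ⟨h.1.1, fun y hy => ?_, fun j => ?_⟩
  · have := List.all_eq_true.1 h.1.2 y hy
    rwa [Nat.blt_eq] at this
  · have := of_upto h.2 j j.2
    simp only [Bool.and_eq_true] at this
    exact ⟨this.1.1.1, this.1.1.2, this.1.2, this.2⟩

theorem Model.dim_eq (M : Model) : M.dim = M.n + 2 * M.r := rfl

omit [CharP K M.p] in
theorem Model.gen_mem (hM : M.Valid) {D : Type*} {deg : ℕ → D} {f : Gen M.n → D}
    (hh : ∀ i : Fin M.n, ∀ k < M.n, deg k = f (.h i))
    (hx : ∀ i : Fin M.n, deg (M.n + i) = f (.x i))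
    (hy : ∀ i : Fin M.n, deg (M.n + M.r + i) = f (.y i)) (a : Gen M.n) :
    val F.e t (M.gen a) ∈ F.graded deg (f a) := by
  have hn := hM.n_le
  have hd := M.dim_eq
  refine F.val_mem _ t fun y hy' => ?_
  rcases a with i | i | i
  · obtain rfl : y = _ := by simpa [Model.gen] using hy'
    rw [← hx i]
    exact F.e_mem_graded (by have := i.2; omega)
  · obtain rfl : y = _ := by simpa [Model.gen] using hy'
    rw [← hy i]
    exact F.e_mem_graded (by have := i.2; omega)
  · have hlt := (Model.chkRel_iff hM i).2.1 y hy'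
    rw [← hh i y.1 hlt]
    exact F.e_mem_graded (by omega)

omit [CharP K M.p] in
theorem Model.e_x (i : Fin M.n) : val F.e t (M.gen (.x i)) = F.e (M.n + i) := by
  simp [Model.gen]

omit [CharP K M.p] in
theorem Model.e_y (i : Fin M.n) :
    val F.e t (M.gen (.y i)) = ev t (M.yCoef.getD i []) • F.e (M.n + M.r + i) := by
  simp [Model.gen]

/-- The pieces of a grading of the algebra by bracket monomials are spanned by basis vectors. -/
theorem Rep.homPart_eq (hM : M.Valid) (hu : M.UnitsAt t) (R : Rep M t F P β)
    {D : Type*} [Add D] {deg : ℕ → D} {f : Gen M.n → D}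
    (hdeg : ∀ i < M.dim, ∀ j < M.dim, ∀ y ∈ M.br i j, deg y.1 = deg i + deg j)
    (hh : ∀ i : Fin M.n, ∀ k < M.n, deg k = f (.h i))
    (hx : ∀ i : Fin M.n, deg (M.n + i) = f (.x i))
    (hy : ∀ i : Fin M.n, deg (M.n + M.r + i) = f (.y i)) {g : Gen M.n → V}
    (hg : ∀ a, g a = val F.e t (M.gen a)) (m : D) : homPart β g f m = F.graded deg m := by
  apply le_antisymm
  · refine Submodule.span_le.2 ?_
    rintro _ ⟨w, rfl, rfl⟩
    induction w with
    | ih1 a =>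
      change g a ∈ F.graded deg (f a)
      rw [hg]
      exact Model.gen_mem hM hh hx hy a
    | ih2 u v hu hv =>
      change β _ _ ∈ F.graded deg (_ + _)
      refine F.bilin_mem_of_graded β _ (fun i hi j hj him hjm => ?_) hu hv
      rw [R.br]
      refine F.val_mem _ t fun y hy => ?_
      rw [← him, ← hjm, ← hdeg i hi j hj y hy]
      exact F.e_mem_graded (Model.par_add hM.par hi hj hy).1
  · have hgen := R.generate hM.words deg hdeg (homPart β g f)
      (fun m m' a ha b hb => mul_mem_homPart β g f ha hb)
      (fun i hi => by
        rw [hx ⟨i, hi⟩, ← Model.e_x (t := t) (F := F) ⟨i, hi⟩, ← hg]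
        exact Submodule.subset_span ⟨.of (.x ⟨i, hi⟩), rfl, rfl⟩)
      (fun i hi => by
        have hc := hu.ne_zero hM.p_pos (Model.chkRel_iff hM ⟨i, hi⟩).1
        rw [hy ⟨i, hi⟩, ← Submodule.smul_mem_iff _ hc, ← Model.e_y (t := t) (F := F) ⟨i, hi⟩, ← hg]
        exact Submodule.subset_span ⟨.of (.y ⟨i, hi⟩), rfl, rfl⟩)
    refine Submodule.span_le.2 ?_
    rintro _ ⟨j, hj, rfl, rfl⟩
    exact hgen j hj

theorem Rep.realization (hM : M.Valid) (hA : M.Presents t A p) (R : Rep M t F P β) :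
    Realization A p P β fun a => val F.e t (M.gen a) where
  lie := R.isLieSuper' hM
  mem a := by
    rw [R.part]
    exact Model.gen_mem hM (fun i k hk => hA.parH k hk) hA.parX hA.parY a
  xy i j := by
    have h := F.val_eq_zero t ((Model.chkRel_iff hM i).2.2 j).1
    rw [val_append, ← R.brS] at h
    by_cases hij : i = j
    · subst hij
      simp only [Nat.beq_refl, cond_true, val_sSgn F.e t hM.p_pos, pow_one, neg_smul,
        one_smul] at h
      rw [if_pos rfl]
      exact eq_of_sub_eq_zero (by rw [sub_eq_add_neg]; exact h)
    · have : Nat.beq i j = false := by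
        rw [← Bool.not_eq_true, Nat.beq_eq]
        exact fun h => hij (Fin.ext h)
      simp only [this, cond_false, val_nil, add_zero] at h
      rw [if_neg hij, h]
  hh i j := by
    rw [R.brS]
    exact F.val_eq_zero t ((Model.chkRel_iff hM i).2.2 j).2.1
  hx i j := by
    have h := F.val_eq_zero t ((Model.chkRel_iff hM i).2.2 j).2.2.1
    rw [val_append, ← R.brS, val_sSgn F.e t hM.p_pos, val_scale, pow_one, neg_smul, one_smul,
      hA.cartan] at h
    exact eq_of_sub_eq_zero (by rw [sub_eq_add_neg]; exact h)
  hy i j := by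
    have h := F.val_eq_zero t ((Model.chkRel_iff hM i).2.2 j).2.2.2
    rw [val_append, ← R.brS, val_scale, hA.cartan] at h
    exact eq_neg_of_add_eq_zero_left h

/-- The subspace of vectors whose coordinates vanish outside the set `s`. -/
def Frame.coordSpace {N : ℕ} (F : Frame K V N) (s : ℕ → Bool) : Submodule K V :=
  F.graded s true

theorem Frame.mul_mem_coordSpace {N : ℕ} (F : Frame K V N) {L : V →ₗ[K] V} {s s' : ℕ → Bool}
    (h : ∀ i < N, s i = true → L (F.e i) ∈ F.coordSpace s') {v : V} (hv : v ∈ F.coordSpace s) :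
    L v ∈ F.coordSpace s' :=
  F.map_mem_of_graded L _ h hv

theorem Frame.val_mem_coordSpace {N : ℕ} (F : Frame K V N) {s : ℕ → Bool} {u : SVec}
    (h : ∀ y ∈ u, y.1 < N → s y.1 = true) : val F.e t u ∈ F.coordSpace s := by
  refine F.val_mem _ t fun y hy => ?_
  by_cases hN : y.1 < N
  · have := F.e_mem_graded (deg := s) hN
    rwa [h y hy hN] at this
  · rw [F.e_out _ (not_lt.1 hN)]
    exact zero_mem _

omit [CharP K M.p] in
theorem Model.tri_of_mem (hM : M.Valid) {i j : ℕ} (hi : i < M.dim) (hj : j < M.dim) {y : ℕ × Coef}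
    (hy : y ∈ M.br i j) :
    (M.isPos i = true → M.isPos j = true → M.isPos y.1 = true) ∧
    (M.isNeg i = true → M.isNeg j = true → M.isNeg y.1 = true) ∧
    (M.isNeg i = true → i < M.n + M.r + M.n → M.isPos j = true → M.isNeg y.1 = false) ∧
    (M.isPos i = true → i < M.n + M.n → M.isNeg j = true → M.isPos y.1 = false) := by
  have := List.all_eq_true.1 (of_upto (of_upto hM.tri i hi) j hj) y hy
  simp only [Bool.and_eq_true, Bool.or_eq_true, Bool.not_eq_true', ← Bool.not_eq_true,
    Nat.blt_eq] at this
  obtain ⟨⟨⟨h1, h2⟩, h3⟩, h4⟩ := this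
  exact ⟨fun a b => h1.resolve_left fun h => h ⟨a, b⟩,
    fun a b => h2.resolve_left fun h => h ⟨a, b⟩,
    fun a b c => Bool.eq_false_iff.2 (h3.resolve_left fun h => h ⟨⟨a, b⟩, c⟩),
    fun a b c => Bool.eq_false_iff.2 (h4.resolve_left fun h => h ⟨⟨a, b⟩, c⟩)⟩

theorem Model.isPos_iff {M : Model} (k : ℕ) : M.isPos k = true ↔ M.n ≤ k ∧ k < M.n + M.r := by
  simp [Model.isPos]

theorem Model.isNeg_iff {M : Model} (k : ℕ) : M.isNeg k = true ↔ M.n + M.r ≤ k := by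
  simp [Model.isNeg]

omit [CharP K M.p] in
theorem Rep.mul_mem_coordSpace (R : Rep M t F P β) {s s' s'' : ℕ → Bool}
    (h : ∀ i < M.dim, ∀ j < M.dim, s i = true → s' j = true → ∀ y ∈ M.br i j, s'' y.1 = true)
    {u v : V} (hu : u ∈ F.coordSpace s) (hv : v ∈ F.coordSpace s') : β u v ∈ F.coordSpace s'' := by
  refine F.mul_mem_coordSpace (L := β.flip v) (fun i hi hsi => ?_) hu
  refine F.mul_mem_coordSpace (L := β (F.e i)) (fun j hj hsj => ?_) hv
  rw [R.br]
  exact F.val_mem_coordSpace fun y hy _ => h i hi j hj hsi hsj y hy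

theorem Frame.coordSpace_or_le {N : ℕ} (F : Frame K V N) (s s' : ℕ → Bool) :
    F.coordSpace (fun k => s k || s' k) ≤ F.coordSpace s ⊔ F.coordSpace s' := by
  refine Submodule.span_le.2 ?_
  rintro _ ⟨k, hk, h, rfl⟩
  rw [Bool.or_eq_true] at h
  rcases h with h | h
  · exact Submodule.mem_sup_left (Submodule.subset_span ⟨k, hk, h, rfl⟩)
  · exact Submodule.mem_sup_right (Submodule.subset_span ⟨k, hk, h, rfl⟩)

omit [CharP K M.p] in
theorem Frame.triangular_indep (F : Frame K V M.dim) :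
    ∀ a ∈ F.coordSpace M.isPos, ∀ b ∈ F.coordSpace (fun k => Nat.blt k M.n),
      ∀ c ∈ F.coordSpace M.isNeg, a + b + c = 0 → a = 0 ∧ b = 0 ∧ c = 0 := by
  intro a ha b hb c hc h
  have hx : ∀ (s : ℕ → Bool) (v : V), v ∈ F.coordSpace s → ∀ k < M.dim,
      s k = false → F.x k v = 0 := fun s v hv k hk hs =>
    F.x_eq_zero_of_mem_graded hv hk (by simp [hs])
  have h3 : ∀ k < M.dim, F.x k a = 0 ∧ F.x k b = 0 ∧ F.x k c = 0 := by
    intro k hk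
    have h0 : F.x k a + F.x k b + F.x k c = 0 := by rw [← map_add, ← map_add, h, map_zero]
    have ea : ¬ (M.n ≤ k ∧ k < M.n + M.r) → F.x k a = 0 := fun h =>
      hx _ a ha k hk (by rwa [← Bool.not_eq_true, Model.isPos_iff])
    have eb : ¬ (k < M.n) → F.x k b = 0 := fun h =>
      hx _ b hb k hk (by rwa [← Bool.not_eq_true, Nat.blt_eq])
    have ec : ¬ (M.n + M.r ≤ k) → F.x k c = 0 := fun h =>
      hx _ c hc k hk (by rwa [← Bool.not_eq_true, Model.isNeg_iff])
    rcases lt_or_ge k M.n with h | h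
    · have e1 := ea (by omega)
      have e2 := ec (by omega)
      exact ⟨e1, by simpa [e1, e2] using h0, e2⟩
    · rcases lt_or_ge k (M.n + M.r) with h' | h'
      · have e1 := eb (by omega)
        have e2 := ec (by omega)
        exact ⟨by simpa [e1, e2] using h0, e1, e2⟩
      · have e1 := eb (by omega)
        have e2 := ea (by omega)
        exact ⟨e2, e1, by simpa [e1, e2] using h0⟩
  exact ⟨F.ext fun k hk => by rw [(h3 k hk).1, map_zero],
    F.ext fun k hk => by rw [(h3 k hk).2.1, map_zero],
    F.ext fun k hk => by rw [(h3 k hk).2.2, map_zero]⟩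

/-- An algebra given by a table has the triangular decomposition given by the order of the basis. -/
theorem Rep.triangular (hM : M.Valid) (hu : M.UnitsAt t) (R : Rep M t F P β)
    (hlin : LinearIndependent K fun i : Fin M.n => val F.e t (M.gen (.h i))) :
    Triangular β (fun a => val F.e t (M.gen a)) (F.coordSpace M.isPos)
      (F.coordSpace fun k => Nat.blt k M.n) (F.coordSpace M.isNeg) := by
  have hn := hM.n_le
  have hd := M.dim_eq
  have hy : ∀ i : Fin M.n, ev t (M.yCoef.getD i []) ≠ 0 := fun i =>
    hu.ne_zero hM.p_pos (Model.chkRel_iff hM i).1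
  refine ⟨fun i => ?_, fun i => ?_, fun i => ?_, ?_, ?_, fun i v hv => ?_, fun i v hv => ?_, ?_,
    hlin, fun U hU hmul' => ?_, fun W hW h => ?_, fun W hW h => ?_⟩
  · refine F.val_mem_coordSpace fun y hy _ => ?_
    obtain rfl : y = _ := by simpa [Model.gen] using hy
    rw [Model.isPos_iff]
    have := i.2
    dsimp only
    omega
  · refine F.val_mem_coordSpace fun y hy _ => ?_
    obtain rfl : y = _ := by simpa [Model.gen] using hy
    rw [Model.isNeg_iff]
    dsimp only
    omega
  · refine F.val_mem_coordSpace fun y hy _ => ?_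
    rw [Nat.blt_eq]
    exact (Model.chkRel_iff hM i).2.1 y hy
  · exact fun u hu v hv => R.mul_mem_coordSpace (fun i hi j hj h h' y hy =>
      (Model.tri_of_mem hM hi hj hy).1 h h') hu hv
  · exact fun u hu v hv => R.mul_mem_coordSpace (fun i hi j hj h h' y hy =>
      (Model.tri_of_mem hM hi hj hy).2.1 h h') hu hv
  · refine F.coordSpace_or_le _ _ ?_
    rw [Model.e_y, LinearMap.map_smul₂]
    refine Submodule.smul_mem _ _ (F.mul_mem_coordSpace (fun j hj hjp => ?_) hv)
    have hi := i.2
    rw [R.br]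
    refine F.val_mem_coordSpace fun y hy hyN => ?_
    have := (Model.tri_of_mem hM (by omega) hj hy).2.2.1 ((Model.isNeg_iff _).2 (by omega))
      (by omega) hjp
    rw [← Bool.not_eq_true, Model.isNeg_iff] at this
    rw [Bool.or_eq_true, Model.isPos_iff, Nat.blt_eq]
    omega
  · refine F.coordSpace_or_le _ _ ?_
    rw [Model.e_x]
    refine F.mul_mem_coordSpace (fun j hj hjp => ?_) hv
    have hi := i.2
    rw [R.br]
    refine F.val_mem_coordSpace fun y hy hyN => ?_
    have := (Model.tri_of_mem hM (by omega) hj hy).2.2.2 ((Model.isPos_iff _).2 (by omega))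
      (by omega) hjp
    rw [← Bool.not_eq_true, Model.isPos_iff] at this
    rw [Bool.or_eq_true, Model.isNeg_iff, Nat.blt_eq]
    omega
  · exact F.triangular_indep
  · have hgen := R.generate hM.words (fun _ => ()) (fun _ _ _ _ _ _ => rfl)
      (fun _ => U) (fun _ _ a ha b hb => hmul' a ha b hb)
      (fun i hi => by
        have := hU (.x ⟨i, hi⟩)
        rwa [M.e_x] at this)
      (fun i hi => by
        have := hU (.y ⟨i, hi⟩)
        rwa [M.e_y, Submodule.smul_mem_iff _ (hy ⟨i, hi⟩)] at this)
    refine eq_top_iff.2 ?_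
    rintro v -
    rw [F.expand v]
    exact Submodule.sum_mem _ fun k hk =>
      Submodule.smul_mem _ _ (hgen k (Finset.mem_range.1 hk))
  · have ht := hM.trans
    rw [Model.chkTrans, Bool.and_eq_true] at ht
    refine R.trans hM.p_pos hu (fun a ha ha' v hv => ?_) _ _ ht.1 fun i hi v hv => ?_
    · have := h ⟨a - (M.n + M.r), by omega⟩ v hv
      rw [Model.e_y, LinearMap.map_smul₂, Submodule.smul_mem_iff _ (hy _)] at this
      rwa [show M.n + M.r + (a - (M.n + M.r)) = a by omega] at this
    · by_cases hN : i < M.dim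
      · refine F.x_eq_zero_of_mem_graded (hW hv) hN ?_
        rw [Nat.testBit_or, Bool.or_eq_true, Nat.testBit_shiftLeft, Nat.testBit_two_pow_sub_one,
          Nat.testBit_two_pow_sub_one] at hi
        simp only [Bool.and_eq_true, decide_eq_true_eq] at hi
        rw [Ne, Model.isPos_iff]
        omega
      · rw [F.x_out i (not_lt.1 hN), LinearMap.zero_apply]
  · have ht := hM.trans
    rw [Model.chkTrans, Bool.and_eq_true] at ht
    refine R.trans hM.p_pos hu (fun a ha ha' v hv => ?_) _ _ ht.2 fun i hi v hv => ?_
    · have := h ⟨a - M.n, by omega⟩ v hv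
      rw [Model.e_x] at this
      rwa [show M.n + (a - M.n) = a by omega] at this
    · by_cases hN : i < M.dim
      · refine F.x_eq_zero_of_mem_graded (hW hv) hN ?_
        rw [Nat.testBit_two_pow_sub_one, decide_eq_true_eq] at hi
        rw [Ne, Model.isNeg_iff]
        omega
      · rw [F.x_out i (not_lt.1 hN), LinearMap.zero_apply]

/-- The Lie superalgebra with a given Cartan matrix has a basis with the structure constants of a
table that passes the checks. -/
theorem Model.exists_frame (hM : M.Valid) (hA : M.Presents t A p) :
    ∃ F : Frame K (CartanAlg A p) M.dim, Rep M t F (NISDeform.parity A p) (bracket A p) ∧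
      (∀ a, NISDeform.gen A p a = val F.e t (M.gen a)) ∧
      ∀ w, rootSpace A p w = F.graded M.weight w := by
  have R0 := M.stdRep t hM.len
  obtain ⟨Φ, hΦ, hg⟩ := (R0.triangular hM hA.units hA.lin_h).exists_equiv (R0.realization hM hA)
  let F := (Frame.std K M.dim).transport Φ
  have hval : ∀ u, val F.e t u = Φ.symm (val (Frame.std K M.dim).e t u) := fun u => by
    rw [← LinearEquiv.coe_coe, map_val]
    rfl
  have hgen : ∀ a, NISDeform.gen A p a = val F.e t (M.gen a) := fun a => by
    rw [hval, LinearEquiv.eq_symm_apply, hg]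
  have R1 : Rep M t F (F.graded M.parity) (bracket A p) :=
    ⟨fun _ => rfl, fun i j => by
      rw [hval, LinearEquiv.eq_symm_apply, hΦ]
      simp [F, Frame.transport, R0.br]⟩
  have hpar : ∀ i, NISDeform.parity A p i = F.graded M.parity i := fun i =>
    R1.homPart_eq hM hA.units (fun i hi j hj y hy => (Model.par_add hM.par hi hj hy).2)
      (fun i k hk => hA.parH k hk) hA.parX hA.parY hgen i
  refine ⟨F, ⟨hpar, R1.br⟩, hgen, fun w => ?_⟩
  exact R1.homPart_eq hM hA.units (fun i hi j hj y hy => Model.wt_add hM.wt hi hj hy)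
      (fun i k hk => hA.wtH k hk) hA.wtX hA.wtY hgen w

end Present

end StructConst

namespace StructConst

variable {K V : Type*} [Field K] [AddCommGroup V] [Module K V]

/-! ### Squares of derivations as cocycles -/

section Deform

variable {P : ZMod 2 → Submodule K V} {β c : Bil K V}

/-- A linear deformation is a Lie superalgebra if its infinitesimal part is a cocycle that
satisfies the Jacobi identity itself. -/
theorem isLieSuper_add (H : IsLieSuper P β) (hc : IsCocycle P β 0 c)
    (hJ : ∀ i j, ∀ x ∈ P i, ∀ y ∈ P j, ∀ z : V,
      c x (c y z) = c (c x y) z + sgn K i j • c y (c x z))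
    (hcub : ∀ x ∈ P 1, c x (c x x) = 0) (l : K) : IsLieSuper P (β + l • c) where
  compl := H.compl
  mem i j a ha b hb := add_mem (H.mem i j a ha b hb)
    (Submodule.smul_mem _ l (by simpa using hc.mem i j a ha b hb))
  skew i j a ha b hb := by
    simp only [LinearMap.add_apply, LinearMap.smul_apply]
    linear_combination (norm := module) H.skew i j a ha b hb + l • hc.skew i j a ha b hb
  alt a ha := by simp [H.alt a ha, hc.alt a ha]
  jacobi i j x hx y hy z := by
    have h1 := H.jacobi i j x hx y hy z
    have h2 := hc.closed i j x hx y hy z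
    have h3 := hJ i j x hx y hy z
    simp only [sgn_zero_right, one_smul] at h2
    simp only [LinearMap.add_apply, LinearMap.smul_apply, map_add, map_smul]
    linear_combination (norm := module) h1 + l • h2 + (l * l) • h3
  cubic x hx := by
    have h1 := H.cubic x hx
    have h2 := hc.cubic x hx
    have h3 := hcub x hx
    simp only [sgn_zero_right, one_smul] at h2
    simp only [LinearMap.add_apply, LinearMap.smul_apply, map_add, map_smul]
    linear_combination (norm := module) h1 + l • h2 + (l * l) • h3

/-- `D` is an even derivation. -/
structure IsEvenDer (P : ZMod 2 → Submodule K V) (β : Bil K V) (D : V →ₗ[K] V) : Prop where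
  mem : ∀ i, ∀ x ∈ P i, D x ∈ P i
  leibniz : ∀ x y, D (β x y) = β (D x) y + β x (D y)

theorem IsLieSuper.isEvenDer (H : IsLieSuper P β) {g : V} (hg : g ∈ P 0) :
    IsEvenDer P β (β g) where
  mem i x hx := by simpa using H.mem 0 i g hg x hx
  leibniz x y := by
    have h : ∀ i, ∀ x ∈ P i, β g (β x y) = β (β g x) y + β x (β g y) := fun i x hx => by
      simpa using H.jacobi 0 i g hg x hx y
    obtain ⟨a, ha, b, hb, rfl⟩ := Submodule.mem_sup.1
      (H.compl.sup_eq_top ▸ Submodule.mem_top : x ∈ P 0 ⊔ P 1)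
    simp only [map_add, LinearMap.add_apply, h 0 a ha, h 1 b hb]
    abel

variable {D : V →ₗ[K] V}

/-- The product `[Dx, Dy]`: the cocycle given, in characteristic 2, by the square of a derivation
with `D² = 0`. -/
noncomputable def sq2 (β : Bil K V) (D : V →ₗ[K] V) : Bil K V := β.compl₁₂ D D

/-- The product `[Dx, D²y] + [D²x, Dy]`: the cocycle given, in characteristic 3, by the third power
of a derivation with `D³ = 0`. -/
noncomputable def sq3 (β : Bil K V) (D : V →ₗ[K] V) : Bil K V :=
  β.compl₁₂ D (D ∘ₗ D) + β.compl₁₂ (D ∘ₗ D) D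

theorem sq2_apply (x y : V) : sq2 β D x y = β (D x) (D y) := rfl

theorem sq3_apply (x y : V) : sq3 β D x y = β (D x) (D (D y)) + β (D (D x)) (D y) := rfl

/-- The square of a derivation is a derivation up to twice the product `[Dx, Dy]`, which is
therefore a cocycle, in all characteristics. -/
theorem IsEvenDer.isCocycle_sq2 (H : IsLieSuper P β) (hD : IsEvenDer P β D) :
    IsCocycle P β 0 (sq2 β D) where
  mem i j a ha b hb := by
    rw [add_zero]
    exact H.mem i j _ (hD.mem i a ha) _ (hD.mem j b hb)
  skew i j a ha b hb := H.skew i j _ (hD.mem i a ha) _ (hD.mem j b hb)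
  alt a ha := H.alt _ (hD.mem 0 a ha)
  closed i j x hx y hy z := by
    have hx' := hD.mem i x hx
    have hy' := hD.mem j y hy
    simp only [sq2_apply, hD.leibniz, map_add, LinearMap.add_apply, sgn_zero_right, one_smul]
    linear_combination (norm := module) H.jacobi i j x hx _ hy' (D z) +
      H.jacobi i j _ hx' _ hy' z + H.jacobi i j _ hx' y hy (D z)
  cubic x hx := by
    have hx' := hD.mem 1 x hx
    have z : (1 + 1 : ZMod 2) = 0 := by decide
    have e1 := H.skew 1 1 _ hx' x hx
    have e2 := H.jacobi 1 1 x hx _ hx' (D x)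
    have e3 := H.skew 0 1 (β x (D x)) (by rw [← z]; exact H.mem 1 1 x hx _ hx') _ hx'
    simp only [sgn_one_one, sgn_zero_left, one_smul, neg_smul, neg_neg] at e1 e2 e3
    simp only [sq2_apply, hD.leibniz, map_add, sgn_zero_right, one_smul, e1, e2, e3]
    abel

theorem IsEvenDer.isLieSuper_sq2 (H : IsLieSuper P β) (hD : IsEvenDer P β D)
    (h2 : ∀ x, D (D x) = 0) (l : K) : IsLieSuper P (β + l • sq2 β D) := by
  have h0 : ∀ x y, D (sq2 β D x y) = 0 := fun x y => by
    rw [sq2_apply, hD.leibniz, h2, h2, map_zero, map_zero, LinearMap.zero_apply, add_zero]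
  refine isLieSuper_add H (hD.isCocycle_sq2 H) (fun i j x _ y _ z => ?_) (fun x _ => ?_) l
  · rw [sq2_apply _ (sq2 β D y z), sq2_apply (sq2 β D x y), sq2_apply _ (sq2 β D x z), h0, h0, h0]
    simp
  · rw [sq2_apply _ (sq2 β D x x), h0, map_zero]

/-- The third power of a derivation is a derivation up to three times the cochain `sq3`, which is
therefore a cocycle, in all characteristics. -/
theorem IsEvenDer.isCocycle_sq3 (H : IsLieSuper P β) (hD : IsEvenDer P β D) :
    IsCocycle P β 0 (sq3 β D) := by
  have hm := hD.mem
  refine ⟨fun i j a ha b hb => ?_, fun i j a ha b hb => ?_, fun a ha => ?_,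
    fun i j x hx y hy z => ?_, fun x hx => ?_⟩
  · rw [add_zero]
    exact add_mem (H.mem i j _ (hm i a ha) _ (hm j _ (hm j b hb)))
      (H.mem i j _ (hm i _ (hm i a ha)) _ (hm j b hb))
  · simp only [sq3_apply]
    linear_combination (norm := module) H.skew i j _ (hm i a ha) _ (hm j _ (hm j b hb)) +
      H.skew i j _ (hm i _ (hm i a ha)) _ (hm j b hb)
  · have := H.skew 0 0 _ (hm 0 a ha) _ (hm 0 _ (hm 0 a ha))
    rw [sgn_zero_left, one_smul] at this
    rw [sq3_apply, this, neg_add_cancel]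
  · have hx' := hm i x hx
    have hy' := hm j y hy
    have hx'' := hm i _ hx'
    have hy'' := hm j _ hy'
    simp only [sq3_apply, hD.leibniz, map_add, LinearMap.add_apply, sgn_zero_right, one_smul]
    linear_combination (norm := module) H.jacobi i j x hx _ hy' (D (D z)) +
      H.jacobi i j x hx _ hy'' (D z) + H.jacobi i j _ hx' _ hy'' z +
      2 • H.jacobi i j _ hx' _ hy' (D z) + H.jacobi i j _ hx' y hy (D (D z)) +
      H.jacobi i j _ hx'' _ hy' z + H.jacobi i j _ hx'' y hy (D z)
  · have hx' := hm 1 x hx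
    have hx'' := hm 1 _ hx'
    have z : (1 + 1 : ZMod 2) = 0 := by decide
    have even : ∀ a ∈ P 1, ∀ b ∈ P 1, β a b ∈ P 0 := fun a ha b hb => by
      rw [← z]; exact H.mem 1 1 a ha b hb
    have sk : ∀ a ∈ P 1, ∀ b ∈ P 1, β a b = β b a := fun a ha b hb => by
      simpa using H.skew 1 1 a ha b hb
    have sk' : ∀ a ∈ P 0, ∀ b ∈ P 1, β a b = -β b a := fun a ha b hb => by
      simpa using H.skew 0 1 a ha b hb
    have jac : ∀ a ∈ P 1, ∀ b ∈ P 1, ∀ c, β a (β b c) = β (β a b) c - β b (β a c) :=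
      fun a ha b hb c => by
        rw [sub_eq_add_neg]
        simpa using H.jacobi 1 1 a ha b hb c
    have j1 := jac x hx _ hx' (D (D x))
    have j2 := jac _ hx' _ hx' x
    have j3 := jac _ hx' _ hx' (D x)
    rw [sk' _ (even x hx _ hx') _ hx''] at j1
    rw [sk' _ (even _ hx' _ hx') _ hx'] at j3
    have c3 := H.cubic _ hx'
    simp only [sq3_apply, hD.leibniz, map_add, sgn_zero_right, one_smul, sk _ hx'' _ hx',
      sk _ hx' _ hx, c3]
    rw [j1]
    module

theorem IsEvenDer.isLieSuper_sq3 (H : IsLieSuper P β) (hD : IsEvenDer P β D)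
    (h3 : ∀ x, D (D (D x)) = 0) (l : K) : IsLieSuper P (β + l • sq3 β D) := by
  have hm := hD.mem
  have h1 : ∀ x y, D (sq3 β D x y) = (2 : K) • β (D (D x)) (D (D y)) := fun x y => by
    simp only [sq3_apply, map_add, hD.leibniz, h3, map_zero, LinearMap.zero_apply]
    module
  have h2 : ∀ x y, D (D (sq3 β D x y)) = 0 := fun x y => by
    simp [h1, hD.leibniz, h3]
  -- the iterated product is twice that of the elements `D²x`, `D²y`, `D²z`
  have hr : ∀ x y z, sq3 β D x (sq3 β D y z) = (2 : K) • β (D (D x)) (β (D (D y)) (D (D z))) :=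
    fun x y z => by rw [sq3_apply x, h2, h1, map_zero, zero_add, map_smul]
  refine isLieSuper_add H (hD.isCocycle_sq3 H) (fun i j x hx y hy z => ?_) (fun x hx => ?_) l
  · rw [hr, hr, sq3_apply (sq3 β D x y), h2, h1, map_zero, LinearMap.zero_apply, add_zero,
      H.jacobi i j _ (hm i _ (hm i x hx)) _ (hm j _ (hm j y hy)), LinearMap.map_smul₂]
    module
  · rw [hr, H.cubic _ (hm 1 _ (hm 1 x hx)), smul_zero]

end Deform

section Forms

variable {P : ZMod 2 → Submodule K V} {β : Bil K V} {B : LinearMap.BilinForm K V}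

theorem IsInvariantForm.neg_ad (H : IsLieSuper P β) (hB : IsInvariantForm P β B) {g : V}
    (hg : g ∈ P 0) (x y : V) : B (β g x) y = -B x (β g y) := by
  have h : ∀ i, ∀ x ∈ P i, B (β g x) y = -B x (β g y) := fun i x hx => by
    have := H.skew 0 i g hg x hx
    rw [sgn_zero_left, one_smul] at this
    rw [this, map_neg, LinearMap.neg_apply, hB.invariant]
  obtain ⟨a, ha, b, hb, rfl⟩ := Submodule.mem_sup.1
    (H.compl.sup_eq_top ▸ Submodule.mem_top : x ∈ P 0 ⊔ P 1)
  simp only [map_add, LinearMap.add_apply, h 0 a ha, h 1 b hb]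
  ring

/-- A NIS remains a NIS for a deformation by a cochain with respect to which it is invariant. -/
theorem IsNIS.add (hB : IsNIS P β B) {c : Bil K V} (hc : ∀ x y z, B (c x y) z = B x (c y z))
    (l : K) : IsNIS P (β + l • c) B where
  even := hB.even
  supersymm := hB.supersymm
  invariant x y z := by simp [hB.invariant, hc]
  nondegenerate := hB.nondegenerate

variable {D : V →ₗ[K] V}

theorem invariant_sq2 [CharP K 2] (hB : IsInvariantForm P β B) (hD : IsEvenDer P β D)
    (hBD : ∀ x y, B (D x) y = -B x (D y)) (h2 : ∀ x, D (D x) = 0) (x y z : V) :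
    B (sq2 β D x y) z = B x (sq2 β D y z) := by
  rw [sq2_apply, sq2_apply, hB.invariant, hBD, hD.leibniz, h2, map_zero, LinearMap.zero_apply,
    zero_add, CharTwo.neg_eq]

theorem invariant_sq3 (hB : IsInvariantForm P β B) (hD : IsEvenDer P β D)
    (hBD : ∀ x y, B (D x) y = -B x (D y)) (h3 : ∀ x, D (D (D x)) = 0) (x y z : V) :
    B (sq3 β D x y) z = B x (sq3 β D y z) := by
  rw [sq3_apply, sq3_apply, map_add, LinearMap.add_apply, hB.invariant, hB.invariant, hBD, hBD,
    hBD]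
  simp only [hD.leibniz, map_add, h3, map_zero, LinearMap.zero_apply]
  ring

end Forms

end StructConst

namespace StructConst

variable {K V : Type*} [Field K] [AddCommGroup V] [Module K V]

/-! ### Invariant forms given by tables -/

namespace Model

variable (M : Model) (G : List SVec)

/-- The entry of a Gram matrix that is given by its sparse rows. -/
def gram (G : List SVec) (i j : ℕ) : Coef := coefAt j (G.getD i [])

/-- The product of a sparse vector with a basis vector. -/
def gramL (G : List SVec) (u : SVec) (j : ℕ) : Coef :=
  u.foldr (fun y c => cAdd (cMul y.2 (gram G y.1 j)) c) []

/-- The product of a basis vector with a sparse vector. -/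
def gramR (G : List SVec) (i : ℕ) (v : SVec) : Coef :=
  v.foldr (fun y c => cAdd (cMul y.2 (gram G i y.1)) c) []

/-- The product of two sparse vectors. -/
def gramS (G : List SVec) (u v : SVec) : Coef :=
  u.foldr (fun y c => cAdd (cMul y.2 (gramR G y.1 v)) c) []

/-- The Gram matrix has at most `N` rows and columns, and pairs opposite weights only. -/
def chkGram : Bool := Nat.ble G.length M.dim && upto M.dim fun i => (G.getD i []).all fun y =>
  Nat.blt y.1 M.dim && upto M.n fun q => Nat.beq (M.w i q + M.w y.1 q) 12

/-- The form is even and supersymmetric. -/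
def chkSym : Bool := upto M.dim fun i => upto M.dim fun j =>
  cEq M.p (gram G i j) (cSgn M.p (M.pr i * M.pr j) (gram G j i)) &&
    (Nat.beq ((M.pr i + M.pr j) % 2) 0 || cZero M.p (gram G i j))

/-- `([a, g], c) = (a, [g, c])` for the Chevalley generators `g`. -/
def chkInv : Bool := upto M.n fun a => upto M.dim fun i => upto M.dim fun k =>
  cEq M.p (gramL G (M.br i (M.n + a)) k) (gramR G i (M.br (M.n + a) k)) &&
  cEq M.p (gramL G (M.br i (M.n + M.r + a)) k) (gramR G i (M.br (M.n + M.r + a) k))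

/-- The form is `q` times the standard form on the Chevalley generators. -/
def chkStd (q : Coef) : Bool := upto M.n fun i => upto M.n fun j =>
  cEq M.p (gramS G (M.hGen.getD i []) (M.hGen.getD j [])) (cMul q (M.cartanAt i j)) &&
  cEq M.p (gramS G [(M.n + i, [1])] [(M.n + M.r + j, M.yCoef.getD j [])])
    (bif Nat.beq i j then q else [])

/-- For every `k` a vector `u` such that the form `(u, ·)` is, up to an admitted denominator, the
`k`th coordinate. -/
def chkNondeg (D : List SVec) : Bool := upto M.dim fun k =>
  M.isUnit (gramL G (D.getD k []) k) && upto M.dim fun j =>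
    Nat.beq j k || cZero M.p (gramL G (D.getD k []) j)

/-- The `i`th of the `h_i` is, up to a denominator, the `i`th basis vector plus previous ones. -/
def chkH : Bool := upto M.n fun i =>
  M.isUnit (coefAt i (M.hGen.getD i [])) && (M.hGen.getD i []).all fun y => Nat.ble y.1 i

/-- Positive roots are positive, negative roots are negative, and a vector whose weight is the
`i`th simple root is the `i`th positive root vector. -/
def chkSigns : Bool := upto M.dim fun i =>
  (!M.isPos i || (upto M.n (fun q => Nat.ble 6 (M.w i q)) &&
    !upto M.n fun q => Nat.beq (M.w i q) 6)) &&
  (!M.isNeg i || (upto M.n (fun q => Nat.ble (M.w i q) 6) &&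
    !upto M.n fun q => Nat.beq (M.w i q) 6)) &&
  upto M.n fun j => !(upto M.n fun q => Nat.beq (M.w i q) (M.w (M.n + j) q)) ||
    Nat.beq i (M.n + j)

/-- Test that all negative root vectors are obtained from those in the set `S` by successive
brackets of negative root vectors. -/
def negOK : List (ℕ × ℕ × ℕ) → ℕ → Bool
  | [], S => upto M.dim fun i => !M.isNeg i || S.testBit i
  | g :: l, S => Nat.blt g.2.1 M.dim && Nat.blt g.2.2 M.dim && M.isNeg g.2.1 && M.isNeg g.2.2 &&
      S.testBit g.2.2 &&
      ((M.br g.2.1 g.2.2).all fun y => Nat.beq y.1 g.1 || S.testBit y.1) &&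
      M.isScalar (coefAt g.1 (M.br g.2.1 g.2.2)) && negOK l (S ||| 1 <<< g.1)

/-- The checks needed for the uniqueness of the standard form. -/
def chkUnique : Bool := M.chkSigns && M.chkH &&
  M.negOK (M.words.filter fun g => M.isNeg g.1) ((2 ^ M.n - 1) <<< (M.n + M.r))

end Model

/-- `B` is given by a Gram matrix in the frame `F`. -/
def GramRep (t : K) {N : ℕ} (F : Frame K V N) (G : List SVec) (B : LinearMap.BilinForm K V) :
    Prop := ∀ i j, B (F.e i) (F.e j) = ev t (Model.gram G i j)

section Gram

variable {t : K} {N : ℕ} {F : Frame K V N} {G : List SVec} {B : LinearMap.BilinForm K V}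

theorem GramRep.left (h : GramRep t F G B) (u : SVec) (j : ℕ) :
    B (val F.e t u) (F.e j) = ev t (Model.gramL G u j) := by
  induction u with
  | nil => simp [Model.gramL]
  | cons y u ih =>
    rw [Model.gramL] at ih ⊢
    simp only [val_cons, map_add, map_smul, LinearMap.add_apply, LinearMap.smul_apply, ih,
      List.foldr_cons, ev_cAdd, ev_cMul, h y.1 j, smul_eq_mul]

theorem GramRep.right (h : GramRep t F G B) (i : ℕ) (v : SVec) :
    B (F.e i) (val F.e t v) = ev t (Model.gramR G i v) := by
  induction v with
  | nil => simp [Model.gramR]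
  | cons y u ih =>
    rw [Model.gramR] at ih ⊢
    simp only [val_cons, map_add, map_smul, ih, List.foldr_cons, ev_cAdd, ev_cMul, h i y.1,
      smul_eq_mul]

theorem GramRep.both (h : GramRep t F G B) (u v : SVec) :
    B (val F.e t u) (val F.e t v) = ev t (Model.gramS G u v) := by
  induction u with
  | nil => simp [Model.gramS]
  | cons y u ih =>
    rw [Model.gramS] at ih ⊢
    simp only [val_cons, map_add, map_smul, LinearMap.add_apply, LinearMap.smul_apply, ih,
      List.foldr_cons, ev_cAdd, ev_cMul, h.right, smul_eq_mul]

end Gram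

variable {M : Model} {t : K} {F : Frame K V M.dim} {P : ZMod 2 → Submodule K V} {β : Bil K V}
  {G : List SVec}

theorem Model.exists_gramRep (F : Frame K V M.dim) (t : K) (h : M.chkGram G = true) :
    ∃ B : LinearMap.BilinForm K V, GramRep t F G B := by
  rw [Model.chkGram, Bool.and_eq_true, Nat.ble_eq] at h
  refine ⟨F.bilin fun i j => ev t (Model.gram G i j), fun i j => ?_⟩
  by_cases hi : i < M.dim
  · by_cases hj : j < M.dim
    · exact F.bilin_e _ hi hj
    · rw [F.e_out j (not_lt.1 hj), map_zero, Model.gram, Frame.coefAt_eq_nil, ev_nil]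
      rintro y hy rfl
      have := List.all_eq_true.1 (of_upto h.2 i hi) y hy
      rw [Bool.and_eq_true, Nat.blt_eq] at this
      exact hj this.1
  · rw [F.e_out i (not_lt.1 hi), map_zero, LinearMap.zero_apply, Model.gram,
      List.getD_eq_default _ _ (h.1.trans (not_lt.1 hi))]
    rfl

variable {B : LinearMap.BilinForm K V}

theorem GramRep.eq_zero_of_weight (h : GramRep t F G B) (hG : M.chkGram G = true) {i j : ℕ}
    (hi : i < M.dim) (hij : (M.weight i : Fin M.n → ℤ) + M.weight j ≠ 0) :
    B (F.e i) (F.e j) = 0 := by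
  rw [Model.chkGram, Bool.and_eq_true] at hG
  rw [h, Model.gram, Frame.coefAt_eq_nil, ev_nil]
  rintro y hy rfl
  have := List.all_eq_true.1 (of_upto hG.2 i hi) y hy
  rw [Bool.and_eq_true] at this
  refine hij (funext fun q => ?_)
  have := Nat.eq_of_beq_eq_true (of_upto this.2 q q.2)
  simp only [Model.weight, Pi.add_apply, Pi.zero_apply]
  omega

section Invariant

variable [CharP K M.p]

theorem Rep.isInvariantForm (R : Rep M t F P β) (hM : M.Valid) (h : GramRep t F G B)
    (hs : M.chkSym G = true) (hi : M.chkInv G = true) : IsInvariantForm P β B := by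
  have hsym : ∀ i < M.dim, ∀ j < M.dim,
      ev t (Model.gram G i j) = (-1) ^ (M.pr i * M.pr j) * ev t (Model.gram G j i) ∧
      ((M.pr i + M.pr j) % 2 = 0 ∨ ev t (Model.gram G i j) = 0) := fun i hi j hj => by
    have := of_upto (of_upto hs i hi) j hj
    rw [Bool.and_eq_true, Bool.or_eq_true] at this
    rw [ev_eq_of_cEq t hM.p_pos this.1, ev_cSgn t hM.p_pos]
    refine ⟨rfl, this.2.imp Nat.eq_of_beq_eq_true fun h => ?_⟩
    rw [← ev_cSgn t hM.p_pos, ← ev_eq_of_cEq t hM.p_pos this.1]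
    exact ev_eq_zero t h
  have hd := M.dim_eq
  have hn := hM.n_le
  have hskew := R.skew hM.p_pos hM.skew
  have hjac := (R.isLieSuper' hM).jacobi
  refine ⟨fun i j hij a ha b hb => ?_, fun i j a ha b hb => ?_, fun a b c => ?_⟩
  · rw [R.part] at ha hb
    refine F.bilin_eq_zero_on_graded B (fun k hk l hl hki hlj => ?_) ha hb
    rw [h]
    refine (hsym k hk l hl).2.resolve_left fun h0 => hij ?_
    have : ((M.pr k + M.pr l : ℕ) : ZMod 2) = 0 :=
      (ZMod.natCast_eq_zero_iff _ 2).2 (Nat.dvd_of_mod_eq_zero h0)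
    push_cast at this
    rw [← hki, ← hlj, Model.parity, Model.parity, eq_neg_of_add_eq_zero_left this,
      ZModModule.neg_eq_self]
  · rw [R.part] at ha hb
    rw [← sub_eq_zero]
    refine F.bilin_eq_zero_on_graded (B - sgn K i j • LinearMap.flip B) (fun k hk l hl hki hlj => ?_) ha hb
    simp only [LinearMap.sub_apply, LinearMap.smul_apply, LinearMap.flip_apply, smul_eq_mul]
    rw [h, h, (hsym k hk l hl).1, ← hki, ← hlj, Model.parity, Model.parity, sgn_natCast, sub_self]
  · -- the elements `b` with `([a, b], c) = (a, [b, c])` form a subalgebra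
    let Q : ZMod 2 → Submodule K V := fun i =>
      { carrier := {b | b ∈ P i ∧ ∀ a c, B (β a b) c = B a (β b c)}
        add_mem' := fun hx hy => ⟨add_mem hx.1 hy.1, fun a c => by simp [hx.2, hy.2]⟩
        zero_mem' := ⟨zero_mem _, by simp⟩
        smul_mem' := fun s x hx => ⟨Submodule.smul_mem _ s hx.1, fun a c => by simp [hx.2]⟩ }
    have hQ : ∀ m m', ∀ b ∈ Q m, ∀ b' ∈ Q m', β b b' ∈ Q (m + m') := by
      rintro m m' b ⟨hb, hb'⟩ b' ⟨hc, hc'⟩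
      refine ⟨R.mem hM.par m m' b hb b' hc, fun a c => ?_⟩
      have key : ∀ i, ∀ a ∈ P i, B (β a (β b b')) c = B a (β (β b b') c) := by
        intro i a ha
        have e1 := hjac i m a ha b hb b'
        have e2 := hskew m (i + m') b hb _ (R.mem hM.par i m' a ha b' hc)
        have e3 := hjac m m' b hb b' hc c
        rw [e2, sgn_add_right, sgn_comm m i] at e1
        have e4 : sgn K i m * sgn K i m = 1 := sgn_mul_self i m
        have e5 : B (β (β a b) b') c = B a (β b (β b' c)) := by rw [hc', hb']
        have e6 : B (β (β a b') b) c = B a (β b' (β b c)) := by rw [hb', hc']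
        rw [← sub_eq_iff_eq_add] at e3
        rw [e1, ← e3]
        simp only [map_add, map_neg, map_smul, map_sub, LinearMap.add_apply, LinearMap.neg_apply,
          LinearMap.smul_apply, smul_eq_mul, e5, e6]
        linear_combination -(sgn K m m' * B a (β b' (β b c))) * e4
      obtain ⟨a0, h0, a1, h1, rfl⟩ := Submodule.mem_sup.1
        ((R.isLieSuper' hM).compl.sup_eq_top ▸ Submodule.mem_top : a ∈ P 0 ⊔ P 1)
      simp only [map_add, LinearMap.add_apply, key 0 a0 h0, key 1 a1 h1]
    have hgen : ∀ g < M.dim, (∀ i < M.dim, ∀ k < M.dim,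
        cEq M.p (Model.gramL G (M.br i g) k) (Model.gramR G i (M.br g k)) = true) →
        F.e g ∈ Q (M.parity g) := by
      refine fun g hg hc => ⟨by rw [R.part]; exact F.e_mem_graded hg, fun a c => ?_⟩
      have : B ∘ₗ (β.flip (F.e g)) = B.compl₂ (β (F.e g)) := by
        refine F.bilin_ext fun i hi k hk => ?_
        simp only [LinearMap.comp_apply, LinearMap.flip_apply, LinearMap.compl₂_apply]
        rw [R.br, R.br, h.left, h.right, ev_eq_of_cEq t hM.p_pos (hc i hi k hk)]
      exact LinearMap.congr_fun (LinearMap.congr_fun this a) c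
    have hall := R.generate hM.words M.parity
      (fun i hi j hj y hy => (Model.par_add hM.par hi hj hy).2) Q hQ
      (fun i hi' => hgen _ (by omega) fun j hj k hk => by
        have := of_upto (of_upto (of_upto hi i hi') j hj) k hk
        rw [Bool.and_eq_true] at this
        exact this.1)
      (fun i hi' => hgen _ (by omega) fun j hj k hk => by
        have := of_upto (of_upto (of_upto hi i hi') j hj) k hk
        rw [Bool.and_eq_true] at this
        exact this.2)
    have hlin : (LinearMap.flip B c ∘ₗ β a) b = (B a ∘ₗ β.flip c) b :=
      F.linearMap_ext (fun k hk => (hall k hk).2 a c) b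
    exact hlin

theorem GramRep.nondegenerate (hM : M.Valid) (hu : M.UnitsAt t) (h : GramRep t F G B)
    (hB : IsInvariantForm P β B) (hP : IsCompl (P 0) (P 1)) {D : List SVec}
    (hD : M.chkNondeg G D = true) : B.Nondegenerate := by
  have hr : ∀ b, (∀ a, B a b = 0) → b = 0 := by
    refine fun b hb => F.ext fun k hk => ?_
    have := of_upto hD k hk
    rw [Bool.and_eq_true] at this
    have hlin : B (val F.e t (D.getD k [])) b =
        (ev t (Model.gramL G (D.getD k []) k) • F.x k) b := by
      refine F.linearMap_ext (fun j hj => ?_) b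
      rw [h.left, LinearMap.smul_apply, F.x_e _ _ hk]
      have hj' := of_upto this.2 j hj
      rw [Bool.or_eq_true, Nat.beq_eq] at hj'
      by_cases hjk : j = k
      · simp [hjk]
      · rw [if_neg hjk, smul_zero]
        exact ev_eq_zero t (hj'.resolve_left hjk)
    rw [hb, LinearMap.smul_apply, smul_eq_mul] at hlin
    rw [map_zero]
    exact (mul_eq_zero.1 hlin.symm).resolve_left (hu.ne_zero hM.p_pos this.1)
  refine ⟨fun a ha => ?_, hr⟩
  -- by supersymmetry, the left kernel is contained in the right one
  refine hr a fun b => ?_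
  have hz : ∀ i, ∀ a ∈ P i, (∀ j, ∀ b ∈ P j, B a b = 0) → ∀ b, B b a = 0 := by
    intro i a ha h0 b
    obtain ⟨b0, h0', b1, h1', rfl⟩ := Submodule.mem_sup.1
      (hP.sup_eq_top ▸ Submodule.mem_top : b ∈ P 0 ⊔ P 1)
    rw [map_add, LinearMap.add_apply, hB.supersymm 0 i _ h0' _ ha, hB.supersymm 1 i _ h1' _ ha,
      h0 0 _ h0', h0 1 _ h1']
    simp
  obtain ⟨a0, h0, a1, h1, rfl⟩ := Submodule.mem_sup.1
    (hP.sup_eq_top ▸ Submodule.mem_top : a ∈ P 0 ⊔ P 1)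
  have e : ∀ j, ∀ b ∈ P j, B a0 b = 0 ∧ B a1 b = 0 := by
    intro j b hb
    have := ha b
    rw [map_add, LinearMap.add_apply] at this
    have hj : ∀ j : ZMod 2, j = 0 ∨ j = 1 := by decide
    rcases hj j with rfl | rfl
    · have e1 := hB.even 1 0 (by decide) a1 h1 b hb
      rw [e1, add_zero] at this
      exact ⟨this, e1⟩
    · have e1 := hB.even 0 1 (by decide) a0 h0 b hb
      rw [e1, zero_add] at this
      exact ⟨e1, this⟩
  rw [map_add, hz 0 a0 h0 (fun j b hb => (e j b hb).1), hz 1 a1 h1 fun j b hb => (e j b hb).2,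
    add_zero]

end Invariant

theorem isInvariantForm_smul (hB : IsInvariantForm P β B) (s : K) :
    IsInvariantForm P β (s • B) where
  even i j hij a ha b hb := by simp [hB.even i j hij a ha b hb]
  supersymm i j a ha b hb := by
    simp only [LinearMap.smul_apply, smul_eq_mul]
    rw [hB.supersymm i j a ha b hb]
    ring
  invariant a b c := by simp [hB.invariant]

theorem nondegenerate_smul (hB : B.Nondegenerate) {s : K} (hs : s ≠ 0) :
    (s • B).Nondegenerate :=
  ⟨fun a ha => hB.1 a fun b => by simpa [hs] using ha b,
    fun b hb => hB.2 b fun a => by simpa [hs] using hb a⟩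

section Standard

theorem exists_isPos_or {M : Model} {i : ℕ} : i < M.n ∨ M.isPos i = true ∨ M.isNeg i = true := by
  rw [Model.isPos_iff, Model.isNeg_iff]
  omega

theorem Model.weight_sum (hS : M.chkSigns = true) {i : ℕ} (hi : i < M.dim) :
    (M.isPos i = true → 0 < ∑ q, (M.weight i : Fin M.n → ℤ) q) ∧
    (M.isNeg i = true → ∑ q, (M.weight i : Fin M.n → ℤ) q < 0) := by
  have h := of_upto hS i hi
  simp only [Bool.and_eq_true, Bool.or_eq_true, Bool.not_eq_true'] at h
  have hne : upto M.n (fun q => Nat.beq (M.w i q) 6) = false → ∃ q : Fin M.n, M.w i q ≠ 6 := by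
    intro h0
    by_contra! hc
    rw [upto_iff.2 fun q hq => by rw [hc ⟨q, hq⟩, Nat.beq_refl]] at h0
    exact absurd h0 (by simp)
  constructor
  · intro hp
    obtain ⟨h1, h2⟩ := h.1.1.resolve_left (by simp [hp])
    obtain ⟨q, hq⟩ := hne h2
    have hle : ∀ q : Fin M.n, 6 ≤ M.w i q := fun q => Nat.le_of_ble_eq_true (of_upto h1 q q.2)
    refine Finset.sum_pos' (fun q _ => ?_) ⟨q, Finset.mem_univ q, ?_⟩
    · have := hle q
      simp only [Model.weight]
      omega
    · have := hle q
      simp only [Model.weight]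
      omega
  · intro hp
    obtain ⟨h1, h2⟩ := h.1.2.resolve_left (by simp [hp])
    obtain ⟨q, hq⟩ := hne h2
    have hle : ∀ q : Fin M.n, M.w i q ≤ 6 := fun q => Nat.le_of_ble_eq_true (of_upto h1 q q.2)
    refine Finset.sum_neg' (fun q _ => ?_) ⟨q, Finset.mem_univ q, ?_⟩
    · have := hle q
      simp only [Model.weight]
      omega
    · have := hle q
      simp only [Model.weight]
      omega

theorem Model.eq_of_weight_eq (hS : M.chkSigns = true) {k i : ℕ} (hk : k < M.dim) (hi : i < M.n)
    (h : (M.weight k : Fin M.n → ℤ) = M.weight (M.n + i)) : k = M.n + i := by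
  have h0 := of_upto hS k hk
  simp only [Bool.and_eq_true, Bool.or_eq_true, Bool.not_eq_true'] at h0
  have h2 := of_upto h0.2 i hi
  rw [Bool.or_eq_true, Bool.not_eq_true'] at h2
  rcases h2 with h1 | h1
  · exfalso
    rw [upto_iff.2 fun q hq => ?_] at h1
    · exact absurd h1 (by simp)
    · have hq' := congrFun h ⟨q, hq⟩
      simp only [Model.weight] at hq'
      rw [Nat.beq_eq]
      omega
  · exact Nat.eq_of_beq_eq_true h1

theorem Model.e_mem_span_h [CharP K M.p] (hp : 0 < M.p) (hu : M.UnitsAt t) (hH : M.chkH = true)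
    (F : Frame K V M.dim) : ∀ m < M.n,
    F.e m ∈ Submodule.span K (Set.range fun i : Fin M.n => val F.e t (M.gen (.h i))) := by
  intro m
  induction m using Nat.strong_induction_on with
  | _ m ih =>
    intro hm
    have := of_upto hH m hm
    rw [Bool.and_eq_true, List.all_eq_true] at this
    have h1 : val F.e t (M.gen (.h ⟨m, hm⟩)) ∈
        Submodule.span K (Set.range fun i : Fin M.n => val F.e t (M.gen (.h i))) :=
      Submodule.subset_span ⟨_, rfl⟩
    rw [val_eq_coefAt_add F.e t m] at h1
    have h2 := (Submodule.add_mem_iff_left _ (F.val_mem _ t fun y hy => ?_)).1 h1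
    · exact (Submodule.smul_mem_iff _ (hu.ne_zero hp this.1)).1 h2
    · rw [List.mem_filter] at hy
      have hne : ¬ Nat.beq y.1 m = true := by
        rw [Bool.not_eq_true]
        simpa only [Bool.not_eq_true'] using hy.2
      rw [Nat.beq_eq] at hne
      have hle := Nat.le_of_ble_eq_true (this.2 y hy.1)
      exact ih y.1 (by omega) (by omega)

theorem Model.linearIndependent_h [CharP K M.p] (hp : 0 < M.p) (hu : M.UnitsAt t)
    (hH : M.chkH = true) (F : Frame K V M.dim) :
    LinearIndependent K fun i : Fin M.n => val F.e t (M.gen (.h i)) := by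
  rw [Fintype.linearIndependent_iff]
  intro g hg i
  -- by descending induction on `i`, comparing the `i`th coordinates
  have hd := M.dim_eq
  suffices H : ∀ d, ∀ i : Fin M.n, M.n ≤ i + d → g i = 0 from H M.n i (by omega)
  intro d
  induction d with
  | zero => exact fun i hi => absurd i.2 (by omega)
  | succ d ih =>
    intro i hi
    have h0 : F.x i (∑ j, g j • val F.e t (M.gen (.h j))) = 0 := by rw [hg, map_zero]
    have hi2 := i.2
    rw [map_sum, Finset.sum_eq_single i] at h0
    · have := of_upto hH i i.2
      rw [Bool.and_eq_true] at this
      rw [map_smul, F.x_val t (by omega), smul_eq_mul] at h0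
      exact (mul_eq_zero.1 h0).resolve_right (hu.ne_zero hp this.1)
    · intro j _ hji
      rcases lt_or_ge i j with hij | hij
      · rw [ih j (by have : (i : ℕ) < j := hij; omega), zero_smul, map_zero]
      · have hlt : (j : ℕ) < i := lt_of_le_of_ne hij fun h => hji (Fin.ext h)
        have := of_upto hH j j.2
        rw [Bool.and_eq_true, List.all_eq_true] at this
        rw [map_smul, F.x_val t (by omega), Frame.coefAt_eq_nil, ev_nil, smul_zero]
        intro y hy h
        have := Nat.le_of_ble_eq_true (this.2 y hy)
        omega
    · exact fun h => absurd (Finset.mem_univ i) h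

variable [CharP K M.p] {A : Matrix (Fin M.n) (Fin M.n) K} {p : Fin M.n → ZMod 2}

/-- An invariant form with the prescribed values on the Chevalley generators is standard. -/
theorem isStandardForm (hM : M.Valid) (hA : M.Presents t A p) (hAs : A.IsSymm)
    {F : Frame K (CartanAlg A p) M.dim} (hg : ∀ a, NISDeform.gen A p a = val F.e t (M.gen a))
    (hroot : ∀ w, rootSpace A p w = F.graded M.weight w) {q : Coef} (hq : ev t q ≠ 0)
    {B : LinearMap.BilinForm K (CartanAlg A p)} (h : GramRep t F G B)
    (hB : IsInvariantForm (NISDeform.parity A p) (bracket A p) B) (hG : M.chkGram G = true)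
    (hs : M.chkStd G q = true) : IsStandardForm A p 1 A ((ev t q)⁻¹ • B) where
  factor := by rw [Pi.one_def, Matrix.diagonal_one, one_mul]
  symm := hAs
  hh i j := by
    have := of_upto (of_upto hs i i.2) j j.2
    rw [Bool.and_eq_true] at this
    have h1 := ev_eq_of_cEq t hM.p_pos this.1
    rw [← h.both, ev_cMul, hA.cartan] at h1
    rw [hg, hg, LinearMap.smul_apply, LinearMap.smul_apply]
    simp only [Model.gen, h1, smul_eq_mul, Pi.one_apply, mul_one]
    field_simp
  xy i j := by
    have := of_upto (of_upto hs i i.2) j j.2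
    rw [Bool.and_eq_true] at this
    have h1 := ev_eq_of_cEq t hM.p_pos this.2
    rw [← h.both] at h1
    rw [hg, hg, LinearMap.smul_apply, LinearMap.smul_apply]
    simp only [Model.gen, h1, smul_eq_mul, Pi.one_apply]
    by_cases hij : i = j
    · subst hij
      simp [hq]
    · have : Nat.beq i j = false := by
        rw [← Bool.not_eq_true, Nat.beq_eq]
        exact fun h => hij (Fin.ext h)
      simp [this, hij]
  supersymm := (isInvariantForm_smul hB _).supersymm
  step w₁ w₂ _ _ a _ u _ v _ := ((isInvariantForm_smul hB _).invariant a u v).symm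
  orth w₁ w₂ hw a ha b hb := by
    rw [hroot] at ha hb
    refine F.bilin_eq_zero_on_graded _ (fun i hi j hj hi1 hj2 => ?_) ha hb
    rw [LinearMap.smul_apply, LinearMap.smul_apply, h.eq_zero_of_weight hG hi, smul_zero]
    rwa [hi1, hj2]

/-- The standard form is unique: it is determined on the pairs of opposite root vectors by induction
on the negative ones, and its values on the span of the `h_i` are prescribed. -/
theorem isStandardForm_unique (hM : M.Valid) (hA : M.Presents t A p)
    {F : Frame K (CartanAlg A p) M.dim}
    (R : Rep M t F (NISDeform.parity A p) (bracket A p))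
    (hg : ∀ a, NISDeform.gen A p a = val F.e t (M.gen a))
    (hroot : ∀ w, rootSpace A p w = F.graded M.weight w) (hU : M.chkUnique = true)
    {B B' : LinearMap.BilinForm K (CartanAlg A p)} (h : IsStandardForm A p 1 A B)
    (h' : IsStandardForm A p 1 A B') : B' = B := by
  simp only [Model.chkUnique, Bool.and_eq_true] at hU
  obtain ⟨⟨hS, hH⟩, hN⟩ := hU
  have hd := M.dim_eq
  have hn := hM.n_le
  have hmem : ∀ i < M.dim, F.e i ∈ rootSpace A p (M.weight i) := fun i hi => by
    rw [hroot]
    exact F.e_mem_graded hi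
  have hmul : ∀ w w', ∀ a ∈ rootSpace A p w, ∀ b ∈ rootSpace A p w',
      bracket A p a b ∈ rootSpace A p (w + w') := fun w w' a ha b hb =>
    mul_mem_homPart _ _ _ ha hb
  -- the values on pairs of opposite root vectors, by induction along the negative words
  have hneg : ∀ j < M.dim, M.isNeg j = true → ∀ a ∈ rootSpace A p (-M.weight j),
      B' a (F.e j) = B a (F.e j) := by
    suffices H : ∀ (l : List (ℕ × ℕ × ℕ)) (S : ℕ), M.negOK l S = true →
        (∀ i, S.testBit i = true → ∀ a ∈ rootSpace A p (-M.weight i),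
          B' a (F.e i) = B a (F.e i)) → ∀ j < M.dim, M.isNeg j = true →
          ∀ a ∈ rootSpace A p (-M.weight j), B' a (F.e j) = B a (F.e j) by
      refine H _ _ hN fun i hi a ha => ?_
      rw [Nat.testBit_shiftLeft, Nat.testBit_two_pow_sub_one, Bool.and_eq_true,
        decide_eq_true_eq, decide_eq_true_eq] at hi
      obtain ⟨k, rfl⟩ : ∃ k : Fin M.n, i = M.n + M.r + k :=
        ⟨⟨i - (M.n + M.r), hi.2⟩, by simp only; omega⟩
      rw [hroot, hA.wtY k, neg_neg] at ha
      have hk := k.2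
      rw [← sub_eq_zero, ← LinearMap.sub_apply]
      refine F.eq_zero_on_graded (LinearMap.flip (B' - B) (F.e (M.n + M.r + k)))
        (fun m hm hmw => ?_) ha
      rw [← hA.wtX k] at hmw
      rw [Model.eq_of_weight_eq hS hm hk hmw, LinearMap.flip_apply]
      have hc := hA.units.ne_zero hM.p_pos (Model.chkRel_iff hM k).1
      have e := (h'.xy k k).trans (h.xy k k).symm
      rw [hg, hg, Model.e_x, Model.e_y, map_smul, map_smul] at e
      rw [LinearMap.sub_apply, LinearMap.sub_apply, sub_eq_zero]
      exact smul_right_injective K hc e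
    intro l
    induction l with
    | nil =>
      intro S h0 hS' j hj hjn
      have := of_upto h0 j hj
      rw [Bool.or_eq_true, hjn] at this
      exact hS' j (this.resolve_left (by simp))
    | cons g l ih =>
      intro S h0 hS'
      obtain ⟨j, u, v⟩ := g
      simp only [Model.negOK, Bool.and_eq_true, List.all_eq_true, Bool.or_eq_true,
        Nat.blt_eq] at h0
      obtain ⟨⟨⟨⟨⟨⟨⟨huN, hvN⟩, hu'⟩, hv'⟩, hvS⟩, hall⟩, hunit⟩, hl⟩ := h0
      refine ih _ hl fun i hi a ha => ?_
      rcases testBit_or_shiftLeft hi with hi | rfl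
      · exact hS' i hi a ha
      · have hc : ev t _ ≠ 0 := Model.isScalar_ne_zero hunit
        have hdi : (M.weight i : Fin M.n → ℤ) = M.weight u + M.weight v := by
          by_contra hne
          apply hc
          rw [Frame.coefAt_eq_nil, ev_nil]
          rintro y hy rfl
          exact hne (Model.wt_add hM.wt huN hvN hy)
        rw [hdi] at ha
        have hwu := (Model.weight_sum hS huN).2 hu'
        have hwv := (Model.weight_sum hS hvN).2 hv'
        have e1 := h.step _ _ hwu hwv a ha _ (hmem u huN) _ (hmem v hvN)
        have e2 := h'.step _ _ hwu hwv a ha _ (hmem u huN) _ (hmem v hvN)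
        have hau := hmul _ _ a ha _ (hmem u huN)
        rw [show -(M.weight u + M.weight v) + M.weight u = -(M.weight v : Fin M.n → ℤ) by
          abel] at hau
        rw [← hS' v hvS _ hau, ← e2, R.br, val_eq_coefAt_add F.e t i] at e1
        have e3 : ∀ w : SVec, (∀ y ∈ w, B' a (F.e y.1) = B a (F.e y.1)) →
            B' a (val F.e t w) = B a (val F.e t w) := by
          intro w hw
          rw [map_val, map_val]
          induction w with
          | nil => rfl
          | cons y w ih =>
            rw [val_cons, val_cons, hw y (by simp), ih fun z hz => hw z (by simp [hz])]
        rw [map_add, map_add, e3, add_left_inj, map_smul, map_smul] at e1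
        · exact (smul_right_injective K hc e1).symm
        · intro y hy
          rw [List.mem_filter] at hy
          have hne : ¬ Nat.beq y.1 i = true := by
            rw [Bool.not_eq_true]
            simpa only [Bool.not_eq_true'] using hy.2
          refine hS' y.1 ((hall y hy.1).resolve_left hne) a ?_
          rwa [Model.wt_add hM.wt huN hvN hy.1]
  refine F.bilin_ext fun i hi j hj => ?_
  by_cases hij : (M.weight i : Fin M.n → ℤ) + M.weight j = 0
  · have hpar : ∀ k < M.dim, F.e k ∈ NISDeform.parity A p (M.parity k) := fun k hk => by
      rw [R.part]
      exact F.e_mem_graded hk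
    have hsum : ∑ q, (M.weight i : Fin M.n → ℤ) q + ∑ q, (M.weight j : Fin M.n → ℤ) q = 0 := by
      rw [← Finset.sum_add_distrib]
      exact Finset.sum_eq_zero fun q _ => congrFun hij q
    by_cases hjn : M.isNeg j = true
    · refine hneg j hj hjn _ ?_
      rw [← eq_neg_of_add_eq_zero_left hij]
      exact hmem i hi
    · by_cases hin : M.isNeg i = true
      · rw [h'.supersymm _ _ _ (hpar i hi) _ (hpar j hj),
          h.supersymm _ _ _ (hpar i hi) _ (hpar j hj), hneg i hi hin]
        rw [← eq_neg_of_add_eq_zero_right hij]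
        exact hmem j hj
      · have h0 : ∀ k < M.n, ∑ q, (M.weight k : Fin M.n → ℤ) q = 0 := fun k hk => by
          rw [hA.wtH k hk]
          simp
        have hi' : i < M.n := by
          by_contra hc
          have hip := (exists_isPos_or.resolve_left hc).resolve_right hin
          have h1 := (Model.weight_sum hS hi).1 hip
          rcases exists_isPos_or (M := M) (i := j) with hj' | hj' | hj'
          · rw [h0 j hj'] at hsum
            omega
          · have := (Model.weight_sum hS hj).1 hj'
            omega
          · exact hjn hj'
        have hj' : j < M.n := by
          by_contra hc
          have hjp := (exists_isPos_or.resolve_left hc).resolve_right hjn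
          have h1 := (Model.weight_sum hS hj).1 hjp
          rw [h0 i hi'] at hsum
          omega
        -- the span of the `h_i`
        have hspan : ∀ a ∈ Submodule.span K (Set.range fun i : Fin M.n => val F.e t (M.gen (.h i))),
            ∀ b ∈ Submodule.span K (Set.range fun i : Fin M.n => val F.e t (M.gen (.h i))),
            B' a b = B a b := by
          intro a ha b hb
          induction ha, hb using Submodule.span_induction₂ with
          | mem_mem x y hx hy =>
            obtain ⟨k, rfl⟩ := hx
            obtain ⟨l, rfl⟩ := hy
            simp only
            rw [← hg, ← hg, h'.hh, h.hh]
          | zero_left => simp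
          | zero_right => simp
          | add_left x y z _ _ _ e1 e2 => simp [e1, e2]
          | add_right x y z _ _ _ e1 e2 => simp [e1, e2]
          | smul_left r x y _ _ e => simp [e]
          | smul_right r x y _ _ e => simp [e]
        exact hspan _ (Model.e_mem_span_h hM.p_pos hA.units hH F i hi') _
          (Model.e_mem_span_h hM.p_pos hA.units hH F j hj')
  · rw [h'.orth _ _ hij _ (hmem i hi) _ (hmem j hj), h.orth _ _ hij _ (hmem i hi) _ (hmem j hj)]

end Standard

end StructConst

namespace StructConst

variable {K V : Type*} [Field K] [AddCommGroup V] [Module K V]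

/-! ### Cocycles and coboundaries -/

section Cochains

variable {P : ZMod 2 → Submodule K V} {β : Bil K V} {d : ZMod 2}

theorem IsCocycle.sub_smul {z c : Bil K V} (hz : IsCocycle P β d z) (hc : IsCocycle P β d c)
    (a : K) : IsCocycle P β d (z - a • c) where
  mem i j x hx y hy := sub_mem (hz.mem i j x hx y hy)
    (Submodule.smul_mem _ a (hc.mem i j x hx y hy))
  skew i j x hx y hy := by
    simp only [LinearMap.sub_apply, LinearMap.smul_apply]
    linear_combination (norm := module) hz.skew i j x hx y hy - a • hc.skew i j x hx y hy
  alt x hx := by simp [hz.alt x hx, hc.alt x hx]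
  closed i j x hx y hy z' := by
    simp only [LinearMap.sub_apply, LinearMap.smul_apply, map_sub, map_smul]
    linear_combination (norm := module) hz.closed i j x hx y hy z' - a • hc.closed i j x hx y hy z'
  cubic x hx := by
    simp only [LinearMap.sub_apply, LinearMap.smul_apply, map_sub, map_smul]
    linear_combination (norm := module) hz.cubic x hx - a • hc.cubic x hx

/-- Coboundaries are cocycles. -/
theorem IsCoboundary.isCocycle (H : IsLieSuper P β) {c : Bil K V} (hc : IsCoboundary P β d c) :
    IsCocycle P β d c := by
  obtain ⟨f, hf, hc⟩ := hc
  have hd : ∀ d : ZMod 2, d = 0 ∨ d = 1 := by decide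
  refine ⟨fun i j x hx y hy => ?_, fun i j x hx y hy => ?_, fun x hx => ?_,
    fun i j x hx y hy z => ?_, fun x hx => ?_⟩
  · rw [hc i x hx]
    refine sub_mem (sub_mem (hf _ _ (H.mem i j x hx y hy)) ?_) (Submodule.smul_mem _ _ ?_)
    · have := H.mem _ _ _ (hf i x hx) y hy
      rwa [add_right_comm] at this
    · have := H.mem _ _ x hx _ (hf j y hy)
      rwa [← add_assoc] at this
  · have e1 := H.skew i j x hx y hy
    have e2 := H.skew _ _ _ (hf i x hx) y hy
    have e3 := H.skew _ _ x hx _ (hf j y hy)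
    have h1 : sgn K i d * sgn K i d = 1 := sgn_mul_self i d
    rw [sgn_add_left, sgn_comm d j] at e2
    rw [sgn_add_right] at e3
    rw [hc i x hx, hc j y hy, e1, e2, e3, map_neg, map_smul]
    linear_combination (norm := module) (sgn K i j) • h1 • β (f y) x
  · have e := H.skew _ _ _ (hf 0 x hx) x hx
    rw [sgn_zero_right, one_smul] at e
    rw [hc 0 x hx, H.alt x hx, e, map_zero, sgn_zero_left, one_smul]
    abel
  · have h1 : sgn K i d * sgn K i d = 1 := sgn_mul_self i d
    have j1 := H.jacobi _ _ x hx _ (hf j y hy) z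
    have j2 := H.jacobi _ _ x hx y hy (f z)
    have j3 := congrArg f (H.jacobi _ _ x hx y hy z)
    have j4 := H.jacobi _ _ _ (hf i x hx) y hy z
    rw [sgn_add_right] at j1
    rw [sgn_add_left, sgn_comm d j] at j4
    rw [map_add, map_smul] at j3
    rw [hc j y hy, hc i x hx, hc i x hx, hc _ _ (H.mem i j x hx y hy), hc i x hx, hc j y hy,
      sgn_add_left]
    simp only [map_sub, map_smul, LinearMap.sub_apply, LinearMap.smul_apply]
    linear_combination (norm := module) (-sgn K i d) • j1 - (sgn K i d * sgn K j d) • j2 + j3 - j4 -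
      (sgn K i j) • h1 • β (f y) (β x z)
  · have z : (1 + 1 : ZMod 2) = 0 := by decide
    have hxx : β x x ∈ P 0 := by rw [← z]; exact H.mem 1 1 x hx x hx
    have e1 := H.skew _ _ x hx _ (hf 1 x hx)
    have e2 := H.skew _ _ _ (hf 1 x hx) _ hxx
    have e3 := H.jacobi 1 1 x hx x hx (f x)
    have e4 := H.cubic x hx
    have h1 : sgn K 1 d * sgn K 1 d = 1 := sgn_mul_self 1 d
    rw [sgn_add_right, sgn_one_one] at e1
    rw [sgn_zero_right, one_smul] at e2
    rw [sgn_one_one] at e3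
    have e5 : β (f x) x = sgn K 1 d • β x (f x) := by
      rw [e1]
      linear_combination (norm := module) (-h1) • β (f x) x
    rw [hc 1 x hx, hc 1 x hx, e5, e4, e2]
    simp only [map_sub, map_smul, map_zero]
    linear_combination (norm := module) (-2 * h1) • β x (β x (f x)) - e3

variable (P β d) in
/-- The space of cocycles. -/
def cocycles : Submodule K (Bil K V) where
  carrier := {c | IsCocycle P β d c}
  add_mem' {a b} ha hb := by
    have := IsCocycle.sub_smul ha hb (-1 : K)
    rwa [show a - (-1 : K) • b = a + b by module] at this
  zero_mem' := by constructor <;> intros <;> simp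
  smul_mem' a c hc := by
    have := IsCocycle.sub_smul hc hc (1 - a)
    rwa [show c - (1 - a) • c = a • c by module] at this

theorem IsCoboundary.zero : IsCoboundary P β d 0 :=
  ⟨0, fun i x _ => by simp, fun i x _ y => by simp⟩

theorem IsCoboundary.add {c c' : Bil K V} (h : IsCoboundary P β d c)
    (h' : IsCoboundary P β d c') : IsCoboundary P β d (c + c') := by
  obtain ⟨f, hf, hc⟩ := h
  obtain ⟨f', hf', hc'⟩ := h'
  refine ⟨f + f', fun i x hx => add_mem (hf i x hx) (hf' i x hx), fun i x hx y => ?_⟩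
  simp only [LinearMap.add_apply, map_add, hc i x hx, hc' i x hx]
  module

theorem IsCoboundary.smul {c : Bil K V} (h : IsCoboundary P β d c) (a : K) :
    IsCoboundary P β d (a • c) := by
  obtain ⟨f, hf, hc⟩ := h
  refine ⟨a • f, fun i x hx => Submodule.smul_mem _ a (hf i x hx), fun i x hx y => ?_⟩
  simp only [LinearMap.smul_apply, map_smul, hc i x hx]
  module

variable (P β d) in
/-- The space of coboundaries. -/
def coboundaries : Submodule K (Bil K V) where
  carrier := {c | IsCoboundary P β d c}
  add_mem' := IsCoboundary.add
  zero_mem' := IsCoboundary.zero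
  smul_mem' a _ h := IsCoboundary.smul h a

end Cochains

theorem val_eq_sum (e : ℕ → V) (t : K) (u : SVec) (s : Finset ℕ) (h : ∀ y ∈ u, y.1 ∈ s) :
    val e t u = ∑ i ∈ s, ev t (coefAt i u) • e i := by
  induction u with
  | nil => simp [coefAt]
  | cons y u ih =>
    have : ∀ i, ev t (coefAt i (y :: u)) • e i =
        (if y.1 = i then ev t y.2 • e i else 0) + ev t (coefAt i u) • e i := by
      intro i
      by_cases hi : y.1 = i
      · simp [coefAt, hi, ev_cAdd, add_smul]
      · have hb : Nat.beq y.1 i = false := by rwa [← Bool.not_eq_true, Nat.beq_eq]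
        simp [coefAt, hi, hb]
    rw [val_cons, ih fun z hz => h z (by simp [hz])]
    simp_rw [this]
    rw [Finset.sum_add_distrib, Finset.sum_ite_eq, if_pos (h y (by simp))]

/-- If all terms but those with index `c` vanish, then `c` is responsible for the value. -/
theorem val_eq_of_unique {p : ℕ} [CharP K p] (e : ℕ → V) (t : K) (u : SVec) (c : ℕ)
    (h : ∀ y ∈ u, y.1 = c ∨ e y.1 = 0 ∨ cZero p (coefAt y.1 u) = true) :
    val e t u = ev t (coefAt c u) • e c := by
  rw [val_eq_sum e t u (insert c (u.map Prod.fst).toFinset)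
    (fun y hy => Finset.mem_insert_of_mem (by
      rw [List.mem_toFinset, List.mem_map]; exact ⟨y, hy, rfl⟩))]
  refine Finset.sum_eq_single c (fun i hi hic => ?_) fun h => absurd (Finset.mem_insert_self _ _) h
  rw [Finset.mem_insert, List.mem_toFinset, List.mem_map] at hi
  obtain ⟨y, hy, rfl⟩ := hi.resolve_left hic
  rcases h y hy with h | h | h
  · exact absurd h hic
  · rw [h, smul_zero]
  · rw [ev_eq_zero t h, zero_smul]

/-! ### Linear equations for the coordinates of a cocycle -/

namespace Model

variable (M : Model)

/-- The number of the coordinate `x_k (z (e_i, e_j))` of a cochain `z`. -/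
def code (i j k : ℕ) : ℕ := (i * M.dim + j) * M.dim + k

/-- The term `s * x_k (z (e_i, e_j))`, expressed by the coordinates with `i ≤ j`. -/
def zTerm (s : Coef) (i j k : ℕ) : SVec :=
  bif Nat.beq i j && Nat.beq (M.pr i % 2) 0 then []
  else bif Nat.blt j i then [(M.code j i k, cSgn M.p (1 + M.pr i * M.pr j) s)]
  else [(M.code i j k, s)]

/-- The `k`th coordinate of `z (e_i, u)`. -/
def zR (i : ℕ) (u : SVec) (k : ℕ) : SVec := u.flatMap fun y => M.zTerm y.2 i y.1 k

/-- The `k`th coordinate of `z (u, e_l)`. -/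
def zL (u : SVec) (l k : ℕ) : SVec := u.flatMap fun y => M.zTerm y.2 y.1 l k

/-- The `k`th coordinate of `[e_i, z (e_a, e_b)]`. -/
def bz (i a b k : ℕ) : SVec := (colTerms k 0 (M.row i)).flatMap fun y => M.zTerm y.2 a b y.1

/-- The `k`th coordinate of the cocycle equation for `e_i`, `e_j`, `e_l`; for `i = j = l`, of the
cubic equation for `e_i`. -/
def eqTerms (d i j l k : ℕ) : SVec :=
  bif Nat.beq i j && Nat.beq j l then
    sSgn M.p (M.pr i * d) (M.bz i i i k) ++ M.zR i (M.br i i) k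
  else
    sSgn M.p (M.pr i * d) (M.bz i j l k) ++ (M.zR i (M.br j l) k ++
    (sSgn M.p ((M.pr i + M.pr j + d) * M.pr l) (M.bz l i j k) ++
    (sSgn M.p 1 (M.zL (M.br i j) l k) ++
    (sSgn M.p (1 + M.pr i * M.pr j + M.pr j * d) (M.bz j i l k) ++
    sSgn M.p (1 + M.pr i * M.pr j) (M.zR j (M.br i l) k)))))

/-- The equation with the given number. -/
def eqAt (d c : ℕ) : SVec :=
  M.eqTerms d (c / M.dim / M.dim / M.dim) (c / M.dim / M.dim % M.dim) (c / M.dim % M.dim)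
    (c % M.dim)

/-- Given a set `S` of coordinates known to vanish, an equation with exactly one other coordinate,
whose coefficient is an admitted denominator, shows that this coordinate vanishes as well. -/
def solve (u : SVec) (S : ℕ) : ℕ :=
  match u.find? fun y => !S.testBit y.1 && !cZero M.p (coefAt y.1 u) with
  | none => S
  | some y => bif M.isUnit (coefAt y.1 u) &&
      u.all (fun z => Nat.beq z.1 y.1 || S.testBit z.1 || cZero M.p (coefAt z.1 u))
      then S ||| 1 <<< y.1 else S

/-- The value `f n`. The recursion on `n` makes the kernel evaluate `n` to a literal first, so that
unevaluated sets do not pile up in `run`. -/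
def force {α : Type*} (n : ℕ) (f : ℕ → α) : α := Nat.rec (f 0) (fun k _ => f (k + 1)) n

theorem force_eq {α : Type*} (n : ℕ) (f : ℕ → α) : force n f = f n := by
  cases n <;> rfl

/-- The coordinates that vanish, given the set `S` of those known to vanish and a list of numbers
of equations, used one after the other. -/
def run (d : ℕ) : List ℕ → ℕ → ℕ
  | [], S => S
  | c :: l, S => force (bif Nat.blt c (M.dim * M.dim * M.dim * M.dim) then
      M.solve (M.eqAt d c) S else S) (run d l)

end Model

/-- The coordinates of a cochain. -/
def cochainCoord {N : ℕ} (F : Frame K V N) (z : Bil K V) (c : ℕ) : K :=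
  F.x (c % N) (z (F.e (c / N / N)) (F.e (c / N % N)))

theorem Model.decode (M : Model) {i j k : ℕ} (hj : j < M.dim) (hk : k < M.dim) :
    M.code i j k % M.dim = k ∧ M.code i j k / M.dim % M.dim = j ∧
      M.code i j k / M.dim / M.dim = i := by
  have h0 : 0 < M.dim := by omega
  have h1 : M.code i j k / M.dim = i * M.dim + j := by
    rw [code, mul_comm, Nat.mul_add_div h0, Nat.div_eq_of_lt hk, add_zero]
  refine ⟨?_, ?_, ?_⟩
  · rw [code, mul_comm, Nat.mul_add_mod, Nat.mod_eq_of_lt hk]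
  · rw [h1, mul_comm, Nat.mul_add_mod, Nat.mod_eq_of_lt hj]
  · rw [h1, mul_comm, Nat.mul_add_div h0, Nat.div_eq_of_lt hj, add_zero]

theorem colTerms_lt (k : ℕ) (row : List SVec) (m : ℕ) : ∀ y ∈ colTerms k m row,
    y.1 < m + row.length := by
  induction row generalizing m with
  | nil => simp [colTerms]
  | cons u l ih =>
    intro y hy
    rw [colTerms, List.mem_append, List.mem_filterMap] at hy
    rcases hy with ⟨x, -, hx⟩ | hy
    · by_cases h : Nat.beq x.1 k = true
      · simp only [h, cond_true, Option.some.injEq] at hx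
        rw [← hx, List.length_cons]
        simp
      · rw [Bool.not_eq_true] at h
        simp [h] at hx
    · have := ih (m + 1) y hy
      rw [List.length_cons]
      omega

theorem Model.colTerms_row_lt {M : Model} (h : M.chkLen = true) (k i : ℕ) :
    ∀ y ∈ colTerms k 0 (M.row i), y.1 < M.dim := by
  intro y hy
  have h1 := colTerms_lt k (M.row i) 0 y hy
  rw [zero_add] at h1
  refine h1.trans_le ?_
  rw [Model.chkLen, Bool.and_eq_true] at h
  unfold Model.row at h1 ⊢
  by_cases hi : i < M.tab.length
  · rw [List.getD_eq_getElem _ _ hi]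
    exact Nat.le_of_ble_eq_true (List.all_eq_true.1 h.2 _ (List.getElem_mem hi))
  · rw [List.getD_eq_default _ _ (not_lt.1 hi)] at h1
    exact absurd h1 (by simp)

section Equations

variable {M : Model} {t : K} [CharP K M.p] {F : Frame K V M.dim} {P : ZMod 2 → Submodule K V}
  {β z : Bil K V} {d : ℕ}

omit [CharP K M.p] in
theorem Rep.e_mem (R : Rep M t F P β) {i : ℕ} (hi : i < M.dim) : F.e i ∈ P (M.parity i) := by
  rw [R.part]
  exact F.e_mem_graded hi

theorem val_zTerm (hp : 0 < M.p) (R : Rep M t F P β) (hz : IsCocycle P β d z) (s : Coef)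
    {i j k : ℕ} (hi : i < M.dim) (hj : j < M.dim) (hk : k < M.dim) :
    val (cochainCoord F z) t (M.zTerm s i j k) = ev t s * F.x k (z (F.e i) (F.e j)) := by
  unfold Model.zTerm
  by_cases h1 : (Nat.beq i j && Nat.beq (M.pr i % 2) 0) = true
  · rw [h1, cond_true]
    rw [Bool.and_eq_true, Nat.beq_eq, Nat.beq_eq] at h1
    have h0 : M.parity i = 0 :=
      (ZMod.natCast_eq_zero_iff _ 2).2 (Nat.dvd_of_mod_eq_zero h1.2)
    rw [← h1.1, hz.alt _ (h0 ▸ R.e_mem hi)]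
    simp
  · rw [Bool.not_eq_true] at h1
    rw [h1, cond_false]
    by_cases h2 : Nat.blt j i = true
    · have hd := M.decode (i := j) hi hk
      rw [h2, cond_true, val_cons, val_nil, add_zero, ev_cSgn t hp, cochainCoord, hd.1, hd.2.1,
        hd.2.2, hz.skew _ _ _ (R.e_mem hi) _ (R.e_mem hj), Model.parity, Model.parity,
        sgn_natCast, map_neg, map_smul, smul_eq_mul, smul_eq_mul, pow_add]
      ring
    · have hd := M.decode (i := i) hj hk
      rw [Bool.not_eq_true] at h2
      rw [h2, cond_false, val_cons, val_nil, add_zero, cochainCoord, hd.1, hd.2.1, hd.2.2,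
        smul_eq_mul]

theorem val_flatMap_terms {W : Type*} [AddCommGroup W] [Module K W] (e : ℕ → W) (t : K)
    (f : ℕ × Coef → SVec) (g : ℕ → W) (u : SVec)
    (h : ∀ y ∈ u, val e t (f y) = ev t y.2 • g y.1) : val e t (u.flatMap f) = val g t u := by
  induction u with
  | nil => simp
  | cons y u ih =>
    rw [List.flatMap_cons, val_append, h y (by simp), ih fun z hz => h z (by simp [hz]), val_cons]

theorem val_zR (hp : 0 < M.p) (R : Rep M t F P β) (hz : IsCocycle P β d z) {i k : ℕ}
    (hi : i < M.dim) (hk : k < M.dim) {u : SVec} (hu : ∀ y ∈ u, y.1 < M.dim) :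
    val (cochainCoord F z) t (M.zR i u k) = F.x k (z (F.e i) (val F.e t u)) := by
  rw [← LinearMap.comp_apply, map_val]
  exact val_flatMap_terms _ _ _ _ _ fun y hy => val_zTerm hp R hz y.2 hi (hu y hy) hk

theorem val_zL (hp : 0 < M.p) (R : Rep M t F P β) (hz : IsCocycle P β d z) {l k : ℕ}
    (hl : l < M.dim) (hk : k < M.dim) {u : SVec} (hu : ∀ y ∈ u, y.1 < M.dim) :
    val (cochainCoord F z) t (M.zL u l k) = F.x k (z (val F.e t u) (F.e l)) := by
  rw [← LinearMap.flip_apply, ← LinearMap.comp_apply, map_val]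
  exact val_flatMap_terms _ _ _ _ _ fun y hy => val_zTerm hp R hz y.2 (hu y hy) hl hk

theorem val_bz (hM : M.Valid) (R : Rep M t F P β) (hz : IsCocycle P β d z) {i a b k : ℕ}
    (ha : a < M.dim) (hb : b < M.dim) (hk : k < M.dim) :
    val (cochainCoord F z) t (M.bz i a b k) = F.x k (β (F.e i) (z (F.e a) (F.e b))) := by
  rw [R.x_mul hk]
  exact val_flatMap_terms _ _ _ _ _ fun y hy =>
    val_zTerm hM.p_pos R hz y.2 ha hb (Model.colTerms_row_lt hM.len k i y hy)

theorem Rep.br_lt (hM : M.Valid) (i j : ℕ) : ∀ y ∈ M.br i j, y.1 < M.dim := by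
  intro y hy
  by_cases hi : i < M.dim
  · by_cases hj : j < M.dim
    · exact (Model.par_add hM.par hi hj hy).1
    · rw [M.br_out hM.len (Or.inr (not_lt.1 hj))] at hy
      simp at hy
  · rw [M.br_out hM.len (Or.inl (not_lt.1 hi))] at hy
    simp at hy

theorem val_eqTerms (hM : M.Valid) (R : Rep M t F P β) (hz : IsCocycle P β d z) {i j l k : ℕ}
    (hi : i < M.dim) (hj : j < M.dim) (hl : l < M.dim) (hk : k < M.dim) :
    val (cochainCoord F z) t (M.eqTerms d i j l k) = 0 := by
  have hp := hM.p_pos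
  unfold Model.eqTerms
  by_cases h : (Nat.beq i j && Nat.beq j l) = true
  · rw [h, cond_true, val_append, val_sSgn _ _ hp, val_bz hM R hz hi hi hk,
      val_zR hp R hz hi hk (Rep.br_lt hM i i), ← R.br]
    by_cases h0 : M.parity i = 0
    · have hi0 : F.e i ∈ P 0 := h0 ▸ R.e_mem hi
      rw [hz.alt _ hi0, (R.isLieSuper' hM).alt _ hi0]
      simp
    · have h01 : ∀ i : ZMod 2, i ≠ 0 → i = 1 := by decide
      have hi1 := h01 _ h0
      have := hz.cubic _ (hi1 ▸ R.e_mem hi)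
      rw [← hi1, Model.parity, sgn_natCast] at this
      rw [← map_smul, ← map_add, this, map_zero]
  · rw [Bool.not_eq_true] at h
    have h1 := hz.closed _ _ _ (R.e_mem hi) _ (R.e_mem hj) (F.e l)
    have h2 := (R.isLieSuper' hM).skew _ _ _ (hz.mem _ _ _ (R.e_mem hi) _ (R.e_mem hj)) _
      (R.e_mem hl)
    rw [h2] at h1
    have h3 := congrArg (F.x k) h1
    rw [h, cond_false]
    simp only [val_append, val_sSgn _ _ hp, val_bz hM R hz hj hl hk, val_bz hM R hz hi hj hk,
      val_bz hM R hz hi hl hk, val_zR hp R hz hi hk (Rep.br_lt hM j l),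
      val_zR hp R hz hj hk (Rep.br_lt hM i l), val_zL hp R hz hl hk (Rep.br_lt hM i j), ← R.br]
    simp only [Model.parity, ← Nat.cast_add, sgn_natCast, map_add, map_neg, map_smul,
      smul_eq_mul] at h3 ⊢
    rw [pow_add, pow_add]
    linear_combination h3

theorem of_solve (hp : 0 < M.p) (hu : M.UnitsAt t) {X : ℕ → K} {u : SVec} (h : val X t u = 0)
    {S : ℕ} (hS : ∀ c, S.testBit c = true → X c = 0) :
    ∀ c, (M.solve u S).testBit c = true → X c = 0 := by
  unfold Model.solve
  split
  · exact hS
  · rename_i y hy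
    intro c hc
    by_cases hb : (M.isUnit (coefAt y.1 u) && u.all (fun z => Nat.beq z.1 y.1 || S.testBit z.1 ||
      cZero M.p (coefAt z.1 u))) = true
    · rw [hb, cond_true] at hc
      rcases testBit_or_shiftLeft hc with hc | rfl
      · exact hS c hc
      · rw [Bool.and_eq_true, List.all_eq_true] at hb
        rw [val_eq_of_unique (p := M.p) X t u y.1, smul_eq_mul] at h
        · exact (mul_eq_zero.1 h).resolve_left (hu.ne_zero hp hb.1)
        · intro z hz
          have := hb.2 z hz
          simp only [Bool.or_eq_true, Nat.beq_eq] at this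
          rcases this with (h | h) | h
          exacts [Or.inl h, Or.inr (Or.inl (hS _ h)), Or.inr (Or.inr h)]
    · rw [Bool.not_eq_true] at hb
      rw [hb, cond_false] at hc
      exact hS c hc

/-- The coordinates found by `run` vanish on a cocycle, if the given ones do. -/
theorem of_run (hM : M.Valid) (hu : M.UnitsAt t) (R : Rep M t F P β) (hz : IsCocycle P β d z)
    (l : List ℕ) {S : ℕ} (hS : ∀ c, S.testBit c = true → cochainCoord F z c = 0) :
    ∀ c, (M.run d l S).testBit c = true → cochainCoord F z c = 0 := by
  induction l generalizing S with
  | nil => exact hS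
  | cons a l ih =>
    rw [Model.run, Model.force_eq]
    refine ih ?_
    by_cases h : Nat.blt a (M.dim * M.dim * M.dim * M.dim) = true
    · rw [h, cond_true]
      rw [Nat.blt_eq] at h
      have h0 : 0 < M.dim := by
        rcases Nat.eq_zero_or_pos M.dim with h0 | h0
        · rw [h0] at h
          simp at h
        · exact h0
      refine of_solve hM.p_pos hu (val_eqTerms hM R hz ?_ (Nat.mod_lt _ h0) (Nat.mod_lt _ h0)
        (Nat.mod_lt _ h0)) hS
      rw [Nat.div_div_eq_div_mul, Nat.div_div_eq_div_mul]
      exact Nat.div_lt_of_lt_mul (h.trans_eq (by ring))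
    · rw [Bool.not_eq_true] at h
      rwa [h, cond_false]

end Equations

end StructConst

namespace StructConst

variable {K V : Type*} [Field K] [AddCommGroup V] [Module K V]

/-! ### The second cohomology of an algebra given by a table -/

namespace Model

variable (M : Model)

/-- The `k`th coordinate of the value of the coboundary of `f` at `(e_i, e_j)`, expressed by the
coordinates `x_b (f e_a)`, which have the numbers `a N + b`. -/
def cobTerms (d i j k : ℕ) : SVec :=
  (M.br i j).map (fun y => (y.1 * M.dim + k, y.2)) ++
  (sSgn M.p ((M.pr i + d) * M.pr j)
    ((colTerms k 0 (M.row j)).map fun y => (i * M.dim + y.1, y.2)) ++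
  sSgn M.p (1 + M.pr i * d) ((colTerms k 0 (M.row i)).map fun y => (j * M.dim + y.1, y.2)))

/-- The same for a coordinate given by its number. -/
def cobAt (d c : ℕ) : SVec := M.cobTerms d (c / M.dim / M.dim) (c / M.dim % M.dim) (c % M.dim)

/-- The value of a table of cochains at the coordinate with the given number. -/
def tabAt (s : ℕ → ℕ → SVec) (c : ℕ) : Coef :=
  coefAt (c % M.dim) (s (c / M.dim / M.dim) (c / M.dim % M.dim))

/-- Linear maps that send `e_a` to `e_b` and the other basis vectors to zero have parity `d`. -/
def parOK (d a b : ℕ) : Bool := Nat.beq ((M.pr b + (M.pr a + d)) % 2) 0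

/-- The value at a coordinate of the cocycle number `s`: this is the coboundary of the map
`e_a ↦ e_b` if `s = a N + b < N²`, and the `(s - N²)`th element of a list of cocycles otherwise. -/
def pivVal (d : ℕ) (cls : ℕ → ℕ → ℕ → SVec) (s c : ℕ) : Coef :=
  bif Nat.blt s (M.dim * M.dim) then coefAt s (M.cobAt d c)
  else M.tabAt (cls (s - M.dim * M.dim)) c

/-- Test that a list of pairs of a cocycle and a coordinate is triangular: the coordinate does not
vanish on its cocycle, and vanishes on those that follow. -/
def pivOK (d m : ℕ) (cls : ℕ → ℕ → ℕ → SVec) : List (ℕ × ℕ) → Bool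
  | [] => true
  | g :: l => (bif Nat.blt g.1 (M.dim * M.dim) then M.parOK d (g.1 / M.dim) (g.1 % M.dim)
        else Nat.blt (g.1 - M.dim * M.dim) m) &&
      Nat.blt g.2 (M.dim * M.dim * M.dim) && M.isUnit (M.pivVal d cls g.1 g.2) &&
      l.all (fun r => cZero M.p (M.pivVal d cls r.1 g.2)) && pivOK d m cls l

/-- The set of the coordinates of a list of pairs. -/
def pivSet (l : List (ℕ × ℕ)) : ℕ := l.foldr (fun g S => S ||| 1 <<< g.2) 0

/-- The coordinates whose weight vanishes modulo `p` belong to the set `S`. -/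
def coverOK (d S : ℕ) : Bool := upto M.dim fun i => upto (i + 1) fun j => upto M.dim fun k =>
  (Nat.beq i j && Nat.beq (M.pr i % 2) 0) || !Nat.beq ((M.pr k + (M.pr i + M.pr j + d)) % 2) 0 ||
  !(upto M.n fun q => Nat.beq ((M.w k q + (M.p - 1) * (M.w i q + M.w j q)) % M.p) 0) ||
  S.testBit (M.code j i k)

/-- The coefficient with which `e_m`, where `m < n`, acts on the `q`th simple root vector. -/
def diagAt (m q : ℕ) : Coef := coefAt (M.n + q) (M.br m (M.n + q))

/-- The first `n` basis vectors are even and act diagonally, with the weights as eigenvalues. -/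
def chkDiag : Bool := Nat.beq (6 % M.p) 0 && upto M.n fun m =>
  Nat.beq (M.pr m % 2) 0 && upto M.dim fun i =>
  sZero M.p (M.br m i ++ [(i, cSmul (M.p - 1)
    ((List.range M.n).foldr (fun q c => cAdd (cSmul (M.w i q) (M.diagAt m q)) c) []))])

/-- The complete test for a list of cocycles to span the cohomology. -/
def chkH2 (d m : ℕ) (cls : ℕ → ℕ → ℕ → SVec) (piv : List (ℕ × ℕ)) (cert : List ℕ) : Bool :=
  M.pivOK d m cls piv && M.coverOK d (M.run d cert (pivSet piv))

/-- Test that linear combinations of coordinates, one for each of `m` cocycles, vanish on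
coboundaries and separate the cocycles. -/
def chkDual (m : ℕ) (cls : ℕ → ℕ → ℕ → SVec) (ℓ : List SVec) : Bool := upto m fun a =>
  ((ℓ.getD a []).all fun y => Nat.blt y.1 (M.dim * M.dim * M.dim)) &&
  ((ℓ.getD a []).flatMap fun y => scale y.2 (M.cobAt 0 y.1)).all (fun y =>
    !M.parOK 0 (y.1 / M.dim) (y.1 % M.dim) ||
    cZero M.p (coefAt y.1 ((ℓ.getD a []).flatMap fun y => scale y.2 (M.cobAt 0 y.1)))) &&
  upto m fun b =>
    bif Nat.beq a b then
      M.isUnit ((ℓ.getD a []).foldr (fun y c => cAdd (cMul y.2 (M.tabAt (cls b) y.1)) c) [])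
    else cZero M.p ((ℓ.getD a []).foldr (fun y c => cAdd (cMul y.2 (M.tabAt (cls b) y.1)) c) [])

end Model

/-- Triangular elimination: coordinates can be made zero by subtracting multiples of vectors on
which they are triangular. -/
theorem exists_reduced {W : Type*} [AddCommGroup W] [Module K W] (X : ℕ → W →ₗ[K] K)
    (D : ℕ → W) (l : List (ℕ × ℕ)) (hne : ∀ g ∈ l, X g.2 (D g.1) ≠ 0)
    (hp : l.Pairwise fun g r => X g.2 (D r.1) = 0) (z : W) :
    ∃ w ∈ Submodule.span K {v | ∃ g ∈ l, D g.1 = v}, ∀ g ∈ l, X g.2 (z - w) = 0 := by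
  induction l generalizing z with
  | nil => exact ⟨0, Submodule.zero_mem _, by simp⟩
  | cons g l ih =>
    rw [List.pairwise_cons] at hp
    have hg : X g.2 (D g.1) ≠ 0 := hne g (by simp)
    obtain ⟨w, hw, h⟩ := ih (fun r hr => hne r (by simp [hr])) hp.2
      (z - (X g.2 z / X g.2 (D g.1)) • D g.1)
    have hXw : X g.2 w = 0 := by
      have : Submodule.span K {v | ∃ r ∈ l, D r.1 = v} ≤ LinearMap.ker (X g.2) := by
        refine Submodule.span_le.2 ?_
        rintro _ ⟨r, hr, rfl⟩
        exact hp.1 r hr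
      exact this hw
    refine ⟨(X g.2 z / X g.2 (D g.1)) • D g.1 + w, add_mem
      (Submodule.smul_mem _ _ (Submodule.subset_span ⟨g, by simp, rfl⟩))
      (Submodule.span_mono ?_ hw), ?_⟩
    · rintro _ ⟨r, hr, rfl⟩
      exact ⟨r, by simp [hr], rfl⟩
    · intro r hr
      rw [← sub_sub]
      rcases List.mem_cons.1 hr with rfl | hr
      · rw [map_sub, map_sub, map_smul, hXw, smul_eq_mul, div_mul_cancel₀ _ hg]
        ring
      · exact h r hr

/-- The coordinates of a linear map. -/
def mapCoord {N : ℕ} (F : Frame K V N) (f : V →ₗ[K] V) (c : ℕ) : K := F.x (c % N) (f (F.e (c / N)))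

/-- The coordinates of a cochain as linear functionals. -/
noncomputable def cochainFun {N : ℕ} (F : Frame K V N) (c : ℕ) : Bil K V →ₗ[K] K where
  toFun z := cochainCoord F z c
  map_add' a b := by simp [cochainCoord]
  map_smul' a b := by simp [cochainCoord]

/-- The coboundary of a linear map of parity `d`. -/
noncomputable def cob (M : Model) (F : Frame K V M.dim) (β : Bil K V) (d : ZMod 2)
    (f : V →ₗ[K] V) : Bil K V :=
  F.bilin fun i j => f (β (F.e i) (F.e j)) - β (f (F.e i)) (F.e j) -
    sgn K (M.parity i) d • β (F.e i) (f (F.e j))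

section Complete

variable {M : Model} {t : K} {F : Frame K V M.dim} {P : ZMod 2 → Submodule K V}
  {β : Bil K V} {d : ℕ}

theorem Rep.isCoboundary_cob (R : Rep M t F P β) {d : ZMod 2} {f : V →ₗ[K] V}
    (hf : ∀ i, ∀ x ∈ P i, f x ∈ P (i + d)) : IsCoboundary P β d (cob M F β d f) := by
  refine ⟨f, hf, fun i x hx y => ?_⟩
  rw [R.part] at hx
  have : ∀ k < M.dim, M.parity k = i → cob M F β d f (F.e k) =
      f ∘ₗ β (F.e k) - β (f (F.e k)) - sgn K i d • β (F.e k) ∘ₗ f := by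
    intro k hk hki
    refine LinearMap.ext fun y => F.linearMap_ext (fun j hj => ?_) y
    rw [cob, F.bilin_e _ hk hj, hki]
    rfl
  have h0 := F.eq_zero_on_graded (cob M F β d f - (β.compr₂ f - β ∘ₗ f - sgn K i d • β.compl₂ f))
    (fun k hk hki => ?_) hx
  · rw [LinearMap.sub_apply, sub_eq_zero] at h0
    rw [h0]
    rfl
  · rw [LinearMap.sub_apply, this k hk hki, sub_eq_zero]
    rfl

theorem Rep.eq_cob (R : Rep M t F P β) {d : ZMod 2} {c : Bil K V} {f : V →ₗ[K] V}
    (hc : ∀ i, ∀ x ∈ P i, ∀ y : V, c x y = f (β x y) - β (f x) y - sgn K i d • β x (f y)) :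
    c = cob M F β d f := by
  refine F.bilin_ext fun i hi j hj => ?_
  rw [cob, F.bilin_e _ hi hj, hc _ _ (R.e_mem hi)]

theorem val_map_terms {W : Type*} [AddCommGroup W] [Module K W] (e : ℕ → W) (t : K) (f : ℕ → ℕ)
    (u : SVec) : val e t (u.map fun y => (f y.1, y.2)) = val (fun i => e (f i)) t u := by
  induction u with
  | nil => rfl
  | cons y u ih => rw [List.map_cons, val_cons, val_cons, ih]

theorem mapCoord_add {N : ℕ} (F : Frame K V N) (f : V →ₗ[K] V) {a b : ℕ} (hb : b < N) :
    mapCoord F f (a * N + b) = F.x b (f (F.e a)) := by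
  have h0 : 0 < N := by omega
  rw [mapCoord, mul_comm, Nat.mul_add_mod, Nat.mod_eq_of_lt hb, Nat.mul_add_div h0,
    Nat.div_eq_of_lt hb, add_zero]

theorem val_congr {W : Type*} [AddCommGroup W] [Module K W] {e e' : ℕ → W} (t : K) {u : SVec}
    (h : ∀ y ∈ u, e y.1 = e' y.1) : val e t u = val e' t u := by
  induction u with
  | nil => rfl
  | cons y u ih => rw [val_cons, val_cons, h y (by simp), ih fun z hz => h z (by simp [hz])]

variable [CharP K M.p]

theorem val_cobTerms (hM : M.Valid) (R : Rep M t F P β) {f : V →ₗ[K] V}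
    (hf : ∀ i, ∀ x ∈ P i, f x ∈ P (i + d)) {i j k : ℕ} (hi : i < M.dim) (hj : j < M.dim)
    (hk : k < M.dim) :
    val (mapCoord F f) t (M.cobTerms d i j k) = F.x k (cob M F β d f (F.e i) (F.e j)) := by
  have hp := hM.p_pos
  have h1 : F.x k (f (β (F.e i) (F.e j))) =
      val (mapCoord F f) t ((M.br i j).map fun y => (y.1 * M.dim + k, y.2)) := by
    rw [val_map_terms _ _ (fun a => a * M.dim + k), R.br, ← LinearMap.comp_apply, map_val]
    exact val_congr _ fun y _ => (mapCoord_add F f hk).symm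
  have h2 : ∀ a b, F.x k (β (F.e a) (f (F.e b))) = val (mapCoord F f) t
      ((colTerms k 0 (M.row a)).map fun y => (b * M.dim + y.1, y.2)) := fun a b => by
    rw [val_map_terms _ _ (fun c => b * M.dim + c), R.x_mul hk]
    exact val_congr _ fun y hy =>
      (mapCoord_add F f (Model.colTerms_row_lt hM.len k a y hy)).symm
  have h3 := (R.isLieSuper' hM).skew _ _ _ (hf _ _ (R.e_mem hi)) _ (R.e_mem hj)
  rw [cob, F.bilin_e _ hi hj, Model.cobTerms, val_append, val_append, val_sSgn _ _ hp,
    val_sSgn _ _ hp, ← h1, ← h2, ← h2, h3]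
  simp only [Model.parity, ← Nat.cast_add, sgn_natCast, map_sub, map_neg, map_smul, smul_eq_mul]
  rw [pow_add]
  ring

theorem val_cobAt (hM : M.Valid) (h0 : 0 < M.dim) (R : Rep M t F P β) {f : V →ₗ[K] V}
    (hf : ∀ i, ∀ x ∈ P i, f x ∈ P (i + d)) (c : ℕ) (hc : c / M.dim / M.dim < M.dim) :
    val (mapCoord F f) t (M.cobAt d c) = cochainCoord F (cob M F β d f) c :=
  val_cobTerms hM R hf hc (Nat.mod_lt _ h0) (Nat.mod_lt _ h0)

end Complete

end StructConst

namespace StructConst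

variable {K V : Type*} [Field K] [AddCommGroup V] [Module K V]

/-! ### Weights and the completeness of a list of cocycles -/

section Complete

variable {M : Model} {t : K} {F : Frame K V M.dim} {P : ZMod 2 → Submodule K V}
  {β z : Bil K V} {d : ℕ}

variable (K) in
/-- The weight of a basis vector, modulo the characteristic. -/
def Model.wtK (M : Model) (i : ℕ) : Fin M.n → K := fun q => (M.w i q : K)

/-- The eigenvalue of the basis vector `e_m`, where `m < n`, on vectors of the given weight. -/
def Model.eigen (M : Model) (t : K) (m : ℕ) (w : Fin M.n → K) : K :=
  ∑ q : Fin M.n, w q * ev t (M.diagAt m q)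

theorem Frame.linear_congr {N : ℕ} (F : Frame K V N) (L : V →ₗ[K] K) {v v' : V}
    (h : ∀ q < N, L (F.e q) = 0 ∨ F.x q v = F.x q v') : L v = L v' := by
  rw [F.expand v, F.expand v', map_sum, map_sum]
  refine Finset.sum_congr rfl fun q hq => ?_
  rw [map_smul, map_smul]
  rcases h q (Finset.mem_range.1 hq) with h | h
  · rw [h, smul_zero, smul_zero]
  · rw [h]

variable [CharP K M.p]

theorem Model.cast_six (hd : M.chkDiag = true) : (6 : K) = 0 := by
  rw [Model.chkDiag, Bool.and_eq_true] at hd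
  have := (CharP.cast_eq_zero_iff K M.p 6).2 (Nat.dvd_of_mod_eq_zero (Nat.eq_of_beq_eq_true hd.1))
  exact_mod_cast this

theorem Model.wtK_add (hM : M.Valid) (hd : M.chkDiag = true) {i j : ℕ} (hi : i < M.dim)
    (hj : j < M.dim) {y : ℕ × Coef} (hy : y ∈ M.br i j) :
    M.wtK K y.1 = M.wtK K i + M.wtK K j := by
  ext q
  have h := List.all_eq_true.1 (of_upto (of_upto hM.wt i hi) j hj) y hy
  have h := congrArg (Nat.cast : ℕ → K) (Nat.eq_of_beq_eq_true (of_upto h q q.2))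
  push_cast at h
  rw [Model.cast_six hd, add_zero] at h
  simpa [Model.wtK] using h

theorem Rep.diag (hM : M.Valid) (R : Rep M t F P β) (hd : M.chkDiag = true) {m i : ℕ}
    (hm : m < M.n) (hi : i < M.dim) :
    β (F.e m) (F.e i) = M.eigen t m (M.wtK K i) • F.e i ∧ M.parity m = 0 := by
  rw [Model.chkDiag, Bool.and_eq_true] at hd
  have h := of_upto hd.2 m hm
  rw [Bool.and_eq_true, Nat.beq_eq] at h
  refine ⟨?_, (ZMod.natCast_eq_zero_iff _ 2).2 (Nat.dvd_of_mod_eq_zero h.1)⟩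
  have h1 := F.val_eq_zero t (of_upto h.2 i hi)
  have h2 : ∀ l : List ℕ, ev t (l.foldr (fun q c => cAdd (cSmul (M.w i q) (M.diagAt m q)) c) []) =
      (l.map fun q => (M.w i q : K) * ev t (M.diagAt m q)).sum := by
    intro l
    induction l with
    | nil => simp
    | cons q l ih => rw [List.foldr_cons, ev_cAdd, ev_cSmul, ih, List.map_cons, List.sum_cons]
  have h3 : ((List.range M.n).map fun q => (M.w i q : K) * ev t (M.diagAt m q)).sum =
      M.eigen t m (M.wtK K i) := by
    exact (Fin.sum_univ_eq_sum_range (fun q => (M.w i q : K) * ev t (M.diagAt m q)) M.n).symm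
  rw [val_append, val_cons, val_nil, add_zero, ev_cSmul, cast_pred hM.p_pos, h2, h3, ← R.br] at h1
  linear_combination (norm := module) h1

theorem Model.eigen_add (M : Model) (t : K) (m : ℕ) (w w' : Fin M.n → K) :
    M.eigen t m (w + w') = M.eigen t m w + M.eigen t m w' := by
  simp only [Model.eigen, Pi.add_apply, add_mul, Finset.sum_add_distrib]

theorem Rep.x_br_eq_zero (hM : M.Valid) (R : Rep M t F P β) (hd : M.chkDiag = true) {i j k : ℕ}
    (hi : i < M.dim) (hj : j < M.dim) (hk : k < M.dim)
    (h : M.wtK K k ≠ M.wtK K i + M.wtK K j) : F.x k (β (F.e i) (F.e j)) = 0 := by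
  rw [R.br, F.x_val t hk, Frame.coefAt_eq_nil, ev_nil]
  rintro y hy rfl
  exact h (Model.wtK_add hM hd hi hj hy)

/-- The torus acts trivially on cohomology: a cocycle without components of weight zero modulo `p`
is a coboundary. Where the torus element `h` acts on a component of `z` by the scalar `μ ≠ 0`, the
component is the coboundary of that of `-μ⁻¹ z (h, ·)`. -/
theorem isCoboundary_of_weights (hM : M.Valid) (R : Rep M t F P β) (hd : M.chkDiag = true)
    (hinj : ∀ w : Fin M.n → K, (∀ m < M.n, M.eigen t m w = 0) → w = 0)
    (hz : IsCocycle P β d z)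
    (h0 : ∀ i < M.dim, ∀ j < M.dim, ∀ k < M.dim, M.wtK K k = M.wtK K i + M.wtK K j →
      F.x k (z (F.e i) (F.e j)) = 0) : IsCoboundary P β d z := by
  classical
  have hsel : ∀ w : Fin M.n → K, ∃ m, w ≠ 0 → m < M.n ∧ M.eigen t m w ≠ 0 := by
    intro w
    by_cases hw : w = 0
    · exact ⟨0, fun h => absurd hw h⟩
    · have := mt (hinj w) hw
      push Not at this
      obtain ⟨m, hm⟩ := this
      exact ⟨m, fun _ => hm⟩
  choose sel hsel using hsel
  let c : (Fin M.n → K) → K := fun w => if w = 0 then 0 else -(M.eigen t (sel w) w)⁻¹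
  let f : V →ₗ[K] V := F.lin fun i => ∑ k ∈ Finset.range M.dim,
    (c (M.wtK K k - M.wtK K i) *
      F.x k (z (F.e (sel (M.wtK K k - M.wtK K i))) (F.e i))) • F.e k
  have hn : M.n ≤ M.dim := by
    have := M.dim_eq
    omega
  have hxf : ∀ i < M.dim, ∀ k < M.dim, F.x k (f (F.e i)) = c (M.wtK K k - M.wtK K i) *
      F.x k (z (F.e (sel (M.wtK K k - M.wtK K i))) (F.e i)) := by
    intro i hi k hk
    rw [F.lin_e _ hi, map_sum, Finset.sum_eq_single k]
    · rw [map_smul, F.x_e _ _ hk, if_pos rfl, smul_eq_mul, mul_one]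
    · intro b _ hbk
      rw [map_smul, F.x_e _ _ hk, if_neg hbk, smul_zero]
    · exact fun h => absurd (Finset.mem_range.2 hk) h
  have hf : ∀ i, ∀ x ∈ P i, f x ∈ P (i + d) := by
    intro i x hx
    rw [R.part] at hx
    refine F.map_mem_of_graded f _ (fun a ha hai => ?_) hx
    rw [R.part]
    refine F.mem_graded_of_x fun k hk hkp => ?_
    rw [hxf a ha k hk]
    by_cases hw : M.wtK K k - M.wtK K a = 0
    · simp only [c, if_pos hw, zero_mul]
    · have hm := (hsel _ hw).1
      have := hz.mem _ _ _ (R.e_mem (hm.trans_le hn)) _ (R.e_mem ha)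
      rw [(R.diag hM hd hm ha).2, zero_add, hai, R.part] at this
      rw [F.x_eq_zero_of_mem_graded this hk hkp, mul_zero]
  have hcob : z = cob M F β d f := by
    refine F.bilin_ext fun i hi j hj => F.ext fun k hk => ?_
    rw [cob, F.bilin_e _ hi hj, map_sub, map_sub, map_smul]
    set w := M.wtK K k - (M.wtK K i + M.wtK K j) with hw
    have e1 : F.x k (f (β (F.e i) (F.e j))) =
        c w * F.x k (z (F.e (sel w)) (β (F.e i) (F.e j))) := by
      have : β (F.e i) (F.e j) ∈ F.graded (M.wtK K) (M.wtK K i + M.wtK K j) :=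
        F.mem_graded_of_x fun q hq hne => R.x_br_eq_zero hM hd hi hj hq hne
      have h := F.eq_zero_on_graded (F.x k ∘ₗ f - c w • (F.x k ∘ₗ z (F.e (sel w))))
        (fun q hq hqw => ?_) this
      · exact sub_eq_zero.1 h
      · simp only [LinearMap.sub_apply, LinearMap.smul_apply, LinearMap.comp_apply, smul_eq_mul]
        rw [hxf q hq k hk, hqw, sub_self]
    have e2 : F.x k (β (f (F.e i)) (F.e j)) =
        c w * F.x k (β (z (F.e (sel w)) (F.e i)) (F.e j)) := by
      have := F.linear_congr (F.x k ∘ₗ β.flip (F.e j)) (v := f (F.e i))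
        (v' := c w • z (F.e (sel w)) (F.e i)) fun q hq => ?_
      · simpa using this
      · by_cases hq' : M.wtK K k = M.wtK K q + M.wtK K j
        · right
          rw [hxf i hi q hq, map_smul, smul_eq_mul,
            show M.wtK K q - M.wtK K i = w by rw [hw, hq']; abel]
        · exact Or.inl (R.x_br_eq_zero hM hd hq hj hk hq')
    have e3 : F.x k (β (F.e i) (f (F.e j))) =
        c w * F.x k (β (F.e i) (z (F.e (sel w)) (F.e j))) := by
      have := F.linear_congr (F.x k ∘ₗ β (F.e i)) (v := f (F.e j))
        (v' := c w • z (F.e (sel w)) (F.e j)) fun q hq => ?_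
      · simpa using this
      · by_cases hq' : M.wtK K k = M.wtK K i + M.wtK K q
        · right
          rw [hxf j hj q hq, map_smul, smul_eq_mul,
            show M.wtK K q - M.wtK K j = w by rw [hw, hq']; abel]
        · exact Or.inl (R.x_br_eq_zero hM hd hi hq hk hq')
    rw [e1, e2, e3]
    by_cases hw0 : w = 0
    · rw [h0 i hi j hj k hk (sub_eq_zero.1 hw0)]
      simp only [c, if_pos hw0]
      simp
    · obtain ⟨hm, hne⟩ := hsel w hw0
      have hmp := (R.diag hM hd hm hi).2
      have hcl := hz.closed _ _ _ (hmp ▸ R.e_mem (hm.trans_le hn)) _ (R.e_mem hi) (F.e j)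
      rw [(R.diag hM hd hm hi).1, (R.diag hM hd hm hj).1] at hcl
      have hx : ∀ v, F.x k (β (F.e (sel w)) v) = M.eigen t (sel w) (M.wtK K k) * F.x k v := by
        intro v
        refine F.linearMap_ext (L := F.x k ∘ₗ β (F.e (sel w)))
          (L' := M.eigen t (sel w) (M.wtK K k) • F.x k) (fun q hq => ?_) v
        simp only [LinearMap.comp_apply, LinearMap.smul_apply, smul_eq_mul]
        rw [(R.diag hM hd hm hq).1, map_smul, F.x_e _ _ hk, smul_eq_mul]
        by_cases hqk : q = k
        · rw [hqk]
        · rw [if_neg hqk, mul_zero, mul_zero]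
      have hcl := congrArg (F.x k) hcl
      simp only [sgn_zero_left, one_smul, map_add, map_smul, LinearMap.smul_apply, hx,
        smul_eq_mul] at hcl
      have hk' : M.eigen t (sel w) (M.wtK K k) =
          M.eigen t (sel w) w +
            (M.eigen t (sel w) (M.wtK K i) + M.eigen t (sel w) (M.wtK K j)) := by
        rw [← Model.eigen_add, ← Model.eigen_add, hw, sub_add_cancel]
      rw [hk'] at hcl
      simp only [c, if_neg hw0, smul_eq_mul]
      field_simp
      linear_combination hcl
  rw [hcob]
  exact R.isCoboundary_cob hf

/-- The map `e_a ↦ e_b`, where `s = a N + b`. -/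
noncomputable def elemMap {N : ℕ} (F : Frame K V N) (s : ℕ) : V →ₗ[K] V :=
  F.lin fun i => if i = s / N then F.e (s % N) else 0

omit [CharP K M.p] in
theorem mapCoord_elemMap {N : ℕ} (F : Frame K V N) {s : ℕ} (hs : s < N * N) :
    mapCoord F (elemMap F s) = fun c => if c = s then (1 : K) else 0 := by
  have h0 : 0 < N := by
    rcases Nat.eq_zero_or_pos N with h | h
    · simp [h] at hs
    · exact h
  have hsN : s / N < N := Nat.div_lt_of_lt_mul hs
  funext c
  rw [mapCoord]
  by_cases hc : c / N < N
  · rw [elemMap, F.lin_e _ hc]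
    by_cases h1 : c / N = s / N
    · rw [if_pos h1, F.x_e _ _ (Nat.mod_lt _ h0)]
      by_cases h2 : s % N = c % N
      · rw [if_pos h2, if_pos]
        rw [← Nat.div_add_mod c N, ← Nat.div_add_mod s N, h1, h2]
      · rw [if_neg h2, if_neg]
        rintro rfl
        exact h2 rfl
    · rw [if_neg h1, map_zero, if_neg]
      rintro rfl
      exact h1 rfl
  · rw [F.e_out _ (not_lt.1 hc), map_zero, map_zero, if_neg]
    rintro rfl
    exact hc hsN

theorem val_indicator (t : K) (s : ℕ) (u : SVec) :
    val (fun c => if c = s then (1 : K) else 0) t u = ev t (coefAt s u) := by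
  induction u with
  | nil => rfl
  | cons y u ih =>
    by_cases h : y.1 = s
    · simp [coefAt, ih, h, ev_cAdd]
    · have : Nat.beq y.1 s = false := by rwa [← Bool.not_eq_true, Nat.beq_eq]
      simp [coefAt, ih, h, this]

omit [CharP K M.p] in
theorem elemMap_mem (R : Rep M t F P β) {s : ℕ} (hs : s < M.dim * M.dim)
    (h : M.parOK d (s / M.dim) (s % M.dim) = true) :
    ∀ i, ∀ x ∈ P i, elemMap F s x ∈ P (i + d) := by
  have h0 : 0 < M.dim := by
    rcases Nat.eq_zero_or_pos M.dim with h | h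
    · simp [h] at hs
    · exact h
  intro i x hx
  rw [R.part] at hx
  refine F.map_mem_of_graded _ _ (fun a ha hai => ?_) hx
  rw [elemMap, F.lin_e _ ha]
  by_cases hsa : a = s / M.dim
  · rw [if_pos hsa]
    have h2 : ((M.pr (s % M.dim) + (M.pr (s / M.dim) + d) : ℕ) : ZMod 2) = 0 :=
      (ZMod.natCast_eq_zero_iff _ 2).2 (Nat.dvd_of_mod_eq_zero (Nat.eq_of_beq_eq_true h))
    have := R.e_mem (Nat.mod_lt s h0)
    push_cast at h2
    rw [Model.parity, eq_neg_of_add_eq_zero_left h2, ZModModule.neg_eq_self] at this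
    rwa [← hai, hsa]
  · rw [if_neg hsa]
    exact zero_mem _

omit [CharP K M.p] in
theorem cochainCoord_tab {cls : ℕ → ℕ → SVec} (h0 : 0 < M.dim)
    (hz : ∀ i j, z (F.e i) (F.e j) = val F.e t (cls i j)) (c : ℕ) :
    cochainCoord F z c = ev t (M.tabAt cls c) := by
  rw [cochainCoord, hz, F.x_val t (Nat.mod_lt _ h0), Model.tabAt]

variable {C : ℕ → Bil K V} {m : ℕ} {cls : ℕ → ℕ → ℕ → SVec}

/-- A cocycle has no components of weight zero modulo `p` if its coordinates in the set `S` vanish.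
The coordinates at `(e_i, e_j)` with `i > j` are determined by skew-symmetry. -/
theorem coordinates_of_cover (hM : M.Valid) (R : Rep M t F P β)
    (hz : IsCocycle P β d z) {S : ℕ} (hS : ∀ c, S.testBit c = true → cochainCoord F z c = 0)
    (hc : M.coverOK d S = true) : ∀ i < M.dim, ∀ j < M.dim, ∀ k < M.dim,
      M.wtK K k = M.wtK K i + M.wtK K j → F.x k (z (F.e i) (F.e j)) = 0 := by
  have key : ∀ i < M.dim, ∀ j ≤ i, ∀ k < M.dim,
      M.wtK K k = M.wtK K i + M.wtK K j → F.x k (z (F.e j) (F.e i)) = 0 := by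
    intro i hi j hj k hk hw
    have hjN : j < M.dim := by omega
    have h := of_upto (of_upto (of_upto hc i hi) j (by omega)) k hk
    simp only [Bool.or_eq_true, Bool.and_eq_true, Nat.beq_eq, Bool.not_eq_true'] at h
    rcases h with ((h | h) | h) | h
    · have h0 : M.parity i = 0 :=
        (ZMod.natCast_eq_zero_iff _ 2).2 (Nat.dvd_of_mod_eq_zero h.2)
      rw [← h.1, hz.alt _ (h0 ▸ R.e_mem hi), map_zero]
    · have := hz.mem _ _ _ (R.e_mem hjN) _ (R.e_mem hi)
      rw [R.part] at this
      refine F.x_eq_zero_of_mem_graded this hk fun hp => ?_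
      have hne : ¬ Nat.beq ((M.pr k + (M.pr i + M.pr j + d)) % 2) 0 = true := by rw [h]; simp
      rw [Nat.beq_eq] at hne
      refine hne (Nat.mod_eq_zero_of_dvd ((ZMod.natCast_eq_zero_iff _ 2).1 ?_))
      push_cast
      change M.parity k + (M.parity i + M.parity j + d) = 0
      rw [hp, add_comm (M.parity i), CharTwo.add_self_eq_zero]
    · exfalso
      rw [upto_iff.2 fun q hq => ?_] at h
      · simp at h
      · rw [Nat.beq_eq]
        refine Nat.mod_eq_zero_of_dvd ((CharP.cast_eq_zero_iff K M.p _).1 ?_)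
        have := congrFun hw ⟨q, hq⟩
        simp only [Model.wtK, Pi.add_apply] at this
        push_cast
        rw [cast_pred hM.p_pos, this]
        ring
    · have := hS _ h
      obtain ⟨h1, h2, h3⟩ := M.decode (i := j) hi hk
      rwa [cochainCoord, h1, h2, h3] at this
  intro i hi j hj k hk hw
  rcases le_total i j with hij | hij
  · exact key j hj i hij k hk (by rw [hw, add_comm])
  · rw [hz.skew _ _ _ (R.e_mem hi) _ (R.e_mem hj), map_neg, map_smul, key i hi j hij k hk hw,
      smul_zero, neg_zero]

/-- The cocycle with the given number, in the sense of `Model.pivVal`. -/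
noncomputable def pivCochain (M : Model) (F : Frame K V M.dim) (β : Bil K V) (d : ℕ)
    (C : ℕ → Bil K V) (s : ℕ) : Bil K V :=
  if s < M.dim * M.dim then cob M F β d (elemMap F s) else C (s - M.dim * M.dim)

/-- The number of a cocycle of parity `d` in the sense of `Model.pivVal`. -/
def Model.IsSource (M : Model) (d m s : ℕ) : Prop :=
  (s < M.dim * M.dim → M.parOK d (s / M.dim) (s % M.dim) = true) ∧
    (¬ s < M.dim * M.dim → s - M.dim * M.dim < m)

theorem cochainFun_pivCochain (hM : M.Valid) (R : Rep M t F P β)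
    (hcls : ∀ l < m, ∀ i j, C l (F.e i) (F.e j) = val F.e t (cls l i j)) {s c : ℕ}
    (hs : M.IsSource d m s) (hc : c < M.dim * M.dim * M.dim) :
    cochainFun F c (pivCochain M F β d C s) = ev t (M.pivVal d cls s c) := by
  have h0 : 0 < M.dim := by
    rcases Nat.eq_zero_or_pos M.dim with h | h
    · simp [h] at hc
    · exact h
  change cochainCoord F (pivCochain M F β d C s) c = _
  by_cases hsN : s < M.dim * M.dim
  · have hb : Nat.blt s (M.dim * M.dim) = true := by rwa [Nat.blt_eq]
    rw [pivCochain, if_pos hsN, Model.pivVal, hb, cond_true,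
      ← val_cobAt hM h0 R (elemMap_mem R hsN (hs.1 hsN)), mapCoord_elemMap F hsN, val_indicator]
    rw [Nat.div_div_eq_div_mul]
    exact Nat.div_lt_of_lt_mul hc
  · have hb : Nat.blt s (M.dim * M.dim) = false := by rwa [← Bool.not_eq_true, Nat.blt_eq]
    rw [pivCochain, if_neg hsN, Model.pivVal, hb, cond_false]
    exact cochainCoord_tab h0 (hcls _ (hs.2 hsN)) c

/-- The list of pivots is triangular. -/
theorem pivOK_spec (hM : M.Valid) (hu : M.UnitsAt t) (R : Rep M t F P β)
    (hcls : ∀ l < m, ∀ i j, C l (F.e i) (F.e j) = val F.e t (cls l i j)) (l : List (ℕ × ℕ))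
    (h : M.pivOK d m cls l = true) :
    (∀ g ∈ l, M.IsSource d m g.1) ∧
      (∀ g ∈ l, cochainFun F g.2 (pivCochain M F β d C g.1) ≠ 0) ∧
      l.Pairwise fun g r => cochainFun F g.2 (pivCochain M F β d C r.1) = 0 := by
  induction l with
  | nil => simp
  | cons g l ih =>
    simp only [Model.pivOK, Bool.and_eq_true, List.all_eq_true] at h
    obtain ⟨⟨⟨⟨hsrc, hlt⟩, hunit⟩, hall⟩, hl⟩ := h
    obtain ⟨i1, i2, i3⟩ := ih hl
    rw [Nat.blt_eq] at hlt
    have hg : M.IsSource d m g.1 := by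
      constructor
      · intro hs
        have hb : Nat.blt g.1 (M.dim * M.dim) = true := by rwa [Nat.blt_eq]
        rwa [hb, cond_true] at hsrc
      · intro hs
        have hb : Nat.blt g.1 (M.dim * M.dim) = false := by rwa [← Bool.not_eq_true, Nat.blt_eq]
        rwa [hb, cond_false, Nat.blt_eq] at hsrc
    refine ⟨?_, ?_, List.pairwise_cons.2 ⟨fun r hr => ?_, i3⟩⟩
    · intro r hr
      rcases List.mem_cons.1 hr with rfl | hr
      exacts [hg, i1 r hr]
    · intro r hr
      rcases List.mem_cons.1 hr with rfl | hr
      · rw [cochainFun_pivCochain hM R hcls hg hlt]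
        exact hu.ne_zero hM.p_pos hunit
      · exact i2 r hr
    · rw [cochainFun_pivCochain hM R hcls (i1 r hr) hlt]
      exact ev_eq_zero t (hall r hr)

theorem cochainCoord_of_pivSet {N : ℕ} (F : Frame K V N) {z : Bil K V} (l : List (ℕ × ℕ))
    (hl : ∀ g ∈ l, cochainCoord F z g.2 = 0) :
    ∀ c, (Model.pivSet l).testBit c = true → cochainCoord F z c = 0 := by
  induction l with
  | nil => simp [Model.pivSet]
  | cons g l ih =>
    intro c hc
    rcases testBit_or_shiftLeft hc with hc | rfl
    · exact ih (fun r hr => hl r (by simp [hr])) c hc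
    · exact hl g (by simp)

/-- Every cocycle is cohomologous to a linear combination of the given ones. -/
theorem exists_isCoboundary (hM : M.Valid) (hu : M.UnitsAt t) (R : Rep M t F P β)
    (hd : M.chkDiag = true) (hinj : ∀ w : Fin M.n → K, (∀ m < M.n, M.eigen t m w = 0) → w = 0)
    (hC : ∀ l < m, IsCocycle P β d (C l))
    (hcls : ∀ l < m, ∀ i j, C l (F.e i) (F.e j) = val F.e t (cls l i j)) {piv : List (ℕ × ℕ)}
    {cert : List ℕ} (hchk : M.chkH2 d m cls piv cert = true) (hz : IsCocycle P β d z) :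
    ∃ a : Fin m → K, IsCoboundary P β d (z - ∑ l : Fin m, a l • C l) := by
  rw [Model.chkH2, Bool.and_eq_true] at hchk
  obtain ⟨hpiv, hcov⟩ := hchk
  let T : Submodule K (Bil K V) :=
    Submodule.span K (Set.range fun l : Fin m => C l) ⊔ coboundaries P β d
  have hTc : T ≤ cocycles P β d := by
    refine sup_le (Submodule.span_le.2 ?_) fun c hc =>
      IsCoboundary.isCocycle (R.isLieSuper' hM) hc
    rintro _ ⟨l, rfl⟩
    exact hC l l.2
  obtain ⟨ok1, ok2, ok3⟩ := pivOK_spec hM hu R hcls piv hpiv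
  obtain ⟨w, hw, hred⟩ := exists_reduced (cochainFun F) (pivCochain M F β d C) piv ok2 ok3 z
  have hwT : w ∈ T := by
    refine Submodule.span_le.2 ?_ hw
    rintro _ ⟨g, hg, rfl⟩
    by_cases hs : g.1 < M.dim * M.dim
    · rw [pivCochain, if_pos hs]
      exact Submodule.mem_sup_right (R.isCoboundary_cob (elemMap_mem R hs ((ok1 g hg).1 hs)))
    · rw [pivCochain, if_neg hs]
      exact Submodule.mem_sup_left (Submodule.subset_span ⟨⟨_, (ok1 g hg).2 hs⟩, rfl⟩)
  have hzw : IsCocycle P β d (z - w) :=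
    (cocycles P β (d : ZMod 2)).sub_mem (show z ∈ cocycles P β d from hz) (hTc hwT)
  have hcob := isCoboundary_of_weights hM R hd hinj hzw
    (coordinates_of_cover hM R hzw
      (of_run hM hu R hzw cert (cochainCoord_of_pivSet F piv hred)) hcov)
  obtain ⟨a, ha, b, hb, hab⟩ := Submodule.mem_sup.1 hwT
  obtain ⟨s, hs⟩ := (Submodule.mem_span_range_iff_exists_fun K).1 ha
  refine ⟨s, ?_⟩
  have : z - ∑ l : Fin m, s l • C l = (z - w) + b := by
    rw [hs, ← hab]
    abel
  rw [this]
  exact IsCoboundary.add hcob hb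

omit [CharP K M.p] in
/-- A parity-preserving linear map has no coordinates of odd parity. -/
theorem mapCoord_eq_zero (R : Rep M t F P β) {f : V →ₗ[K] V}
    (hf : ∀ i, ∀ x ∈ P i, f x ∈ P (i + 0)) {c : ℕ}
    (hc : M.parOK 0 (c / M.dim) (c % M.dim) = false) : mapCoord F f c = 0 := by
  rw [mapCoord]
  by_cases h : c / M.dim < M.dim
  · have h1 := hf _ _ (R.e_mem h)
    rw [R.part] at h1
    refine F.x_eq_zero_of_mem_graded h1 (Nat.mod_lt _ ((Nat.zero_le _).trans_lt h)) fun hp => ?_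
    rw [add_zero] at hp
    have hne : ¬ M.parOK 0 (c / M.dim) (c % M.dim) = true := by rw [hc]; simp
    rw [Model.parOK, Nat.beq_eq] at hne
    refine hne (Nat.mod_eq_zero_of_dvd ((ZMod.natCast_eq_zero_iff _ 2).1 ?_))
    push_cast
    change M.parity (c % M.dim) + (M.parity (c / M.dim) + 0) = 0
    rw [hp, add_zero, CharTwo.add_self_eq_zero]
  · rw [F.e_out _ (not_lt.1 h), map_zero, map_zero]

/-- Combinations of the given cocycles are coboundaries only if they vanish. -/
theorem eq_zero_of_isCoboundary (hM : M.Valid) (hu : M.UnitsAt t) (R : Rep M t F P β)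
    (hcls : ∀ l < m, ∀ i j, C l (F.e i) (F.e j) = val F.e t (cls l i j)) {ℓ : List SVec}
    (hchk : M.chkDual m cls ℓ = true) {a : Fin m → K}
    (ha : IsCoboundary P β 0 (∑ l : Fin m, a l • C l)) : a = 0 := by
  obtain ⟨f, hf, hc⟩ := ha
  have hcob := R.eq_cob hc
  funext b
  have h := of_upto hchk b b.2
  simp only [Bool.and_eq_true, List.all_eq_true] at h
  obtain ⟨⟨hlt, hz⟩, hdual⟩ := h
  -- the functional with number `b` vanishes on coboundaries and on the cocycles except for `C b`
  have h1 : val (fun c => cochainCoord F (cob M F β 0 f) c) t (ℓ.getD b []) = 0 := by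
    rw [← val_flatMap_terms (mapCoord F f) t (fun y => scale y.2 (M.cobAt 0 y.1))
      (fun c => cochainCoord F (cob M F β 0 f) c)]
    · rw [val_eq_sum _ _ _ _ fun y hy =>
        List.mem_toFinset.2 (List.mem_map_of_mem (f := Prod.fst) hy)]
      refine Finset.sum_eq_zero fun i hi => ?_
      rw [List.mem_toFinset, List.mem_map] at hi
      obtain ⟨y, hy, rfl⟩ := hi
      have := hz y hy
      rw [Bool.or_eq_true, Bool.not_eq_true'] at this
      rcases this with h | h
      · rw [mapCoord_eq_zero R hf h, smul_zero]
      · rw [ev_eq_zero t h, zero_smul]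
    · intro y hy
      have hy' := hlt y hy
      rw [Nat.blt_eq] at hy'
      have h0 : 0 < M.dim := by
        rcases Nat.eq_zero_or_pos M.dim with h | h
        · simp [h] at hy'
        · exact h
      rw [val_scale, val_cobAt (d := 0) hM h0 R (by exact_mod_cast hf)]
      · norm_cast
      · rw [Nat.div_div_eq_div_mul]
        exact Nat.div_lt_of_lt_mul hy'
  rw [← hcob] at h1
  have h2 : ∀ l : Fin m, val (fun c => cochainCoord F (C l) c) t (ℓ.getD b []) = ev t
      ((ℓ.getD b []).foldr (fun y c => cAdd (cMul y.2 (M.tabAt (cls l) y.1)) c) []) := by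
    intro l
    generalize ℓ.getD b [] = u at hlt ⊢
    induction u with
    | nil => rfl
    | cons y u ih =>
      have hy' := hlt y (by simp)
      rw [Nat.blt_eq] at hy'
      have h0 : 0 < M.dim := by
        rcases Nat.eq_zero_or_pos M.dim with h | h
        · simp [h] at hy'
        · exact h
      rw [val_cons, ih fun z hz => hlt z (by simp [hz]), List.foldr_cons, ev_cAdd, ev_cMul,
        cochainCoord_tab h0 (hcls l l.2), smul_eq_mul]
  have h3 : ∀ u : SVec, val (fun c => cochainCoord F (∑ l : Fin m, a l • C l) c) t u =
      ∑ l : Fin m, a l * val (fun c => cochainCoord F (C l) c) t u := by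
    intro u
    induction u with
    | nil => simp
    | cons y u ih =>
      have : cochainCoord F (∑ l : Fin m, a l • C l) y.1 =
          ∑ l : Fin m, a l * cochainCoord F (C l) y.1 := by
        change cochainFun F y.1 _ = _
        rw [map_sum]
        exact Finset.sum_congr rfl fun l _ => map_smul _ _ _
      simp only [val_cons, ih, this, smul_eq_mul, mul_add, Finset.sum_add_distrib, Finset.mul_sum]
      congr 1
      exact Finset.sum_congr rfl fun l _ => by ring
  rw [h3, Finset.sum_eq_single b] at h1
  · have hb := of_upto hdual b b.2
    rw [Nat.beq_refl, cond_true] at hb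
    rw [h2] at h1
    exact (mul_eq_zero.1 h1).resolve_right (hu.ne_zero hM.p_pos hb)
  · intro l _ hl
    have hb := of_upto hdual l l.2
    have : Nat.beq b l = false := by
      rw [← Bool.not_eq_true, Nat.beq_eq]
      exact fun h => hl (Fin.ext h.symm)
    rw [this, cond_false] at hb
    rw [h2, ev_eq_zero t hb, mul_zero]
  · exact fun h => absurd (Finset.mem_univ b) h

/-- The classes of cocycles that pass both tests form a basis of the even cohomology. -/
theorem isCohomologyBasis (hM : M.Valid) (hu : M.UnitsAt t) (R : Rep M t F P β)
    (hd : M.chkDiag = true) (hinj : ∀ w : Fin M.n → K, (∀ m < M.n, M.eigen t m w = 0) → w = 0)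
    (hC : ∀ l < m, IsCocycle P β 0 (C l))
    (hcls : ∀ l < m, ∀ i j, C l (F.e i) (F.e j) = val F.e t (cls l i j)) {piv : List (ℕ × ℕ)}
    {cert : List ℕ} (hchk : M.chkH2 0 m cls piv cert = true) {ℓ : List SVec}
    (hdual : M.chkDual m cls ℓ = true) :
    IsCohomologyBasis P β fun l : Fin m => C l := by
  refine ⟨fun l => hC l l.2, fun z hz => ?_⟩
  obtain ⟨a, ha⟩ := exists_isCoboundary (d := 0) hM hu R hd hinj (by exact_mod_cast hC) hcls hchk
    (by exact_mod_cast hz)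
  rw [Nat.cast_zero] at ha
  refine ⟨a, ha, fun b hb => ?_⟩
  have h : IsCoboundary P β 0 (∑ l : Fin m, (b - a) l • C l) := by
    have := (coboundaries P β 0).sub_mem ha hb
    rwa [sub_sub_sub_cancel_left, ← Finset.sum_sub_distrib,
      Finset.sum_congr rfl fun l _ => (sub_smul (b l) (a l) (C l)).symm] at this
  exact sub_eq_zero.1 (eq_zero_of_isCoboundary hM hu R hcls hdual h)

end Complete

end StructConst

namespace StructConst

variable {K V : Type*} [Field K] [AddCommGroup V] [Module K V]

/-! ### Tables of the cocycles given by squares and cubes of inner derivations -/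

namespace Model

variable (M : Model)

/-- The table of `sq2` for the derivation `ad e_g` if `p = 2`, and of `sq3` if `p = 3`. -/
def sqTab (g i j : ℕ) : SVec :=
  bif Nat.beq M.p 2 then M.brS (M.br g i) (M.br g j)
  else M.brS (M.br g i) (M.adl g (M.br g j)) ++ M.brS (M.adl g (M.br g i)) (M.br g j)

/-- `e_g` is even and `(ad e_g)^p = 0`, where `p` is 2 or 3. -/
def nilOK (g : ℕ) : Bool := Nat.blt g M.dim && Nat.beq (M.pr g % 2) 0 && upto M.dim fun j =>
  sZero M.p (bif Nat.beq M.p 2 then M.adl g (M.br g j) else M.adl g (M.adl g (M.br g j)))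

end Model

/-- `sq2` or `sq3`, according to the characteristic. -/
noncomputable def sqP (p : ℕ) (β : Bil K V) (D : V →ₗ[K] V) : Bil K V :=
  if p = 2 then sq2 β D else sq3 β D

section Sq

variable {M : Model} {t : K} {F : Frame K V M.dim} {P : ZMod 2 → Submodule K V} {β : Bil K V}
  {g : ℕ}

theorem Rep.sqP_e (R : Rep M t F P β) (g i j : ℕ) :
    sqP M.p β (β (F.e g)) (F.e i) (F.e j) = val F.e t (M.sqTab g i j) := by
  unfold sqP Model.sqTab
  by_cases h : M.p = 2
  · rw [if_pos h, h]
    simp only [Nat.beq_refl, cond_true]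
    rw [sq2_apply, R.br, R.br, R.brS]
  · have h' : Nat.beq M.p 2 = false := by rwa [← Bool.not_eq_true, Nat.beq_eq]
    rw [if_neg h, h', cond_false, val_append, sq3_apply, ← R.brS, ← R.brS, ← R.adl, ← R.adl,
      ← R.br, ← R.br]

variable [CharP K M.p]

theorem Rep.nil_two (R : Rep M t F P β) (h : M.nilOK g = true) (hp : M.p = 2) (x : V) :
    β (F.e g) (β (F.e g) x) = 0 := by
  simp only [Model.nilOK, Bool.and_eq_true] at h
  refine F.linearMap_ext (L := β (F.e g) ∘ₗ β (F.e g)) (L' := 0) (fun j hj => ?_) x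
  have h2 := of_upto h.2 j hj
  rw [hp, Nat.beq_refl, cond_true] at h2
  rw [LinearMap.comp_apply, R.br, R.adl, LinearMap.zero_apply]
  exact F.val_eq_zero (p := M.p) _ (by rw [hp]; exact h2)

theorem Rep.nil_three (R : Rep M t F P β) (h : M.nilOK g = true) (hp : M.p ≠ 2) (x : V) :
    β (F.e g) (β (F.e g) (β (F.e g) x)) = 0 := by
  simp only [Model.nilOK, Bool.and_eq_true] at h
  refine F.linearMap_ext (L := β (F.e g) ∘ₗ β (F.e g) ∘ₗ β (F.e g)) (L' := 0)
    (fun j hj => ?_) x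
  have h2 := of_upto h.2 j hj
  rw [show Nat.beq M.p 2 = false by rwa [← Bool.not_eq_true, Nat.beq_eq], cond_false] at h2
  rw [LinearMap.comp_apply, LinearMap.comp_apply, R.br, R.adl, R.adl, LinearMap.zero_apply]
  exact F.val_eq_zero _ h2

omit [CharP K M.p] in
theorem Rep.mem_even (R : Rep M t F P β) (h : M.nilOK g = true) : F.e g ∈ P 0 := by
  simp only [Model.nilOK, Bool.and_eq_true, Nat.blt_eq] at h
  have h0 : M.parity g = 0 :=
    (ZMod.natCast_eq_zero_iff _ 2).2 (Nat.dvd_of_mod_eq_zero (Nat.eq_of_beq_eq_true h.1.2))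
  exact h0 ▸ R.e_mem h.1.1

theorem Rep.isCocycle_sqP (hM : M.Valid) (R : Rep M t F P β) (h : M.nilOK g = true) :
    IsCocycle P β 0 (sqP M.p β (β (F.e g))) := by
  have H := R.isLieSuper' hM
  have hD := IsLieSuper.isEvenDer H (R.mem_even h)
  unfold sqP
  split_ifs
  · exact hD.isCocycle_sq2 H
  · exact hD.isCocycle_sq3 H

theorem Rep.isLieSuper_sqP (hM : M.Valid) (R : Rep M t F P β) (h : M.nilOK g = true) (l : K) :
    IsLieSuper P (β + l • sqP M.p β (β (F.e g))) := by
  have H := R.isLieSuper' hM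
  have hD := IsLieSuper.isEvenDer H (R.mem_even h)
  unfold sqP
  split_ifs with hp
  · exact hD.isLieSuper_sq2 H (R.nil_two h hp) l
  · exact hD.isLieSuper_sq3 H (R.nil_three h hp) l

theorem Rep.isNIS_sqP (hM : M.Valid) (R : Rep M t F P β) (h : M.nilOK g = true)
    {B : LinearMap.BilinForm K V} (hB : IsNIS P β B) (l : K) :
    IsNIS P (β + l • sqP M.p β (β (F.e g))) B := by
  have H := R.isLieSuper' hM
  have hD := IsLieSuper.isEvenDer H (R.mem_even h)
  have hBD := IsInvariantForm.neg_ad H hB.toIsInvariantForm (R.mem_even h)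
  refine IsNIS.add hB (fun x y z => ?_) l
  unfold sqP
  split_ifs with hp
  · have h2 := R.nil_two h hp
    have : CharP K 2 := CharP.congr M.p hp
    exact invariant_sq2 hB.toIsInvariantForm hD hBD h2 x y z
  · exact invariant_sq3 hB.toIsInvariantForm hD hBD (R.nil_three h hp) x y z

end Sq

/-! ### The derivative of a table with respect to the parameter -/

/-- The derivative of a polynomial. -/
def derivCoef : Coef → Coef
  | [] => []
  | _ :: l => cAdd l (0 :: derivCoef l)

namespace Model

variable (M : Model)

/-- The table obtained by applying a map to all structure constants. -/
def mapCoef (f : Coef → Coef) : Model :=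
  { M with tab := M.tab.map fun l => l.map fun u => u.map fun y => (y.1, f y.2) }

/-- The table with the derivatives of all structure constants. -/
def deriv : Model := M.mapCoef derivCoef

/-- The table with other polynomials admitted as denominators. -/
def withUnits (U : List Coef) : Model := { M with units := U }

/-- The derivative of the bracket satisfies the cocycle identity for `e_i`, `e_j`, `e_k`. -/
def closedOK (i j k : ℕ) : Bool :=
  sZero M.p (M.adl i (M.deriv.br j k) ++ (M.deriv.adl i (M.br j k) ++
    sSgn M.p 1 (M.adr (M.deriv.br i j) k ++ (M.deriv.adr (M.br i j) k ++
      (M.adl j (M.deriv.br i k) ++ M.deriv.adl j (M.br i k))))))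

/-- All basis vectors are even, and the derivative of the bracket is an alternating map that
satisfies the cocycle identity whenever the first element is a Chevalley generator. -/
def chkClosed : Bool := (upto M.dim fun i => Nat.beq (M.pr i % 2) 0) && M.deriv.chkPar &&
  M.deriv.chkSkew && upto M.n fun i => upto M.dim fun j => upto M.dim fun k =>
    M.closedOK (M.n + i) j k && M.closedOK (M.n + M.r + i) j k

/-- The structure constants have degree at most `N - 1` in the parameter. -/
def chkDeg (N : ℕ) : Bool := upto M.dim fun i => upto M.dim fun j => (M.br i j).all fun y =>
  Nat.ble y.2.length N

theorem br_mapCoef (f : Coef → Coef) (i j : ℕ) :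
    (M.mapCoef f).br i j = (M.br i j).map fun y => (y.1, f y.2) := by
  unfold br row
  rw [mapCoef]
  simp only
  rw [show ([] : List SVec) = ([] : List SVec).map fun u : SVec => u.map fun y => (y.1, f y.2)
      from rfl, List.getD_map,
    show ([] : SVec) = ([] : SVec).map fun y => (y.1, f y.2) from rfl, List.getD_map]
  rfl

/-! ### Linear equations for the values of an invariant form -/

/-- The number of the pair `(e_i, e_j)`, up to the order of `i` and `j`. -/
def formCode (i j : ℕ) : ℕ := bif Nat.ble i j then i * M.dim + j else j * M.dim + i

/-- The equation `B ([e_a, e_b], e_k) = B (e_a, [e_b, e_k])` for a symmetric form. -/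
def formTerms (a b k : ℕ) : SVec :=
  ((M.br a b).map fun y => (M.formCode y.1 k, y.2)) ++
    sSgn M.p 1 ((M.br b k).map fun y => (M.formCode a y.1, y.2))

/-- The pairs at which an invariant form vanishes, given the set `S` of those known and a list of
numbers of equations, used one after the other. -/
def formRun : List ℕ → ℕ → ℕ
  | [], S => S
  | c :: l, S => force (bif Nat.blt c (M.dim * M.dim * M.dim) then
      M.solve (M.formTerms (c / M.dim / M.dim) (c / M.dim % M.dim) (c % M.dim)) S else S)
        (formRun l)

/-- All pairs outside of the set `T` are obtained from those in the set `S`. -/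
def formOK (l : List ℕ) (S T : ℕ) : Bool := force (M.formRun l S) fun S' =>
  upto M.dim fun i => upto M.dim fun j => S'.testBit (M.formCode i j) || T.testBit (M.formCode i j)

end Model

end StructConst

namespace StructConst

/-! ### The table of `br(3)` -/

/-- The structure constants of `br(3)`. -/
def br3Model : Model where
  p := 3
  n := 3
  r := 13
  tab := [
    [
    [], [], [], [(3, [2])], [(4, [2])], [], [(6, [1])], [(7, [2])], [(8, [1])], [(9, [2])],
    [(10, [1])], [], [], [], [(14, [2])], [(15, [1])], [(16, [1])], [(17, [1])], [], [(19, [2])],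
    [(20, [1])], [(21, [2])], [(22, [1])], [(23, [2])], [], [], [], [(27, [1])], [(28, [2])]],
    [
    [], [], [], [(3, [2])], [(4, [2])], [(5, [2])], [(6, [1])], [(7, [1])], [], [], [(10, [2])],
    [(11, [1])], [], [(13, [2])], [(14, [1])], [], [(16, [1])], [(17, [1])], [(18, [1])],
    [(19, [2])], [(20, [2])], [], [], [(23, [1])], [(24, [2])], [], [(26, [1])], [(27, [2])]],
    [
    [], [], [], [], [(4, [2])], [], [(6, [2])], [(7, [2])], [(8, [2])], [(9, [2])], [(10, [2])],
    [(11, [1])], [(12, [1])], [(13, [1])], [], [], [], [(17, [1])], [], [(19, [1])], [(20, [1])],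
    [(21, [1])], [(22, [1])], [(23, [1])], [(24, [2])], [(25, [2])], [(26, [2])]],
    [
    [(3, [1])], [(3, [1])], [], [], [(6, [2])], [], [], [(8, [2])], [], [(10, [2])], [], [], [],
    [], [(15, [1])], [], [(0, [1])], [], [], [(17, [2])], [], [(20, [2])], [], [(22, [2])], [],
    [], [], [], [(27, [1])]],
    [
    [(4, [1])], [(4, [1])], [(4, [1])], [(6, [1])], [], [(7, [2])], [], [], [], [], [(11, [1])],
    [], [], [(14, [1])], [], [], [], [(1, [1])], [], [(16, [1])], [(18, [2])], [], [], [],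
    [(23, [1])], [], [], [(26, [1])]],
    [
    [], [(5, [1])], [], [], [(7, [1])], [], [(8, [1])], [(9, [1])], [(10, [1])], [], [],
    [(12, [1])], [(13, [1])], [], [], [], [], [], [(2, [1])], [], [(17, [1])], [(19, [1])],
    [(20, [2])], [(21, [2])], [], [(24, [2])], [(25, [1])]],
    [
    [(6, [2])], [(6, [2])], [(6, [1])], [], [], [(8, [2])], [], [], [], [(11, [2])], [], [], [],
    [(15, [2])], [], [], [(4, [1])], [(3, [2])], [], [(0, [2]), (1, [2])], [], [(18, [1])], [],
    [], [(22, [1])], [], [], [], [(26, [1])]],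
    [
    [(7, [1])], [(7, [2])], [(7, [1])], [(8, [1])], [], [(9, [2])], [], [], [(11, [2])], [],
    [(12, [1])], [], [(14, [2])], [], [], [], [], [(5, [1])], [(4, [2])], [],
    [(1, [2]), (2, [2])], [(16, [2])], [(18, [2])], [], [(21, [2])], [(23, [1])], [],
    [(25, [1])]],
    [
    [(8, [2])], [], [(8, [1])], [], [], [(10, [2])], [], [(11, [1])], [], [(12, [2])], [], [],
    [(15, [1])], [], [], [], [(7, [1])], [], [(6, [2])], [(5, [2])], [(3, [1])],
    [(0, [1]), (1, [1]), (2, [1])], [], [(18, [1])], [(20, [2])], [(22, [1])], [], [],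
    [(25, [1])]],
    [
    [(9, [1])], [], [(9, [1])], [(10, [1])], [], [], [(11, [1])], [], [(12, [1])], [],
    [(13, [1])], [(14, [1])], [], [], [], [], [], [], [(7, [1])], [], [(5, [1])], [],
    [(1, [2]), (2, [1])], [(16, [2])], [(19, [2])], [(21, [1])], [(23, [2])], [(24, [2])]],
    [
    [(10, [2])], [(10, [1])], [(10, [1])], [], [(11, [2])], [], [], [(12, [2])], [], [(13, [2])],
    [], [(15, [2])], [], [], [], [], [(9, [1])], [], [(8, [1])], [], [], [(5, [2])], [(3, [1])],
    [(0, [1]), (1, [1]), (2, [2])], [(17, [2])], [(20, [1])], [(22, [2])], [], [(24, [2])]],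
    [
    [], [(11, [2])], [(11, [2])], [], [], [(12, [2])], [], [], [], [(14, [2])], [(15, [1])], [],
    [], [], [], [], [], [(10, [2])], [], [(9, [2])], [(8, [1])], [(7, [1])], [(6, [1])],
    [(4, [1])], [(0, [2]), (1, [1]), (2, [1])], [(18, [2])], [], [(22, [1])], [(23, [2])]],
    [
    [], [], [(12, [2])], [], [], [(13, [2])], [], [(14, [1])], [(15, [2])], [], [], [], [], [],
    [], [], [], [], [(11, [1])], [], [(10, [2])], [(9, [2])], [(8, [2])], [(7, [2])], [(5, [1])],
    [(0, [2]), (1, [1])], [(18, [1])], [(20, [2])], [(21, [1])]],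
    [
    [], [(13, [1])], [(13, [2])], [], [(14, [2])], [], [(15, [1])], [], [], [], [], [], [], [],
    [], [], [], [], [(12, [2])], [], [], [], [(10, [1])], [(9, [1])], [], [(5, [2])],
    [(0, [1]), (1, [2]), (2, [1])], [(17, [2])], [(19, [1])]],
    [
    [(14, [1])], [(14, [2])], [], [(15, [2])], [], [], [], [], [], [], [], [], [], [], [], [],
    [], [(13, [2])], [], [], [(12, [2])], [], [(11, [1])], [], [(9, [2])], [(7, [1])],
    [(4, [1])], [(0, [2]), (2, [2])], [(16, [1])]],
    [
    [(15, [2])], [], [], [], [], [], [], [], [], [], [], [], [], [], [], [], [(14, [2])], [], [],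
    [(13, [2])], [], [(12, [2])], [], [(11, [1])], [(10, [1])], [(8, [2])], [(6, [2])],
    [(3, [2])], [(0, [2]), (2, [1])]],
    [
    [(16, [2])], [(16, [2])], [], [(0, [2])], [], [], [(4, [2])], [], [(7, [2])], [], [(9, [2])],
    [], [], [], [], [(14, [1])], [], [(19, [2])], [], [], [(21, [2])], [], [(23, [2])], [], [],
    [], [], [(28, [1])]],
    [
    [(17, [2])], [(17, [2])], [(17, [2])], [], [(1, [2])], [], [(3, [1])], [(5, [2])], [], [],
    [], [(10, [1])], [], [], [(13, [1])], [], [(19, [1])], [], [(20, [2])], [], [], [], [],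
    [(24, [1])], [], [], [(27, [1])]],
    [
    [], [(18, [2])], [], [], [], [(2, [2])], [], [(4, [1])], [(6, [1])], [(7, [2])], [(8, [2])],
    [], [(11, [2])], [(12, [1])], [], [], [], [(20, [1])], [], [(21, [1])], [(22, [1])],
    [(23, [1])], [], [], [(25, [1])], [(26, [1])]],
    [
    [(19, [1])], [(19, [1])], [(19, [2])], [(17, [1])], [(16, [2])], [], [(0, [1]), (1, [1])],
    [], [(5, [1])], [], [], [(9, [1])], [], [], [], [(13, [1])], [], [], [(21, [2])], [], [], [],
    [(24, [2])], [], [], [], [(28, [2])]],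
    [
    [(20, [2])], [(20, [1])], [(20, [2])], [], [(18, [1])], [(17, [2])], [],
    [(1, [1]), (2, [1])], [(3, [2])], [(5, [2])], [], [(8, [2])], [(10, [1])], [], [(12, [1])],
    [], [(21, [1])], [], [(22, [2])], [], [], [(24, [2])], [], [(25, [1])], [], [(27, [2])]],
    [
    [(21, [1])], [], [(21, [2])], [(20, [1])], [], [(19, [2])], [(18, [2])], [(16, [1])],
    [(0, [2]), (1, [2]), (2, [2])], [], [(5, [1])], [(7, [2])], [(9, [1])], [], [], [(12, [1])],
    [], [], [(23, [2])], [], [(24, [1])], [], [(25, [2])], [], [], [(28, [1])]],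
    [
    [(22, [2])], [], [(22, [2])], [], [], [(20, [1])], [], [(18, [1])], [], [(1, [1]), (2, [2])],
    [(3, [2])], [(6, [2])], [(8, [1])], [(10, [2])], [(11, [2])], [], [(23, [1])], [], [],
    [(24, [1])], [], [(25, [1])], [], [(26, [1])], [(27, [1])]],
    [
    [(23, [1])], [(23, [2])], [(23, [2])], [(22, [1])], [], [(21, [1])], [], [], [(18, [2])],
    [(16, [1])], [(0, [2]), (1, [2]), (2, [1])], [(4, [2])], [(7, [1])], [(9, [2])], [],
    [(11, [2])], [], [(24, [2])], [], [], [(25, [2])], [], [(26, [2])], [], [(28, [2])]],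
    [
    [], [(24, [1])], [(24, [1])], [], [(23, [2])], [], [(22, [2])], [(21, [1])], [(20, [1])],
    [(19, [1])], [(17, [1])], [(0, [1]), (1, [2]), (2, [2])], [(5, [2])], [], [(9, [1])],
    [(10, [2])], [], [], [(25, [2])], [], [], [], [(27, [2])], [(28, [1])]],
    [
    [], [], [(25, [1])], [], [], [(24, [1])], [], [(23, [2])], [(22, [2])], [(21, [2])],
    [(20, [2])], [(18, [1])], [(0, [1]), (1, [2])], [(5, [1])], [(7, [2])], [(8, [1])], [], [],
    [(26, [2])], [], [(27, [1])], [(28, [2])]],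
    [
    [], [(26, [2])], [(26, [1])], [], [], [(25, [2])], [], [], [], [(23, [1])], [(22, [1])], [],
    [(18, [2])], [(0, [2]), (1, [1]), (2, [2])], [(4, [2])], [(6, [1])], [], [(27, [2])], [],
    [(28, [1])]],
    [
    [(27, [2])], [(27, [1])], [], [], [(26, [2])], [], [], [(25, [2])], [], [(24, [1])], [],
    [(22, [2])], [(20, [1])], [(17, [1])], [(0, [1]), (2, [1])], [(3, [1])], [(28, [2])]],
    [
    [(28, [1])], [], [], [(27, [2])], [], [], [(26, [2])], [], [(25, [2])], [], [(24, [1])],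
    [(23, [1])], [(21, [2])], [(19, [2])], [(16, [2])], [(0, [1]), (2, [2])]]]
  par := [0, 0, 0, 0, 0, 0, 0, 0, 0, 0, 0, 0, 0, 0, 0, 0, 0, 0, 0, 0, 0, 0, 0, 0, 0, 0, 0, 0, 0]
  wt := [
    [6, 6, 6], [6, 6, 6], [6, 6, 6], [7, 6, 6], [6, 7, 6], [6, 6, 7], [7, 7, 6], [6, 7, 7],
    [7, 7, 7], [6, 7, 8], [7, 7, 8], [7, 8, 8], [7, 8, 9], [7, 8, 10], [7, 9, 10], [8, 9, 10],
    [5, 6, 6], [6, 5, 6], [6, 6, 5], [5, 5, 6], [6, 5, 5], [5, 5, 5], [6, 5, 4], [5, 5, 4],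
    [5, 4, 4], [5, 4, 3], [5, 4, 2], [5, 3, 2], [4, 3, 2]]
  words := [
    (6, 3, 4), (7, 4, 5), (8, 3, 7), (9, 5, 7), (10, 3, 9), (11, 4, 10), (12, 5, 11),
    (13, 5, 12), (14, 4, 13), (15, 3, 14), (19, 16, 17), (20, 17, 18), (21, 16, 20),
    (22, 18, 20), (23, 16, 22), (24, 17, 23), (25, 18, 24), (26, 18, 25), (27, 17, 26),
    (28, 16, 27), (0, 3, 16), (1, 4, 17), (2, 5, 18)]
  units := [[1], [2]]
  cartan := [[[2], [2], []], [[2], [2], [2]], [[], [2], []]]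
  hGen := [[(0, [1])], [(1, [1])], [(2, [1])]]
  yCoef := [[1], [1], [1]]
  posTrans := [
    (3, 16, 0), (4, 17, 1), (6, 17, 3), (5, 18, 2), (7, 18, 4), (8, 18, 6), (9, 18, 7),
    (10, 18, 8), (11, 17, 10), (12, 18, 11), (13, 18, 12), (14, 17, 13), (15, 16, 14)]
  negTrans := [
    (16, 3, 0), (17, 4, 1), (19, 4, 16), (18, 5, 2), (20, 5, 17), (21, 5, 19), (22, 5, 20),
    (23, 5, 21), (24, 4, 23), (25, 5, 24), (26, 5, 25), (27, 4, 26), (28, 3, 27)]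

/-- The Gram matrix of an invariant form on `br(3)`. -/
def br3Gram : List SVec := [
  [(0, [2]), (1, [2])], [(0, [2]), (1, [2]), (2, [2])], [(1, [2])], [(16, [1])], [(17, [1])],
  [(18, [1])], [(19, [2])], [(20, [2])], [(21, [1])], [(22, [2])], [(23, [1])], [(24, [2])],
  [(25, [2])], [(26, [1])], [(27, [2])], [(28, [1])], [(3, [1])], [(4, [1])], [(5, [1])],
  [(6, [2])], [(7, [2])], [(8, [1])], [(9, [2])], [(10, [1])], [(11, [2])], [(12, [2])],
  [(13, [1])], [(14, [2])], [(15, [1])]]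

/-- Vectors whose products with others are, up to a factor, the coordinates of the latter. -/
def br3Dual : List SVec := [
  [(0, [2]), (2, [1])], [(2, [2])], [(0, [2]), (1, [1])], [(16, [1])], [(17, [1])], [(18, [1])],
  [(19, [1])], [(20, [1])], [(21, [1])], [(22, [1])], [(23, [1])], [(24, [1])], [(25, [1])],
  [(26, [1])], [(27, [1])], [(28, [1])], [(3, [1])], [(4, [1])], [(5, [1])], [(6, [1])],
  [(7, [1])], [(8, [1])], [(9, [1])], [(10, [1])], [(11, [1])], [(12, [1])], [(13, [1])],
  [(14, [1])], [(15, [1])]]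

/-- The numbers of the root vectors that give rise to cohomology classes. -/
def br3Roots : List ℕ := [5, 18, 7, 20, 8, 21, 12, 25]

/-- Pairs of a coboundary or cocycle and a coordinate, which eliminate the cocycles. -/
def br3Pivots : List (ℕ × ℕ) := [
  (848, 4639), (846, 2722), (844, 3589), (842, 4470), (0, 450), (1, 90), (2, 120), (29, 1291),
  (30, 931), (31, 961), (58, 2132), (59, 1772), (60, 1802), (90, 2987), (120, 2645), (150, 3516),
  (510, 3858), (540, 4729), (570, 3091), (600, 3962), (240, 7284), (270, 8154), (630, 3152),
  (660, 4863), (300, 2794), (690, 3212), (330, 3665), (720, 4083), (360, 4536), (750, 4954),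
  (390, 4566), (780, 4984), (420, 3755), (810, 4173), (450, 2944), (840, 3362), (841, 3550),
  (843, 2682), (845, 4684), (847, 15936)]

/-- Cocycle equations that determine the remaining coordinates. -/
def br3Equations : List ℕ := [
  77805, 102166, 102222, 127395, 127423, 128208, 128292, 129048, 129104, 131625, 131653, 132464,
  132492, 134156, 154277, 154305, 156825, 102891, 102919, 103031, 103059, 106391, 106418, 77630,
  77743, 81129, 81175, 81257, 85457, 77570, 78439, 78523, 78550, 78562, 78595, 78626, 78761,
  78820, 79363, 79389, 79498, 79720, 85479, 85540, 85600, 127326, 128212, 128244, 128322, 128410,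
  132523, 134290, 101984, 102039, 103768, 103830, 103860, 104018, 104136, 104166, 104548, 104770,
  106450, 108113, 108958, 109014, 109115, 109176, 111560, 77639, 129815, 130008, 130081, 130112,
  130233, 130908, 131695, 131751, 132538, 132595, 132623, 132650, 132751, 136817, 136876, 138529,
  991, 1171, 1261, 1832, 2012, 2102, 2645, 2944, 2987, 3755, 3858, 3931, 11687, 11733, 11764,
  26221, 26401, 26491, 27034, 27333, 27376, 28144, 28247, 28320, 36076, 36122, 36153, 51423,
  51722, 51765, 52533, 52636, 52709, 60465, 60511, 60542, 76803, 76923, 77158, 77249, 77369,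
  78059, 81350, 86261, 87463, 102063, 102123, 102417, 102478, 102509, 102569, 105712, 106582,
  110679, 112663, 135097, 135939, 137863, 157745, 160388, 160509, 161470, 164746, 183933, 185799,
  186670, 189195, 189976, 191660, 232769, 234325, 257931, 283190, 407797, 409450, 433809, 79610,
  79663, 79739, 79770, 79801, 79891, 81266, 82979, 83035, 85419, 87163, 87403, 88876, 89837,
  89927, 102259, 103101, 103943, 104785, 105627, 106469, 106526, 107311, 108153, 108995, 110736,
  111521, 112393, 112453, 112483, 112513, 112543, 112573, 112603, 127676, 133413, 136781, 137653,
  157888, 159515, 160284, 160285, 162913, 162943, 162973, 163003, 163033, 163063, 182306, 184046,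
  184775, 185544, 204926, 205768, 206582, 206724, 207509, 209066, 209150, 209148, 228445, 229258,
  229344, 230129, 230186, 232825, 234484, 235264, 236949, 239655, 240467, 253619, 254604, 258061,
  258123, 258153, 259639, 259638, 259637, 259713, 259865, 260524, 262239, 262300, 262330, 263081,
  263953, 279865, 279893, 281605, 282447, 283245, 283321, 283352, 283412, 284003, 284897, 284898,
  285004, 285784, 285815, 288341, 289213, 308394, 308422, 308503, 308502, 308549, 308611, 308641,
  309290, 309391, 332896, 332922, 332921, 332920, 332998, 333028, 356391, 356419, 356473, 356499,
  356497, 356543, 356574, 357313, 379940, 380023, 380049, 380076, 380075, 380119, 380889, 4729,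
  6385, 7199, 8098, 8883, 9754, 10625, 53507, 55163, 55977, 56876, 57661, 58532, 59403, 128135,
  128947, 177726, 102819, 102849, 103192, 103220, 103248, 103276, 103327, 103405, 103435, 104213,
  105039, 106501, 106725, 113333, 113377, 113471, 127762, 77878, 77964, 78077, 78104, 78155,
  78157, 79561, 79841, 81330, 81526, 88054, 88110, 88189, 88267, 90631, 90683, 90792, 78894,
  78922, 78978, 79006, 92423, 92469, 102327, 128456, 134546, 135965, 136022, 136107, 136134,
  136215, 138681, 138753, 140334, 140438, 182483, 187323, 187380, 189115, 230420, 104183, 104267,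
  111693, 111777, 117659, 117712, 136982, 137066, 138663, 138719, 142920, 142948, 89132, 115174,
  115202, 141216, 141272, 164793, 164821, 167258, 167342, 215253, 215281, 216961, 241294, 241322,
  242162, 266580, 291810]

/-- Functionals that separate the cohomology classes. -/
def br3Functionals : List SVec := [
  [(3550, [1])], [(4470, [1])], [(2682, [1])], [(3589, [1])], [(4684, [1])], [(2722, [1])],
  [(15936, [1])], [(4639, [1])]]

theorem br3_valid : br3Model.Valid where
  p_pos := by decide
  len := by decide +kernel
  par := by decide +kernel
  wt := by decide +kernel
  skew := by decide +kernel
  jac := by decide +kernel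
  words := by decide +kernel
  rel := by decide +kernel
  tri := by decide +kernel
  trans := by decide +kernel

theorem br3_chkGram : br3Model.chkGram br3Gram = true := by decide +kernel

theorem br3_chkSym : br3Model.chkSym br3Gram = true := by decide +kernel

theorem br3_chkInv : br3Model.chkInv br3Gram = true := by decide +kernel

theorem br3_chkStd : br3Model.chkStd br3Gram [1] = true := by decide +kernel

theorem br3_chkNondeg : br3Model.chkNondeg br3Gram br3Dual = true := by decide +kernel

theorem br3_chkUnique : br3Model.chkUnique = true := by decide +kernel

theorem br3_chkDiag : br3Model.chkDiag = true := by decide +kernel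

theorem br3_nilOK : (br3Roots.all br3Model.nilOK) = true := by decide +kernel

theorem br3_chkH2 : br3Model.chkH2 0 br3Roots.length
    (fun l => br3Model.sqTab (br3Roots.getD l 0)) br3Pivots br3Equations = true := by
  decide +kernel

theorem br3_chkDual : br3Model.chkDual br3Roots.length
    (fun l => br3Model.sqTab (br3Roots.getD l 0)) br3Functionals = true := by
  decide +kernel

end StructConst

namespace StructConst

/-! ### The table of `brj(2;3)` -/

/-- The structure constants of `brj(2;3)`. -/
def brjModel : Model where
  p := 3
  n := 2
  r := 8
  tab := [
    [
    [], [], [], [(3, [2])], [(4, [2])], [(5, [1])], [(6, [1])], [], [(8, [2])], [(9, [2])], [],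
    [(11, [1])], [(12, [1])], [(13, [2])], [(14, [2])], [], [(16, [1])], [(17, [1])]],
    [
    [], [], [(2, [2])], [], [(4, [2])], [(5, [2])], [(6, [1])], [(7, [1])], [(8, [1])], [],
    [(10, [1])], [], [(12, [1])], [(13, [1])], [(14, [2])], [(15, [2])], [(16, [2])]],
    [
    [], [(2, [1])], [], [(4, [2])], [], [(6, [1])], [], [], [(9, [1])], [], [(0, [1])], [],
    [(11, [2])], [], [(13, [2])], [], [], [(16, [1])]],
    [
    [(3, [1])], [], [(4, [1])], [], [(5, [1])], [], [(7, [1])], [(8, [1])], [], [], [],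
    [(1, [1])], [(10, [1])], [(12, [2])], [], [(14, [2])], [(15, [1])]],
    [
    [(4, [1])], [(4, [1])], [], [(5, [2])], [(6, [2])], [(7, [1])], [], [(9, [2])], [], [],
    [(3, [1])], [(2, [2])], [(0, [2]), (1, [2])], [(11, [2])], [(12, [1])], [(13, [2])], [],
    [(15, [1])]],
    [
    [(5, [2])], [(5, [1])], [(6, [1])], [], [(7, [1])], [(8, [1])], [(9, [1])], [], [], [], [],
    [(4, [1])], [(3, [1])], [(0, [2]), (1, [1])], [(10, [1])], [(12, [2])], [(13, [1])],
    [(14, [2])]],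
    [
    [(6, [2])], [(6, [2])], [], [(7, [2])], [], [(9, [2])], [], [], [], [], [(5, [2])], [],
    [(4, [1])], [(2, [1])], [(0, [2]), (1, [2])], [(11, [1])], [], [(13, [2])]],
    [
    [], [(7, [2])], [], [(8, [2])], [(9, [1])], [], [], [], [], [], [], [(6, [1])], [(5, [2])],
    [(4, [2])], [(3, [2])], [(0, [2])], [(11, [2])], [(12, [1])]],
    [
    [(8, [1])], [(8, [2])], [(9, [2])], [], [], [], [], [], [], [], [], [(7, [2])], [],
    [(5, [1])], [], [(3, [1])], [(0, [1]), (1, [2])], [(10, [1])]],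
    [
    [(9, [1])], [], [], [], [], [], [], [], [], [], [(8, [2])], [], [(7, [2])], [(6, [1])],
    [(5, [1])], [(4, [2])], [(2, [2])], [(1, [1])]],
    [
    [], [(10, [2])], [(0, [1])], [], [(3, [1])], [], [(5, [1])], [], [], [(8, [2])], [],
    [(12, [2])], [], [(14, [1])], [], [], [(17, [1])]],
    [
    [(11, [2])], [], [], [(1, [2])], [(2, [1])], [(4, [2])], [], [(6, [2])], [(7, [1])], [],
    [(12, [1])], [], [(13, [1])], [], [(15, [1])], [(16, [1])]],
    [
    [(12, [2])], [(12, [2])], [(11, [2])], [(10, [2])], [(0, [2]), (1, [2])], [(3, [1])],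
    [(4, [2])], [(5, [1])], [], [(7, [2])], [], [(13, [2])], [(14, [2])], [(15, [1])], [],
    [(17, [2])]],
    [
    [(13, [1])], [(13, [2])], [], [(12, [1])], [(11, [2])], [(0, [2]), (1, [1])], [(2, [2])],
    [(4, [1])], [(5, [2])], [(6, [1])], [(14, [1])], [], [(15, [1])], [(16, [1])], [(17, [1])]],
    [
    [(14, [1])], [(14, [1])], [(13, [1])], [], [(12, [2])], [(10, [2])], [(0, [1]), (1, [1])],
    [(3, [1])], [], [(5, [2])], [], [(15, [2])], [], [(17, [2])]],
    [
    [], [(15, [1])], [], [(14, [1])], [(13, [1])], [(12, [1])], [(11, [2])], [(0, [1])],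
    [(3, [2])], [(4, [1])], [], [(16, [2])], [(17, [1])]],
    [
    [(16, [2])], [(16, [1])], [], [(15, [2])], [], [(13, [2])], [], [(11, [1])],
    [(0, [2]), (1, [1])], [(2, [1])], [(17, [2])]],
    [
    [(17, [2])], [], [(16, [1])], [], [(15, [1])], [(14, [2])], [(13, [1])], [(12, [2])],
    [(10, [2])], [(1, [1])]]]
  par := [0, 0, 1, 0, 1, 1, 0, 0, 0, 1, 1, 0, 1, 1, 0, 0, 0, 1]
  wt := [
    [6, 6], [6, 6], [7, 6], [6, 7], [7, 7], [7, 8], [8, 8], [8, 9], [8, 10], [9, 10], [5, 6],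
    [6, 5], [5, 5], [5, 4], [4, 4], [4, 3], [4, 2], [3, 2]]
  words := [
    (4, 2, 3), (5, 3, 4), (6, 2, 5), (7, 3, 6), (8, 3, 7), (9, 2, 8), (12, 10, 11), (13, 11, 12),
    (14, 10, 13), (15, 11, 14), (16, 11, 15), (17, 10, 16), (0, 2, 10), (1, 3, 11)]
  units := [[1], [2]]
  cartan := [[[], [2]], [[2], []]]
  hGen := [[(0, [1])], [(1, [1])]]
  yCoef := [[1], [1]]
  posTrans := [
    (2, 10, 0), (3, 11, 1), (4, 11, 2), (5, 11, 4), (6, 10, 5), (7, 11, 6), (8, 11, 7),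
    (9, 10, 8)]
  negTrans := [
    (10, 2, 0), (11, 3, 1), (12, 3, 10), (13, 3, 12), (14, 2, 13), (15, 3, 14), (16, 3, 15),
    (17, 2, 16)]

/-- The Gram matrix of an invariant form on `brj(2;3)`. -/
def brjGram : List SVec := [
  [(1, [2])], [(0, [2])], [(10, [1])], [(11, [1])], [(12, [2])], [(13, [2])], [(14, [1])],
  [(15, [1])], [(16, [2])], [(17, [1])], [(2, [2])], [(3, [1])], [(4, [1])], [(5, [1])],
  [(6, [1])], [(7, [1])], [(8, [2])], [(9, [2])]]

/-- Vectors whose products with others are, up to a factor, the coordinates of the latter. -/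
def brjDual : List SVec := [
  [(1, [2])], [(0, [2])], [(10, [1])], [(11, [1])], [(12, [1])], [(13, [1])], [(14, [1])],
  [(15, [1])], [(16, [1])], [(17, [1])], [(2, [1])], [(3, [1])], [(4, [1])], [(5, [1])],
  [(6, [1])], [(7, [1])], [(8, [1])], [(9, [1])]]

/-- The numbers of the root vectors that give rise to cohomology classes. -/
def brjRoots : List ℕ := [3, 11, 7, 15]

/-- Pairs of a coboundary or cocycle and a coordinate, which eliminate the cocycles. -/
def brjPivots : List (ℕ × ℕ) := [
  (327, 1151), (325, 1064), (0, 57), (1, 38), (18, 381), (19, 362), (38, 828), (57, 706),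
  (209, 1171), (228, 875), (95, 1839), (247, 1218), (114, 744), (266, 913), (133, 1087),
  (285, 1256), (152, 1106), (304, 1275), (171, 801), (323, 970), (324, 691), (326, 3879)]

/-- Cocycle equations that determine the remaining coordinates. -/
def brjEquations : List ℕ := [
  12797, 12814, 18935, 18969, 19615, 19938, 20575, 24766, 24783, 25106, 12419, 12470, 13456,
  19212, 19296, 19343, 19381, 19622, 19948, 19982, 20027, 20930, 20967, 362, 381, 706, 828, 1049,
  1171, 1198, 1218, 1374, 1393, 1431, 1560, 1579, 1617, 1718, 1921, 6538, 6660, 6881, 7003, 7030,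
  7050, 7206, 7225, 7263, 7392, 7411, 7449, 7550, 7753, 12494, 12733, 12771, 12819, 12836, 12853,
  12881, 12900, 12919, 12957, 13469, 14204, 14444, 15113, 15151, 15208, 19353, 20619, 20721,
  20944, 21288, 21326, 21345, 21689, 21995, 26127, 26144, 26161, 26469, 26503, 27444, 27463,
  27826, 32601, 32941, 33045, 33274, 33294, 33351, 38434, 38467, 38514, 38533, 38774, 38819,
  50441, 50458, 50781, 50824, 51103, 51102, 55967, 56001, 56017, 56016, 56274, 56631, 56646,
  56675, 56694, 18994, 24809, 30985, 31292, 12374, 12516, 12550, 12582, 12611, 12934, 13490,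
  13575, 15462, 15529, 21015, 21049, 22342, 62181, 62198, 68319, 68353, 68999, 69322, 69967,
  74150, 74167, 74490]

/-- Pairs of a coboundary or cocycle and a coordinate, which eliminate the odd cocycles. -/
def brjPivotsOdd : List (ℕ × ℕ) := [
  (106, 1060), (157, 1111), (51, 716), (215, 862), (120, 750), (136, 774), (165, 795),
  (63, 1160), (222, 1212), (256, 1229), (272, 1262), (317, 1279), (242, 891), (293, 942)]

/-- Cocycle equations that determine the remaining coordinates of odd cocycles. -/
def brjEquationsOdd : List ℕ := [
  14435, 1060, 1111, 6892, 6943, 18989, 19330, 19568, 20033, 20299, 24770, 24820, 25143, 25180,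
  25789, 25864, 26112, 26149, 26206, 26435, 30974, 31620, 31942, 31961, 32256, 43599, 49757,
  12379, 12413, 12440, 12460, 12507, 12544, 12720, 12745, 12765, 12803, 12887, 13154, 13377,
  13415, 13453, 13571, 13800, 14084, 14122, 14141, 14179, 14236, 14455, 14502, 14540, 14763,
  15119, 19610, 20656, 20714, 24717, 24736, 25822, 25899, 26121, 26222, 26446, 26463, 27125,
  30988, 31303, 31330, 31407, 37884, 6548, 12387, 20920, 12894, 12944, 15091, 19376, 19410,
  21052, 21944, 22333, 23327, 26756, 26858, 26875, 26874, 29158, 32675, 33338, 33967, 33966,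
  33995, 38508, 39188, 44358, 45294, 45650, 45666, 50174, 50532, 51501, 56041, 56688, 57656,
  58313, 61797, 62104, 62165, 1160, 1195, 1229, 1246, 1279, 6992, 7061, 19017, 19068, 19102, 891,
  942, 6723, 6774, 12573, 12624, 15453, 16116, 16166, 17167, 21302, 27152, 27781, 28477, 28476,
  28504, 33614, 34660, 39158, 39447, 40144, 44702, 45008, 45314, 45977, 57643, 63819]

/-- Functionals that separate the cohomology classes. -/
def brjFunctionals : List SVec := [[(691, [1])], [(1064, [1])], [(3879, [1])], [(1151, [1])]]

theorem brj_valid : brjModel.Valid where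
  p_pos := by decide
  len := by decide +kernel
  par := by decide +kernel
  wt := by decide +kernel
  skew := by decide +kernel
  jac := by decide +kernel
  words := by decide +kernel
  rel := by decide +kernel
  tri := by decide +kernel
  trans := by decide +kernel

theorem brj_chkGram : brjModel.chkGram brjGram = true := by decide +kernel

theorem brj_chkSym : brjModel.chkSym brjGram = true := by decide +kernel

theorem brj_chkInv : brjModel.chkInv brjGram = true := by decide +kernel

theorem brj_chkStd : brjModel.chkStd brjGram [1] = true := by decide +kernel

theorem brj_chkNondeg : brjModel.chkNondeg brjGram brjDual = true := by decide +kernel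

theorem brj_chkUnique : brjModel.chkUnique = true := by decide +kernel

theorem brj_chkDiag : brjModel.chkDiag = true := by decide +kernel

theorem brj_nilOK : (brjRoots.all brjModel.nilOK) = true := by decide +kernel

theorem brj_chkH2 : brjModel.chkH2 0 brjRoots.length
    (fun l => brjModel.sqTab (brjRoots.getD l 0)) brjPivots brjEquations = true := by
  decide +kernel

theorem brj_chkH2Odd :
    brjModel.chkH2 1 0 (fun _ _ _ => []) brjPivotsOdd brjEquationsOdd = true := by
  decide +kernel

theorem brj_chkDual : brjModel.chkDual brjRoots.length
    (fun l => brjModel.sqTab (brjRoots.getD l 0)) brjFunctionals = true := by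
  decide +kernel

end StructConst

namespace StructConst

/-! ### The table of `wk(4;α)` -/

/-- The structure constants of `wk(4;α)`, where the parameter is `α`, in the basis described at the
beginning of this file. -/
def wkModel : Model where
  p := 2
  n := 4
  r := 15
  tab := [
    [
    [], [], [], [], [], [(5, [0,1])], [(6, [1])], [], [(8, [0,1])], [(9, [1])], [(10, [1])],
    [(11, [1,1])], [(12, [1])], [(13, [1,1])], [(14, [1,1])], [(15, [1,1])], [(16, [0,1])],
    [(17, [0,1])], [], [], [(20, [0,1])], [(21, [1])], [], [(23, [0,1])], [(24, [1])],
    [(25, [1])], [(26, [1,1])], [(27, [1])], [(28, [1,1])], [(29, [1,1])], [(30, [1,1])],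
    [(31, [0,1])], [(32, [0,1])]],
    [
    [], [], [], [], [(4, [1])], [], [], [], [(8, [1])], [(9, [1])], [], [(11, [1])], [(12, [1])],
    [], [(14, [1])], [], [], [(17, [1])], [(18, [1])], [(19, [1])], [], [], [], [(23, [1])],
    [(24, [1])], [], [(26, [1])], [(27, [1])], [], [(29, [1])], [], [], [(32, [1])], [(33, [1])]],
    [
    [], [], [], [], [(4, [1])], [], [], [(7, [1])], [(8, [1])], [(9, [1])], [(10, [1])],
    [(11, [1])], [], [], [], [(15, [1])], [(16, [1])], [], [], [(19, [1])], [], [], [(22, [1])],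
    [(23, [1])], [(24, [1])], [(25, [1])], [(26, [1])], [], [], [], [(30, [1])], [(31, [1])]],
    [
    [], [], [], [], [(4, [0,1])], [], [(6, [1])], [], [(8, [0,1])], [(9, [1,1])], [(10, [1])],
    [(11, [1,1])], [(12, [1,1])], [(13, [1])], [(14, [1,1])], [(15, [1])], [], [(17, [0,1])],
    [(18, [0,1])], [(19, [0,1])], [], [(21, [1])], [], [(23, [0,1])], [(24, [1,1])], [(25, [1])],
    [(26, [1,1])], [(27, [1,1])], [(28, [1])], [(29, [1,1])], [(30, [1])], [], [(32, [0,1])],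
    [(33, [0,1])]],
    [
    [], [(4, [1])], [(4, [1])], [(4, [0,1])], [], [(8, [1])], [(9, [1])], [], [], [],
    [(12, [1])], [(13, [1])], [], [], [(15, [1])], [], [(17, [1])], [], [], [(0, [1])], [], [],
    [], [(20, [0,1])], [(21, [1])], [], [], [(25, [1])], [(26, [1,1])], [], [(29, [1,1])], [],
    [(31, [0,1])]],
    [
    [(5, [0,1])], [], [], [], [(8, [1])], [], [], [], [], [(11, [1])], [], [], [(14, [1])], [],
    [], [], [], [(18, [1])], [], [], [(1, [1])], [], [], [(19, [1])], [], [], [(24, [1])], [],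
    [], [(27, [1])], [], [], [], [(32, [1])]],
    [
    [(6, [1])], [], [], [(6, [1])], [(9, [1])], [], [], [(10, [1])], [(11, [1])], [], [], [], [],
    [], [], [(16, [1])], [], [], [], [], [], [(2, [1])], [], [], [(19, [1])], [(22, [1])],
    [(23, [1])], [], [], [], [], [(30, [1])]],
    [
    [], [], [(7, [1])], [], [], [], [(10, [1])], [], [], [(12, [1])], [], [(14, [1])], [],
    [(15, [1])], [], [], [], [], [], [], [], [], [(1, [0,1]), (3, [1])], [], [], [(21, [1])], [],
    [(24, [1])], [], [(26, [1])], [(28, [1])]],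
    [
    [(8, [0,1])], [(8, [1])], [(8, [1])], [(8, [0,1])], [], [], [(11, [1])], [], [], [(13, [1])],
    [(14, [1])], [], [(15, [1])], [], [], [], [(18, [1])], [], [], [(5, [0,1])], [(4, [1])], [],
    [], [(0, [1]), (1, [0,1])], [], [], [(21, [1])], [], [(24, [1,1])], [(25, [1])],
    [(27, [1,1])], [], [], [(31, [0,1])]],
    [
    [(9, [1])], [(9, [1])], [(9, [1])], [(9, [1,1])], [], [(11, [1])], [], [(12, [1])],
    [(13, [1])], [], [], [], [], [], [(16, [1])], [(17, [1])], [], [], [], [(6, [1])], [],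
    [(4, [1])], [], [], [(0, [1]), (2, [1])], [], [(20, [0,1])], [(22, [1])], [(23, [1,1])], [],
    [], [(29, [1,1])], [(30, [0,1])]],
    [
    [(10, [1])], [], [(10, [1])], [(10, [1])], [(12, [1])], [], [], [], [(14, [1])], [], [], [],
    [], [(16, [1])], [], [], [], [], [], [], [], [(7, [1])], [(6, [1])], [], [],
    [(1, [0,1]), (2, [1]), (3, [1])], [], [(19, [1])], [], [(23, [1])], [], [(28, [1])]],
    [
    [(11, [1,1])], [(11, [1])], [(11, [1])], [(11, [1,1])], [(13, [1])], [], [], [(14, [1])], [],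
    [], [], [], [(16, [1])], [], [], [(18, [1])], [], [], [], [], [(9, [1])], [(8, [1])], [],
    [(6, [1])], [(5, [0,1])], [], [(0, [1]), (1, [0,1]), (2, [1])], [], [(19, [1,1])],
    [(22, [1])], [], [(27, [1,1])], [], [(30, [0,1])]],
    [
    [(12, [1])], [(12, [1])], [], [(12, [1,1])], [], [(14, [1])], [], [], [(15, [1])], [], [],
    [(16, [1])], [], [(17, [1])], [], [], [], [], [], [(10, [1])], [], [], [(9, [1])], [],
    [(7, [1])], [(4, [1])], [], [(0, [1]), (1, [0,1]), (2, [1]), (3, [1])], [], [(20, [0,1])],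
    [(23, [1,1])], [(26, [1,1])], [(28, [0,1])]],
    [
    [(13, [1,1])], [], [], [(13, [1])], [], [], [], [(15, [1])], [], [], [(16, [1])], [],
    [(17, [1])], [], [(18, [1])], [], [], [], [], [(11, [1,1])], [], [], [], [(9, [1,1])],
    [(8, [1,1])], [], [(4, [1,1])], [], [(1, [0,1,1]), (2, [1,1])], [], [(22, [1,1])],
    [(25, [1,1])], [(27, [0,1,1])], [(29, [0,1,1])]],
    [
    [(14, [1,1])], [(14, [1])], [], [(14, [1,1])], [(15, [1])], [], [], [], [], [(16, [1])], [],
    [], [], [(18, [1])], [], [], [], [], [], [], [(12, [1])], [], [(11, [1])], [(10, [1])], [],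
    [(8, [1])], [(7, [1])], [(5, [0,1])], [], [(0, [1]), (2, [1]), (3, [1])], [(19, [1,1])],
    [(24, [1,1])], [], [(28, [0,1])]],
    [
    [(15, [1,1])], [], [(15, [1])], [(15, [1])], [], [], [(16, [1])], [], [], [(17, [1])], [],
    [(18, [1])], [], [], [], [], [], [], [], [(14, [1,1])], [], [], [(13, [1])], [(12, [1,1])],
    [], [], [], [(8, [1,1])], [(7, [1,1])], [(4, [1,1])], [(2, [1,1]), (3, [1,1])],
    [(21, [1,1])], [(24, [0,1,1])], [(26, [0,1,1])]],
    [
    [(16, [0,1])], [], [(16, [1])], [], [(17, [1])], [], [], [], [(18, [1])], [], [], [], [], [],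
    [], [], [], [], [], [], [], [(15, [1])], [], [], [(14, [1,1])], [(13, [1])], [(12, [1,1])],
    [(11, [1,1])], [(10, [1,1])], [(9, [1,1])], [(6, [1,1])], [(3, [1,1])], [(19, [0,1,1])],
    [(23, [0,1,1])]],
    [
    [(17, [0,1])], [(17, [1])], [], [(17, [0,1])], [], [(18, [1])], [], [], [], [], [], [], [],
    [], [], [], [], [], [], [(16, [0,1])], [], [], [], [], [(15, [0,1])], [], [], [(13, [0,1])],
    [(12, [0,1,1])], [], [(9, [0,1,1])], [(4, [0,1,1])], [(0, [0,1,1]), (3, [0,1,1])],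
    [(20, [0,0,1,1])]],
    [
    [], [(18, [1])], [], [(18, [0,1])], [], [], [], [], [], [], [], [], [], [], [], [], [], [],
    [], [], [(17, [1])], [], [], [(16, [0,1])], [], [], [(15, [0,1])], [], [(14, [0,1,1])],
    [(13, [0,1])], [(11, [0,1,1])], [(8, [0,1,1])], [(5, [0,0,1,1])],
    [(0, [0,1,1]), (1, [0,0,1,1]), (3, [0,1,1])]],
    [
    [], [(19, [1])], [(19, [1])], [(19, [0,1])], [(0, [1])], [], [], [], [(5, [0,1])],
    [(6, [1])], [], [], [(10, [1])], [(11, [1,1])], [], [(14, [1,1])], [], [(16, [0,1])], [], [],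
    [(23, [1])], [(24, [1])], [], [], [], [(27, [1])], [(28, [1])], [], [], [(30, [1])], [],
    [(32, [1])]],
    [
    [(20, [0,1])], [], [], [], [], [(1, [1])], [], [], [(4, [1])], [], [], [(9, [1])], [], [],
    [(12, [1])], [], [], [], [(17, [1])], [(23, [1])], [], [], [], [], [(26, [1])], [], [],
    [(29, [1])], [], [], [], [], [(33, [1])]],
    [
    [(21, [1])], [], [], [(21, [1])], [], [], [(2, [1])], [], [], [(4, [1])], [(7, [1])],
    [(8, [1])], [], [], [], [], [(15, [1])], [], [], [(24, [1])], [], [], [(25, [1])],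
    [(26, [1])], [], [], [], [], [], [], [(31, [1])]],
    [
    [], [], [(22, [1])], [], [], [], [], [(1, [0,1]), (3, [1])], [], [], [(6, [1])], [],
    [(9, [1])], [], [(11, [1])], [(13, [1])], [], [], [], [], [], [(25, [1])], [], [],
    [(27, [1])], [], [(29, [1])], [], [(30, [1])]],
    [
    [(23, [0,1])], [(23, [1])], [(23, [1])], [(23, [0,1])], [(20, [0,1])], [(19, [1])], [], [],
    [(0, [1]), (1, [0,1])], [], [], [(6, [1])], [], [(9, [1,1])], [(10, [1])], [(12, [1,1])], [],
    [], [(16, [0,1])], [], [], [(26, [1])], [], [], [(28, [1])], [(29, [1])], [], [(30, [1])],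
    [], [], [], [(33, [1])]],
    [
    [(24, [1])], [(24, [1])], [(24, [1])], [(24, [1,1])], [(21, [1])], [], [(19, [1])], [], [],
    [(0, [1]), (2, [1])], [], [(5, [0,1])], [(7, [1])], [(8, [1,1])], [], [], [(14, [1,1])],
    [(15, [0,1])], [], [], [(26, [1])], [], [(27, [1])], [(28, [1])], [], [], [], [], [],
    [(31, [1])], [(32, [1])]],
    [
    [(25, [1])], [], [(25, [1])], [(25, [1])], [], [], [(22, [1])], [(21, [1])], [], [],
    [(1, [0,1]), (2, [1]), (3, [1])], [], [(4, [1])], [], [(8, [1])], [], [(13, [1])], [], [],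
    [(27, [1])], [], [], [], [(29, [1])], [], [], [], [], [(31, [1])]],
    [
    [(26, [1,1])], [(26, [1])], [(26, [1])], [(26, [1,1])], [], [(24, [1])], [(23, [1])], [],
    [(21, [1])], [(20, [0,1])], [], [(0, [1]), (1, [0,1]), (2, [1])], [], [(4, [1,1])],
    [(7, [1])], [], [(12, [1,1])], [], [(15, [0,1])], [(28, [1])], [], [], [(29, [1])], [], [],
    [], [], [(31, [1])], [], [], [(33, [1])]],
    [
    [(27, [1])], [(27, [1])], [], [(27, [1,1])], [(25, [1])], [], [], [(24, [1])], [],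
    [(22, [1])], [(19, [1])], [], [(0, [1]), (1, [0,1]), (2, [1]), (3, [1])], [], [(5, [0,1])],
    [(8, [1,1])], [(11, [1,1])], [(13, [0,1])], [], [], [(29, [1])], [], [], [(30, [1])], [], [],
    [(31, [1])], [], [(32, [1])]],
    [
    [(28, [1,1])], [], [], [(28, [1])], [(26, [1,1])], [], [], [], [(24, [1,1])], [(23, [1,1])],
    [], [(19, [1,1])], [], [(1, [0,1,1]), (2, [1,1])], [], [(7, [1,1])], [(10, [1,1])],
    [(12, [0,1,1])], [(14, [0,1,1])], [], [], [], [(30, [1])], [], [], [(31, [1])], [],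
    [(32, [1])], [], [(33, [1])]],
    [
    [(29, [1,1])], [(29, [1])], [], [(29, [1,1])], [], [(27, [1])], [], [(26, [1])], [(25, [1])],
    [], [(23, [1])], [(22, [1])], [(20, [0,1])], [], [(0, [1]), (2, [1]), (3, [1])],
    [(4, [1,1])], [(9, [1,1])], [], [(13, [0,1])], [(30, [1])], [], [], [], [], [(31, [1])], [],
    [], [], [(33, [1])]],
    [
    [(30, [1,1])], [], [(30, [1])], [(30, [1])], [(29, [1,1])], [], [], [(28, [1])],
    [(27, [1,1])], [], [], [], [(23, [1,1])], [(22, [1,1])], [(19, [1,1])],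
    [(2, [1,1]), (3, [1,1])], [(6, [1,1])], [(9, [0,1,1])], [(11, [0,1,1])], [], [], [(31, [1])],
    [], [], [(32, [1])], [], [(33, [1])]],
    [
    [(31, [0,1])], [], [(31, [1])], [], [], [], [(30, [1])], [], [], [(29, [1,1])], [(28, [1])],
    [(27, [1,1])], [(26, [1,1])], [(25, [1,1])], [(24, [1,1])], [(21, [1,1])], [(3, [1,1])],
    [(4, [0,1,1])], [(8, [0,1,1])], [(32, [1])], [], [], [], [(33, [1])]],
    [
    [(32, [0,1])], [(32, [1])], [], [(32, [0,1])], [(31, [0,1])], [], [], [], [], [(30, [0,1])],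
    [], [], [(28, [0,1])], [(27, [0,1,1])], [], [(24, [0,1,1])], [(19, [0,1,1])],
    [(0, [0,1,1]), (3, [0,1,1])], [(5, [0,0,1,1])], [], [(33, [1])]],
    [
    [], [(33, [1])], [], [(33, [0,1])], [], [(32, [1])], [], [], [(31, [0,1])], [], [],
    [(30, [0,1])], [], [(29, [0,1,1])], [(28, [0,1])], [(26, [0,1,1])], [(23, [0,1,1])],
    [(20, [0,0,1,1])], [(0, [0,1,1]), (1, [0,0,1,1]), (3, [0,1,1])]]]
  par := [
    0, 0, 0, 0, 0, 0, 0, 0, 0, 0, 0, 0, 0, 0, 0, 0, 0, 0, 0, 0, 0, 0, 0, 0, 0, 0, 0, 0, 0, 0, 0,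
    0, 0, 0]
  wt := [
    [6, 6, 6, 6], [6, 6, 6, 6], [6, 6, 6, 6], [6, 6, 6, 6], [7, 6, 6, 6], [6, 7, 6, 6],
    [6, 6, 7, 6], [6, 6, 6, 7], [7, 7, 6, 6], [7, 6, 7, 6], [6, 6, 7, 7], [7, 7, 7, 6],
    [7, 6, 7, 7], [8, 7, 7, 6], [7, 7, 7, 7], [8, 7, 7, 7], [8, 7, 8, 7], [9, 7, 8, 7],
    [9, 8, 8, 7], [5, 6, 6, 6], [6, 5, 6, 6], [6, 6, 5, 6], [6, 6, 6, 5], [5, 5, 6, 6],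
    [5, 6, 5, 6], [6, 6, 5, 5], [5, 5, 5, 6], [5, 6, 5, 5], [4, 5, 5, 6], [5, 5, 5, 5],
    [4, 5, 5, 5], [4, 5, 4, 5], [3, 5, 4, 5], [3, 4, 4, 5]]
  words := [
    (8, 4, 5), (23, 19, 20), (9, 4, 6), (24, 19, 21), (10, 6, 7), (25, 21, 22), (11, 6, 8),
    (26, 21, 23), (12, 7, 9), (27, 22, 24), (13, 8, 9), (28, 23, 24), (14, 8, 10), (29, 23, 25),
    (15, 8, 12), (30, 23, 27), (16, 11, 12), (31, 26, 27), (17, 12, 13), (32, 27, 28),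
    (18, 13, 14), (33, 28, 29), (0, 4, 19), (1, 5, 20), (2, 6, 21), (3, 7, 22)]
  units := [[1], [0, 1], [1, 1], [0, 1, 1], [0, 0, 1], [0, 0, 1, 1], [0, 1, 0, 1]]
  cartan := [[[], [0, 1], [1], []], [[0, 1], [], [], []], [[1], [], [], [1]], [[], [], [1], []]]
  hGen := [[(0, [1])], [(1, [0,1])], [(2, [1])], [(1, [0,1]), (3, [1])]]
  yCoef := [[1], [0, 1], [1], [1]]
  posTrans := [
    (4, 19, 0), (5, 20, 1), (8, 20, 4), (6, 21, 2), (9, 21, 4), (11, 21, 8), (7, 22, 1),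
    (10, 22, 6), (12, 22, 9), (14, 22, 11), (13, 19, 11), (15, 19, 14), (16, 21, 15),
    (17, 19, 16), (18, 20, 17)]
  negTrans := [
    (19, 4, 0), (20, 5, 1), (23, 5, 19), (21, 6, 2), (24, 6, 19), (26, 6, 23), (22, 7, 1),
    (25, 7, 21), (27, 7, 24), (29, 7, 26), (28, 4, 26), (30, 4, 29), (31, 6, 30), (32, 4, 31),
    (33, 5, 32)]

/-- The Gram matrix of an invariant form on `wk(4;α)`, equal to `α` times the standard one. -/
def wkGram : List SVec := [
  [(1, [0,1]), (2, [0,1]), (3, [0,0,1])], [(0, [0,1])], [(0, [0,1]), (3, [0,1])],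
  [(0, [0,0,1]), (2, [0,1])], [(19, [0,1])], [(20, [1])], [(21, [0,1])], [(22, [0,1])],
  [(23, [0,1])], [(24, [0,1])], [(25, [0,1])], [(26, [0,1])], [(27, [0,1])], [(28, [0,1,1])],
  [(29, [0,1])], [(30, [0,1,1])], [(31, [0,1,1])], [(32, [0,0,1,1])], [(33, [0,0,1,1])],
  [(4, [0,1])], [(5, [1])], [(6, [0,1])], [(7, [0,1])], [(8, [0,1])], [(9, [0,1])],
  [(10, [0,1])], [(11, [0,1])], [(12, [0,1])], [(13, [0,1,1])], [(14, [0,1])], [(15, [0,1,1])],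
  [(16, [0,1,1])], [(17, [0,0,1,1])], [(18, [0,0,1,1])]]

/-- Vectors whose products with others are, up to a factor, the coordinates of the latter. -/
def wkDual : List SVec := [
  [(1, [1])], [(0, [1]), (2, [0,1]), (3, [1])], [(1, [0,1]), (3, [1])], [(1, [1]), (2, [1])],
  [(19, [1])], [(20, [1])], [(21, [1])], [(22, [1])], [(23, [1])], [(24, [1])], [(25, [1])],
  [(26, [1])], [(27, [1])], [(28, [1])], [(29, [1])], [(30, [1])], [(31, [1])], [(32, [1])],
  [(33, [1])], [(4, [1])], [(5, [1])], [(6, [1])], [(7, [1])], [(8, [1])], [(9, [1])],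
  [(10, [1])], [(11, [1])], [(12, [1])], [(13, [1])], [(14, [1])], [(15, [1])], [(16, [1])],
  [(17, [1])], [(18, [1])]]

/-- The numbers of the root vectors that give rise to cohomology classes. -/
def wkRoots : List ℕ := [16, 31, 15, 30, 13, 28, 14, 29, 11, 26, 8, 23, 12, 27, 9, 24, 4, 19]

/-- Pairs of a coboundary or cocycle and a coordinate, which eliminate the cocycles. -/
def wkPivots : List (ℕ × ℕ) := [
  (645, 6391), (610, 5200), (1158, 7377), (575, 7477), (1160, 4895), (540, 5130), (1162, 5243),
  (470, 5026), (1164, 6049), (505, 6217), (1166, 6012), (400, 6112), (1168, 6228), (295, 4817),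
  (1170, 8641), (435, 4991), (1172, 7383), (330, 4852), (1174, 15714), (155, 4901), (190, 6056),
  (365, 7199), (225, 7246), (260, 8438), (1, 5271), (2, 5272), (3, 5273), (0, 210), (36, 1401),
  (34, 1331), (37, 1366), (35, 1296), (70, 2557), (68, 2487), (71, 2522), (69, 2452),
  (1156, 175), (104, 3713), (102, 3643), (105, 3678), (103, 3608), (665, 5270), (700, 6461),
  (735, 7652), (770, 8843), (280, 4802), (805, 22667), (315, 4837), (840, 22702), (350, 7184),
  (875, 25049), (385, 7219), (910, 25084), (420, 8410), (945, 26275), (455, 9567), (980, 27432),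
  (490, 9602), (1015, 27467), (525, 9671), (1050, 27536), (560, 13140), (1085, 31005),
  (595, 14331), (1120, 32196), (630, 15522), (1155, 33387), (755, 7694), (720, 5347),
  (860, 5486), (685, 5312), (1173, 5997), (650, 6434), (1171, 6034), (825, 6607), (1169, 6544),
  (930, 6712), (1167, 7362), (790, 7729), (1165, 4880), (895, 5521), (1163, 5390), (1000, 5625),
  (1161, 8756), (965, 9059), (1159, 7872), (1035, 7972), (1157, 25212), (1070, 5695),
  (1105, 6886), (1140, 24226)]

/-- Cocycle equations that determine the remaining coordinates. -/
def wkEquations : List ℕ := [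
  6391, 45695, 84999, 124303, 163573, 206344, 206377, 207467, 207566, 210867, 211032, 212155,
  214464, 215617, 216785, 5200, 44504, 83808, 123112, 164694, 168161, 168194, 169250, 169382,
  170537, 174002, 176290, 176329, 176425, 178735, 7477, 46781, 86085, 125389, 164525, 203896,
  207296, 244389, 245511, 247856, 247922, 250167, 250232, 250308, 251387, 252542, 252588, 253710,
  253746, 253784, 253842, 253979, 256152, 257444, 285937, 286102, 288412, 288443, 325405, 326560,
  326591, 328869, 5130, 44434, 83738, 123042, 163266, 163434, 165712, 165779, 165812, 165875,
  165920, 165923, 166967, 167030, 169309, 169394, 169523, 170464, 173910, 174023, 174317, 178763,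
  178937, 210976, 211138, 214449, 214776, 216913, 217086, 290706, 290901, 294366, 5026, 44330,
  83634, 122938, 163330, 163581, 164774, 166796, 166862, 168017, 170374, 170449, 170558, 178775,
  178895, 179036, 207512, 212140, 217046, 217186, 251372, 256349, 257501, 333695, 333802, 370798,
  371847, 408946, 447094, 448458, 487447, 528150, 6217, 45521, 84825, 124129, 203724, 204947,
  205013, 205046, 205079, 205159, 205194, 205290, 206135, 206201, 207422, 208511, 208591, 208667,
  208928, 210869, 210906, 210945, 211017, 211068, 211239, 211377, 214533, 215859, 216840, 217013,
  217153, 244446, 6112, 45416, 84720, 124024, 163226, 203752, 203785, 203899, 203900, 203973,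
  204046, 204234, 204406, 206095, 207299, 207370, 207407, 207480, 207551, 207598, 207701, 207873,
  207977, 211166, 212218, 215765, 215958, 216825, 216924, 217111, 217218, 219264, 4817, 44121,
  83425, 122729, 163268, 163269, 163376, 163447, 163624, 164083, 179098, 205064, 206186, 206292,
  212264, 212383, 212420, 213573, 214711, 214797, 216898, 216998, 217031, 217096, 221746, 225146,
  288717, 291026, 325570, 325675, 326865, 328232, 4991, 44295, 83599, 122903, 164417, 165639,
  165672, 165860, 167982, 169184, 244431, 244505, 286013, 286050, 286087, 286123, 294305, 294425,
  294532, 295464, 295565, 295685, 295756, 370622, 371880, 371985, 408770, 408979, 446918, 447127,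
  487480, 487655, 4852, 44156, 83460, 122764, 164458, 164460, 164531, 164567, 164602, 164927,
  169548, 250152, 251533, 251653, 251865, 253851, 253917, 254174, 256235, 256268, 256464, 256515,
  259722, 262172, 325642, 365752, 366310, 367048, 367133, 367360, 367606, 369448, 4901, 44205,
  83509, 122813, 167060, 167145, 167265, 167618, 170618, 171842, 171941, 172025, 172097, 172170,
  172933, 173065, 173128, 174090, 174255, 174405, 175248, 175634, 176440, 176573, 176606, 176704,
  176785, 181076, 181215, 182509, 187031, 286401, 6056, 45360, 84664, 123968, 203737, 204998,
  206329, 206414, 206570, 206605, 206711, 206887, 207760, 211330, 217280, 7199, 46503, 85807,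
  125111, 244258, 244259, 244328, 244400, 244473, 244589, 244727, 244899, 250364, 252812, 254141,
  7246, 46550, 85854, 125158, 203770, 246580, 246719, 246874, 247030, 247065, 247171, 247277,
  248134, 249324, 254205, 8438, 47742, 87046, 126350, 165657, 205031, 284797, 287404, 287523,
  287560, 287595, 287772, 288750, 289819, 291130, 1331, 1366, 1401, 1436, 2487, 2522, 2557, 2592,
  3643, 3678, 3713, 3748, 6461, 7652, 41791, 41826, 41861, 41896, 42947, 42982, 43017, 43052,
  44106, 44141, 44574, 45401, 45765, 45885, 46488, 46956, 47075, 47147, 47714, 47784, 48145,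
  48267, 48338, 48408, 48871, 48975, 49528, 49599, 50200, 50235, 50791, 50826, 52548, 53172,
  82251, 82286, 82321, 82356, 83410, 83445, 83878, 84705, 85069, 85189, 85792, 86260, 86379,
  86451, 87018, 87088, 87449, 87571, 87642, 87712, 88175, 88279, 88832, 88903, 89504, 89539,
  90095, 90130, 91852, 92476, 122714, 122749, 123182, 124009, 124373, 124493, 125096, 125564,
  125683, 125755, 126322, 126392, 126753, 126875, 126946, 127016, 127479, 127583, 128136, 128207,
  128808, 128843, 129399, 129434, 131156, 131780, 163211, 163315, 163647, 164402, 164804, 165961,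
  166819, 167118, 168275, 169166, 169235, 170426, 178688, 179880, 179915, 179950, 179985, 180020,
  180335, 183489, 204175, 205299, 205365, 208935, 212505, 214885, 215712, 216075, 220375, 220445,
  221602, 224020, 244202, 244637, 244670, 245496, 245600, 248108, 250422, 251810, 253893, 258521,
  260870, 260905, 264445, 265637, 266828, 284697, 285165, 285922, 285991, 286188, 287446, 290917,
  294685, 295545, 295875, 297065, 300173, 301400, 301470, 302662, 307357, 307392, 309705, 325493,
  326751, 329065, 337077, 337079, 337197, 366022, 367179, 376416, 376414, 376415, 376417, 376572,
  378814, 381163, 382355, 382425, 382460, 418067, 418065, 418066, 418258, 418328, 421798, 422920,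
  425268, 425338, 427651, 455027, 456283, 457403, 463555, 487338, 494333, 494465, 494463, 494464,
  496676, 496863, 497984, 499177, 500440, 501597, 501667, 503910, 503980, 506293, 507415, 528956,
  533638, 533801, 534068, 539849, 543143, 575288, 576509, 580309, 582622, 612382, 612674, 616107,
  617264, 624203, 651556, 653901, 653934, 654066, 654130, 654252, 654288, 656311, 657499, 657594,
  657596, 658652, 659841, 659838, 659839, 659840, 659963, 661084, 661157, 662241, 663471, 663506,
  690861, 690995, 691028, 691127, 691189, 691187, 691277, 692396, 694561, 695830, 696871, 696935,
  696933, 696934, 696987, 697060, 699338, 700334, 700422, 700459, 700531, 701616, 702809, 705123,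
  772069, 4802, 6097, 6376, 7184, 8410, 8480, 9567, 9671, 9810, 163350, 163558, 163680, 163778,
  163901, 163972, 170884, 174420, 174421, 174423, 174475, 205622, 207613, 207712, 211084, 211184,
  216869, 216970, 217071, 217138, 217171, 217203, 217234, 217265, 217295, 217294, 217297, 246080,
  246153, 7694, 46998, 86302, 125606, 164912, 207686, 247090, 247156, 249536, 251616, 251882,
  262108, 262193, 262265, 262338, 5347, 44651, 83955, 123259, 163721, 166034, 166134, 166167,
  167357, 174130, 174460, 182308, 182396, 182432, 182575, 5486, 44790, 84094, 123398, 163860,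
  167396, 167462, 170798, 170996, 182252, 182417, 183507, 187034, 187122, 187196, 5312, 44616,
  83920, 123224, 164843, 168413, 168512, 169470, 169767, 176410, 176839, 181118, 181241, 181347,
  181489, 6434, 45738, 85042, 124346, 203709, 203881, 204113, 204247, 204280, 204409, 204410,
  204498, 204571, 207281, 207583, 207880, 208037, 208740, 209006, 209101, 209192, 211053, 211416,
  211501, 215680, 216112, 219267, 219389, 219460, 219495, 219531, 219637, 6607, 45911, 85215,
  124519, 163251, 205341, 205442, 205508, 205541, 205574, 205669, 205719, 206665, 206731, 206912,
  211123, 211224, 211455, 211486, 214694, 214959, 219209, 219374, 221620, 221749, 221911, 225149,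
  225235, 225272, 225345, 225416, 285434, 6712, 46016, 85320, 124624, 163761, 204322, 207791,
  207858, 210238, 212484, 212584, 212617, 212650, 219348, 219480, 222782, 222881, 223007, 223059,
  225257, 226346, 226441, 226532, 228719, 228771, 228810, 228882, 246006, 328184, 328217, 330563,
  448476, 7729, 47033, 86337, 125641, 164510, 244712, 248282, 248381, 250393, 250494, 250662,
  250727, 250818, 253964, 254294, 258479, 258677, 259735, 259898, 259986, 263298, 263383, 263420,
  263493, 263564, 286329, 286560, 365993, 366327, 366418, 366421, 368734, 5521, 44825, 84129,
  123433, 166005, 166207, 166274, 166307, 166370, 166430, 166433, 169508, 169676, 169841, 169904,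
  174302, 174533, 181446, 182639, 188224, 188314, 188351, 188423, 298977, 299078, 299144, 299210,
  300200, 300398, 300429, 302610, 303863, 5625, 44929, 84233, 123537, 165020, 165154, 168656,
  168689, 170936, 181101, 183547, 183647, 183710, 183770, 183773, 184865, 187259, 188299, 191760,
  191815, 191888, 259810, 260008, 265622, 265721, 265783, 266876, 338553, 338586, 348981, 377954,
  535174, 9059, 48363, 87667, 126971, 205412, 244750, 244817, 244884, 286501, 287724, 287757,
  288814, 294730, 294763, 297991, 298058, 298217, 302547, 302680, 302807, 303900, 304015, 306208,
  306293, 308519, 308571, 308608, 308644, 411486, 411519, 488938, 488971, 7972, 47276, 86580,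
  125884, 204460, 246110, 249612, 251958, 251991, 258656, 258790, 258856, 258920, 262157, 262224,
  262323, 262355, 262387, 263346, 263478, 263510, 268067, 268160, 269222, 270377, 270438, 271560,
  271611, 271649, 367558, 376703, 455444, 5695, 44999, 84303, 123607, 164068, 167570, 167603,
  185896, 194140, 194194, 221800, 226322, 339746, 343180, 344302, 345424, 379083, 379116, 382550,
  423010, 457758, 463470, 501652, 503930, 539834, 542112, 544390, 580294, 584850, 621910, 624188,
  625310, 6886, 46190, 85494, 124798, 219556, 220745, 224212, 225302, 225401, 228702, 228867,
  229990, 232299, 233452, 234635, 24226, 63530, 102834, 142138, 184910, 220780, 266952, 309690,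
  342160, 384931, 387242, 427702, 430012, 507466, 509776]

/-- Functionals that separate the cohomology classes. -/
def wkFunctionals : List SVec := [
  [(175, [1]), (210, [0, 1]), (5273, [0, 1])], [(25212, [1])], [(7377, [1])], [(7872, [1])],
  [(4895, [1])], [(8756, [1])], [(5243, [1])], [(5390, [1])], [(6049, [1])], [(4880, [1])],
  [(6012, [1])], [(7362, [1])], [(6228, [1])], [(6544, [1])], [(8641, [1])], [(6034, [1])],
  [(7383, [1])], [(5997, [1])], [(15714, [1])]]

/-- Equations for an invariant form, where the parameter does not vanish, that determine it up to
its value at the second positive and the second negative root vector. -/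
def wkFormEquations : List ℕ := [
  5, 6, 8, 9, 10, 12, 16, 17, 20, 21, 23, 24, 25, 27, 31, 32, 38, 45, 48, 52, 53, 60, 63, 67, 75,
  83, 90, 98, 115, 130, 155, 171, 172, 173, 174, 175, 176, 177, 178, 179, 180, 181, 182, 183,
  184, 185, 186, 187, 188, 189, 190, 191, 192, 193, 194, 195, 196, 197, 198, 199, 200, 201, 202,
  203, 205, 206, 207, 208, 210, 211, 212, 213, 214, 215, 216, 217, 218, 219, 220, 221, 222, 223,
  224, 226, 227, 228, 229, 230, 231, 232, 233, 234, 235, 236, 237, 260, 273, 274, 275, 276, 279,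
  280, 281, 282, 283, 284, 285, 286, 287, 288, 289, 290, 291, 292, 293, 294, 295, 296, 297, 298,
  299, 300, 301, 302, 303, 304, 305, 307, 308, 309, 310, 313, 315, 316, 317, 318, 319, 320, 321,
  322, 323, 324, 325, 326, 327, 328, 329, 331, 332, 333, 334, 335, 336, 337, 338, 339, 341, 342,
  343, 344, 347, 350, 351, 352, 353, 354, 355, 356, 357, 358, 359, 360, 361, 362, 363, 364, 366,
  367, 368, 369, 370, 371, 372, 373, 409, 410, 411, 412, 415, 419, 420, 421, 422, 423, 424, 425,
  426, 427, 428, 429, 430, 431, 432, 433, 434, 436, 437, 438, 439, 440, 441, 545, 546, 547, 548,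
  551, 555, 557, 558, 559, 560, 561, 562, 563, 564, 565, 566, 567, 568, 569, 570, 571, 572, 573,
  574, 575, 576, 577, 579, 580, 581, 582, 585, 589, 591, 592, 593, 595, 596, 597, 598, 599, 600,
  601, 602, 603, 604, 605, 606, 607, 608, 609, 610, 611, 681, 682, 683, 684, 687, 691, 693, 694,
  695, 698, 699, 700, 701, 702, 703, 704, 705, 706, 707, 708, 709, 710, 711, 712, 713, 715, 716,
  717, 718, 721, 725, 727, 728, 729, 732, 733, 735, 736, 737, 738, 739, 740, 741, 742, 743, 744,
  745, 746, 747, 783, 784, 785, 786, 789, 793, 795, 796, 797, 800, 801, 804, 805, 806, 807, 808,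
  809, 810, 811, 812, 813, 814, 815, 817, 818, 819, 820, 823, 827, 829, 830, 831, 834, 835, 838,
  840, 841, 842, 843, 844, 845, 846, 847, 848, 849, 851, 852, 853, 854, 857, 861, 863, 864, 865,
  868, 869, 872, 875, 876, 877, 878, 879, 880, 881, 882, 883, 919, 920, 921, 922, 925, 929, 931,
  932, 933, 936, 937, 940, 944, 945, 946, 947, 948, 949, 950, 951, 1055, 1056, 1057, 1058, 1061,
  1065, 1067, 1068, 1069, 1072, 1073, 1076, 1080, 1082, 1083, 1084, 1085, 1086, 1087, 1089, 1090,
  1091, 1092, 1095, 1099, 1101, 1102, 1103, 1106, 1107, 1110, 1114, 1116, 1117, 1118, 1120, 1121,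
  1194, 1201, 1204, 1208, 1209, 1216, 1219, 1223, 1231, 1239, 1246, 1254, 1271, 1286, 1294, 1295,
  1296, 1299, 1303, 1305, 1306, 1307, 1310, 1311, 1314, 1318, 1320, 1321, 1322, 1325, 1346, 1381,
  1416, 1486, 1532, 1533, 1537, 1541, 1543, 1544, 1545, 1548, 1549, 1552, 1556, 1558, 1559, 1560,
  1563, 1591, 1634, 1635, 1639, 1645, 1646, 1647, 1650, 1651, 1654, 1658, 1660, 1661, 1662, 1665,
  1770, 1771, 1775, 1781, 1783, 1786, 1787, 1790, 1794, 1796, 1797, 1798, 1801, 1804, 1805, 1809,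
  1815, 1817, 1821, 1824, 1828, 1830, 1831, 1832, 1835, 2042, 2043, 2047, 2053, 2055, 2062, 2066,
  2068, 2069, 2070, 2073, 2144, 2145, 2149, 2155, 2157, 2164, 2170, 2171, 2172, 2175, 2280, 2281,
  2285, 2291, 2293, 2300, 2306, 2308, 2311, 2387, 2395, 2402, 2410, 2427, 2442, 2467, 2537, 2553,
  2557, 2563, 2565, 2578, 2580, 2747, 2825, 2835, 2837, 2844, 2850, 2852, 3063, 3067, 3073, 3082,
  3088, 3090, 3172, 3335, 3345, 3360, 3362, 3583, 3598, 3693, 3728, 3923, 3938, 4448]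

/-- Equations for an invariant form, where the parameter vanishes. -/
def wkFormEquationsZero : List ℕ := [
  6, 9, 10, 11, 12, 13, 14, 15, 21, 24, 25, 26, 27, 28, 29, 30, 38, 42, 51, 52, 53, 57, 66, 67,
  75, 84, 90, 99, 155, 190, 205, 206, 207, 208, 209, 210, 211, 212, 213, 214, 215, 216, 217, 218,
  219, 220, 221, 222, 223, 224, 226, 227, 228, 229, 230, 231, 232, 233, 234, 235, 236, 237, 260,
  307, 308, 309, 310, 311, 313, 314, 315, 316, 317, 318, 319, 320, 321, 322, 323, 324, 325, 326,
  327, 328, 329, 331, 332, 333, 334, 335, 336, 337, 338, 339, 341, 342, 343, 344, 345, 347, 348,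
  350, 351, 352, 353, 354, 355, 356, 357, 358, 359, 360, 361, 362, 363, 364, 366, 367, 368, 369,
  370, 371, 372, 373, 375, 376, 377, 378, 379, 381, 382, 385, 386, 387, 388, 389, 390, 391, 392,
  393, 394, 395, 396, 397, 398, 399, 401, 402, 403, 404, 405, 406, 407, 409, 410, 411, 412, 413,
  415, 416, 420, 421, 422, 423, 424, 425, 426, 427, 428, 429, 430, 431, 432, 433, 434, 436, 437,
  438, 439, 440, 441, 443, 444, 445, 446, 447, 449, 450, 455, 456, 457, 458, 459, 460, 461, 462,
  463, 464, 465, 466, 467, 468, 469, 471, 472, 473, 474, 475, 477, 478, 479, 480, 481, 483, 484,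
  490, 491, 492, 493, 494, 495, 496, 497, 498, 499, 500, 501, 502, 503, 504, 506, 507, 508, 509,
  511, 512, 513, 514, 515, 517, 518, 525, 526, 527, 528, 529, 530, 531, 532, 533, 534, 535, 536,
  537, 538, 539, 541, 542, 543, 715, 716, 717, 718, 719, 721, 722, 730, 731, 732, 733, 734, 735,
  736, 737, 738, 739, 740, 741, 742, 743, 744, 745, 746, 747, 817, 818, 819, 820, 821, 823, 824,
  832, 833, 834, 835, 836, 838, 839, 840, 841, 842, 843, 844, 845, 846, 847, 848, 849, 851, 852,
  853, 854, 855, 857, 858, 866, 867, 868, 869, 870, 872, 873, 875, 876, 877, 878, 879, 880, 881,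
  882, 883, 885, 886, 887, 888, 889, 891, 892, 900, 901, 902, 903, 904, 906, 907, 910, 911, 912,
  913, 914, 915, 916, 917, 919, 920, 921, 922, 923, 925, 926, 934, 935, 936, 937, 938, 940, 941,
  945, 946, 947, 948, 949, 950, 951, 953, 954, 955, 956, 957, 959, 960, 968, 969, 970, 971, 972,
  974, 975, 980, 981, 982, 983, 984, 985, 987, 988, 989, 990, 991, 993, 994, 1002, 1003, 1004,
  1005, 1006, 1008, 1009, 1015, 1016, 1017, 1018, 1019, 1021, 1022, 1023, 1024, 1025, 1027, 1028,
  1036, 1037, 1038, 1039, 1040, 1042, 1043, 1050, 1051, 1052, 1053, 1194, 1198, 1207, 1208, 1209,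
  1213, 1222, 1223, 1231, 1240, 1246, 1255, 1294, 1295, 1296, 1297, 1299, 1300, 1308, 1309, 1310,
  1311, 1312, 1314, 1315, 1323, 1324, 1325, 1346, 1381, 1416, 1430, 1431, 1433, 1435, 1436, 1444,
  1445, 1446, 1447, 1448, 1450, 1451, 1459, 1460, 1461, 1486, 1556, 1591, 1661, 1736, 1737, 1739,
  1741, 1750, 1751, 1752, 1753, 1754, 1756, 1757, 1765, 1766, 1767, 1770, 1771, 1773, 1775, 1784,
  1786, 1787, 1788, 1790, 1791, 1799, 1800, 1801, 1804, 1805, 1807, 1809, 1818, 1821, 1822, 1824,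
  1825, 1833, 1834, 1835, 1940, 1941, 1943, 1945, 1954, 1958, 1960, 1961, 1969, 1970, 1971, 2246,
  2247, 2249, 2251, 2260, 2264, 2266, 2275, 2276, 2277, 2280, 2281, 2283, 2285, 2294, 2298, 2300,
  2309, 2311, 2387, 2396, 2402, 2411, 2467, 2537, 2553, 2555, 2557, 2566, 2570, 2581, 2747, 2852,
  2859, 2861, 2872, 2876, 2878, 2887, 3063, 3065, 3067, 3080, 3082, 3091, 3172, 3369, 3371, 3386,
  3397, 3693, 3728, 3938, 5275, 5290, 5970, 6005, 6040, 6480, 7670, 8860]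

theorem wk_valid : wkModel.Valid where
  p_pos := by decide
  len := by decide +kernel
  par := by decide +kernel
  wt := by decide +kernel
  skew := by decide +kernel
  jac := by decide +kernel
  words := by decide +kernel
  rel := by decide +kernel
  tri := by decide +kernel
  trans := by decide +kernel

theorem wk_chkGram : wkModel.chkGram wkGram = true := by decide +kernel

theorem wk_chkSym : wkModel.chkSym wkGram = true := by decide +kernel

theorem wk_chkInv : wkModel.chkInv wkGram = true := by decide +kernel

theorem wk_chkStd : wkModel.chkStd wkGram [0, 1] = true := by decide +kernel

theorem wk_chkNondeg : wkModel.chkNondeg wkGram wkDual = true := by decide +kernel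

theorem wk_chkUnique : wkModel.chkUnique = true := by decide +kernel

theorem wk_chkDiag : wkModel.chkDiag = true := by decide +kernel

theorem wk_nilOK : (wkRoots.all wkModel.nilOK) = true := by decide +kernel

/-- The tables of the cocycles on `wk(4;α)`. -/
def wkClassTab (l : ℕ) : ℕ → ℕ → SVec :=
  match l with
  | 0 => wkModel.deriv.br
  | l + 1 => wkModel.sqTab (wkRoots.getD l 0)

/-- Where the parameter does not vanish, an invariant form that vanishes at `(e_5, e_20)` is
zero. -/
theorem wk_formOK : (wkModel.withUnits [[1], [0, 1]]).formOK wkFormEquations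
    (1 <<< wkModel.formCode 5 20) 0 = true := by
  decide +kernel

/-- Where the parameter vanishes, the forms are determined by the values at the two root vectors
`e_5` and `e_20`. -/
theorem wk_formOK_zero : ((wkModel.mapCoef (List.take 1)).withUnits [[1]]).formOK
    wkFormEquationsZero 0 (1 <<< wkModel.formCode 5 5 ||| 1 <<< wkModel.formCode 5 20 |||
      1 <<< wkModel.formCode 20 20) = true := by
  decide +kernel

theorem wk_chkClosed : wkModel.chkClosed = true := by decide +kernel

theorem wk_chkDeg : wkModel.chkDeg 4 = true := by decide +kernel

theorem wk_chkH2 : wkModel.chkH2 0 wkRoots.length.succ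
    wkClassTab wkPivots wkEquations = true := by
  decide +kernel

theorem wk_chkDual : wkModel.chkDual wkRoots.length.succ
    wkClassTab wkFunctionals = true := by
  decide +kernel

end StructConst

namespace StructConst

/-! ### The two algebras in characteristic 3 -/

section Summary

variable {K V : Type*} [Field K] [AddCommGroup V] [Module K V] {M : Model} {t : K} [CharP K M.p]
  {A : Matrix (Fin M.n) (Fin M.n) K} {p : Fin M.n → ZMod 2} {G D : List SVec}

/-- An invariant form that passes the checks gives rise to the standard form, which is a NIS. -/
theorem Model.exists_standardForm (hM : M.Valid) (hA : M.Presents t A p) (hAs : A.IsSymm)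
    {F : Frame K (CartanAlg A p) M.dim} (R : Rep M t F (NISDeform.parity A p) (bracket A p))
    (hg : ∀ a, NISDeform.gen A p a = val F.e t (M.gen a))
    (hroot : ∀ w, rootSpace A p w = F.graded M.weight w) {q : Coef} (hq : ev t q ≠ 0)
    (hG : M.chkGram G = true) (hS : M.chkSym G = true) (hI : M.chkInv G = true)
    (hC : M.chkStd G q = true) (hD : M.chkNondeg G D = true) (hU : M.chkUnique = true) :
    ∃ B, (IsStandardForm A p 1 A B ∧ ∀ B', IsStandardForm A p 1 A B' → B' = B) ∧
      IsNIS (NISDeform.parity A p) (bracket A p) B := by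
  obtain ⟨B, hB⟩ := M.exists_gramRep F t hG
  have hi := R.isInvariantForm hM hB hS hI
  have h := isStandardForm hM hA hAs hg hroot hq hB hi hG hC
  exact ⟨_, ⟨h, fun B' h' => isStandardForm_unique hM hA R hg hroot hU h h'⟩,
    isInvariantForm_smul hi _,
    nondegenerate_smul (hB.nondegenerate hM hA.units hi (R.isLieSuper' hM).compl hD)
      (inv_ne_zero hq)⟩

/-- An algebra with a Cartan matrix, described by a table, all of whose even cohomology classes are
given by powers of inner derivations: all checks together. -/
theorem Model.exists_deforms (hM : M.Valid) (hA : M.Presents t A p) (hAs : A.IsSymm) {q : Coef}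
    (hq : ev t q ≠ 0) (hG : M.chkGram G = true) (hS : M.chkSym G = true) (hI : M.chkInv G = true)
    (hC : M.chkStd G q = true) (hD : M.chkNondeg G D = true) (hU : M.chkUnique = true)
    (hd : M.chkDiag = true) (hinj : ∀ w : Fin M.n → K, (∀ m < M.n, M.eigen t m w = 0) → w = 0)
    {L : List ℕ} (hL : L.all M.nilOK = true) {piv : List (ℕ × ℕ)} {cert : List ℕ}
    (hchk : M.chkH2 0 L.length (fun l => M.sqTab (L.getD l 0)) piv cert = true) {ℓ : List SVec}
    (hdual : M.chkDual L.length (fun l => M.sqTab (L.getD l 0)) ℓ = true) :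
    IsLieSuper (NISDeform.parity A p) (bracket A p) ∧
    ∃ B, (IsStandardForm A p 1 A B ∧ ∀ B', IsStandardForm A p 1 A B' → B' = B) ∧
      IsNIS (NISDeform.parity A p) (bracket A p) B ∧
      ∃ (m : ℕ) (c : Fin m → Bil K (CartanAlg A p)),
        IsCohomologyBasis (NISDeform.parity A p) (bracket A p) c ∧
        ∀ (i : Fin m) (l : K),
          IsLieSuper (NISDeform.parity A p) (bracket A p + l • c i) ∧
          IsNIS (NISDeform.parity A p) (bracket A p + l • c i) B := by
  obtain ⟨F, R, hg, hroot⟩ := M.exists_frame hM hA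
  obtain ⟨B, hB, hN⟩ :=
    M.exists_standardForm hM hA hAs R hg hroot hq hG hS hI hC hD hU
  have hnil : ∀ l < L.length, M.nilOK (L.getD l 0) = true := fun l hl => by
    rw [List.getD_eq_getElem _ _ hl]
    exact List.all_eq_true.1 hL _ (List.getElem_mem hl)
  let C : ℕ → Bil K (CartanAlg A p) := fun l =>
    sqP M.p (bracket A p) (bracket A p (F.e (L.getD l 0)))
  exact ⟨R.isLieSuper' hM, B, hB, hN, L.length, fun l => C l,
    isCohomologyBasis hM hA.units R hd hinj (fun l hl => R.isCocycle_sqP hM (hnil l hl))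
      (fun l _ => R.sqP_e (L.getD l 0)) hchk hdual,
    fun i l => ⟨R.isLieSuper_sqP hM (hnil i i.2) l, R.isNIS_sqP hM (hnil i i.2) hN l⟩⟩

/-- The check for the absence of odd cohomology. -/
theorem Model.isCoboundary_of_odd (hM : M.Valid) (hA : M.Presents t A p) (hd : M.chkDiag = true)
    (hinj : ∀ w : Fin M.n → K, (∀ m < M.n, M.eigen t m w = 0) → w = 0)
    {piv : List (ℕ × ℕ)} {cert : List ℕ}
    (hchk : M.chkH2 1 0 (fun _ _ _ => []) piv cert = true) (z : Bil K (CartanAlg A p))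
    (hz : IsCocycle (NISDeform.parity A p) (bracket A p) 1 z) :
    IsCoboundary (NISDeform.parity A p) (bracket A p) 1 z := by
  obtain ⟨F, R, -⟩ := M.exists_frame hM hA
  obtain ⟨a, ha⟩ := exists_isCoboundary (d := 1) (C := fun _ => 0) hM hA.units R hd hinj
    (by simp) (by simp) hchk (by rwa [Nat.cast_one])
  simpa using ha

end Summary

variable (K : Type*) [Field K]

theorem two_eq_neg_one [CharP K 3] : (2 : K) = -1 := by
  have h3 : (3 : K) = 0 := by exact_mod_cast CharP.cast_eq_zero K 3
  linear_combination h3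

theorem br3_unitsAt [CharP K 3] : br3Model.UnitsAt (0 : K) := by
  intro c hc
  simp only [br3Model, List.mem_cons, List.not_mem_nil, or_false] at hc
  rcases hc with rfl | rfl <;> simp [two_eq_neg_one K]

theorem br3_isSymm : (br3Matrix K).IsSymm := by
  ext i j
  fin_cases i <;> fin_cases j <;> rfl

theorem br3_presents [CharP K 3] : br3Model.Presents (0 : K) (br3Matrix K) 0 where
  units := br3_unitsAt K
  cartan i j := by
    change Fin 3 at i j
    fin_cases i <;> fin_cases j <;>
      simp [Model.cartanAt, br3Model, br3Matrix, two_eq_neg_one K]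
  parH := by decide
  parX := by decide
  parY := by decide
  wtH := by decide
  wtX := by decide
  wtY := by decide
  lin_h := by
    have : CharP K br3Model.p := ‹CharP K 3›
    have h := br3_chkUnique
    simp only [Model.chkUnique, Bool.and_eq_true] at h
    exact Model.linearIndependent_h (by decide) (br3_unitsAt K) h.1.2 _

theorem br3_eigen [CharP K 3] (w : Fin br3Model.n → K)
    (h : ∀ m < br3Model.n, br3Model.eigen (0 : K) m w = 0) : w = 0 := by
  have e : ∀ m, br3Model.eigen (0 : K) m w = ∑ q : Fin 3, w q * ev 0 (br3Model.diagAt m q) :=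
    fun _ => rfl
  have h0 := h 0 (by decide)
  have h1 := h 1 (by decide)
  have h2 := h 2 (by decide)
  rw [e, Fin.sum_univ_three] at h0 h1 h2
  simp [Model.diagAt, Model.br, Model.row, br3Model, coefAt, two_eq_neg_one K, cAdd] at h0 h1 h2
  ext i
  change Fin 3 at i
  have h3 : w (0 : Fin 3) = 0 := by linear_combination -h0 - h2
  have h4 : w (2 : Fin 3) = 0 := by linear_combination h0 - h1
  fin_cases i
  exacts [h3, h2, h4]

theorem brj_unitsAt [CharP K 3] : brjModel.UnitsAt (0 : K) := by
  intro c hc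
  simp only [brjModel, List.mem_cons, List.not_mem_nil, or_false] at hc
  rcases hc with rfl | rfl <;> simp [two_eq_neg_one K]

theorem brj_isSymm : (brjMatrix K).IsSymm := by
  ext i j
  fin_cases i <;> fin_cases j <;> rfl

theorem brj_presents [CharP K 3] : brjModel.Presents (0 : K) (brjMatrix K) brjParity where
  units := brj_unitsAt K
  cartan i j := by
    change Fin 2 at i j
    fin_cases i <;> fin_cases j <;>
      simp [Model.cartanAt, brjModel, brjMatrix, two_eq_neg_one K]
  parH := by decide
  parX := by unfold brjParity; change ∀ i : Fin 2, _; decide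
  parY := by unfold brjParity; change ∀ i : Fin 2, _; decide
  wtH := by decide
  wtX := by decide
  wtY := by decide
  lin_h := by
    have : CharP K brjModel.p := ‹CharP K 3›
    have h := brj_chkUnique
    simp only [Model.chkUnique, Bool.and_eq_true] at h
    exact Model.linearIndependent_h (by decide) (brj_unitsAt K) h.1.2 _

theorem brj_eigen [CharP K 3] (w : Fin brjModel.n → K)
    (h : ∀ m < brjModel.n, brjModel.eigen (0 : K) m w = 0) : w = 0 := by
  have e : ∀ m, brjModel.eigen (0 : K) m w = ∑ q : Fin 2, w q * ev 0 (brjModel.diagAt m q) :=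
    fun _ => rfl
  have h0 := h 0 (by decide)
  have h1 := h 1 (by decide)
  rw [e, Fin.sum_univ_two] at h0 h1
  simp [Model.diagAt, Model.br, Model.row, brjModel, coefAt, two_eq_neg_one K, cAdd] at h0 h1
  ext i
  change Fin 2 at i
  fin_cases i
  exacts [h1, h0]

/-- The theorem for `br(3)`. -/
theorem br3_deforms [CharP K 3] :
    IsLieSuper (br3Parts K) (br3Bracket K) ∧
    ∃ B, (IsStandardForm (br3Matrix K) 0 1 (br3Matrix K) B ∧
        ∀ B', IsStandardForm (br3Matrix K) 0 1 (br3Matrix K) B' → B' = B) ∧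
      IsNIS (br3Parts K) (br3Bracket K) B ∧
      ∃ (m : ℕ) (c : Fin m → Bil K (Br3 K)),
        IsCohomologyBasis (br3Parts K) (br3Bracket K) c ∧
        ∀ (i : Fin m) (l : K),
          IsLieSuper (br3Parts K) (br3Bracket K + l • c i) ∧
          IsNIS (br3Parts K) (br3Bracket K + l • c i) B := by
  exact @Model.exists_deforms K _ br3Model 0 ‹_› _ _ _ _ br3_valid (br3_presents K)
    (br3_isSymm K) [1] (by simp) br3_chkGram br3_chkSym br3_chkInv br3_chkStd br3_chkNondeg br3_chkUnique br3_chkDiag (br3_eigen K)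
    br3Roots br3_nilOK _ _ br3_chkH2 _ br3_chkDual

/-- The theorem for the even cocycles of `brj(2;3)`. -/
theorem brj_deforms [CharP K 3] :
    IsLieSuper (brjParts K) (brjBracket K) ∧
    ∃ B, (IsStandardForm (brjMatrix K) brjParity 1 (brjMatrix K) B ∧
        ∀ B', IsStandardForm (brjMatrix K) brjParity 1 (brjMatrix K) B' → B' = B) ∧
      IsNIS (brjParts K) (brjBracket K) B ∧
      ∃ (m : ℕ) (c : Fin m → Bil K (Brj K)),
        IsCohomologyBasis (brjParts K) (brjBracket K) c ∧
        ∀ (i : Fin m) (l : K),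
          IsLieSuper (brjParts K) (brjBracket K + l • c i) ∧
          IsNIS (brjParts K) (brjBracket K + l • c i) B := by
  exact @Model.exists_deforms K _ brjModel 0 ‹_› _ _ _ _ brj_valid (brj_presents K)
    (brj_isSymm K) [1] (by simp) brj_chkGram brj_chkSym brj_chkInv brj_chkStd brj_chkNondeg brj_chkUnique brj_chkDiag (brj_eigen K)
    brjRoots brj_nilOK _ _ brj_chkH2 _ brj_chkDual

theorem brj_isCoboundary_of_odd [CharP K 3] (z : Bil K (Brj K))
    (hz : IsCocycle (brjParts K) (brjBracket K) 1 z) :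
    IsCoboundary (brjParts K) (brjBracket K) 1 z := by
  have : CharP K brjModel.p := ‹CharP K 3›
  exact Model.isCoboundary_of_odd brj_valid (brj_presents K) brj_chkDiag (brj_eigen K)
    brj_chkH2Odd z hz

end StructConst

namespace StructConst

/-! ### The deformation along the parameter of a table -/

section Closed

variable {K V : Type*} [Field K] [AddCommGroup V] [Module K V] {β c : Bil K V}

/-- If the cocycle identity holds with `a` and with `b` as the first element, then it holds with
their bracket: the identity for `a` says that `c (a, ·)` is a derivation up to the derivative of
`c` along `ad a`. -/
theorem closed_closure (hj : ∀ x y z, β x (β y z) = β (β x y) z + β y (β x z)) {a b : V}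
    (ha : ∀ y z, β a (c y z) + c a (β y z) =
      β (c a y) z + c (β a y) z + (β y (c a z) + c y (β a z)))
    (hb : ∀ y z, β b (c y z) + c b (β y z) =
      β (c b y) z + c (β b y) z + (β y (c b z) + c y (β b z))) (y z : V) :
    β (β a b) (c y z) + c (β a b) (β y z) =
      β (c (β a b) y) z + c (β (β a b) y) z + (β y (c (β a b) z) + c y (β (β a b) z)) := by
  have hD : ∀ v, β (β a b) v = β a (β b v) - β b (β a v) := fun v => by
    rw [hj a b v]
    abel
  have hC : ∀ v, c (β a b) v = β a (c b v) + c a (β b v) - β (c a b) v - β b (c a v) -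
      c b (β a v) := fun v => by
    linear_combination (norm := module) -ha b v
  have h1 := congrArg (β a) (hb y z)
  have h2 := congrArg (β b) (ha y z)
  simp only [map_add] at h1 h2
  rw [hD, hD, hD, hC, hC, hC]
  simp only [map_add, map_sub, LinearMap.add_apply, LinearMap.sub_apply]
  rw [hj a y z, hj b y z, map_add, map_add]
  linear_combination (norm := module) h1 - h2 + hj a (c b y) z + hj a y (c b z) -
    hj b (c a y) z - hj b y (c a z) + ha (β b y) z + ha y (β b z) - hb (β a y) z - hb y (β a z)
    - hj (c a b) y z

end Closed

section Deriv

open Polynomial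

variable {K V : Type*} [Field K] [AddCommGroup V] [Module K V]

theorem map_ev {R S : Type*} [CommSemiring R] [CommSemiring S] (f : R →+* S) (t : R) (c : Coef) :
    f (ev t c) = ev (f t) c := by
  induction c with
  | nil => simp [ev]
  | cons a l ih => simp [ev, ih]

theorem natDegree_ev_le (t : K) (c : Coef) : (ev (C t + X) c).natDegree ≤ c.length := by
  induction c with
  | nil => simp
  | cons a l ih =>
    rw [ev_cons, List.length_cons]
    refine (natDegree_add_le _ _).trans (max_le (by simp) ((natDegree_mul_le).trans ?_))
    rw [add_comm l.length]
    refine add_le_add ((natDegree_add_le _ _).trans (max_le (by simp) natDegree_X_le)) ih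

theorem coeff_zero_ev (t : K) (c : Coef) : (ev (C t + X) c).coeff 0 = ev t c := by
  rw [coeff_zero_eq_eval_zero, ← coe_evalRingHom, map_ev]
  simp

theorem coeff_one_ev (t : K) (c : Coef) : (ev (C t + X) c).coeff 1 = ev t (derivCoef c) := by
  induction c with
  | nil => rfl
  | cons a l ih =>
    rw [ev_cons, derivCoef, ev_cAdd, ev_cons, ← ih, ← coeff_zero_ev, add_mul, coeff_add, coeff_add,
      coeff_C_mul, coeff_X_mul, coeff_natCast_ite]
    simp [add_comm]

variable {M : Model} {t : K} {F : Frame K V M.dim} {P : ZMod 2 → Submodule K V} {β c : Bil K V}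

/-- The coefficient of `l ^ k` in the bracket whose structure constants are those of the table at
`t + l`. -/
noncomputable def Model.taylor (M : Model) (t : K) (F : Frame K V M.dim) (k : ℕ) : Bil K V :=
  F.bilin fun i j => ((M.br i j).map fun y => (ev (C t + X) y.2).coeff k • F.e y.1).sum

theorem Model.taylor_e (hM : M.Valid) (t : K) (F : Frame K V M.dim) (k i j : ℕ) :
    M.taylor t F k (F.e i) (F.e j) =
      ((M.br i j).map fun y => (ev (C t + X) y.2).coeff k • F.e y.1).sum := by
  by_cases hi : i < M.dim
  · by_cases hj : j < M.dim
    · exact F.bilin_e _ hi hj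
    · rw [M.br_out hM.len (Or.inr (not_lt.1 hj)), F.e_out j (not_lt.1 hj)]
      simp
  · rw [M.br_out hM.len (Or.inl (not_lt.1 hi)), F.e_out i (not_lt.1 hi)]
    simp

theorem Rep.taylor_zero (hM : M.Valid) (R : Rep M t F P β) : M.taylor t F 0 = β := by
  refine F.bilin_ext fun i _ j _ => ?_
  rw [M.taylor_e hM, R.br]
  simp only [coeff_zero_ev]
  induction M.br i j with
  | nil => rfl
  | cons y u ih => rw [List.map_cons, List.sum_cons, val_cons, ih]

theorem Model.taylor_one_e (hM : M.Valid) (t : K) (F : Frame K V M.dim) (i j : ℕ) :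
    M.taylor t F 1 (F.e i) (F.e j) = val F.e t (M.deriv.br i j) := by
  rw [M.taylor_e hM, show M.deriv.br i j = _ from M.br_mapCoef derivCoef i j]
  simp only [coeff_one_ev]
  induction M.br i j with
  | nil => rfl
  | cons y u ih => rw [List.map_cons, List.sum_cons, List.map_cons, val_cons, ih]

theorem Rep.taylor_one (hM : M.Valid) (R : Rep M t F P β) :
    Rep M.deriv t F P (M.taylor t F 1) :=
  ⟨R.part, M.taylor_one_e hM t F⟩

/-- The bracket given by the table at `t + l`. -/
theorem Rep.polyBracket (hM : M.Valid) (R : Rep M t F P β) {N : ℕ} (hN : M.chkDeg N = true)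
    (l : K) : Rep M (t + l) F P (polyBracket (M.taylor t F) N l) where
  part := R.part
  br i j := by
    have key : ∀ u : SVec, (∀ y ∈ u, y.2.length ≤ N) →
        ∑ k ∈ Finset.range (N + 1), l ^ k •
          (u.map fun y => (ev (C t + X) y.2).coeff k • F.e y.1).sum = val F.e (t + l) u := by
      intro u
      induction u with
      | nil => simp
      | cons y u ih =>
        intro h
        simp only [List.map_cons, List.sum_cons, smul_add, Finset.sum_add_distrib]
        rw [ih fun z hz => h z (by simp [hz]), val_cons]
        congr 1
        have h1 : (ev (C t + X) y.2).eval l = ev (t + l) y.2 := by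
          rw [← coe_evalRingHom, map_ev]
          simp
        rw [← h1, eval_eq_sum_range' (Nat.lt_succ_of_le
          ((natDegree_ev_le t y.2).trans (h y (by simp)))), Finset.sum_smul]
        exact Finset.sum_congr rfl fun k _ => by rw [smul_smul, mul_comm]
    simp only [NISDeform.polyBracket, LinearMap.sum_apply, LinearMap.smul_apply, M.taylor_e hM]
    by_cases hi : i < M.dim
    · by_cases hj : j < M.dim
      · exact key _ fun y hy => Nat.le_of_ble_eq_true
          (List.all_eq_true.1 (of_upto (of_upto hN i hi) j hj) y hy)
      · exact key _ (by simp [M.br_out hM.len (Or.inr (not_lt.1 hj))])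
    · exact key _ (by simp [M.br_out hM.len (Or.inl (not_lt.1 hi))])

theorem Model.taylor_mem (hM : M.Valid) (t : K) (F : Frame K V M.dim) (k : ℕ)
    {w w' : Fin M.n → ℤ} {a b : V} (ha : a ∈ F.graded M.weight w) (hb : b ∈ F.graded M.weight w') :
    M.taylor t F k a b ∈ F.graded M.weight (w + w') := by
  refine F.bilin_mem_of_graded _ _ (fun i hi j hj hiw hjw => ?_) ha hb
  rw [M.taylor_e hM]
  refine list_sum_mem fun v hv => ?_
  obtain ⟨y, hy, rfl⟩ := List.mem_map.1 hv
  refine Submodule.smul_mem _ _ ?_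
  rw [← hiw, ← hjw, ← Model.wt_add hM.wt hi hj hy]
  exact F.e_mem_graded (Model.par_add hM.par hi hj hy).1

/-- If all basis vectors are even, then there is no odd part. -/
theorem Rep.eq_bot (R : Rep M t F P β) (h : ∀ i < M.dim, M.pr i % 2 = 0) : P 1 = ⊥ := by
  rw [R.part]
  refine Submodule.span_eq_bot.2 ?_
  rintro _ ⟨i, hi, h1, rfl⟩
  have h0 : M.parity i = 0 :=
    (ZMod.natCast_eq_zero_iff _ 2).2 (Nat.dvd_of_mod_eq_zero (h i hi))
  rw [h0] at h1
  exact absurd h1 (by decide)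

/-- The derivative of the bracket with respect to the parameter is a cocycle. -/
theorem Rep.isCocycle_deriv [CharP K M.p] (hM : M.Valid) (R : Rep M t F P β)
    (R' : Rep M.deriv t F P c) (hc : M.chkClosed = true) : IsCocycle P β 0 c := by
  simp only [Model.chkClosed, Bool.and_eq_true] at hc
  obtain ⟨⟨⟨hpar, hP⟩, hS⟩, hcl⟩ := hc
  have hp0 : ∀ i < M.dim, M.pr i % 2 = 0 := fun i hi => Nat.eq_of_beq_eq_true (of_upto hpar i hi)
  have hbot := R.eq_bot hp0
  have H := R.isLieSuper' hM
  have htop : ∀ v : V, v ∈ P 0 := fun v => by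
    have := H.compl.sup_eq_top
    rw [hbot, sup_bot_eq] at this
    rw [this]
    exact Submodule.mem_top
  have hz : ∀ i : ZMod 2, i = 0 ∨ i = 1 := by decide
  have hj : ∀ x y z, β x (β y z) = β (β x y) z + β y (β x z) := fun x y z => by
    simpa using H.jacobi 0 0 x (htop x) y (htop y) z
  have hgen : ∀ g, (∀ j < M.dim, ∀ k < M.dim, M.closedOK g j k = true) → ∀ y z,
      β (F.e g) (c y z) + c (F.e g) (β y z) =
      β (c (F.e g) y) z + c (β (F.e g) y) z + (β y (c (F.e g) z) + c y (β (F.e g) z)) := by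
    intro g hg y z
    let L : Bil K V := c.compr₂ (β (F.e g)) + β.compr₂ (c (F.e g))
    let L' : Bil K V := β ∘ₗ c (F.e g) + c ∘ₗ β (F.e g) +
      (β.compl₂ (c (F.e g)) + c.compl₂ (β (F.e g)))
    suffices h : L = L' from LinearMap.congr_fun₂ h y z
    refine F.bilin_ext fun j hj k hk => ?_
    have h := F.val_eq_zero (p := M.p) t (hg j hj k hk)
    have e1 := R'.adl
    have e2 := R'.adr
    simp only [val_append, val_sSgn _ _ hM.p_pos] at h
    rw [← R.adl, ← e1, ← R.adr, ← e2, ← R.adl, ← e1, ← R.br, ← R.br, ← R.br, ← R'.br, ← R'.br,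
      ← R'.br] at h
    simp only [L, L', LinearMap.add_apply, LinearMap.compr₂_apply, LinearMap.comp_apply,
      LinearMap.compl₂_apply]
    linear_combination (norm := module) h
  -- the elements for which the cocycle identity holds with them in the first place
  let Q : Submodule K V :=
    { carrier := {x | ∀ y z, β x (c y z) + c x (β y z) =
        β (c x y) z + c (β x y) z + (β y (c x z) + c y (β x z))}
      add_mem' := fun {a b} ha hb y z => by
        simp only [map_add, LinearMap.add_apply]
        linear_combination (norm := module) ha y z + hb y z
      zero_mem' := by simp
      smul_mem' := fun s a ha y z => by
        simp only [map_smul, LinearMap.smul_apply]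
        linear_combination (norm := module) s • ha y z }
  have hQ := R.generate hM.words (fun _ => (0 : ℕ)) (by simp) (fun _ => Q)
    (fun _ _ a ha b hb => closed_closure hj ha hb)
    (fun i hi => hgen _ fun j hj k hk => by
      have := of_upto (of_upto (of_upto hcl i hi) j hj) k hk
      rw [Bool.and_eq_true] at this
      exact this.1)
    (fun i hi => hgen _ fun j hj k hk => by
      have := of_upto (of_upto (of_upto hcl i hi) j hj) k hk
      rw [Bool.and_eq_true] at this
      exact this.2)
  have hall : ∀ x, x ∈ Q := fun x => by
    rw [F.expand x]
    exact Submodule.sum_mem _ fun k hk => Submodule.smul_mem _ _ (hQ k (Finset.mem_range.1 hk))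
  refine ⟨fun i j a ha b hb => by simpa using R'.mem hP i j a ha b hb,
    R'.skew hM.p_pos hS, R'.alt hM.p_pos hS, fun i j x hx y hy z => ?_, fun x hx => ?_⟩
  · rcases hz i with rfl | rfl
    · rcases hz j with rfl | rfl
      · simpa using hall x y z
      · rw [hbot, Submodule.mem_bot] at hy
        simp [hy]
    · rw [hbot, Submodule.mem_bot] at hx
      simp [hx]
  · rw [hbot, Submodule.mem_bot] at hx
    simp [hx]

end Deriv

end StructConst

namespace StructConst

/-! ### Uniqueness of invariant forms -/

section FormRun

variable {K V : Type*} [Field K] [AddCommGroup V] [Module K V] {M : Model} {t : K}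
  {F : Frame K V M.dim} {P : ZMod 2 → Submodule K V} {β : Bil K V} {B : LinearMap.BilinForm K V}

/-- The value of a form at the pair of basis vectors with the given number. -/
def formCoord {N : ℕ} (F : Frame K V N) (B : LinearMap.BilinForm K V) (c : ℕ) : K :=
  B (F.e (c / N)) (F.e (c % N))

theorem formCoord_formCode (hs : ∀ x y, B x y = B y x) {i j : ℕ} (hi : i < M.dim)
    (hj : j < M.dim) : formCoord F B (M.formCode i j) = B (F.e i) (F.e j) := by
  have h0 : 0 < M.dim := by omega
  have key : ∀ a b, b < M.dim → formCoord F B (a * M.dim + b) = B (F.e a) (F.e b) := by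
    intro a b hb
    rw [formCoord, mul_comm, Nat.mul_add_div h0, Nat.div_eq_of_lt hb, add_zero, Nat.mul_add_mod,
      Nat.mod_eq_of_lt hb]
  unfold Model.formCode
  cases Nat.ble i j
  · rw [cond_false, key j i hi, hs]
  · rw [cond_true, key i j hj]

theorem val_formTerms [CharP K M.p] (hp : 0 < M.p) (R : Rep M t F P β)
    (hlt : ∀ i j, ∀ y ∈ M.br i j, y.1 < M.dim) (hs : ∀ x y, B x y = B y x)
    (hi : ∀ x y z, B (β x y) z = B x (β y z)) {a b k : ℕ} (ha : a < M.dim) (hk : k < M.dim) :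
    val (formCoord F B) t (M.formTerms a b k) = 0 := by
  have h1 : ∀ u : SVec, (∀ y ∈ u, y.1 < M.dim) →
      val (formCoord F B) t (u.map fun y => (M.formCode y.1 k, y.2)) =
        B (val F.e t u) (F.e k) := by
    intro u
    induction u with
    | nil => simp
    | cons y u ih =>
      intro hu
      rw [List.map_cons, val_cons, val_cons, ih fun z hz => hu z (by simp [hz]),
        formCoord_formCode hs (hu y (by simp)) hk]
      simp
  have h2 : ∀ u : SVec, (∀ y ∈ u, y.1 < M.dim) →
      val (formCoord F B) t (u.map fun y => (M.formCode a y.1, y.2)) =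
        B (F.e a) (val F.e t u) := by
    intro u
    induction u with
    | nil => simp
    | cons y u ih =>
      intro hu
      rw [List.map_cons, val_cons, val_cons, ih fun z hz => hu z (by simp [hz]),
        formCoord_formCode hs ha (hu y (by simp))]
      simp
  rw [Model.formTerms, val_append, val_sSgn _ _ hp, h1 _ (hlt a b), h2 _ (hlt b k), ← R.br,
    ← R.br, hi]
  simp

theorem of_formRun [CharP K M.p] (hp : 0 < M.p) (hu : M.UnitsAt t) (R : Rep M t F P β)
    (hlt : ∀ i j, ∀ y ∈ M.br i j, y.1 < M.dim) (hs : ∀ x y, B x y = B y x)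
    (hi : ∀ x y z, B (β x y) z = B x (β y z)) (l : List ℕ) {S : ℕ}
    (hS : ∀ c, S.testBit c = true → formCoord F B c = 0) :
    ∀ c, (M.formRun l S).testBit c = true → formCoord F B c = 0 := by
  induction l generalizing S with
  | nil => exact hS
  | cons a l ih =>
    rw [Model.formRun, Model.force_eq]
    refine ih ?_
    by_cases h : Nat.blt a (M.dim * M.dim * M.dim) = true
    · rw [h, cond_true]
      rw [Nat.blt_eq] at h
      have h0 : 0 < M.dim := by
        rcases Nat.eq_zero_or_pos M.dim with h0 | h0
        · rw [h0] at h
          simp at h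
        · exact h0
      refine of_solve hp hu (val_formTerms hp R hlt hs hi ?_ (Nat.mod_lt _ h0)) hS
      rw [Nat.div_div_eq_div_mul]
      exact Nat.div_lt_of_lt_mul (h.trans_eq (by ring))
    · rw [Bool.not_eq_true] at h
      rwa [h, cond_false]

/-- An invariant form vanishes on all pairs that are not in `T` if it does on those in `S`. -/
theorem eq_zero_of_formOK [CharP K M.p] (hp : 0 < M.p) (hu : M.UnitsAt t) (R : Rep M t F P β)
    (hlt : ∀ i j, ∀ y ∈ M.br i j, y.1 < M.dim) (hs : ∀ x y, B x y = B y x)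
    (hi : ∀ x y z, B (β x y) z = B x (β y z)) {l : List ℕ} {S T : ℕ}
    (hS : ∀ c, S.testBit c = true → formCoord F B c = 0) (h : M.formOK l S T = true) {i j : ℕ}
    (hi' : i < M.dim) (hj : j < M.dim) (hT : T.testBit (M.formCode i j) = false) :
    B (F.e i) (F.e j) = 0 := by
  rw [Model.formOK, Model.force_eq] at h
  have := of_upto (of_upto h i hi') j hj
  rw [hT, Bool.or_false] at this
  rw [← formCoord_formCode hs hi' hj]
  exact of_formRun hp hu R hlt hs hi l hS _ this

theorem Rep.withUnits (R : Rep M t F P β) (U : List Coef) : Rep (M.withUnits U) t F P β :=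
  ⟨R.part, R.br⟩

theorem ev_zero_take (c : Coef) : ev (0 : K) (c.take 1) = ev 0 c := by
  cases c <;> simp

/-- At the parameter `0` only the constant terms of the structure constants matter. -/
theorem Rep.atZero (R : Rep M (0 : K) F P β) : Rep (M.mapCoef (List.take 1)) 0 F P β where
  part := R.part
  br i j := by
    rw [R.br, M.br_mapCoef]
    induction M.br i j with
    | nil => rfl
    | cons y u ih =>
      rw [List.map_cons, val_cons, val_cons, ih, ev_zero_take]

theorem isInvariantForm_sub_smul {B₁ B₂ : LinearMap.BilinForm K V} (h₁ : IsInvariantForm P β B₁)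
    (h₂ : IsInvariantForm P β B₂) (s : K) : IsInvariantForm P β (B₂ - s • B₁) where
  even i j hij a ha b hb := by simp [h₁.even i j hij a ha b hb, h₂.even i j hij a ha b hb]
  supersymm i j a ha b hb := by
    simp only [LinearMap.sub_apply, LinearMap.smul_apply, smul_eq_mul]
    rw [h₁.supersymm i j a ha b hb, h₂.supersymm i j a ha b hb]
    ring
  invariant a b c := by simp [h₁.invariant, h₂.invariant]

/-- Without an odd part, invariant forms are symmetric. -/
theorem IsInvariantForm.symm (hP : IsCompl (P 0) (P 1)) (h : P 1 = ⊥) (hB : IsInvariantForm P β B)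
    (x y : V) : B x y = B y x := by
  have htop : ∀ v : V, v ∈ P 0 := fun v => by
    have := hP.sup_eq_top
    rw [h, sup_bot_eq] at this
    rw [this]
    exact Submodule.mem_top
  simpa using hB.supersymm 0 0 x (htop x) y (htop y)

end FormRun

end StructConst

namespace StructConst

/-! ### The algebra in characteristic 2: presentation and basis -/

section WkPresents

variable {K : Type*} [Field K] [CharP K 2]

theorem wk_unitsAt {t : K} (h0 : t ≠ 0) (h1 : t ≠ 1) : wkModel.UnitsAt t := by
  have h2 : (2 : K) = 0 := CharTwo.two_eq_zero
  have h1' : 1 + t ≠ 0 := fun h => h1 (by linear_combination h - h2)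
  have key : ∀ {c : Coef} (a b : ℕ), ev t c = t ^ a * (1 + t) ^ b → ev t c ≠ 0 := by
    intro c a b h
    rw [h]
    exact mul_ne_zero (pow_ne_zero _ h0) (pow_ne_zero _ h1')
  intro c hc
  simp only [wkModel, List.mem_cons, List.not_mem_nil, or_false] at hc
  rcases hc with rfl | rfl | rfl | rfl | rfl | rfl | rfl
  · exact key 0 0 (by simp)
  · exact key 1 0 (by simp)
  · exact key 0 1 (by simp)
  · exact key 1 1 (by simp)
  · exact key 2 0 (by simp; ring)
  · exact key 2 1 (by simp; ring)
  · exact key 1 2 (by simp only [ev_cons, ev_nil]; push_cast; linear_combination (-t ^ 2) * h2)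

theorem wk_presents {α : K} (h0 : α ≠ 0) (h1 : α ≠ 1) :
    wkModel.Presents α (wkMatrix α) 0 where
  units := wk_unitsAt h0 h1
  cartan i j := by
    change Fin 4 at i j
    fin_cases i <;> fin_cases j <;> simp [Model.cartanAt, wkModel, wkMatrix]
  parH := by decide
  parX := by decide
  parY := by decide
  wtH := by decide
  wtX := by decide
  wtY := by decide
  lin_h := by
    have : CharP K wkModel.p := ‹CharP K 2›
    have h := wk_chkUnique
    simp only [Model.chkUnique, Bool.and_eq_true] at h
    exact Model.linearIndependent_h (by decide) (wk_unitsAt h0 h1) h.1.2 _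

omit [CharP K 2] in
theorem wk_isSymm (α : K) : (wkMatrix α).IsSymm := by
  ext i j
  fin_cases i <;> fin_cases j <;> rfl

omit [CharP K 2] in
theorem wk_eigen {α : K} (h0 : α ≠ 0) (w : Fin wkModel.n → K)
    (h : ∀ m < wkModel.n, wkModel.eigen α m w = 0) : w = 0 := by
  have e : ∀ m, wkModel.eigen α m w = ∑ q : Fin 4, w q * ev α (wkModel.diagAt m q) :=
    fun _ => rfl
  have e0 := h 0 (by decide)
  have e1 := h 1 (by decide)
  have e2 := h 2 (by decide)
  have e3 := h 3 (by decide)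
  rw [e, Fin.sum_univ_four] at e0 e1 e2 e3
  simp [Model.diagAt, Model.br, Model.row, wkModel, coefAt, cAdd] at e0 e1 e2 e3
  have h2 : w (2 : Fin 4) = 0 := by linear_combination e3 - α * e1
  have h1 : w (1 : Fin 4) = 0 := by
    refine (mul_eq_zero.1 ?_).resolve_right h0
    linear_combination e0 - h2
  have h3 : w (3 : Fin 4) = 0 := by linear_combination e2 - e1
  ext i
  change Fin 4 at i
  fin_cases i
  exacts [e1, h1, h2, h3]

end WkPresents

section WkBasis

variable {K V : Type*} [Field K] [AddCommGroup V] [Module K V]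

/-- The multiplicities of the second simple root in the 15 positive roots. -/
def wkDeg : Fin 15 → ℕ := ![0, 1, 0, 0, 1, 0, 0, 1, 0, 1, 1, 1, 1, 1, 2]

theorem wk_rootVectors {t : K} {F : Frame K V wkModel.dim} {P : ZMod 2 → Submodule K V}
    {β : Bil K V} (R : Rep wkModel t F P β) {o : ℕ} (ho : o = 4 ∨ o = 19) (s : K)
    {g : Fin 4 → V} (hg : g = ![F.e o, s • F.e (o + 1), F.e (o + 2), F.e (o + 3)]) (j : Fin 15) :
    wkRootVectors β g j = s ^ wkDeg j • F.e (o + j) := by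
  have hbr : ∀ i j k, wkModel.br i j = [(k, [1])] → β (F.e i) (F.e j) = F.e k := fun i j k h => by
    rw [R.br, h]
    simp
  have h5 : β (F.e o) (F.e (o + 1)) = F.e (o + 4) := hbr _ _ _ (by rcases ho with rfl | rfl <;> rfl)
  have h6 : β (F.e o) (F.e (o + 2)) = F.e (o + 5) := hbr _ _ _ (by rcases ho with rfl | rfl <;> rfl)
  have h7 : β (F.e (o + 2)) (F.e (o + 3)) = F.e (o + 6) :=
    hbr _ _ _ (by rcases ho with rfl | rfl <;> rfl)
  have h8 : β (F.e (o + 2)) (F.e (o + 4)) = F.e (o + 7) :=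
    hbr _ _ _ (by rcases ho with rfl | rfl <;> rfl)
  have h9 : β (F.e (o + 3)) (F.e (o + 5)) = F.e (o + 8) :=
    hbr _ _ _ (by rcases ho with rfl | rfl <;> rfl)
  have h10 : β (F.e (o + 4)) (F.e (o + 5)) = F.e (o + 9) :=
    hbr _ _ _ (by rcases ho with rfl | rfl <;> rfl)
  have h11 : β (F.e (o + 4)) (F.e (o + 6)) = F.e (o + 10) :=
    hbr _ _ _ (by rcases ho with rfl | rfl <;> rfl)
  have h12 : β (F.e (o + 4)) (F.e (o + 8)) = F.e (o + 11) :=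
    hbr _ _ _ (by rcases ho with rfl | rfl <;> rfl)
  have h13 : β (F.e (o + 7)) (F.e (o + 8)) = F.e (o + 12) :=
    hbr _ _ _ (by rcases ho with rfl | rfl <;> rfl)
  have h14 : β (F.e (o + 8)) (F.e (o + 9)) = F.e (o + 13) :=
    hbr _ _ _ (by rcases ho with rfl | rfl <;> rfl)
  have h15 : β (F.e (o + 9)) (F.e (o + 10)) = F.e (o + 14) :=
    hbr _ _ _ (by rcases ho with rfl | rfl <;> rfl)
  subst hg
  fin_cases j <;>
    simp [wkRootVectors, wkDeg, h5, h6, h7, h8, h9, h10, h11, h12, h13, h14, h15, pow_two,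
      smul_smul]

/-- The Chevalley basis of `wk(4;α)`, expressed in the basis `e`. -/
def wkCoordBasis {N : ℕ} (α : K) (F : Frame K V N) : Fin 4 ⊕ (Fin 15 ⊕ Fin 15) → V :=
  Sum.elim ![F.e 0, α • F.e 1, F.e 2, F.e 3 + α • F.e 1]
    (Sum.elim (fun j => F.e (4 + j)) fun j => α ^ wkDeg j • F.e (19 + j))

theorem wkBasis_eq {α : K} {F : Frame K (Wk α) wkModel.dim}
    (R : Rep wkModel α F (wkParts α) (wkBracket α))
    (hg : ∀ a : Gen 4, NISDeform.gen (wkMatrix α) 0 a = val F.e α (wkModel.gen a)) :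
    wkBasis α = wkCoordBasis α F := by
  funext i
  rcases i with i | i | i
  · simp only [wkBasis, wkCoordBasis, Sum.elim_inl, hg]
    fin_cases i <;> simp [Model.gen, wkModel, add_comm]
  · simp only [wkBasis, wkCoordBasis, Sum.elim_inl, Sum.elim_inr, hg]
    rw [wk_rootVectors R (Or.inl rfl) 1, one_pow, one_smul]
    funext i
    fin_cases i <;> simp [Model.gen, wkModel]
  · simp only [wkBasis, wkCoordBasis, Sum.elim_inr, hg]
    rw [wk_rootVectors R (Or.inr rfl) α]
    funext i
    fin_cases i <;> simp [Model.gen, wkModel]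

theorem Frame.linearIndependent {N : ℕ} (F : Frame K V N) :
    LinearIndependent K fun i : Fin N => F.e i := by
  rw [Fintype.linearIndependent_iff]
  intro g hg i
  have := congrArg (F.x i) hg
  rw [map_sum, map_zero, Finset.sum_eq_single i] at this
  · simpa [F.x_e _ _ i.2] using this
  · intro j _ hj
    have : (j : ℕ) ≠ i := fun h => hj (Fin.ext h)
    simp [F.x_e _ _ i.2, this]
  · simp

theorem Frame.span_eq_top {N : ℕ} (F : Frame K V N) (U : Submodule K V)
    (h : ∀ k < N, F.e k ∈ U) : U = ⊤ := by
  refine eq_top_iff.2 fun v _ => ?_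
  rw [F.expand v]
  exact Submodule.sum_mem _ fun k hk => U.smul_mem _ (h k (Finset.mem_range.1 hk))

theorem Frame.finrank {N : ℕ} (F : Frame K V N) : Module.finrank K V = N := by
  have h := F.span_eq_top (Submodule.span K (Set.range fun i : Fin N => F.e i))
    fun k hk => Submodule.subset_span ⟨⟨k, hk⟩, rfl⟩
  rw [Module.finrank_eq_card_basis (Module.Basis.mk F.linearIndependent h.ge), Fintype.card_fin]

theorem wkCoordBasis_isBasis {α : K} (h0 : α ≠ 0) (F : Frame K V wkModel.dim) :
    LinearIndependent K (wkCoordBasis α F) ∧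
      Submodule.span K (Set.range (wkCoordBasis α F)) = ⊤ := by
  set U := Submodule.span K (Set.range (wkCoordBasis α F))
  have hm : ∀ i, wkCoordBasis α F i ∈ U := fun i => Submodule.subset_span ⟨i, rfl⟩
  have hsp : U = ⊤ := by
    refine F.span_eq_top U fun k hk => ?_
    have hk : k < 34 := hk
    have e1 : F.e 1 ∈ U := (Submodule.smul_mem_iff U h0).1 (hm (Sum.inl 1))
    have hx : ∀ j (hj : j < 15), F.e (4 + j) ∈ U := fun j hj => hm (Sum.inr (Sum.inl ⟨j, hj⟩))
    have hy : ∀ j (hj : j < 15), F.e (19 + j) ∈ U := fun j hj =>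
      (Submodule.smul_mem_iff U (pow_ne_zero _ h0)).1 (hm (Sum.inr (Sum.inr ⟨j, hj⟩)))
    by_cases h4 : k < 4
    · interval_cases k
      · exact hm (Sum.inl 0)
      · exact e1
      · exact hm (Sum.inl 2)
      · exact (Submodule.add_mem_iff_left U (U.smul_mem α e1)).1 (hm (Sum.inl 3))
    · by_cases h19 : k < 19
      · have := hx (k - 4) (by omega)
        rwa [Nat.add_sub_cancel' (by omega)] at this
      · have := hy (k - 19) (by omega)
        rwa [Nat.add_sub_cancel' (by omega)] at this
  refine ⟨linearIndependent_of_top_le_span_of_card_eq_finrank hsp.ge ?_, hsp⟩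
  rw [F.finrank]
  rfl

end WkBasis

end StructConst

namespace StructConst

/-! ### The algebra in characteristic 2: invariant forms of the deforms -/

section WkForms

variable {K V : Type*} [Field K] [AddCommGroup V] [Module K V]

/-- The pairs of basis vectors on which the form does not vanish for reasons of weight. -/
def wkPaired (i j : ℕ) : Bool :=
  (Nat.blt i 4 && Nat.blt j 4) || (Nat.ble 4 i && Nat.beq j (i + 15)) ||
    (Nat.ble 4 j && Nat.beq i (j + 15))

theorem wkGram_eq_nil {i j : ℕ} (hi : i < 34) (hj : j < 34) (h : wkPaired i j = false) :
    Model.gram wkGram i j = [] := by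
  have : (upto 34 fun i => upto 34 fun j => wkPaired i j || (Model.gram wkGram i j).isEmpty) = true := by
    decide +kernel
  have := of_upto (of_upto this i hi) j hj
  rw [h, Bool.false_or, List.isEmpty_iff] at this
  exact this

theorem wkGram_hh : (List.range 4).map (fun i => (List.range 4).map (Model.gram wkGram i)) =
    [[[], [0, 1], [0, 1], [0, 0, 1]], [[0, 1], [], [], []], [[0, 1], [], [], [0, 1]],
      [[0, 0, 1], [], [0, 1], []]] := by decide

/-- The products of the positive and the negative root vectors. -/
def wkXY : Fin 15 → Coef := ![[0, 1], [1], [0, 1], [0, 1], [0, 1], [0, 1], [0, 1], [0, 1], [0, 1],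
  [0, 1, 1], [0, 1], [0, 1, 1], [0, 1, 1], [0, 0, 1, 1], [0, 0, 1, 1]]

theorem wkGram_xy (j : Fin 15) : Model.gram wkGram (4 + j) (19 + j) = wkXY j ∧
    Model.gram wkGram (19 + j) (4 + j) = wkXY j := by
  revert j
  decide

variable {α t : K} {F : Frame K V wkModel.dim} {B : LinearMap.BilinForm K V}

/-- The Gram matrix of a multiple of the invariant form in the Chevalley basis. -/
theorem hasGram_wkCoordBasis (hB : GramRep t F wkGram B) (s : K)
    {H : Matrix (Fin 4) (Fin 4) K} (hH : H = s • !![0, α * t, t, t ^ 2 + α * t; α * t, 0, 0, 0;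
      t, 0, 0, t; t ^ 2 + α * t, 0, t, 0]) {D : Fin 15 → K}
    (hD : ∀ j, D j = s * (α ^ wkDeg j * ev t (wkXY j))) :
    HasGram (s • B) (wkCoordBasis α F) (Matrix.fromBlocks H 0 0
      (Matrix.fromBlocks 0 (Matrix.diagonal D) (Matrix.diagonal D).transpose 0)) := by
  have h0 : ∀ i < 34, ∀ j < 34, wkPaired i j = false → B (F.e i) (F.e j) = 0 :=
    fun i hi j hj h => by rw [hB, wkGram_eq_nil hi hj h, ev_nil]
  have hu : ∀ i < 4, ∀ j : Fin 15, B (F.e i) (F.e (4 + j)) = 0 ∧ B (F.e (4 + j)) (F.e i) = 0 ∧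
      B (F.e i) (F.e (19 + j)) = 0 ∧ B (F.e (19 + j)) (F.e i) = 0 := by
    have : ∀ i < 4, ∀ j : Fin 15, wkPaired i (4 + j) = false ∧ wkPaired (4 + j) i = false ∧
        wkPaired i (19 + j) = false ∧ wkPaired (19 + j) i = false := by decide
    intro i hi j
    have hj := j.2
    obtain ⟨a, b, c, d⟩ := this i hi j
    exact ⟨h0 _ (by omega) _ (by omega) a, h0 _ (by omega) _ (by omega) b,
      h0 _ (by omega) _ (by omega) c, h0 _ (by omega) _ (by omega) d⟩
  have hxx : ∀ i j : Fin 15, B (F.e (4 + i)) (F.e (4 + j)) = 0 ∧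
      B (F.e (19 + i)) (F.e (19 + j)) = 0 := by
    have : ∀ i j : Fin 15, wkPaired (4 + i) (4 + j) = false ∧
        wkPaired (19 + i) (19 + j) = false := by decide
    intro i j
    have hi := i.2
    have hj := j.2
    exact ⟨h0 _ (by omega) _ (by omega) (this i j).1, h0 _ (by omega) _ (by omega) (this i j).2⟩
  have hxy : ∀ i j : Fin 15, B (F.e (4 + i)) (F.e (19 + j)) = (if i = j then ev t (wkXY j) else 0) ∧
      B (F.e (19 + i)) (F.e (4 + j)) = if i = j then ev t (wkXY j) else 0 := by
    have : ∀ i j : Fin 15, i ≠ j → wkPaired (4 + i) (19 + j) = false ∧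
        wkPaired (19 + i) (4 + j) = false := by decide
    intro i j
    have hi := i.2
    have hj := j.2
    by_cases hij : i = j
    · subst hij
      rw [if_pos rfl, hB, hB, (wkGram_xy i).1, (wkGram_xy i).2]
      exact ⟨rfl, rfl⟩
    · rw [if_neg hij]
      exact ⟨h0 _ (by omega) _ (by omega) (this i j hij).1,
        h0 _ (by omega) _ (by omega) (this i j hij).2⟩
  have hhh : ∀ i < 4, ∀ j < 4, B (F.e i) (F.e j) = ev t ((([[[], [0, 1], [0, 1], [0, 0, 1]], [[0, 1], [], [], []], [[0, 1], [], [], [0, 1]],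
      [[0, 0, 1], [], [0, 1], []]] : List (List Coef)).getD i []).getD j []) := by
    intro i hi j hj
    rw [hB, ← wkGram_hh]
    simp [List.getD_eq_getElem?_getD, hi, hj]
  intro i j
  rcases i with i | i | i <;> rcases j with j | j | j
  · subst hH
    fin_cases i <;> fin_cases j <;> simp [wkCoordBasis, hhh] <;>
      first | ring1 | exact Or.inl (by ring1)
  · fin_cases i <;> simp [wkCoordBasis, hu]
  · fin_cases i <;> simp [wkCoordBasis, hu]
  · fin_cases j <;> simp [wkCoordBasis, hu]
  · simp [wkCoordBasis, hxx]
  · change s * B (F.e (4 + i)) (α ^ wkDeg j • F.e (19 + j)) = Matrix.diagonal D i j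
    rw [map_smul, (hxy i j).1, Matrix.diagonal_apply]
    split_ifs with h
    · rw [h, hD, smul_eq_mul]
    · rw [smul_zero, mul_zero]
  · fin_cases j <;> simp [wkCoordBasis, hu]
  · change s * B (α ^ wkDeg i • F.e (19 + i)) (F.e (4 + j)) = Matrix.diagonal D j i
    rw [map_smul, LinearMap.smul_apply, (hxy i j).2, Matrix.diagonal_apply]
    by_cases h : i = j
    · rw [if_pos h, if_pos h.symm, h, hD, smul_eq_mul]
    · rw [if_neg h, if_neg (Ne.symm h), smul_zero, mul_zero]
  · simp [wkCoordBasis, hxx]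

variable [CharP K 2]

theorem gammaMatrix_eq {l : K} (hl : l ≠ α) : gammaMatrix α l =
    Matrix.fromBlocks ((α + l)⁻¹ • !![0, α * (α + l), α + l, (α + l) ^ 2 + α * (α + l);
      α * (α + l), 0, 0, 0; α + l, 0, 0, α + l; (α + l) ^ 2 + α * (α + l), 0, α + l, 0]) 0 0
      (Matrix.fromBlocks 0
        (Matrix.diagonal fun j => (α + l)⁻¹ * (α ^ wkDeg j * ev (α + l) (wkXY j)))
        (Matrix.diagonal fun j => (α + l)⁻¹ * (α ^ wkDeg j * ev (α + l) (wkXY j))).transpose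
        0) := by
  have h2 : (2 : K) = 0 := CharTwo.two_eq_zero
  have ht : α + l ≠ 0 := fun h => hl (by linear_combination h - α * h2)
  have hH : gammaHH α l = (α + l)⁻¹ • !![0, α * (α + l), α + l, (α + l) ^ 2 + α * (α + l);
      α * (α + l), 0, 0, 0; α + l, 0, 0, α + l; (α + l) ^ 2 + α * (α + l), 0, α + l, 0] := by
    rw [eq_inv_smul_iff₀ ht]
    ext i j
    fin_cases i <;> fin_cases j <;> simp [gammaHH, mul_comm]
    · linear_combination (-(α + l) * α) * h2
    · linear_combination (-(α + l) * α) * h2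
  have hD : gammaXY α l =
      Matrix.diagonal fun j => (α + l)⁻¹ * (α ^ wkDeg j * ev (α + l) (wkXY j)) := by
    unfold gammaXY
    refine congrArg Matrix.diagonal (funext fun j => ?_)
    rw [eq_inv_mul_iff_mul_eq₀ ht]
    fin_cases j <;> simp [wkDeg, wkXY]
    · field_simp
    all_goals first
      | ring1
      | linear_combination (-(α + l) * α * α * l) * h2
      | linear_combination (-(α + l) * α * α * α * l) * h2
  rw [gammaMatrix, hH, hD]

omit [CharP K 2] in
theorem gammaDegenerate_eq (h0 : α ≠ 0) : gammaDegenerate K =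
    Matrix.fromBlocks (α⁻¹ • !![0, α * 0, 0, 0 ^ 2 + α * 0; α * 0, 0, 0, 0; 0, 0, 0, 0;
      0 ^ 2 + α * 0, 0, 0, 0]) 0 0
      (Matrix.fromBlocks 0
        (Matrix.diagonal fun j => α⁻¹ * (α ^ wkDeg j * ev 0 (wkXY j)))
        (Matrix.diagonal fun j => α⁻¹ * (α ^ wkDeg j * ev 0 (wkXY j))).transpose 0) := by
  have hD : ∀ j, α⁻¹ * (α ^ wkDeg j * ev 0 (wkXY j)) = if j = 1 then 1 else 0 := by
    intro j
    fin_cases j <;> simp [wkDeg, wkXY, h0]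
  ext i j
  rcases i with i | i | i <;> rcases j with j | j | j
  · fin_cases i <;> fin_cases j <;> simp [gammaDegenerate, idxX2, idxY2]
  all_goals simp [gammaDegenerate, idxX2, idxY2, Matrix.single_apply, Matrix.diagonal_apply, hD]
  all_goals grind

/-- The invariant forms on the deforms for a nonzero value `t` of the parameter of the table. -/
theorem wk_forms_ne_zero {P : ZMod 2 → Submodule K V} {β : Bil K V} (R : Rep wkModel t F P β)
    (ht : t ≠ 0) (hB : GramRep t F wkGram B) (s : K) (hs : s ≠ 0) :
    IsInvariantForm P β (s • B) ∧ (IsNIS P β (s • B) ↔ t ≠ 1) ∧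
      ∀ B₂, IsInvariantForm P β B₂ → ∃ r : K, B₂ = r • s • B := by
  have hch : CharP K wkModel.p := ‹CharP K 2›
  have hi := isInvariantForm_smul (R.isInvariantForm wk_valid hB wk_chkSym wk_chkInv) s
  have H := R.isLieSuper' wk_valid
  refine ⟨hi, ⟨fun h ht1 => ?_, fun ht1 => ⟨hi, ?_⟩⟩, fun B₂ hB₂ => ?_⟩
  · -- at `t = 1` the vector `e 13` lies in the radical
    have h0 : F.e 13 = 0 := h.nondegenerate.1 _ fun v => by
      have : (s • B) (F.e 13) = 0 := by
        refine LinearMap.ext fun v => F.linearMap_ext (fun j hj => ?_) v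
        rw [LinearMap.smul_apply, LinearMap.smul_apply, hB, LinearMap.zero_apply]
        have hj : j < 34 := hj
        by_cases h28 : j = 28
        · subst h28
          have : Model.gram wkGram 13 28 = [0, 1, 1] := by decide
          have h2 : (1 : K) + 1 = 0 := CharTwo.add_self_eq_zero 1
          simp [this, ht1, h2]
        · have : wkPaired 13 j = false := by
            interval_cases j <;> first | rfl | exact absurd rfl h28
          rw [wkGram_eq_nil (by decide) hj this, ev_nil, smul_zero]
      rw [this, LinearMap.zero_apply]
    have h1 := F.x_e 13 13 (by decide)
    rw [h0, map_zero, if_pos rfl] at h1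
    exact zero_ne_one h1
  · exact nondegenerate_smul (hB.nondegenerate wk_valid (wk_unitsAt ht ht1)
      (R.isInvariantForm wk_valid hB wk_chkSym wk_chkInv) H.compl wk_chkNondeg) hs
  · have hbot := R.eq_bot (by decide +kernel)
    have h520 : (s • B) (F.e 5) (F.e 20) = s := by
      have : Model.gram wkGram 5 20 = [1] := by decide
      rw [LinearMap.smul_apply, LinearMap.smul_apply, hB, this]
      simp
    refine ⟨B₂ (F.e 5) (F.e 20) * s⁻¹, ?_⟩
    have hd := isInvariantForm_sub_smul hi hB₂ (B₂ (F.e 5) (F.e 20) * s⁻¹)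
    rw [← sub_eq_zero]
    have hsymm := IsInvariantForm.symm H.compl hbot hd
    refine F.bilin_ext fun i hi' j hj => ?_
    refine eq_zero_of_formOK (M := wkModel.withUnits [[1], [0, 1]]) (by decide) ?_
      (R.withUnits _) (fun i j => Rep.br_lt wk_valid i j) hsymm hd.invariant (fun c hc => ?_)
      wk_formOK hi' hj (Nat.zero_testBit _)
    · intro c hc
      simp only [Model.withUnits, List.mem_cons, List.not_mem_nil, or_false] at hc
      rcases hc with rfl | rfl <;> simp [ht]
    · rw [Nat.one_shiftLeft, Nat.testBit_two_pow, decide_eq_true_eq] at hc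
      rw [← hc]
      refine (formCoord_formCode (M := wkModel) hsymm (by decide) (by decide)).trans ?_
      rw [LinearMap.sub_apply, LinearMap.sub_apply, LinearMap.smul_apply, LinearMap.smul_apply,
        h520, smul_eq_mul, mul_assoc, inv_mul_cancel₀ hs, mul_one, sub_self]

/-- The invariant forms on the deform for the value `0` of the parameter of the table. -/
theorem wk_forms_zero {P : ZMod 2 → Submodule K V} {β : Bil K V} (R : Rep wkModel (0 : K) F P β)
    {B₂ : LinearMap.BilinForm K V} (hB₂ : IsInvariantForm P β B₂) {i j : ℕ} (hi : i < 34)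
    (hj : j < 34) (hij : ¬ ((i = 5 ∨ i = 20) ∧ (j = 5 ∨ j = 20))) : B₂ (F.e i) (F.e j) = 0 := by
  have hch : CharP K wkModel.p := ‹CharP K 2›
  have H := R.isLieSuper' wk_valid
  have hbot := R.eq_bot (by decide +kernel)
  have hsymm := IsInvariantForm.symm H.compl hbot hB₂
  refine eq_zero_of_formOK (M := (wkModel.mapCoef (List.take 1)).withUnits [[1]]) (by decide) ?_
    (R.atZero.withUnits _) (fun i j y hy => ?_) hsymm hB₂.invariant (S := 0) (fun c hc => ?_)
    wk_formOK_zero hi hj ?_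
  · intro c hc
    simp only [Model.withUnits, List.mem_cons, List.not_mem_nil, or_false] at hc
    rw [hc]
    simp
  · have hy : y ∈ (wkModel.mapCoef (List.take 1)).br i j := hy
    rw [wkModel.br_mapCoef] at hy
    obtain ⟨z, hz, rfl⟩ := List.mem_map.1 hy
    exact Rep.br_lt wk_valid i j z hz
  · simp at hc
  · have : (upto 34 fun i => upto 34 fun j => (1 <<< wkModel.formCode 5 5 |||
        1 <<< wkModel.formCode 5 20 ||| 1 <<< wkModel.formCode 20 20).testBit
          (wkModel.formCode i j) == ((i == 5 || i == 20) && (j == 5 || j == 20))) = true := by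
      decide +kernel
    have := of_upto (of_upto this i hi) j hj
    rw [beq_iff_eq] at this
    refine this.trans ?_
    rw [← Bool.not_eq_true]
    simpa using hij

end WkForms

end StructConst

namespace StructConst

/-! ### The algebra in characteristic 2: the theorem -/

section WkMain

variable {K : Type*} [Field K] [CharP K 2]

/-- The cocycles on `wk(4;α)`: the derivative of the bracket with respect to the parameter, and the
squares of inner derivations. -/
noncomputable def wkCocycle {α : K} (F : Frame K (Wk α) wkModel.dim) : ℕ → Bil K (Wk α)
  | 0 => wkModel.taylor α F 1
  | l + 1 => sqP wkModel.p (wkBracket α) (wkBracket α (F.e (wkRoots.getD l 0)))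

/-- The theorem for `wk(4;α)`. -/
theorem wk_deforms (α : K) (h0 : α ≠ 0) (h1 : α ≠ 1) :
    IsLieSuper (wkParts α) (wkBracket α) ∧
    (LinearIndependent K (wkBasis α) ∧ Submodule.span K (Set.range (wkBasis α)) = ⊤) ∧
    ∃ B, (IsStandardForm (wkMatrix α) 0 1 (wkMatrix α) B ∧
        ∀ B', IsStandardForm (wkMatrix α) 0 1 (wkMatrix α) B' → B' = B) ∧
      IsNIS (wkParts α) (wkBracket α) B ∧
      ∃ (m : ℕ) (c : Fin (m + 1) → Bil K (Wk α)),
        IsCohomologyBasis (wkParts α) (wkBracket α) c ∧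
        (∀ i : Fin (m + 1), i ≠ 0 → ∀ l : K,
          IsLieSuper (wkParts α) (wkBracket α + l • c i) ∧
          IsNIS (wkParts α) (wkBracket α + l • c i) B) ∧
        -- the deform with the infinitesimal cocycle `c 0`, which preserves the root grading
        ∃ (N : ℕ) (φ : ℕ → Bil K (Wk α)),
          1 ≤ N ∧ φ 0 = wkBracket α ∧ φ 1 = c 0 ∧
          (∀ k, ∀ w₁ w₂ : Fin 4 → ℤ, ∀ a ∈ rootSpace (wkMatrix α) 0 w₁,
            ∀ b ∈ rootSpace (wkMatrix α) 0 w₂, φ k a b ∈ rootSpace (wkMatrix α) 0 (w₁ + w₂)) ∧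
          (∀ l : K, IsLieSuper (wkParts α) (polyBracket φ N l)) ∧
          (∀ l : K, l ≠ α →
            ∃ B₁, HasGram B₁ (wkBasis α) (gammaMatrix α l) ∧
              IsInvariantForm (wkParts α) (polyBracket φ N l) B₁ ∧
              (IsNIS (wkParts α) (polyBracket φ N l) B₁ ↔ l ≠ α + 1) ∧
              ∀ B₂, IsInvariantForm (wkParts α) (polyBracket φ N l) B₂ →
                ∃ t : K, B₂ = t • B₁) ∧
          (∃ B₁, HasGram B₁ (wkBasis α) (gammaDegenerate K) ∧
            IsInvariantForm (wkParts α) (polyBracket φ N α) B₁) ∧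
          (∀ B₂, IsInvariantForm (wkParts α) (polyBracket φ N α) B₂ →
            ¬ IsNIS (wkParts α) (polyBracket φ N α) B₂ ∧
            ∀ i j, ¬ (i ∈ ({idxX2, idxY2} : Set _) ∧ j ∈ ({idxX2, idxY2} : Set _)) →
              B₂ (wkBasis α i) (wkBasis α j) = 0) := by
  have hch : CharP K wkModel.p := ‹CharP K 2›
  have h2 : (2 : K) = 0 := CharTwo.two_eq_zero
  have hA := wk_presents h0 h1
  obtain ⟨F, R, hg, hroot⟩ : ∃ F : Frame K (Wk α) wkModel.dim,
      Rep wkModel α F (wkParts α) (wkBracket α) ∧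
      (∀ a : Gen 4, NISDeform.gen (wkMatrix α) 0 a = val F.e α (wkModel.gen a)) ∧
      ∀ w : Fin 4 → ℤ, rootSpace (wkMatrix α) 0 w = F.graded wkModel.weight w :=
    wkModel.exists_frame wk_valid hA
  have hbasis := wkBasis_eq R hg
  obtain ⟨B, hB, hN⟩ : ∃ B, (IsStandardForm (wkMatrix α) 0 1 (wkMatrix α) B ∧
      ∀ B', IsStandardForm (wkMatrix α) 0 1 (wkMatrix α) B' → B' = B) ∧
      IsNIS (wkParts α) (wkBracket α) B :=
    wkModel.exists_standardForm wk_valid hA (wk_isSymm α) R hg hroot (q := [0, 1])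
      (by simpa using h0) wk_chkGram wk_chkSym wk_chkInv wk_chkStd wk_chkNondeg wk_chkUnique
  have hnil : ∀ l < wkRoots.length, wkModel.nilOK (wkRoots.getD l 0) = true := fun l hl => by
    rw [List.getD_eq_getElem _ _ hl]
    exact List.all_eq_true.1 wk_nilOK _ (List.getElem_mem hl)
  have hcoc : ∀ l < wkRoots.length.succ,
      IsCocycle (wkParts α) (wkBracket α) 0 (wkCocycle F l) := by
    intro l hl
    cases l with
    | zero => exact R.isCocycle_deriv wk_valid (R.taylor_one wk_valid) wk_chkClosed
    | succ l => exact R.isCocycle_sqP wk_valid (hnil l (Nat.lt_of_succ_lt_succ hl))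
  have hcls : ∀ l < wkRoots.length.succ, ∀ i j,
      wkCocycle F l (F.e i) (F.e j) = val F.e α (wkClassTab l i j) := by
    intro l _ i j
    cases l with
    | zero =>
      simp only [wkCocycle, wkClassTab]
      exact wkModel.taylor_one_e wk_valid α F i j
    | succ l =>
      simp only [wkCocycle, wkClassTab]
      exact R.sqP_e _ i j
  refine ⟨R.isLieSuper' wk_valid, ?_, B, hB, hN, wkRoots.length, fun l => wkCocycle F l,
    isCohomologyBasis wk_valid hA.units R wk_chkDiag (wk_eigen h0) hcoc hcls wk_chkH2 wk_chkDual,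
    fun i hi l => ?_, 4, wkModel.taylor α F, by decide, R.taylor_zero wk_valid, rfl, ?_,
    fun l => (R.polyBracket wk_valid wk_chkDeg l).isLieSuper' wk_valid, fun l hl => ?_, ?_, ?_⟩
  · rw [hbasis]
    exact wkCoordBasis_isBasis h0 F
  · obtain ⟨i, rfl⟩ := Fin.exists_succ_eq.2 hi
    exact ⟨R.isLieSuper_sqP wk_valid (hnil i i.2) l, R.isNIS_sqP wk_valid (hnil i i.2) hN l⟩
  · intro k w₁ w₂ a ha b hb
    rw [hroot] at ha hb ⊢
    exact wkModel.taylor_mem wk_valid α F k ha hb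
  · -- the form `t⁻¹ Q`, where `Q` is the form of the table at `t = α + l`
    have ht : α + l ≠ 0 := fun h => hl (by linear_combination h - α * h2)
    have ht1 : α + l ≠ 1 ↔ l ≠ α + 1 :=
      not_congr ⟨fun h => by linear_combination h - α * h2,
        fun h => by linear_combination h + α * h2⟩
    obtain ⟨B₀, hB₀⟩ := wkModel.exists_gramRep F (α + l) wk_chkGram
    have h := wk_forms_ne_zero (R.polyBracket wk_valid wk_chkDeg l) ht hB₀ (α + l)⁻¹
      (inv_ne_zero ht)
    refine ⟨(α + l)⁻¹ • B₀, ?_, h.1, h.2.1.trans ht1, h.2.2⟩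
    rw [hbasis, gammaMatrix_eq hl]
    exact hasGram_wkCoordBasis hB₀ _ rfl fun j => rfl
  · have R' := R.polyBracket wk_valid wk_chkDeg α
    rw [CharTwo.add_self_eq_zero] at R'
    obtain ⟨B₀, hB₀⟩ := wkModel.exists_gramRep F (0 : K) wk_chkGram
    refine ⟨α⁻¹ • B₀, ?_, isInvariantForm_smul
      (R'.isInvariantForm wk_valid hB₀ wk_chkSym wk_chkInv) _⟩
    rw [hbasis, gammaDegenerate_eq h0]
    exact hasGram_wkCoordBasis hB₀ _ rfl fun j => rfl
  · intro B₂ hB₂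
    have R' := R.polyBracket wk_valid wk_chkDeg α
    rw [CharTwo.add_self_eq_zero] at R'
    have hz : ∀ {i j : ℕ}, i < 34 → j < 34 → ¬ ((i = 5 ∨ i = 20) ∧ (j = 5 ∨ j = 20)) →
        B₂ (F.e i) (F.e j) = 0 := fun hi hj => wk_forms_zero R' hB₂ hi hj
    refine ⟨fun h => ?_, fun i j hij => ?_⟩
    · have h0 : F.e 4 = 0 := h.nondegenerate.1 _ fun v => by
        have : B₂ (F.e 4) = 0 := LinearMap.ext fun v =>
          F.linearMap_ext (L' := 0) (fun j hj => hz (by decide) hj (by omega)) v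
        rw [this, LinearMap.zero_apply]
      have h1 := F.x_e 4 4 (by decide)
      rw [h0, map_zero, if_pos rfl] at h1
      exact zero_ne_one h1
    · -- all basis vectors except for `e 5` and `e 20` lie in the radical
      let U : Submodule K (Wk α) := LinearMap.ker B₂ ⊓ LinearMap.ker B₂.flip
      have hU : ∀ k < 34, k ≠ 5 → k ≠ 20 → F.e k ∈ U := fun k hk h5 h20 =>
        ⟨LinearMap.mem_ker.2 <| LinearMap.ext fun v =>
          F.linearMap_ext (L' := 0) (fun j hj => hz hk hj (by omega)) v,
        LinearMap.mem_ker.2 <| LinearMap.ext fun v =>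
          F.linearMap_ext (L' := 0) (fun j hj =>
            show B₂ (F.e j) (F.e k) = 0 from hz hj hk (by omega)) v⟩
      have hw : ∀ i, i ∉ ({idxX2, idxY2} : Set _) → wkBasis α i ∈ U := by
        intro i hi
        rw [hbasis]
        have e1 := U.smul_mem α (hU 1 (by decide) (by decide) (by decide))
        rcases i with i | i | i
        · fin_cases i
          · exact hU 0 (by decide) (by decide) (by decide)
          · exact e1
          · exact hU 2 (by decide) (by decide) (by decide)
          · exact U.add_mem (hU 3 (by decide) (by decide) (by decide)) e1
        · have h1 : (i : ℕ) ≠ 1 := fun h => hi (Or.inl (by rw [idxX2]; congr 2; exact Fin.ext h))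
          have := i.2
          exact hU _ (by omega) (by omega) (by omega)
        · have h1 : (i : ℕ) ≠ 1 := fun h => hi (Or.inr (by
            rw [Set.mem_singleton_iff, idxY2]; congr 2; exact Fin.ext h))
          have := i.2
          exact U.smul_mem _ (hU _ (by omega) (by omega) (by omega))
      rcases not_and_or.1 hij with h | h
      · rw [LinearMap.mem_ker.1 (hw i h).1, LinearMap.zero_apply]
      · exact LinearMap.congr_fun (LinearMap.mem_ker.1 (hw j h).2) _

end WkMain

end StructConst

open NISDeform in
theorem mainTheorem3 :
    -- `br(3)`
    (∀ (K : Type*) [Field K] [CharP K 3],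
      IsLieSuper (br3Parts K) (br3Bracket K) ∧
      ∃ B, (IsStandardForm (br3Matrix K) 0 1 (br3Matrix K) B ∧
          ∀ B', IsStandardForm (br3Matrix K) 0 1 (br3Matrix K) B' → B' = B) ∧
        IsNIS (br3Parts K) (br3Bracket K) B ∧
        ∃ (m : ℕ) (c : Fin m → Bil K (Br3 K)),
          IsCohomologyBasis (br3Parts K) (br3Bracket K) c ∧
          ∀ (i : Fin m) (l : K),
            IsLieSuper (br3Parts K) (br3Bracket K + l • c i) ∧
            IsNIS (br3Parts K) (br3Bracket K + l • c i) B) ∧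
    -- `brj(2;3)`
    (∀ (K : Type*) [Field K] [CharP K 3],
      IsLieSuper (brjParts K) (brjBracket K) ∧
      ∃ B, (IsStandardForm (brjMatrix K) brjParity 1 (brjMatrix K) B ∧
          ∀ B', IsStandardForm (brjMatrix K) brjParity 1 (brjMatrix K) B' → B' = B) ∧
        IsNIS (brjParts K) (brjBracket K) B ∧
        (∀ z, IsCocycle (brjParts K) (brjBracket K) 1 z →
          IsCoboundary (brjParts K) (brjBracket K) 1 z) ∧
        ∃ (m : ℕ) (c : Fin m → Bil K (Brj K)),
          IsCohomologyBasis (brjParts K) (brjBracket K) c ∧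
          ∀ (i : Fin m) (l : K),
            IsLieSuper (brjParts K) (brjBracket K + l • c i) ∧
            IsNIS (brjParts K) (brjBracket K + l • c i) B) ∧
    -- `wk(4;α)`; the exceptional cocycle is `c 0`
    (∀ (K : Type*) [Field K] [CharP K 2] (α : K), α ≠ 0 → α ≠ 1 →
      IsLieSuper (wkParts α) (wkBracket α) ∧
      (LinearIndependent K (wkBasis α) ∧ Submodule.span K (Set.range (wkBasis α)) = ⊤) ∧
      ∃ B, (IsStandardForm (wkMatrix α) 0 1 (wkMatrix α) B ∧
          ∀ B', IsStandardForm (wkMatrix α) 0 1 (wkMatrix α) B' → B' = B) ∧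
        IsNIS (wkParts α) (wkBracket α) B ∧
        ∃ (m : ℕ) (c : Fin (m + 1) → Bil K (Wk α)),
          IsCohomologyBasis (wkParts α) (wkBracket α) c ∧
          (∀ i : Fin (m + 1), i ≠ 0 → ∀ l : K,
            IsLieSuper (wkParts α) (wkBracket α + l • c i) ∧
            IsNIS (wkParts α) (wkBracket α + l • c i) B) ∧
          -- the deform with the infinitesimal cocycle `c 0`, which preserves the root grading
          ∃ (N : ℕ) (φ : ℕ → Bil K (Wk α)),
            1 ≤ N ∧ φ 0 = wkBracket α ∧ φ 1 = c 0 ∧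
            (∀ k, ∀ w₁ w₂ : Fin 4 → ℤ, ∀ a ∈ rootSpace (wkMatrix α) 0 w₁,
              ∀ b ∈ rootSpace (wkMatrix α) 0 w₂, φ k a b ∈ rootSpace (wkMatrix α) 0 (w₁ + w₂)) ∧
            (∀ l : K, IsLieSuper (wkParts α) (polyBracket φ N l)) ∧
            (∀ l : K, l ≠ α →
              ∃ B₁, HasGram B₁ (wkBasis α) (gammaMatrix α l) ∧
                IsInvariantForm (wkParts α) (polyBracket φ N l) B₁ ∧
                (IsNIS (wkParts α) (polyBracket φ N l) B₁ ↔ l ≠ α + 1) ∧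
                ∀ B₂, IsInvariantForm (wkParts α) (polyBracket φ N l) B₂ →
                  ∃ t : K, B₂ = t • B₁) ∧
            (∃ B₁, HasGram B₁ (wkBasis α) (gammaDegenerate K) ∧
              IsInvariantForm (wkParts α) (polyBracket φ N α) B₁) ∧
            (∀ B₂, IsInvariantForm (wkParts α) (polyBracket φ N α) B₂ →
              ¬ IsNIS (wkParts α) (polyBracket φ N α) B₂ ∧
              ∀ i j, ¬ (i ∈ ({idxX2, idxY2} : Set _) ∧ j ∈ ({idxX2, idxY2} : Set _)) →
                B₂ (wkBasis α i) (wkBasis α j) = 0)) := by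
  exact ⟨fun K _ _ => StructConst.br3_deforms K, fun K _ _ => by
      obtain ⟨h, B, hB, hN, hc⟩ := StructConst.brj_deforms K
      exact ⟨h, B, hB, hN, StructConst.brj_isCoboundary_of_odd K, hc⟩,
    fun K _ _ α h0 h1 => StructConst.wk_deforms α h0 h1⟩
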